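/- Let $d\ge 2$ and, for $r\ge 2$, let $s_r := \frac{r-1+(d-1)(r/2-1)}{r}$ (so $s_2=\tfrac12$). There is $r_0>2$, depending only on $d$, with $\tfrac12\le s_r<1$ for all $2\le r\le r_0$, such that the following holds. Setting. Let $\Omega_0\subseteq\Omega\subset\mathbb R^d$ be bounded Lipschitz domains with $\Gamma:=\partial\Omega\subseteq\partial\Omega_0$, let $q\ge1$ be an integer and $\kappa\in\mathbb R$. Let $\mathcal T$ be a conforming triangulation of $\overline{\Omega_0}$ into nondegenerate $d$-simplices (so that $\Gamma$ is polyhedral) which is $\kappa$-shape regular, i.e. $\mathrm{diam}(T)\le\kappa|T|^{1/d}$ for all $T\in\mathcal T$ (for instance any mesh of a sequence $(\mathcal T_\ell)_\ell$ generated by newest vertex bisection from an initial mesh $\mathcal T_0$, with $\kappa$ depending only on $\mathcal T_0$). Let $\mathcal T^\Gamma$ be the set of facets of elements that are contained in $\Gamma$, and let $Q^\Gamma$ be the $L^2(\Gamma)$-orthogonal projection onto $\mathcal T^\Gamma$-piecewise constants, i.e. the facetwise integral mean. Let $\mathcal S^q(\mathcal T)$ be the space of continuous $\mathcal T$-piecewise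 polynomials of degree at most $q$ on $\overline{\Omega_0}$, extended by zero, with Lagrange nodes $\mathcal D$ and nodal basis $\zeta_z$, $\zeta_z(z')=\delta_{zz'}$ for $z,z'\in\mathcal D$. For each $z\in\mathcal D\cap\Gamma$ choose a facet $K_z\in\mathcal T^\Gamma$ with $z\in K_z$, and let $\psi_z$ be the polynomial of degree at most $q$ on $K_z$ with $\int_{K_z}\psi_z\zeta_{z'}=\delta_{zz'}$ for all $z'\in\mathcal D\cap K_z$. The boundary Scott--Zhang projector is $Jf:=\sum_{z\in\mathcal D\cap\Gamma}\bigl(\int_{K_z}\psi_z f\bigr)\,\zeta_z|_\Gamma$, and its natural lifting to $\Omega$ is $\widehat J f:=\sum_{z\in\mathcal D\cap\Gamma}\bigl(\int_{K_z}\psi_z f\bigr)\,\zeta_z$. For $0<s<1$ let $|f|_{H^s(\Gamma)}^2:=\int_\Gamma\int_\Gamma\frac{|f(x)-f(y)|^2}{|x-y|^{d-1+2s}}\,dx\,dy$ and $\|f\|_{H^s(\Gamma)}^2:=\|f\|_{L^2(\Gamma)}^2+|f|_{H^s(\Gamma)}^2$. Let $H^{-1/2}(\Gamma)$ be the dual space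 of $H^{1/2}(\Gamma)$, with the dual norm and with densities $\psi \in L^2(\Gamma)$ embedded via the $L^2(\Gamma)$-pairing. Assertion. For all $2\le r\le r_0$ there is $C_r>0$, independent of $\mathcal T$ (within the class of $\kappa$-shape-regular conforming triangulations of $\overline{\Omega_0}$) and of the choice of the facets $K_z$, such that for all $f\in H^{s_r}(\Gamma)$ the function $\widehat J(f-Q^\Gamma f)$ is weakly differentiable in $\Omega$ and $$\|\nabla\widehat J(f-Q^\Gamma f)\|_{L^r(\Omega)}\le C_r\,|f|_{H^{s_r}(\Gamma)} .$$ In particular ($r=2$): let $V:H^{-1/2}(\Gamma)\to H^{1/2}(\Gamma)$ be the single-layer operator, i.e. the continuous extension of $(V\psi)(x)=\int_\Gamma G(x-y)\psi(y)\,dy$, where $G$ is the fundamental solution of $-\Delta$, and let $C_V$ be its (finite) operator norm. Let $p\ge0$, $g\in H^{1/2}(\Gamma)$, and let the $\mathcal T^\Gamma$-piecewise polynomial $\phi_\ell^\star$ of degree at most $p$ be a Galerkin solution, i.e. $\langle V\phi_\ell^\star,\chi\rangle_\Gamma=\langle g,\chi\rangle_\Gamma$ for all $\mathcal T^\Gamma$-piecewise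 polynomials $\chi$ of degree at most $p$. Then $\widehat g_\ell:=\widehat J(g-V\phi_\ell^\star)$ satisfies, with the constant $C_2$ from above, $$\|\nabla\widehat g_\ell\|_{L^2(\Omega)}\le C_2\,|g-V\phi_\ell^\star|_{H^{1/2}(\Gamma)},$$ and, whenever $\phi^\star\in H^{-1/2}(\Gamma)$ solves $V\phi^\star=g$, $$C_2\,|g-V\phi_\ell^\star|_{H^{1/2}(\Gamma)}\le C_2\,C_V\,\|\phi^\star-\phi_\ell^\star\|_{H^{-1/2}(\Gamma)} .$$ -/

import Mathlib

open MeasureTheory Set Filter Topology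
open scoped ENNReal NNReal ContDiff

noncomputable section

namespace BEM

/-- The Euclidean space `ℝ^d`. -/
abbrev E (d : ℕ) := EuclideanSpace ℝ (Fin d)

/-! ### Domains, surface measure, weak gradients -/

/-- Bounded Lipschitz domain: nonempty, connected, open, bounded, and near every boundary point the
set lies strictly above the graph of a Lipschitz function `γ` in some unit direction `ν`
(the function `γ` is constant along `ν`, i.e. it is a function on the hyperplane `ν^⊥`). -/
structure IsLipschitzDomain {d : ℕ} (Ω : Set (E d)) : Prop where
  isOpen : IsOpen Ω
  isConnected : IsConnected Ω
  isBounded : Bornology.IsBounded Ω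
  graph : ∀ x ∈ frontier Ω, ∃ (ν : E d) (γ : E d → ℝ) (L : ℝ≥0) (ρ : ℝ),
    ‖ν‖ = 1 ∧ 0 < ρ ∧ LipschitzWith L γ ∧ (∀ (y : E d) (t : ℝ), γ (y + t • ν) = γ y) ∧
    ∀ y ∈ Metric.ball x ρ, (y ∈ Ω ↔ γ y < inner ℝ ν y)

/-- The surface measure on `Γ = ∂Ω`: the normalized `(d-1)`-dimensional Hausdorff measure. -/
def surf {d : ℕ} (Ω : Set (E d)) : Measure (E d) :=
  (Measure.euclideanHausdorffMeasure (d - 1)).restrict (frontier Ω)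

/-- `G` is the distributional gradient of `w` on the open set `Ω`. -/
structure HasWeakGradient {d : ℕ} (Ω : Set (E d)) (w : E d → ℝ) (G : E d → E d) : Prop where
  locInt : LocallyIntegrableOn w Ω
  locInt_grad : LocallyIntegrableOn G Ω
  integral_eq : ∀ φ : E d → ℝ, ContDiff ℝ ∞ φ → HasCompactSupport φ → tsupport φ ⊆ Ω →
    ∀ e : E d, ∫ x in Ω, w x * fderiv ℝ φ x e = - ∫ x in Ω, inner ℝ (G x) e * φ x

/-! ### Fractional Sobolev spaces on the boundary -/

/-- The difference quotient whose `L²(Γ × Γ)`-norm is the `H^s(Γ)`-seminorm, `0 < s < 1`: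
its square is `|f x - f y|² / |x - y|^{d - 1 + 2 s}`. -/
def diffQuot {d : ℕ} (s : ℝ) (f : E d → ℝ) (z : E d × E d) : ℝ :=
  (f z.1 - f z.2) / ‖z.1 - z.2‖ ^ (((d : ℝ) - 1) / 2 + s)

/-- The seminorm `|f|_{H^s(Γ)}`, `0 < s < 1`. -/
def hsSeminorm {d : ℕ} (Ω : Set (E d)) (s : ℝ) (f : E d → ℝ) : ℝ≥0∞ :=
  eLpNorm (diffQuot s f) 2 ((surf Ω).prod (surf Ω))

/-- The norm `‖f‖_{H^s(Γ)} = (‖f‖²_{L²(Γ)} + |f|²_{H^s(Γ)})^{1/2}`, `0 < s < 1`. -/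
def hsNorm {d : ℕ} (Ω : Set (E d)) (s : ℝ) (f : E d → ℝ) : ℝ≥0∞ :=
  (eLpNorm f 2 (surf Ω) ^ 2 + hsSeminorm Ω s f ^ 2) ^ (1 / 2 : ℝ)

/-- The space `H^s(Γ)`, `0 < s < 1`, as a space of functions (not identified up to null sets). -/
def Hs {d : ℕ} (Ω : Set (E d)) (s : ℝ) : Submodule ℝ (E d → ℝ) where
  carrier := {f | MemLp f 2 (surf Ω) ∧ MemLp (diffQuot s f) 2 ((surf Ω).prod (surf Ω))}
  zero_mem' := by
    refine ⟨MemLp.zero, ?_⟩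
    have h : diffQuot s (0 : E d → ℝ) = 0 := by
      funext z; simp [diffQuot]
    rw [h]; exact MemLp.zero
  add_mem' := by
    rintro f g ⟨hf, hf'⟩ ⟨hg, hg'⟩
    refine ⟨hf.add hg, ?_⟩
    have h : diffQuot s (f + g) = diffQuot s f + diffQuot s g := by
      funext z; simp only [diffQuot, Pi.add_apply]; ring
    rw [h]; exact hf'.add hg'
  smul_mem' := by
    rintro c f ⟨hf, hf'⟩
    refine ⟨hf.const_smul c, ?_⟩
    have h : diffQuot s (c • f) = c • diffQuot s f := by
      funext z; simp only [diffQuot, Pi.smul_apply, smul_eq_mul]; ring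
    rw [h]; exact hf'.const_smul c

/-- The dual norm `‖Φ‖_{H^{-1/2}(Γ)}` of a functional on `H^{1/2}(Γ)`. The space `H^{-1/2}(Γ)`
consists of the linear functionals for which it is finite. -/
def dualNorm {d : ℕ} (Ω : Set (E d)) (Φ : Hs Ω (1 / 2) → ℝ) : ℝ≥0∞ :=
  ⨆ (v : Hs Ω (1 / 2)) (_ : hsNorm Ω (1 / 2) v ≤ 1), ‖Φ v‖ₑ

/-- The action `v ↦ ⟨ψ, v⟩_Γ` of a density `ψ ∈ L²(Γ)` on `H^{1/2}(Γ)`. -/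
def pairing {d : ℕ} (Ω : Set (E d)) (ψ : E d → ℝ) (v : Hs Ω (1 / 2)) : ℝ :=
  ∫ x, ψ x * (v : E d → ℝ) x ∂(surf Ω)

/-! ### The single-layer operator -/

/-- The fundamental solution of the (negative) Laplacian; `toSphere` is the surface measure on
the unit sphere. -/
def fundSol (d : ℕ) (x : E d) : ℝ :=
  if d = 2 then -(1 / (2 * Real.pi)) * Real.log ‖x‖
  else 1 / (((d : ℝ) - 2) * (volume : Measure (E d)).toSphere.real univ) * ‖x‖ ^ (2 - (d : ℤ))

/-- The single-layer integral `(V ψ)(x) = ∫_Γ G(x - y) ψ(y) dy`. -/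
def singleLayer {d : ℕ} (Ω : Set (E d)) (ψ : E d → ℝ) (x : E d) : ℝ :=
  ∫ y, fundSol d (x - y) * ψ y ∂(surf Ω)

/-- `V Φ = h` for `Φ ∈ H^{-1/2}(Γ)` and `h ∈ H^{1/2}(Γ)`, where `V : H^{-1/2}(Γ) → H^{1/2}(Γ)` is
the continuous extension of the single-layer integral from the dense space of bounded densities. -/
def IsSingleLayer {d : ℕ} (Ω : Set (E d)) (Φ : Hs Ω (1 / 2) →ₗ[ℝ] ℝ) (h : E d → ℝ) : Prop :=
  h ∈ Hs Ω (1 / 2) ∧ ∃ ψ : ℕ → E d → ℝ, (∀ n, MemLp (ψ n) ⊤ (surf Ω)) ∧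
    Tendsto (fun n => dualNorm Ω fun v => Φ v - pairing Ω (ψ n) v) atTop (𝓝 0) ∧
    Tendsto (fun n => hsNorm Ω (1 / 2) (h - singleLayer Ω (ψ n))) atTop (𝓝 0)

/-- The operator norm `C_V` of `V : H^{-1/2}(Γ) → H^{1/2}(Γ)`. -/
def singleLayerNorm {d : ℕ} (Ω : Set (E d)) : ℝ≥0∞ :=
  sInf {C : ℝ≥0∞ | ∀ (Φ : Hs Ω (1 / 2) →ₗ[ℝ] ℝ) (h : E d → ℝ), IsSingleLayer Ω Φ h →
    hsNorm Ω (1 / 2) h ≤ C * dualNorm Ω Φ}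

/-! ### Meshes and discrete spaces -/

/-- The closed simplex with vertex set `T`. -/
abbrev cell {d : ℕ} (T : Finset (E d)) : Set (E d) := convexHull ℝ (T : Set (E d))

/-- `𝓣` (a finite set of vertex sets) is a conforming triangulation of `closure Ω₀` into
nondegenerate `d`-simplices: the intersection of two elements is the simplex spanned by their
common vertices (empty, if there are none). -/
structure IsMesh {d : ℕ} (Ω₀ : Set (E d)) (𝓣 : Finset (Finset (E d))) : Prop where
  card_eq : ∀ T ∈ 𝓣, T.card = d + 1
  affineIndependent : ∀ T ∈ 𝓣, AffineIndependent ℝ ((↑) : T → E d)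
  conforming : ∀ T ∈ 𝓣, ∀ T' ∈ 𝓣,
    cell T ∩ cell T' = convexHull ℝ ((T : Set (E d)) ∩ (T' : Set (E d)))
  cover : ⋃ T ∈ 𝓣, cell T = closure Ω₀

/-- `κ`-shape regularity: `diam(T) ≤ κ |T|^{1/d}` for all elements. -/
def IsShapeRegular {d : ℕ} (κ : ℝ) (𝓣 : Finset (Finset (E d))) : Prop :=
  ∀ T ∈ 𝓣, Metric.diam (cell T) ≤ κ * (volume.real (cell T)) ^ (1 / (d : ℝ))

open Classical in
/-- The induced boundary mesh on `Γ = ∂Ω`: all facets of elements that are contained in `Γ`. -/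
def bdryMesh {d : ℕ} (Ω : Set (E d)) (𝓣 : Finset (Finset (E d))) : Finset (Finset (E d)) :=
  (𝓣.biUnion fun T => T.powersetCard d).filter fun F => cell F ⊆ frontier Ω

/-- `v` coincides on `S` with a polynomial of (total) degree at most `q`. -/
def IsPolyOn {d : ℕ} (q : ℕ) (S : Set (E d)) (v : E d → ℝ) : Prop :=
  ∃ P : MvPolynomial (Fin d) ℝ, P.totalDegree ≤ q ∧
    ∀ x ∈ S, v x = MvPolynomial.eval (fun i => x i) P

/-- The space `S^q(𝓣)` of functions on the triangulated set that are polynomials of degree at most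
`q` on each closed element (and hence continuous there); they are extended by zero. -/
def IsFEM {d : ℕ} (q : ℕ) (𝓣 : Finset (Finset (E d))) (v : E d → ℝ) : Prop :=
  (∀ T ∈ 𝓣, IsPolyOn q (cell T) v) ∧ ∀ x, (∀ T ∈ 𝓣, x ∉ cell T) → v x = 0

open Classical in
/-- The Lagrange nodes of `S^q(𝓣)`: on each element `T` with vertices `v`, the points
`∑ (k_v / q) v` with nonnegative integers `k_v` that sum up to `q`. -/
def nodes {d : ℕ} (q : ℕ) (𝓣 : Finset (Finset (E d))) : Finset (E d) :=
  𝓣.biUnion fun T => (T.piAntidiag q).image fun k => ∑ v ∈ T, ((k v : ℝ) / q) • v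

open Classical in
/-- The Lagrange nodes on the boundary `Γ = ∂Ω`. -/
def bdryNodes {d : ℕ} (Ω : Set (E d)) (q : ℕ) (𝓣 : Finset (Finset (E d))) : Finset (E d) :=
  (nodes q 𝓣).filter fun z => z ∈ frontier Ω

open Classical in
/-- The nodal basis function `ζ_z`: the unique element of `S^q(𝓣)` with `ζ_z(z') = δ_{zz'}` for all
Lagrange nodes `z'`. -/
def nodalBasis {d : ℕ} (q : ℕ) (𝓣 : Finset (Finset (E d))) (z : E d) : E d → ℝ :=
  Classical.epsilon fun v => IsFEM q 𝓣 v ∧ ∀ z' ∈ nodes q 𝓣, v z' = if z' = z then 1 else 0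

/-- The space `P^p` of piecewise polynomials on the boundary mesh (as elements of `L²(Γ)`, the
values on the null set where facets meet are irrelevant). -/
def IsPiecewisePoly {d : ℕ} (Ω : Set (E d)) (p : ℕ) (𝓣 : Finset (Finset (E d)))
    (φ : E d → ℝ) : Prop :=
  ∀ F ∈ bdryMesh Ω 𝓣, ∃ P : MvPolynomial (Fin d) ℝ, P.totalDegree ≤ p ∧
    ∀ᵐ x ∂((surf Ω).restrict (cell F)), φ x = MvPolynomial.eval (fun i => x i) P

/-- The `L²(Γ)`-orthogonal projection `Q` onto piecewise constants on the boundary mesh: on each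
facet it is the integral mean. -/
def meanProj {d : ℕ} (Ω : Set (E d)) (𝓣 : Finset (Finset (E d))) (f : E d → ℝ) (x : E d) : ℝ :=
  ∑ F ∈ bdryMesh Ω 𝓣, (cell F).indicator (fun _ => ⨍ y in cell F, f y ∂(surf Ω)) x

/-! ### Scott–Zhang projector and natural lifting -/

open Classical in
/-- Admissible choices in the definition of the boundary Scott–Zhang projector: for every boundary
node `z`, a boundary facet `K z` containing `z`, and a polynomial `ψ z` of degree at most `q` on
`K z` that is dual to the nodal basis. -/
structure IsScottZhang {d : ℕ} (Ω : Set (E d)) (q : ℕ) (𝓣 : Finset (Finset (E d)))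
    (K : E d → Finset (E d)) (ψ : E d → MvPolynomial (Fin d) ℝ) : Prop where
  facet : ∀ z ∈ bdryNodes Ω q 𝓣, K z ∈ bdryMesh Ω 𝓣
  mem : ∀ z ∈ bdryNodes Ω q 𝓣, z ∈ cell (K z)
  degree : ∀ z ∈ bdryNodes Ω q 𝓣, (ψ z).totalDegree ≤ q
  dual : ∀ z ∈ bdryNodes Ω q 𝓣, ∀ z' ∈ nodes q 𝓣, z' ∈ cell (K z) →
    ∫ x in cell (K z), MvPolynomial.eval (fun i => x i) (ψ z) * nodalBasis q 𝓣 z' x ∂(surf Ω)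
      = if z' = z then 1 else 0

/-- The natural lifting of the Scott–Zhang interpolant `J f = ∑_z α_z ζ_z|_Γ`,
`α_z = ∫_{K z} ψ_z f`, of a function `f` on `Γ`, i.e. `∑_z α_z ζ_z` where `z` runs through the
boundary nodes. -/
def liftSZ {d : ℕ} (Ω : Set (E d)) (q : ℕ) (𝓣 : Finset (Finset (E d)))
    (K : E d → Finset (E d)) (ψ : E d → MvPolynomial (Fin d) ℝ) (f : E d → ℝ) (x : E d) : ℝ :=
  ∑ z ∈ bdryNodes Ω q 𝓣,
    (∫ y in cell (K z), MvPolynomial.eval (fun i => y i) (ψ z) * f y ∂(surf Ω)) *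
      nodalBasis q 𝓣 z x

/-- `φ ∈ P^p` is the Galerkin solution: `⟨V φ, χ⟩_Γ = ⟨g, χ⟩_Γ` for all `χ ∈ P^p`. -/
def IsGalerkin {d : ℕ} (Ω : Set (E d)) (p : ℕ) (𝓣 : Finset (Finset (E d))) (g φ : E d → ℝ) :
    Prop :=
  IsPiecewisePoly Ω p 𝓣 φ ∧ ∀ χ : E d → ℝ, IsPiecewisePoly Ω p 𝓣 χ →
    ∫ x, singleLayer Ω φ x * χ x ∂(surf Ω) = ∫ x, g x * χ x ∂(surf Ω)

/-- The exponent `s_r = [r - 1 + (d - 1)(r/2 - 1)] / r`. -/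
def sExp (d : ℕ) (r : ℝ) : ℝ := (r - 1 + ((d : ℝ) - 1) * (r / 2 - 1)) / r

end BEM

end

noncomputable section

namespace BEM

/-! ### Boundedness of the single-layer operator on an upper regular boundary -/

/-! ### The tent function and its autocorrelation -/

/-! Two independent arguments meet at the end: a scaling argument for the lifting and a proof that
`V` is bounded.

Lifting. On an element `T` the lifting is a polynomial whose nodal values are the coefficients `∫
ψ_z (f - Q f)` at nodes on `Γ` and zero elsewhere. Duality gives `∫ ψ_z² = ψ_z(z)`, so the inverse
estimate on `K_z` bounds the `L²`-norm of `ψ_z` by `diam^(-(d-1)/2)`, and Poincaré's inequality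
bounds `f - Q f` by the contribution `a_F` of `F × F`, `F = K_z`, to `|f|²`
(`IsScottZhang.exists_coeff_sq_le`). In `‖∇w‖^r |T|` all powers of the mesh size cancel exactly for
`s = s_r`, which leaves `a_F^(r/2)`. The `a_F` sum up to at most `|f|²`, and `r ≥ 2` allows `∑
a_F^(r/2) ≤ (∑ a_F)^(r/2)`; bounded overlap finishes the estimate
(`exists_eLpNorm_gradient_liftSZ_le`).

Two geometric facts enter. First, `T` and the element carrying `K_z` may share nothing but a face
containing `z`, so their diameters must be compared: elements at a boundary point are connected
through common edges, because a Lipschitz domain is locally connected at its boundary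
(`starGraph_preconnected`, `diam_le_diam`). Secondly, the lifting has to vanish on the part of `∂Ω₀`
inside `Ω` to be weakly differentiable across it. The set `∂Ω₀ \ ∂Ω` is closed
(`isClosed_frontier_diff`), so a face in `∂Ω₀` that meets `Γ` lies in `Γ`; a boundary face through a
point of `Ω` therefore carries no node of `Γ` (`liftSZ_eq_zero`, `IsFEM.hasWeakGradient`).

Boundedness of `V`. Up to constants, the fundamental solution is an integral over scales `τ` of
autocorrelations of tents of width `τ`. The scales `τ > 1` give a kernel with Lipschitz bounds on
differences and double differences, whose potential is controlled by testing the density with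
Lipschitz functions (`exists_smoothPot_hsNorm_le`). The scales `τ ≤ 1` give a positive kernel: the
energy `∫ ψ u` of a density and its potential `u` is a weighted square integral of tent averages of
`ψ`. A Schur-type argument, using only the upper regularity of the surface measure, bounds `‖u‖²` in
`H^{1/2}(Γ)` by this energy (`exists_mainPot_le`). Since the energy is at most the dual norm of `ψ`
times `‖u‖`, one factor cancels.

Galerkin residuals are orthogonal to piecewise constants, so `Q` annihilates them
(`IsGalerkin.meanProj_eq_zero`) and the case `r = 2` applies to the residual itself. -/

/-- The tent function on `ℝ^d`. -/
def tent {d : ℕ} (z : E d) : ℝ := max 0 (1 - ‖z‖)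

lemma tent_nonneg {d : ℕ} (z : E d) : 0 ≤ tent z := le_max_left _ _

lemma tent_le_one {d : ℕ} (z : E d) : tent z ≤ 1 := by
  unfold tent; have := norm_nonneg z
  exact max_le zero_le_one (by linarith)

lemma tent_eq_zero {d : ℕ} {z : E d} (h : 1 ≤ ‖z‖) : tent z = 0 :=
  max_eq_left (by linarith)

lemma abs_tent_sub_le {d : ℕ} (x y : E d) : |tent x - tent y| ≤ ‖x - y‖ := by
  unfold tent
  have h := abs_max_sub_max_le_abs (1 - ‖x‖) (1 - ‖y‖) 0
  rw [max_comm 0, max_comm 0]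
  refine h.trans ?_
  have := abs_norm_sub_norm_le y x
  rw [norm_sub_rev y x] at this
  have e : 1 - ‖x‖ - (1 - ‖y‖) = ‖y‖ - ‖x‖ := by ring
  rwa [e]

lemma abs_tent_sub_le_one {d : ℕ} (x y : E d) : |tent x - tent y| ≤ 1 := by
  rw [abs_le]
  constructor <;> linarith [tent_nonneg x, tent_nonneg y, tent_le_one x, tent_le_one y]

@[fun_prop]
lemma continuous_tent {d : ℕ} : Continuous (tent : E d → ℝ) := by
  unfold tent; fun_prop

/-- The scaled tent kernel. -/
def tentKer {d : ℕ} (τ : ℝ) (x z : E d) : ℝ := tent (τ⁻¹ • (x - z))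

lemma tentKer_nonneg {d : ℕ} (τ : ℝ) (x z : E d) : 0 ≤ tentKer τ x z := tent_nonneg _

lemma tentKer_le_one {d : ℕ} (τ : ℝ) (x z : E d) : tentKer τ x z ≤ 1 := tent_le_one _

lemma tentKer_le_indicator {d : ℕ} {τ : ℝ} (hτ : 0 < τ) (x z : E d) :
    tentKer τ x z ≤ (Metric.closedBall x τ).indicator 1 z := by
  by_cases h : z ∈ Metric.closedBall x τ
  · simpa [h] using tentKer_le_one τ x z
  · unfold tentKer
    rw [tent_eq_zero]
    · simp [h]
    · simp only [Metric.mem_closedBall, not_le, dist_comm z, dist_eq_norm] at h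
      rw [norm_smul, norm_inv, Real.norm_of_nonneg hτ.le, inv_mul_eq_div, one_le_div hτ]
      exact h.le

/-- Combines two bounds on the increment, `1` and `‖x - y‖ / τ`, with the fact that it vanishes
unless `z` is within `τ` of `x` or `y`. The localization is what makes the Schur tests work. -/
lemma abs_tentKer_sub_le {d : ℕ} {τ : ℝ} (hτ : 0 < τ) (x y z : E d) :
    |tentKer τ x z - tentKer τ y z| ≤ τ⁻¹ * min τ ‖x - y‖ *
      ((Metric.closedBall x τ).indicator 1 z + (Metric.closedBall y τ).indicator 1 z) := by
  have hx := tentKer_le_indicator hτ x z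
  have hy := tentKer_le_indicator hτ y z
  have hx0 := tentKer_nonneg τ x z
  have hy0 := tentKer_nonneg τ y z
  have h1 : |tentKer τ x z - tentKer τ y z| ≤ τ⁻¹ * min τ ‖x - y‖ := by
    rw [mul_min_of_nonneg _ _ (by positivity), inv_mul_cancel₀ hτ.ne', le_min_iff]
    refine ⟨abs_tent_sub_le_one _ _, (abs_tent_sub_le _ _).trans_eq ?_⟩
    rw [← smul_sub, norm_smul, norm_inv, Real.norm_of_nonneg hτ.le]
    congr 2; abel
  by_cases hzx : z ∈ Metric.closedBall x τ
  · refine h1.trans ?_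
    have h2 : (0:ℝ) ≤ (Metric.closedBall y τ).indicator 1 z :=
      indicator_nonneg (fun _ _ => zero_le_one) _
    simp only [hzx, indicator_of_mem, Pi.one_apply]
    have := (abs_nonneg _).trans h1
    nlinarith
  by_cases hzy : z ∈ Metric.closedBall y τ
  · refine h1.trans ?_
    simp [hzx, hzy]
  · simp only [hzx, hzy, not_false_eq_true, indicator_of_notMem] at hx hy ⊢
    have e1 : tentKer τ x z = 0 := le_antisymm hx hx0
    have e2 : tentKer τ y z = 0 := le_antisymm hy hy0
    simp [e1, e2]

lemma measurable_tentKer {d : ℕ} :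
    Measurable fun p : ℝ × E d × E d => tentKer p.1 p.2.1 p.2.2 := by
  unfold tentKer
  exact continuous_tent.measurable.comp (by fun_prop)

/-- The autocorrelation of the tent function. -/
def tentCorr {d : ℕ} (v : E d) : ℝ := ∫ w, tent w * tent (w - v)

lemma integrable_tent {d : ℕ} : Integrable (tent : E d → ℝ) := by
  refine continuous_tent.integrable_of_hasCompactSupport ?_
  refine HasCompactSupport.intro (isCompact_closedBall (0 : E d) 1) fun x hx => tent_eq_zero ?_
  simp at hx; exact hx.le

lemma integrable_tent_mul {d : ℕ} {g : E d → ℝ} (hg : Continuous g) :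
    Integrable (fun w => tent w * g w) := by
  refine (continuous_tent.mul hg).integrable_of_hasCompactSupport ?_
  refine HasCompactSupport.intro (isCompact_closedBall (0 : E d) 1) fun x hx => ?_
  have : tent x = 0 := tent_eq_zero (by simp at hx; exact hx.le)
  simp [this]

/-- The factorization behind the energy method: a function of `x - y` at scale `τ` becomes an
integral over `z` of products with `x` and `y` in separate factors, hence a positive kernel. The
substitution is `z ↦ x - τ w`. -/
lemma integral_tentKer_mul_tentKer {d : ℕ} {τ : ℝ} (hτ : 0 < τ) (x y : E d) :
    ∫ z, tentKer τ x z * tentKer τ y z = τ ^ d * tentCorr (τ⁻¹ • (x - y)) := by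
  have h1 := integral_sub_left_eq_self (fun z => tentKer τ x z * tentKer τ y z) volume x
  have h2 := Measure.integral_comp_smul (volume : Measure (E d))
    (fun z => tentKer τ x (x - z) * tentKer τ y (x - z)) τ
  rw [← h1]
  have h3 : (fun w : E d => tentKer τ x (x - τ • w) * tentKer τ y (x - τ • w)) =
      fun w => tent w * tent (w - τ⁻¹ • (x - y)) := by
    funext w
    unfold tentKer
    congr 2
    · rw [sub_sub_cancel, inv_smul_smul₀ hτ.ne']
    · rw [sub_sub_eq_add_sub, add_comm, add_sub_assoc, smul_add, inv_smul_smul₀ hτ.ne',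
        ← neg_sub x y, smul_neg, ← sub_eq_add_neg]
  rw [h3] at h2
  unfold tentCorr
  rw [h2, finrank_euclideanSpace_fin, abs_inv, abs_of_pos (by positivity), smul_eq_mul,
    mul_inv_cancel_left₀ (by positivity)]

lemma tentCorr_nonneg {d : ℕ} (v : E d) : 0 ≤ tentCorr v :=
  integral_nonneg fun _ => mul_nonneg (tent_nonneg _) (tent_nonneg _)

lemma tentCorr_eq_zero {d : ℕ} {v : E d} (hv : 2 ≤ ‖v‖) : tentCorr v = 0 := by
  unfold tentCorr
  rw [integral_eq_zero_of_ae]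
  refine Eventually.of_forall fun w => ?_
  by_cases h : 1 ≤ ‖w‖
  · simp [tent_eq_zero h]
  · have : 1 ≤ ‖w - v‖ := by
      have := norm_sub_norm_le v w
      rw [norm_sub_rev] at this
      linarith
    simp [tent_eq_zero this]

lemma tentCorr_zero_pos {d : ℕ} : 0 < tentCorr (0 : E d) := by
  unfold tentCorr
  refine Continuous.integral_pos_of_hasCompactSupport_nonneg_nonzero (x := 0) (by fun_prop) ?_ ?_ ?_
  · refine HasCompactSupport.intro (isCompact_closedBall (0 : E d) 1) fun x hx => ?_
    simp at hx
    simp [tent_eq_zero hx.le]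
  · exact fun _ => mul_nonneg (tent_nonneg _) (tent_nonneg _)
  · simp [tent]

/-- The reflection that maps `u` to `v` preserves norms and volume. Radial symmetry is what turns
the scale integral into an exact power or logarithm of `‖x‖`. -/
lemma tentCorr_eq_of_norm_eq {d : ℕ} {u v : E d} (h : ‖u‖ = ‖v‖) : tentCorr u = tentCorr v := by
  let L : E d ≃ₗᵢ[ℝ] E d := (ℝ ∙ (u - v))ᗮ.reflection
  have hL : L u = v := Submodule.reflection_sub h
  have hn : ∀ w, tent (L w) = tent w := fun w => by simp [tent]
  unfold tentCorr
  conv_rhs => rw [← L.measurePreserving.integral_comp L.toHomeomorph.measurableEmbedding]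
  refine integral_congr_ae (Eventually.of_forall fun w => ?_)
  simp only [hn]
  rw [← hL, ← map_sub, hn]

/-- The integral of the tent function is a Lipschitz constant of its autocorrelation. -/
lemma abs_tentCorr_sub_le {d : ℕ} (u v : E d) :
    |tentCorr u - tentCorr v| ≤ (∫ w : E d, tent w) * ‖u - v‖ := by
  unfold tentCorr
  rw [← integral_sub (integrable_tent_mul (by fun_prop)) (integrable_tent_mul (by fun_prop)),
    ← integral_mul_const]
  refine (abs_integral_le_integral_abs).trans (integral_mono_of_nonneg
    (Eventually.of_forall fun _ => abs_nonneg _) (integrable_tent.mul_const _)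
    (Eventually.of_forall fun w => ?_))
  simp only
  rw [← mul_sub, abs_mul, abs_of_nonneg (tent_nonneg w)]
  refine mul_le_mul_of_nonneg_left ((abs_tent_sub_le _ _).trans_eq ?_) (tent_nonneg w)
  rw [norm_sub_rev]; congr 1; abel

lemma tentCorr_le {d : ℕ} (v : E d) : tentCorr v ≤ ∫ w : E d, tent w := by
  unfold tentCorr
  refine integral_mono (integrable_tent_mul (by fun_prop)) integrable_tent fun w => ?_
  exact mul_le_of_le_one_right (tent_nonneg w) (tent_le_one _)

lemma continuous_tentCorr {d : ℕ} : Continuous (tentCorr : E d → ℝ) := by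
  have : LipschitzWith (Real.toNNReal (∫ w : E d, tent w)) (tentCorr : E d → ℝ) := by
    refine LipschitzWith.of_dist_le_mul fun u v => ?_
    rw [Real.coe_toNNReal _ (integral_nonneg tent_nonneg), Real.dist_eq, dist_eq_norm]
    exact abs_tentCorr_sub_le u v
  exact this.continuous

/-- Double differences of the autocorrelation. -/
lemma abs_tentCorr_double_diff_le {d : ℕ} (x x' y y' : E d) :
    |tentCorr (x - y) - tentCorr (x' - y) - tentCorr (x - y') + tentCorr (x' - y')| ≤
      2 * volume.real (Metric.closedBall (0 : E d) 1) * (‖x - x'‖ * ‖y - y'‖) := by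
  -- With `a` and `b` in separate factors, a double difference of the autocorrelation becomes an
  -- integral of a product of two single differences.
  have key : ∀ a b : E d, tentCorr (a - b) = ∫ z, tent (a - z) * tent (b - z) := fun a b => by
    have := integral_tentKer_mul_tentKer (d := d) one_pos a b
    simpa [tentKer] using this.symm
  have hi : ∀ a b : E d, Integrable fun z => tent (a - z) * tent (b - z) := fun a b => by
    refine Continuous.integrable_of_hasCompactSupport (by fun_prop) ?_
    refine HasCompactSupport.intro (isCompact_closedBall a 1) fun x hx => ?_
    simp only [Metric.mem_closedBall, dist_comm x, dist_eq_norm, not_le] at hx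
    simp [tent_eq_zero hx.le]
  simp only [key]
  rw [← integral_sub (hi _ _) (hi _ _), sub_add, ← integral_sub (hi _ _) (hi _ _),
    ← integral_sub ((hi _ _).sub' (hi _ _)) ((hi _ _).sub' (hi _ _))]
  let B : E d → ℝ := fun z => (Metric.closedBall x 1).indicator 1 z +
    (Metric.closedBall x' 1).indicator 1 z
  have hBi : ∀ a : E d, Integrable ((Metric.closedBall a 1).indicator (1 : E d → ℝ)) := fun a =>
    (integrable_indicator_iff measurableSet_closedBall).2
      (integrableOn_const (measure_closedBall_lt_top).ne)
  have hv : ∀ a : E d, ∫ z, (Metric.closedBall a 1).indicator (1 : E d → ℝ) z =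
      volume.real (Metric.closedBall (0 : E d) 1) := fun a => by
    rw [integral_indicator_one measurableSet_closedBall, measureReal_def, measureReal_def,
      Measure.addHaar_closedBall_center]
  have hB : ∫ z, B z * (‖x - x'‖ * ‖y - y'‖) =
      2 * volume.real (Metric.closedBall (0 : E d) 1) * (‖x - x'‖ * ‖y - y'‖) := by
    rw [integral_mul_const, integral_add (hBi _) (hBi _), hv, hv]; ring
  rw [← hB]
  refine (abs_integral_le_integral_abs).trans (integral_mono_of_nonneg
    (Eventually.of_forall fun _ => abs_nonneg _) (((hBi _).add (hBi _)).mul_const _)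
    (Eventually.of_forall fun z => ?_))
  simp only
  have e : tent (x - z) * tent (y - z) - tent (x' - z) * tent (y - z) -
      (tent (x - z) * tent (y' - z) - tent (x' - z) * tent (y' - z)) =
      (tent (x - z) - tent (x' - z)) * (tent (y - z) - tent (y' - z)) := by ring
  rw [e, abs_mul, ← mul_assoc]
  have h1 := abs_tentKer_sub_le one_pos x x' z
  simp only [tentKer, inv_one, one_smul, one_mul] at h1
  have h2 := abs_tent_sub_le (y - z) (y' - z)
  rw [sub_sub_sub_cancel_right] at h2
  have hBn : 0 ≤ B z := add_nonneg (indicator_nonneg (fun _ _ => zero_le_one) _)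
    (indicator_nonneg (fun _ _ => zero_le_one) _)
  refine mul_le_mul (h1.trans ?_) h2 (abs_nonneg _) (mul_nonneg hBn (norm_nonneg _))
  rw [mul_comm]
  exact mul_le_mul_of_nonneg_left (min_le_right _ _) hBn

/-! ### Multiscale decomposition of the fundamental solution -/

/-- The contribution of the scales `τ ≤ 1` to the fundamental solution. -/
def mainKer {d : ℕ} (x : E d) : ℝ :=
  ∫ τ in Ioc (0 : ℝ) 1, (τ ^ (d - 1))⁻¹ * tentCorr (τ⁻¹ • x)

/-- The renormalization of the kernel at large scales, needed for `d = 2` only. -/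
def corrConst (d : ℕ) : ℝ := if d = 2 then tentCorr (0 : E d) else 0

/-- The contribution of the scales `τ > 1` to the fundamental solution. -/
def remKer {d : ℕ} (x : E d) : ℝ :=
  ∫ τ in Ioi (1 : ℝ), (τ ^ (d - 1))⁻¹ * (tentCorr (τ⁻¹ • x) - corrConst d)

lemma measurable_scaledCorr {d : ℕ} (x : E d) (b : ℝ) :
    Measurable fun τ : ℝ => (τ ^ (d - 1))⁻¹ * (tentCorr (τ⁻¹ • x) - b) := by
  have : Measurable (tentCorr : E d → ℝ) := continuous_tentCorr.measurable
  fun_prop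

/-- The autocorrelation vanishes outside the ball of radius two, so only the scales `τ > ‖x‖ / 2`
contribute and there is no singularity at zero. -/
lemma integrableOn_Ioc_scaledCorr {d : ℕ} {x : E d} (hx : x ≠ 0) (a : ℝ) :
    IntegrableOn (fun τ : ℝ => (τ ^ (d - 1))⁻¹ * tentCorr (τ⁻¹ • x)) (Ioc 0 a) := by
  have hx' : 0 < ‖x‖ := norm_pos_iff.2 hx
  refine Measure.integrableOn_of_bounded (M := ((‖x‖ / 2) ^ (d - 1))⁻¹ * ∫ w : E d, tent w)
    (by simp) (by simpa using (measurable_scaledCorr x 0).aestronglyMeasurable) ?_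
  refine (ae_restrict_iff' measurableSet_Ioc).2 (Eventually.of_forall fun τ hτ => ?_)
  rw [Real.norm_of_nonneg (mul_nonneg (inv_nonneg.2 (pow_nonneg hτ.1.le _)) (tentCorr_nonneg _))]
  by_cases h : 2 ≤ ‖τ⁻¹ • x‖
  · rw [tentCorr_eq_zero h, mul_zero]
    exact mul_nonneg (by positivity) (integral_nonneg tent_nonneg)
  · have : ‖x‖ / 2 ≤ τ := by
      rw [norm_smul, norm_inv, Real.norm_of_nonneg hτ.1.le, inv_mul_eq_div, not_le,
        div_lt_iff₀ hτ.1] at h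
      linarith
    refine mul_le_mul ?_ (tentCorr_le _) (tentCorr_nonneg _) (by positivity)
    gcongr

lemma integrableOn_Ioi_inv_sq {a : ℝ} (ha : 0 < a) :
    IntegrableOn (fun τ : ℝ => (τ ^ 2)⁻¹) (Ioi a) := by
  have := integrableOn_Ioi_rpow_of_lt (show (-2 : ℝ) < -1 by norm_num) ha
  refine this.congr_fun (fun τ hτ => ?_) measurableSet_Ioi
  have : 0 < τ := ha.trans hτ
  simp only
  rw [Real.rpow_neg this.le]; norm_cast

/-- Decay like `τ⁻²` at large scales. For `d ≥ 3` the power of `τ` suffices; for `d = 2` the missing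
power comes from Lipschitz continuity once the value at zero is subtracted. The truncated exponent
`d - 3` is zero for `d = 2`, where that summand is mere slack. -/
lemma integrableOn_Ioi_scaledCorr {d : ℕ} (hd : 2 ≤ d) (x : E d) {a : ℝ} (ha : 0 < a) :
    IntegrableOn (fun τ : ℝ => (τ ^ (d - 1))⁻¹ * (tentCorr (τ⁻¹ • x) - corrConst d)) (Ioi a) := by
  have hI : 0 ≤ ∫ w : E d, tent w := integral_nonneg tent_nonneg
  have : IntegrableOn (fun τ : ℝ => (τ ^ 2)⁻¹ *
      ((∫ w : E d, tent w) * (‖x‖ + (a ^ (d - 3))⁻¹))) (Ioi a) :=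
    (integrableOn_Ioi_inv_sq ha).mul_const _
  refine this.mono' (measurable_scaledCorr x _).aestronglyMeasurable ?_
  refine (ae_restrict_iff' measurableSet_Ioi).2 (Eventually.of_forall fun τ hτ => ?_)
  have hτ0 : 0 < τ := ha.trans hτ
  rw [norm_mul, norm_inv, norm_pow, Real.norm_of_nonneg hτ0.le, Real.norm_eq_abs]
  by_cases h2 : d = 2
  · have h := abs_tentCorr_sub_le (τ⁻¹ • x) 0
    rw [sub_zero, norm_smul, norm_inv, Real.norm_of_nonneg hτ0.le] at h
    rw [corrConst, if_pos h2]
    subst h2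
    calc (τ ^ (2 - 1))⁻¹ * |tentCorr (τ⁻¹ • x) - tentCorr 0|
        ≤ (τ ^ (2 - 1))⁻¹ * ((∫ w : E 2, tent w) * (τ⁻¹ * ‖x‖)) := by gcongr
      _ = (τ ^ 2)⁻¹ * ((∫ w : E 2, tent w) * ‖x‖) := by
          rw [show 2 - 1 = 1 from rfl]; field_simp
      _ ≤ _ := by gcongr; simp
  · rw [corrConst, if_neg h2, sub_zero, abs_of_nonneg (tentCorr_nonneg _)]
    have e : (τ ^ (d - 1))⁻¹ = (τ ^ 2)⁻¹ * (τ ^ (d - 3))⁻¹ := by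
      rw [← mul_inv, ← pow_add]; congr 2; omega
    rw [e, mul_assoc]
    have h1 : (τ ^ (d - 3))⁻¹ ≤ (a ^ (d - 3))⁻¹ := by
      have : a ≤ τ := le_of_lt hτ
      gcongr
    have h2 : (τ ^ (d - 3))⁻¹ * tentCorr (τ⁻¹ • x) ≤ (a ^ (d - 3))⁻¹ * ∫ w : E d, tent w :=
      mul_le_mul h1 (tentCorr_le _) (tentCorr_nonneg _) (by positivity)
    have h3 : 0 ≤ (∫ w : E d, tent w) * ‖x‖ := by positivity
    exact mul_le_mul_of_nonneg_left (by linarith) (by positivity)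

lemma setIntegral_inv_sq_nonneg : 0 ≤ ∫ τ in Ioi (1 : ℝ), (τ ^ 2)⁻¹ :=
  setIntegral_nonneg measurableSet_Ioi fun τ _ => by positivity

/-- On scales above one, `τ^(-(d-1))` is at most `τ⁻¹`, and the difference supplies a second factor
`τ⁻¹`. The renormalization constant cancels. -/
lemma abs_remKer_sub_le {d : ℕ} (hd : 2 ≤ d) (u v : E d) :
    |remKer u - remKer v| ≤
      (∫ τ in Ioi (1 : ℝ), (τ ^ 2)⁻¹) * (∫ w : E d, tent w) * ‖u - v‖ := by
  unfold remKer
  rw [← integral_sub (integrableOn_Ioi_scaledCorr hd u one_pos)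
    (integrableOn_Ioi_scaledCorr hd v one_pos), mul_assoc, ← integral_mul_const,
    ← Real.norm_eq_abs]
  refine norm_integral_le_of_norm_le ((integrableOn_Ioi_inv_sq one_pos).mul_const _) ?_
  refine (ae_restrict_iff' measurableSet_Ioi).2 (Eventually.of_forall fun τ hτ => ?_)
  have hτ1 : 1 < τ := hτ
  have hτ0 : 0 < τ := one_pos.trans hτ1
  rw [← mul_sub, sub_sub_sub_cancel_right, norm_mul, norm_inv, norm_pow,
    Real.norm_of_nonneg hτ0.le, Real.norm_eq_abs]
  have h := abs_tentCorr_sub_le (τ⁻¹ • u) (τ⁻¹ • v)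
  rw [← smul_sub, norm_smul, norm_inv, Real.norm_of_nonneg hτ0.le] at h
  have hI : 0 ≤ ∫ w : E d, tent w := integral_nonneg tent_nonneg
  calc _ ≤ τ⁻¹ * ((∫ w : E d, tent w) * (τ⁻¹ * ‖u - v‖)) := by
        gcongr
        exact le_self_pow₀ hτ1.le (by omega)
    _ = _ := by field_simp

/-- The two differences supply `τ⁻²` by themselves, so the prefactor is simply bounded by one. -/
lemma abs_remKer_double_diff_le {d : ℕ} (hd : 2 ≤ d) (x x' y y' : E d) :
    |remKer (x - y) - remKer (x' - y) - (remKer (x - y') - remKer (x' - y'))| ≤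
      (∫ τ in Ioi (1 : ℝ), (τ ^ 2)⁻¹) * (2 * volume.real (Metric.closedBall (0 : E d) 1)) *
        (‖x - x'‖ * ‖y - y'‖) := by
  unfold remKer
  have hi := fun u : E d => integrableOn_Ioi_scaledCorr hd u one_pos
  rw [← integral_sub (hi _) (hi _), ← integral_sub (hi _) (hi _),
    ← integral_sub ((hi _).sub' (hi _)) ((hi _).sub' (hi _)), mul_assoc, ← integral_mul_const,
    ← Real.norm_eq_abs]
  refine norm_integral_le_of_norm_le ((integrableOn_Ioi_inv_sq one_pos).mul_const _) ?_
  refine (ae_restrict_iff' measurableSet_Ioi).2 (Eventually.of_forall fun τ hτ => ?_)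
  have hτ1 : 1 < τ := hτ
  have hτ0 : 0 < τ := one_pos.trans hτ1
  rw [← mul_sub, ← mul_sub, sub_sub_sub_cancel_right, sub_sub_sub_cancel_right, ← mul_sub,
    norm_mul, norm_inv, norm_pow, Real.norm_of_nonneg hτ0.le, Real.norm_eq_abs]
  have h := abs_tentCorr_double_diff_le (τ⁻¹ • x) (τ⁻¹ • x') (τ⁻¹ • y) (τ⁻¹ • y')
  simp only [← smul_sub, norm_smul, norm_inv, Real.norm_of_nonneg hτ0.le] at h
  rw [← sub_add]
  calc _ ≤ 1 * (2 * volume.real (Metric.closedBall (0 : E d) 1) *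
          (τ⁻¹ * ‖x - x'‖ * (τ⁻¹ * ‖y - y'‖))) := by
        gcongr
        exact inv_le_one_of_one_le₀ (one_le_pow₀ hτ1.le)
    _ = _ := by field_simp

lemma tentCorr_inv_smul {d : ℕ} {e x : E d} (he : ‖e‖ = 1) {t τ : ℝ} (ht : ‖x‖ = t) :
    tentCorr (τ⁻¹ • x) = tentCorr ((τ / t)⁻¹ • e) := by
  refine tentCorr_eq_of_norm_eq ?_
  rw [norm_smul, norm_smul, ht, he, inv_div, norm_inv, norm_div, mul_one, inv_mul_eq_div,
    Real.norm_of_nonneg (ht ▸ norm_nonneg x : 0 ≤ t)]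

/-- In dimension `d ≥ 3`, the multiscale kernel is homogeneous. -/
lemma mainKer_add_remKer_of_three_le {d : ℕ} (hd : 3 ≤ d) {e x : E d} (he : ‖e‖ = 1)
    (hx : x ≠ 0) : mainKer x + remKer x = ‖x‖ ^ (2 - (d : ℤ)) * (mainKer e + remKer e) := by
  have h0 : ∀ y : E d, y ≠ 0 → mainKer y + remKer y =
      ∫ τ in Ioi (0 : ℝ), (τ ^ (d - 1))⁻¹ * tentCorr (τ⁻¹ • y) := fun y hy => by
    have hb : corrConst d = 0 := if_neg (by omega)
    have h1 := integrableOn_Ioi_scaledCorr (by omega) y one_pos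
    unfold mainKer remKer
    simp only [hb, sub_zero] at h1 ⊢
    rw [← Ioc_union_Ioi_eq_Ioi (zero_le_one (α := ℝ)),
      setIntegral_union (Ioc_disjoint_Ioi le_rfl) measurableSet_Ioi
        (integrableOn_Ioc_scaledCorr hy 1) h1]
  have hx' : 0 < ‖x‖ := norm_pos_iff.2 hx
  rw [h0 x hx, h0 e (by rintro rfl; simp at he)]
  -- The substitution `τ = ‖x‖ s` together with radial symmetry extracts the power of `‖x‖`.
  have hs := integral_comp_mul_left_Ioi (fun τ => (τ ^ (d - 1))⁻¹ * tentCorr (τ⁻¹ • x)) 0 hx'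
  rw [mul_zero, smul_eq_mul, inv_mul_eq_div, eq_div_iff hx'.ne', mul_comm] at hs
  rw [← hs, ← integral_const_mul, ← integral_const_mul]
  refine setIntegral_congr_fun measurableSet_Ioi fun s hs => ?_
  beta_reduce
  rw [tentCorr_inv_smul he rfl, mul_div_cancel_left₀ _ hx'.ne', mul_pow, mul_inv, ← mul_assoc,
    ← mul_assoc, ← mul_assoc]
  congr 2
  rw [show (2 - (d : ℤ)) = 1 - ((d - 1 : ℕ) : ℤ) by push_cast [show 1 ≤ d by omega]; ring,
    zpow_sub₀ hx'.ne', zpow_one, zpow_natCast, div_eq_mul_inv]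

/-- In dimension two, the multiscale kernel is logarithmic. -/
lemma mainKer_add_remKer_of_two {e x : E 2} (he : ‖e‖ = 1) (hx : x ≠ 0) :
    mainKer x + remKer x = mainKer e + remKer e - tentCorr (0 : E 2) * Real.log ‖x‖ := by
  have hx' : 0 < ‖x‖ := norm_pos_iff.2 hx
  have he0 : e ≠ 0 := by rintro rfl; simp at he
  have hb : corrConst 2 = tentCorr (0 : E 2) := if_pos rfl
  let g : ℝ → ℝ := fun τ => τ⁻¹ * tentCorr (τ⁻¹ • e)
  let g' : ℝ → ℝ := fun τ => τ⁻¹ * (tentCorr (τ⁻¹ • e) - tentCorr (0 : E 2))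
  have hg : ∀ a b : ℝ, 0 ≤ a → 0 ≤ b → IntervalIntegrable g volume a b := fun a b ha hb => by
    rw [intervalIntegrable_iff]
    refine IntegrableOn.mono_set (t := Ioc 0 (max a b)) ?_ ?_
    · simpa [g] using integrableOn_Ioc_scaledCorr he0 (max a b)
    · exact Ioc_subset_Ioc_left (le_min ha hb)
  have hg' : ∀ a : ℝ, 0 < a → IntegrableOn g' (Ioi a) := fun a ha => by
    simpa [g', hb] using integrableOn_Ioi_scaledCorr le_rfl e ha
  -- After the substitution `τ = ‖y‖ s` the integrands no longer depend on `y`; only the splitting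
  -- point `‖y‖⁻¹` does.
  have hm : ∀ y : E 2, y ≠ 0 → mainKer y + remKer y =
      (∫ s in (0 : ℝ)..‖y‖⁻¹, g s) + ∫ s in Ioi ‖y‖⁻¹, g' s := fun y hy => by
    have hy' : 0 < ‖y‖ := norm_pos_iff.2 hy
    unfold mainKer remKer
    congr 1
    · rw [← intervalIntegral.integral_of_le zero_le_one]
      have := intervalIntegral.integral_comp_mul_left (a := 0) (b := 1) g (inv_ne_zero hy'.ne')
      rw [mul_zero, mul_one, inv_inv, smul_eq_mul, ← inv_mul_eq_iff_eq_mul₀ hy'.ne',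
        ← intervalIntegral.integral_const_mul] at this
      rw [← this]
      refine intervalIntegral.integral_congr fun τ _ => ?_
      simp only [g]
      rw [tentCorr_inv_smul he rfl, ← div_eq_inv_mul, inv_div, show 2 - 1 = 1 from rfl, pow_one]
      field_simp
    · have := integral_comp_mul_left_Ioi g' 1 (inv_pos.2 hy')
      rw [mul_one, inv_inv, smul_eq_mul, ← inv_mul_eq_iff_eq_mul₀ hy'.ne',
        ← integral_const_mul] at this
      rw [← this]
      refine setIntegral_congr_fun measurableSet_Ioi fun τ _ => ?_
      simp only [g', hb]
      rw [tentCorr_inv_smul he rfl, ← div_eq_inv_mul, inv_div, show 2 - 1 = 1 from rfl, pow_one]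
      field_simp
  have hxi := inv_pos.2 hx'
  rw [hm x hx, hm e he0, he, inv_one,
    ← intervalIntegral.integral_add_adjacent_intervals (hg 0 1 le_rfl zero_le_one)
      (hg 1 ‖x‖⁻¹ zero_le_one hxi.le),
    ← intervalIntegral.integral_interval_add_Ioi (hg' 1 one_pos) (hg' _ hxi)]
  -- Moving the splitting point from `1` to `‖x‖⁻¹` replaces `g'` by `g` in between. They differ by
  -- a multiple of `1 / s`, whose integral is the logarithm.
  have hgi : ∫ s in (1 : ℝ)..‖x‖⁻¹, g s = (∫ s in (1 : ℝ)..‖x‖⁻¹, g' s) -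
      tentCorr (0 : E 2) * Real.log ‖x‖ := by
    have h1 : ∫ s in (1 : ℝ)..‖x‖⁻¹, s⁻¹ * tentCorr (0 : E 2) =
        - (tentCorr (0 : E 2) * Real.log ‖x‖) := by
      rw [intervalIntegral.integral_mul_const, integral_inv_of_pos one_pos hxi, div_one,
        Real.log_inv]; ring
    rw [sub_eq_add_neg, ← h1, ← intervalIntegral.integral_add]
    · refine intervalIntegral.integral_congr fun s _ => ?_
      simp only [g, g']; ring
    · rw [intervalIntegrable_iff]
      exact (hg' (min 1 ‖x‖⁻¹ / 2) (by positivity)).mono_set fun s hs =>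
        lt_of_le_of_lt (half_le_self (by positivity)) hs.1
    · refine (intervalIntegral.intervalIntegrable_inv (fun s hs => ?_) continuousOn_id).mul_const _
      have := hs.1
      have h2 : 0 < min 1 ‖x‖⁻¹ := by positivity
      exact (h2.trans_le this).ne'
  rw [hgi]; ring

/-- The factor in `exists_fundSol_eq` for `d ≥ 3` divides by this value. The autocorrelation is
positive at the origin, hence at `τ⁻¹ • e` for all large `τ`. -/
lemma mainKer_add_remKer_pos {d : ℕ} (hd : 3 ≤ d) (e : E d) :
    0 < mainKer e + remKer e := by
  have hb : corrConst d = 0 := if_neg (by omega)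
  have h1 : 0 ≤ mainKer e := setIntegral_nonneg measurableSet_Ioc fun τ hτ =>
    mul_nonneg (inv_nonneg.2 (pow_nonneg hτ.1.le _)) (tentCorr_nonneg _)
  refine add_pos_of_nonneg_of_pos h1 ?_
  have hint := integrableOn_Ioi_scaledCorr (by omega) e one_pos
  unfold remKer
  simp only [hb, sub_zero] at hint ⊢
  rw [setIntegral_pos_iff_support_of_nonneg_ae _ hint]
  · have ht : Tendsto (fun τ : ℝ => tentCorr (τ⁻¹ • e)) atTop (𝓝 (tentCorr (0 : E d))) := by
      refine continuous_tentCorr.continuousAt.tendsto.comp ?_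
      simpa using (tendsto_inv_atTop_zero (𝕜 := ℝ)).smul_const e
    obtain ⟨S, hS⟩ := eventually_atTop.1 (ht.eventually_const_lt tentCorr_zero_pos)
    refine lt_of_lt_of_le ?_ (measure_mono (s := Ioi (max S 1)) fun τ hτ => ?_)
    · simp
    · have h2 := max_lt_iff.1 (mem_Ioi.1 hτ)
      have h3 : 0 < τ := one_pos.trans h2.2
      exact ⟨(mul_pos (by positivity) (hS τ h2.1.le)).ne', h2.2⟩
  · refine (ae_restrict_iff' measurableSet_Ioi).2 (Eventually.of_forall fun τ hτ => ?_)
    have hτ1 : 1 < τ := hτ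
    exact mul_nonneg (by positivity) (tentCorr_nonneg _)

/-- Up to a constant, the fundamental solution is a multiple of the multiscale kernel. -/
lemma exists_fundSol_eq {d : ℕ} (hd : 2 ≤ d) :
    ∃ c c₀ : ℝ, 0 < c ∧ ∀ x : E d, x ≠ 0 → fundSol d x = c * (mainKer x + remKer x) + c₀ := by
  let e : E d := EuclideanSpace.single ⟨0, by omega⟩ 1
  have he : ‖e‖ = 1 := by simp [e]
  by_cases h2 : d = 2
  · subst h2
    have h0 := tentCorr_zero_pos (d := 2)
    refine ⟨1 / (2 * Real.pi * tentCorr (0 : E 2)),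
      -(1 / (2 * Real.pi * tentCorr (0 : E 2)) * (mainKer e + remKer e)),
      by have := Real.pi_pos; positivity, fun x hx => ?_⟩
    rw [mainKer_add_remKer_of_two he hx, fundSol, if_pos rfl]
    have := Real.pi_pos
    field_simp
    ring
  · have hA := mainKer_add_remKer_pos (by omega) e
    have hS : 0 < (volume : Measure (E d)).toSphere.real univ := by
      have : Nonempty (Fin d) := ⟨⟨0, by omega⟩⟩
      rw [measureReal_def, ENNReal.toReal_pos_iff, Measure.toSphere_apply_univ]
      exact ⟨ENNReal.mul_pos (by simp; omega)
        (Metric.measure_ball_pos _ _ one_pos).ne',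
        ENNReal.mul_lt_top (by simp) measure_ball_lt_top⟩
    have hd3 : (0 : ℝ) < (d : ℝ) - 2 := by
      have : 3 ≤ d := by omega
      have : (3 : ℝ) ≤ d := by exact_mod_cast this
      linarith
    refine ⟨1 / (((d : ℝ) - 2) * (volume : Measure (E d)).toSphere.real univ) /
      (mainKer e + remKer e), 0, by positivity, fun x hx => ?_⟩
    rw [mainKer_add_remKer_of_three_le (by omega) he hx, fundSol, if_neg h2, add_zero]
    field_simp

/-! ### The trace estimate for multiscale potentials -/

/-- Upper Ahlfors regularity of dimension `d - 1`. -/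
def UpperRegular {d : ℕ} (A : ℝ) (σ : Measure (E d)) : Prop :=
  0 ≤ A ∧ ∀ (x : E d) (r : ℝ), 0 < r → σ (Metric.closedBall x r) ≤ ENNReal.ofReal (A * r ^ (d - 1))

/-- Positions and scales `0 < τ ≤ 1`. -/
def scaleMeasure (d : ℕ) : Measure (E d × ℝ) :=
  (volume : Measure (E d)).prod (volume.restrict (Ioc (0 : ℝ) 1))

instance {d : ℕ} : SFinite (scaleMeasure d) := by unfold scaleMeasure; infer_instance

lemma ae_scaleMeasure {d : ℕ} : ∀ᵐ p ∂(scaleMeasure d), p.2 ∈ Ioc (0 : ℝ) 1 := by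
  have : ∀ᵐ τ ∂(volume.restrict (Ioc (0 : ℝ) 1)), τ ∈ Ioc (0 : ℝ) 1 :=
    ae_restrict_mem measurableSet_Ioc
  exact (Measure.quasiMeasurePreserving_snd (μ := (volume : Measure (E d)))).ae this

lemma lintegral_scaleMeasure {d : ℕ} {f : E d × ℝ → ℝ≥0∞} (hf : Measurable f) :
    ∫⁻ p, f p ∂(scaleMeasure d) = ∫⁻ τ in Ioc (0 : ℝ) 1, ∫⁻ z, f (z, τ) :=
  lintegral_prod_symm _ hf.aemeasurable

/-- The indicator function of `|x - z| ≤ τ`. -/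
def near {d : ℕ} (τ : ℝ) (x z : E d) : ℝ≥0∞ := if dist x z ≤ τ then 1 else 0

lemma measurable_near {d : ℕ} : Measurable fun p : ℝ × E d × E d => near p.1 p.2.1 p.2.2 :=
  Measurable.ite (measurableSet_le (by fun_prop) (by fun_prop)) measurable_const measurable_const

@[fun_prop]
lemma measurable_near_comp {d : ℕ} {α : Type*} [MeasurableSpace α] {t : α → ℝ} {f g : α → E d}
    (ht : Measurable t) (hf : Measurable f) (hg : Measurable g) :
    Measurable (fun a : α => near (t a) (f a) (g a)) :=
  Measurable.comp (f := fun a => (t a, f a, g a)) (g := fun p : ℝ × E d × E d => near p.1 p.2.1 p.2.2)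
    measurable_near (ht.prodMk (hf.prodMk hg))

@[fun_prop]
lemma measurable_tentKer_comp {d : ℕ} {α : Type*} [MeasurableSpace α] {t : α → ℝ} {f g : α → E d}
    (ht : Measurable t) (hf : Measurable f) (hg : Measurable g) :
    Measurable (fun a : α => tentKer (t a) (f a) (g a)) :=
  Measurable.comp (f := fun a => (t a, f a, g a)) (g := fun p : ℝ × E d × E d => tentKer p.1 p.2.1 p.2.2)
    measurable_tentKer (ht.prodMk (hf.prodMk hg))

lemma near_eq_indicator {d : ℕ} (τ : ℝ) (x z : E d) :
    near τ x z = (Metric.closedBall x τ).indicator 1 z := by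
  unfold near
  by_cases h : dist x z ≤ τ
  · rw [if_pos h, indicator_of_mem (by simpa [dist_comm] using h)]; rfl
  · rw [if_neg h, indicator_of_notMem (by simpa [dist_comm] using h)]

lemma near_comm {d : ℕ} (τ : ℝ) (x z : E d) : near τ x z = near τ z x := by
  unfold near; rw [dist_comm]

lemma lintegral_near {d : ℕ} (σ : Measure (E d)) (τ : ℝ) (x : E d) :
    ∫⁻ z, near τ x z ∂σ = σ (Metric.closedBall x τ) := by
  simp_rw [near_eq_indicator]
  exact lintegral_indicator_one measurableSet_closedBall

lemma lintegral_near_volume {d : ℕ} {τ : ℝ} (hτ : 0 < τ) (x : E d) :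
    ∫⁻ z, near τ x z = ENNReal.ofReal (τ ^ (d : ℝ) * volume.real (Metric.ball (0 : E d) 1)) := by
  rw [lintegral_near, Measure.addHaar_closedBall _ _ hτ.le, finrank_euclideanSpace_fin,
    ENNReal.ofReal_mul (by positivity), Real.rpow_natCast, measureReal_def,
    ENNReal.ofReal_toReal measure_ball_lt_top.ne]

lemma ofReal_tentKer_le {d : ℕ} {τ : ℝ} (hτ : 0 < τ) (x z : E d) :
    ENNReal.ofReal (tentKer τ x z) ≤ near τ x z := by
  have h := tentKer_le_indicator hτ x z
  rw [near_eq_indicator]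
  by_cases hz : z ∈ Metric.closedBall x τ
  · simp only [hz, indicator_of_mem, Pi.one_apply] at h ⊢
    exact ENNReal.ofReal_le_one.2 h
  · simp only [hz, not_false_eq_true, indicator_of_notMem] at h ⊢
    simp [h]

lemma ofReal_abs_tentKer_sub_le {d : ℕ} {τ : ℝ} (hτ : 0 < τ) (x y z : E d) :
    ENNReal.ofReal |tentKer τ x z - tentKer τ y z| ≤
      ENNReal.ofReal (τ⁻¹ * min τ ‖x - y‖) * (near τ x z + near τ y z) := by
  have h := ENNReal.ofReal_le_ofReal (abs_tentKer_sub_le hτ x y z)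
  have h1 : ∀ w : E d, ENNReal.ofReal ((Metric.closedBall w τ).indicator (1 : E d → ℝ) z) =
      near τ w z := fun w => by
    rw [near_eq_indicator]
    by_cases hz : z ∈ Metric.closedBall w τ <;> simp [hz]
  have h2 : ∀ w : E d, 0 ≤ (Metric.closedBall w τ).indicator (1 : E d → ℝ) z := fun w =>
    indicator_nonneg (fun _ _ => zero_le_one) _
  rwa [ENNReal.ofReal_mul (by have := norm_nonneg (x - y); positivity),
    ENNReal.ofReal_add (h2 _) (h2 _), h1, h1] at h

/-- The scale integral behind the Schur tests. -/
lemma lintegral_rpow_mul_min_le {τ : ℝ} (hτ : 0 < τ) :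
    ∫⁻ s in Ioi (0 : ℝ), ENNReal.ofReal (s ^ (-3 / 2 : ℝ) * min τ s) ≤
      ENNReal.ofReal (4 * τ ^ (1 / 2 : ℝ)) := by
  have hp : 0 ≤ τ ^ (1 / 2 : ℝ) := by positivity
  -- The integral splits at `s = τ` into two equal contributions.
  have e1 : ∫⁻ s in Ioc (0 : ℝ) τ, ENNReal.ofReal (s ^ (-3 / 2 : ℝ) * min τ s) =
      ENNReal.ofReal (2 * τ ^ (1 / 2 : ℝ)) := by
    have hi : IntervalIntegrable (fun s : ℝ => s ^ (-1 / 2 : ℝ)) volume 0 τ :=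
      intervalIntegral.intervalIntegrable_rpow' (by norm_num)
    have h2 : ∫ s in Ioc (0 : ℝ) τ, s ^ (-1 / 2 : ℝ) = 2 * τ ^ (1 / 2 : ℝ) := by
      rw [← intervalIntegral.integral_of_le hτ.le, integral_rpow (by norm_num)]
      norm_num
      ring
    rw [← h2, ofReal_integral_eq_lintegral_ofReal
      ((intervalIntegrable_iff_integrableOn_Ioc_of_le hτ.le).1 hi)
      ((ae_restrict_iff' measurableSet_Ioc).2 (Eventually.of_forall fun s hs =>
        Real.rpow_nonneg hs.1.le _))]
    refine setLIntegral_congr_fun measurableSet_Ioc fun s hs => ?_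
    rw [min_eq_right hs.2]
    nth_rewrite 2 [← Real.rpow_one s]
    rw [← Real.rpow_add hs.1]
    norm_num
  have e2 : ∫⁻ s in Ioi τ, ENNReal.ofReal (s ^ (-3 / 2 : ℝ) * min τ s) =
      ENNReal.ofReal (2 * τ ^ (1 / 2 : ℝ)) := by
    have hi : IntegrableOn (fun s : ℝ => s ^ (-3 / 2 : ℝ)) (Ioi τ) :=
      integrableOn_Ioi_rpow_of_lt (by norm_num) hτ
    have h2 : ∫ s in Ioi τ, s ^ (-3 / 2 : ℝ) * τ = 2 * τ ^ (1 / 2 : ℝ) := by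
      rw [integral_mul_const, integral_Ioi_rpow_of_lt (by norm_num) hτ]
      have : τ ^ (1 / 2 : ℝ) = τ ^ (-3 / 2 + 1 : ℝ) * τ := by
        nth_rewrite 3 [← Real.rpow_one τ]
        rw [← Real.rpow_add hτ]; norm_num
      rw [this]; ring
    rw [← h2, ofReal_integral_eq_lintegral_ofReal (hi.mul_const _)
      ((ae_restrict_iff' measurableSet_Ioi).2 (Eventually.of_forall fun s hs =>
        mul_nonneg (Real.rpow_nonneg (hτ.trans hs).le _) hτ.le))]
    refine setLIntegral_congr_fun measurableSet_Ioi fun s hs => ?_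
    rw [min_eq_left (le_of_lt hs)]
  rw [← Ioc_union_Ioi_eq_Ioi hτ.le, lintegral_union measurableSet_Ioi (Ioc_disjoint_Ioi le_rfl),
    e1, e2, ← ENNReal.ofReal_add (by positivity) (by positivity)]
  apply ENNReal.ofReal_le_ofReal
  linarith

/-- A singular integral over an upper regular measure. -/
lemma UpperRegular.lintegral_rpow_mul_min_le {d : ℕ} (hd : 2 ≤ d) {A : ℝ} {σ : Measure (E d)}
    [SFinite σ] (hA : UpperRegular A σ) {τ : ℝ} (hτ : 0 < τ) (x : E d) :
    ∫⁻ y, ENNReal.ofReal (‖x - y‖ ^ (1 / 2 - d : ℝ) * min τ ‖x - y‖) ∂σ ≤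
      ENNReal.ofReal (4 * d * A * τ ^ (1 / 2 : ℝ)) := by
  have hd' : (2 : ℝ) ≤ d := by exact_mod_cast hd
  let k : ℝ → ℝ := fun s => (d : ℝ) * (s ^ (-1 / 2 - d : ℝ) * min τ s)
  have hk : Measurable k := by fun_prop
  -- Layer cake formula: with `h = ‖x - y‖`, the kernel equals `(d - 1/2) ∫_h^∞ min(τ, h) s^(-1/2-d)
  -- ds`, and `near s x y` encodes `s ≥ h`. Exchanging the integrals leaves measures of balls, which
  -- are at most `A s^(d-1)`.
  have h1 : ∀ y, ENNReal.ofReal (‖x - y‖ ^ (1 / 2 - d : ℝ) * min τ ‖x - y‖) ≤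
      ∫⁻ s in Ioi (0 : ℝ), ENNReal.ofReal (k s) * near s x y := fun y => by
    rcases eq_or_lt_of_le (norm_nonneg (x - y)) with h0 | h0
    · rw [← h0, min_eq_right hτ.le]; simp
    set h := ‖x - y‖ with hh
    have hm : 0 < min τ h := lt_min hτ h0
    have h2 : ∫ s in Ioi h, ((d : ℝ) - 1 / 2) * min τ h * s ^ (-1 / 2 - d : ℝ) =
        h ^ (1 / 2 - d : ℝ) * min τ h := by
      rw [integral_const_mul, integral_Ioi_rpow_of_lt (by linarith) h0]
      have e : (-1 / 2 - d + 1 : ℝ) = 1 / 2 - d := by ring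
      rw [e]
      have : (1 - 2 * d : ℝ) ≠ 0 := by linarith
      have e2 : (d : ℝ) - 1 / 2 = -(1 / 2 - d) := by ring
      have e3 : (1 / 2 - d : ℝ) ≠ 0 := by linarith
      rw [e2]
      generalize (1 / 2 - d : ℝ) = b at *
      field_simp
    rw [← h2, ofReal_integral_eq_lintegral_ofReal
      ((integrableOn_Ioi_rpow_of_lt (by linarith) h0).const_mul _)]
    · refine (setLIntegral_mono' measurableSet_Ioi fun s hs => ?_).trans
        (lintegral_mono_set (Ioi_subset_Ioi h0.le))
      have hs' : h < s := hs
      have hs0 : 0 < s := h0.trans hs'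
      rw [near, if_pos (by rw [dist_eq_norm]; exact hs'.le), mul_one]
      refine ENNReal.ofReal_le_ofReal ?_
      have h3 : min τ h ≤ min τ s := min_le_min le_rfl hs'.le
      have h4 : 0 ≤ s ^ (-1 / 2 - d : ℝ) := by positivity
      have h5 : min τ h * s ^ (-1 / 2 - d : ℝ) ≤ s ^ (-1 / 2 - d : ℝ) * min τ s := by nlinarith
      have h6 : 0 ≤ min τ h * s ^ (-1 / 2 - d : ℝ) := mul_nonneg hm.le h4
      simp only [k]
      nlinarith
    · refine (ae_restrict_iff' measurableSet_Ioi).2 (Eventually.of_forall fun s hs => ?_)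
      have hs0 : 0 < s := h0.trans hs
      exact mul_nonneg (mul_nonneg (by linarith) hm.le) (Real.rpow_nonneg hs0.le _)
  calc _ ≤ ∫⁻ y, (∫⁻ s in Ioi (0 : ℝ), ENNReal.ofReal (k s) * near s x y) ∂σ := lintegral_mono h1
    _ = ∫⁻ s in Ioi (0 : ℝ), (∫⁻ y, ENNReal.ofReal (k s) * near s x y ∂σ) := by
        apply lintegral_lintegral_swap
        have : Measurable fun p : E d × ℝ => ENNReal.ofReal (k p.2) * near p.2 x p.1 := by fun_prop
        exact this.aemeasurable
    _ ≤ ∫⁻ s in Ioi (0 : ℝ), ENNReal.ofReal (d * A) *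
          ENNReal.ofReal (s ^ (-3 / 2 : ℝ) * min τ s) := by
        refine setLIntegral_mono' measurableSet_Ioi fun s hs => ?_
        have hs0 : 0 < s := hs
        rw [lintegral_const_mul _ (by fun_prop), lintegral_near]
        refine (mul_le_mul_right (hA.2 x s hs0) _).trans_eq ?_
        have hA0 := hA.1
        rw [← ENNReal.ofReal_mul (by positivity), ← ENNReal.ofReal_mul (by positivity)]
        congr 1
        have e : s ^ (-3 / 2 : ℝ) = s ^ (-1 / 2 - d : ℝ) * s ^ (d - 1) := by
          rw [← Real.rpow_natCast, ← Real.rpow_add hs0]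
          congr 1
          push_cast [show 1 ≤ d by omega]
          ring
        rw [e]
        simp only [k]
        ring
    _ ≤ _ := by
        rw [lintegral_const_mul _ (by fun_prop)]
        refine (mul_le_mul_right (BEM.lintegral_rpow_mul_min_le hτ) _).trans_eq ?_
        have hA0 := hA.1
        rw [← ENNReal.ofReal_mul (by positivity)]
        congr 1
        ring

/-- The weighted Cauchy–Schwarz inequality. -/
lemma sq_lintegral_mul_le {α : Type*} [MeasurableSpace α] {μ : Measure α} {k V W F : α → ℝ≥0∞}
    (hk : Measurable k) (hV : Measurable V) (hW : Measurable W) (hF : Measurable F)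
    (hVW : ∀ᵐ a ∂μ, V a * W a = 1) :
    (∫⁻ a, k a * F a ∂μ) ^ 2 ≤ (∫⁻ a, k a * V a ∂μ) * ∫⁻ a, k a * W a * F a ^ 2 ∂μ := by
  have h := ENNReal.lintegral_mul_le_Lp_mul_Lq μ Real.HolderConjugate.two_two
    (f := fun a => (k a * V a) ^ (1 / 2 : ℝ)) (g := fun a => (k a * W a) ^ (1 / 2 : ℝ) * F a)
    (by fun_prop) (by fun_prop)
  have e0 : ∫⁻ a, ((fun a => (k a * V a) ^ (1 / 2 : ℝ)) *
      fun a => (k a * W a) ^ (1 / 2 : ℝ) * F a) a ∂μ = ∫⁻ a, k a * F a ∂μ := by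
    refine lintegral_congr_ae (hVW.mono fun a ha => ?_)
    simp only [Pi.mul_apply]
    rw [← mul_assoc, ← ENNReal.mul_rpow_of_nonneg _ _ (by norm_num)]
    have : k a * V a * (k a * W a) = k a ^ 2 := by
      rw [show k a * V a * (k a * W a) = k a ^ 2 * (V a * W a) by ring, ha, mul_one]
    rw [this, ← ENNReal.rpow_natCast, ← ENNReal.rpow_mul]
    norm_num
  rw [e0] at h
  have h2 := pow_le_pow_left₀ (by positivity) h 2
  refine h2.trans_eq ?_
  rw [mul_pow, ← ENNReal.rpow_natCast, ← ENNReal.rpow_natCast, ← ENNReal.rpow_mul,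
    ← ENNReal.rpow_mul]
  norm_num
  congr 1
  · refine lintegral_congr fun a => ?_
    rw [← ENNReal.rpow_natCast, ← ENNReal.rpow_mul]; norm_num
  · refine lintegral_congr fun a => ?_
    rw [mul_pow, ← ENNReal.rpow_natCast, ← ENNReal.rpow_mul]; norm_num

lemma ofReal_rpow_mul_rpow {τ : ℝ} (hτ : 0 < τ) (a b : ℝ) :
    ENNReal.ofReal (τ ^ a) * ENNReal.ofReal (τ ^ b) = ENNReal.ofReal (τ ^ (a + b)) := by
  rw [← ENNReal.ofReal_mul (by positivity), ← Real.rpow_add hτ]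

/-- First factor of the weighted Cauchy–Schwarz inequality for the seminorm. The weight `τ^(d-3/2)`
is chosen such that the powers combine to `τ^(-3/2) min(‖x - y‖, τ)`, whose integral over all scales
is of order `‖x - y‖^(1/2)`. -/
lemma lintegral_weight_diff_le {d : ℕ} {x y : E d} (h : 0 < ‖x - y‖) :
    ∫⁻ p, ENNReal.ofReal (p.2 ^ (1 - 2 * d : ℝ)) *
      ENNReal.ofReal |tentKer p.2 x p.1 - tentKer p.2 y p.1| *
        ENNReal.ofReal (p.2 ^ (d - 3 / 2 : ℝ)) ∂(scaleMeasure d) ≤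
      ENNReal.ofReal (8 * volume.real (Metric.ball (0 : E d) 1)) *
        ENNReal.ofReal (‖x - y‖ ^ (1 / 2 : ℝ)) := by
  set w := volume.real (Metric.ball (0 : E d) 1) with hw
  have hw0 : 0 ≤ w := measureReal_nonneg
  rw [lintegral_scaleMeasure (by fun_prop)]
  calc _ ≤ ∫⁻ τ in Ioc (0 : ℝ) 1, ENNReal.ofReal (2 * w) *
        ENNReal.ofReal (τ ^ (-3 / 2 : ℝ) * min ‖x - y‖ τ) := by
        refine setLIntegral_mono' measurableSet_Ioc fun τ hτ => ?_
        have hτ0 := hτ.1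
        beta_reduce
        dsimp only
        have h1 : ∫⁻ z : E d, ENNReal.ofReal |tentKer τ x z - tentKer τ y z| ≤
            ENNReal.ofReal (τ⁻¹ * min τ ‖x - y‖) * ENNReal.ofReal (2 * (τ ^ (d : ℝ) * w)) := by
          refine (lintegral_mono fun z => ofReal_abs_tentKer_sub_le hτ0 x y z).trans_eq ?_
          rw [lintegral_const_mul _ (by fun_prop (disch := fun_prop)),
            lintegral_add_left (by fun_prop), lintegral_near_volume hτ0,
            lintegral_near_volume hτ0, ← ENNReal.ofReal_add (by positivity) (by positivity),
            two_mul]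
        rw [lintegral_mul_const _ (by fun_prop), lintegral_const_mul _ (by fun_prop)]
        calc _ ≤ ENNReal.ofReal (τ ^ (1 - 2 * d : ℝ)) * (ENNReal.ofReal (τ⁻¹ * min τ ‖x - y‖) *
              ENNReal.ofReal (2 * (τ ^ (d : ℝ) * w))) * ENNReal.ofReal (τ ^ (d - 3 / 2 : ℝ)) := by
              gcongr
          _ = _ := by
              rw [← ENNReal.ofReal_mul (by positivity), ← ENNReal.ofReal_mul (by positivity),
                ← ENNReal.ofReal_mul (by positivity), ← ENNReal.ofReal_mul (by positivity)]
              congr 1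
              have e : τ ^ (-3 / 2 : ℝ) = τ ^ (1 - 2 * d : ℝ) * τ⁻¹ * τ ^ (d : ℝ) *
                  τ ^ (d - 3 / 2 : ℝ) := by
                rw [← Real.rpow_neg_one, ← Real.rpow_add hτ0, ← Real.rpow_add hτ0,
                  ← Real.rpow_add hτ0]
                congr 1; ring
              rw [e, min_comm]; ring
    _ ≤ ENNReal.ofReal (2 * w) * ∫⁻ τ in Ioi (0 : ℝ),
          ENNReal.ofReal (τ ^ (-3 / 2 : ℝ) * min ‖x - y‖ τ) := by
        rw [lintegral_const_mul _ (by fun_prop)]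
        gcongr
        exact Ioc_subset_Ioi_self
    _ ≤ _ := by
        refine (mul_le_mul_right (lintegral_rpow_mul_min_le h) _).trans_eq ?_
        rw [← ENNReal.ofReal_mul (by positivity), ← ENNReal.ofReal_mul (by positivity)]
        congr 1; ring

/-- Counterpart for the `L²`-part with the same weight. On scales at most one, `τ = min 1 τ`, so the
same scale integral applies. -/
lemma lintegral_weight_le {d : ℕ} (x : E d) :
    ∫⁻ p, ENNReal.ofReal (p.2 ^ (1 - 2 * d : ℝ)) * ENNReal.ofReal (tentKer p.2 x p.1) *
        ENNReal.ofReal (p.2 ^ (d - 3 / 2 : ℝ)) ∂(scaleMeasure d) ≤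
      ENNReal.ofReal (4 * volume.real (Metric.ball (0 : E d) 1)) := by
  set w := volume.real (Metric.ball (0 : E d) 1) with hw
  have hw0 : 0 ≤ w := measureReal_nonneg
  rw [lintegral_scaleMeasure (by fun_prop)]
  calc _ ≤ ∫⁻ τ in Ioc (0 : ℝ) 1, ENNReal.ofReal w *
        ENNReal.ofReal (τ ^ (-3 / 2 : ℝ) * min 1 τ) := by
        refine setLIntegral_mono' measurableSet_Ioc fun τ hτ => ?_
        have hτ0 := hτ.1
        dsimp only
        have h1 : ∫⁻ z : E d, ENNReal.ofReal (tentKer τ x z) ≤ ENNReal.ofReal (τ ^ (d : ℝ) * w) :=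
          (lintegral_mono fun z => ofReal_tentKer_le hτ0 x z).trans_eq
            (lintegral_near_volume hτ0 x)
        rw [lintegral_mul_const _ (by fun_prop), lintegral_const_mul _ (by fun_prop)]
        calc _ ≤ ENNReal.ofReal (τ ^ (1 - 2 * d : ℝ)) * ENNReal.ofReal (τ ^ (d : ℝ) * w) *
              ENNReal.ofReal (τ ^ (d - 3 / 2 : ℝ)) := by gcongr
          _ = _ := by
              rw [← ENNReal.ofReal_mul (by positivity), ← ENNReal.ofReal_mul (by positivity),
                ← ENNReal.ofReal_mul (by positivity)]
              congr 1
              have e : τ ^ (-3 / 2 : ℝ) * τ = τ ^ (1 - 2 * d : ℝ) * τ ^ (d : ℝ) *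
                  τ ^ (d - 3 / 2 : ℝ) := by
                nth_rewrite 2 [← Real.rpow_one τ]
                rw [← Real.rpow_add hτ0, ← Real.rpow_add hτ0, ← Real.rpow_add hτ0]
                congr 1; ring
              rw [min_eq_right hτ.2, e]; ring
    _ ≤ ENNReal.ofReal w * ∫⁻ τ in Ioi (0 : ℝ),
          ENNReal.ofReal (τ ^ (-3 / 2 : ℝ) * min 1 τ) := by
        rw [lintegral_const_mul _ (by fun_prop)]
        gcongr
        exact Ioc_subset_Ioi_self
    _ ≤ _ := by
        refine (mul_le_mul_right (lintegral_rpow_mul_min_le one_pos) _).trans_eq ?_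
        rw [← ENNReal.ofReal_mul (by positivity)]
        congr 1; norm_num; ring

/-- The multiscale energy. -/
def scaleEnergy {d : ℕ} (F : E d × ℝ → ℝ≥0∞) : ℝ≥0∞ :=
  ∫⁻ p, ENNReal.ofReal (p.2 ^ (1 - 2 * d : ℝ)) * F p ^ 2 ∂(scaleMeasure d)

/-- The trace estimate, `L²`-part. -/
lemma UpperRegular.lintegral_sq_le {d : ℕ} {A : ℝ} {σ : Measure (E d)} [SFinite σ]
    (hd : 2 ≤ d) (hA : UpperRegular A σ) {u : E d → ℝ} {F : E d × ℝ → ℝ≥0∞} (hF : Measurable F)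
    (h1 : ∀ x, ‖u x‖ₑ ≤ ∫⁻ p, ENNReal.ofReal (p.2 ^ (1 - 2 * d : ℝ)) *
      ENNReal.ofReal (tentKer p.2 x p.1) * F p ∂(scaleMeasure d)) :
    ∫⁻ x, ‖u x‖ₑ ^ 2 ∂σ ≤
      ENNReal.ofReal (4 * volume.real (Metric.ball (0 : E d) 1) * A) * scaleEnergy F := by
  set w := volume.real (Metric.ball (0 : E d) 1) with hw
  have hA0 := hA.1
  have hw0 : 0 ≤ w := measureReal_nonneg
  calc _ ≤ ∫⁻ x, ENNReal.ofReal (4 * w) * ∫⁻ p, ENNReal.ofReal (p.2 ^ (5 / 2 - 3 * d : ℝ)) *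
        F p ^ 2 * near p.2 p.1 x ∂(scaleMeasure d) ∂σ := by
        refine lintegral_mono fun x => ?_
        refine (pow_le_pow_left₀ (by positivity) (h1 x) 2).trans ?_
        refine (sq_lintegral_mul_le (V := fun p => ENNReal.ofReal (p.2 ^ (d - 3 / 2 : ℝ)))
          (W := fun p => ENNReal.ofReal (p.2 ^ (3 / 2 - d : ℝ)))
          (by fun_prop) (by fun_prop) (by fun_prop) hF ?_).trans ?_
        · filter_upwards [ae_scaleMeasure] with p hp
          rw [ofReal_rpow_mul_rpow hp.1]; simp
        refine mul_le_mul' (lintegral_weight_le x) (lintegral_mono_ae ?_)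
        filter_upwards [ae_scaleMeasure] with p hp
        calc _ ≤ ENNReal.ofReal (p.2 ^ (1 - 2 * d : ℝ)) * near p.2 x p.1 *
              ENNReal.ofReal (p.2 ^ (3 / 2 - d : ℝ)) * F p ^ 2 := by
              gcongr; exact ofReal_tentKer_le hp.1 _ _
          _ = ENNReal.ofReal (p.2 ^ (1 - 2 * d : ℝ)) * ENNReal.ofReal (p.2 ^ (3 / 2 - d : ℝ)) *
              F p ^ 2 * near p.2 x p.1 := by ring
          _ = _ := by
              rw [ofReal_rpow_mul_rpow hp.1, near_comm]
              ring_nf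
    _ = ENNReal.ofReal (4 * w) * ∫⁻ p, ENNReal.ofReal (p.2 ^ (5 / 2 - 3 * d : ℝ)) *
        F p ^ 2 * σ (Metric.closedBall p.1 p.2) ∂(scaleMeasure d) := by
        rw [lintegral_const_mul', lintegral_lintegral_swap]
        · simp_rw [← lintegral_near]
          congr 1
          refine lintegral_congr fun p => ?_
          rw [lintegral_const_mul _ (by fun_prop)]
        · exact Measurable.aemeasurable (by fun_prop)
        · exact ENNReal.ofReal_ne_top
    _ ≤ ENNReal.ofReal (4 * w) * ∫⁻ p, ENNReal.ofReal A *
          (ENNReal.ofReal (p.2 ^ (1 - 2 * d : ℝ)) * F p ^ 2) ∂(scaleMeasure d) := by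
        gcongr ENNReal.ofReal (4 * w) * ?_
        refine lintegral_mono_ae ?_
        filter_upwards [ae_scaleMeasure] with p hp
        have hp0 := hp.1
        calc _ ≤ ENNReal.ofReal (p.2 ^ (5 / 2 - 3 * d : ℝ)) * F p ^ 2 *
              ENNReal.ofReal (A * p.2 ^ (d - 1)) := by gcongr; exact hA.2 _ _ hp0
          _ = ENNReal.ofReal A * (ENNReal.ofReal (p.2 ^ (5 / 2 - 3 * d : ℝ)) *
                ENNReal.ofReal (p.2 ^ ((d - 1 : ℕ) : ℝ)) * F p ^ 2) := by
              rw [ENNReal.ofReal_mul hA0, Real.rpow_natCast]; ring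
          _ ≤ _ := by
              rw [ofReal_rpow_mul_rpow hp0]
              gcongr ENNReal.ofReal A * (ENNReal.ofReal ?_ * _)
              -- The exponent on the left exceeds `1 - 2 d` by `1/2`, which is harmless because `τ ≤
              -- 1`.
              refine Real.rpow_le_rpow_of_exponent_ge hp0 hp.2 ?_
              push_cast [show 1 ≤ d by omega]
              linarith
    _ = _ := by
        rw [lintegral_const_mul _ (by fun_prop), ← mul_assoc, ← ENNReal.ofReal_mul (by positivity)]
        rfl

/-- The trace estimate, seminorm part. -/
lemma UpperRegular.lintegral_diffQuot_le {d : ℕ} {A : ℝ} {σ : Measure (E d)} [SFinite σ]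
    (hd : 2 ≤ d) (hA : UpperRegular A σ) {u : E d → ℝ} {F : E d × ℝ → ℝ≥0∞} (hF : Measurable F)
    (h2 : ∀ x y, ‖u x - u y‖ₑ ≤ ∫⁻ p, ENNReal.ofReal (p.2 ^ (1 - 2 * d : ℝ)) *
      ENNReal.ofReal |tentKer p.2 x p.1 - tentKer p.2 y p.1| * F p ∂(scaleMeasure d)) :
    ∫⁻ x, ∫⁻ y, ‖diffQuot (1 / 2) u (x, y)‖ₑ ^ 2 ∂σ ∂σ ≤
      ENNReal.ofReal (64 * d * volume.real (Metric.ball (0 : E d) 1) * A ^ 2) *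
        scaleEnergy F := by
  set w := volume.real (Metric.ball (0 : E d) 1) with hw
  have hA0 := hA.1
  have hw0 : 0 ≤ w := measureReal_nonneg
  -- Second Cauchy–Schwarz factor, localized near its first argument. The part localized near the
  -- other point is the same function with arguments exchanged.
  let J : E d → E d → ℝ≥0∞ := fun x y => ∫⁻ p, ENNReal.ofReal (p.2 ^ (3 / 2 - 3 * d : ℝ)) *
    ENNReal.ofReal (min p.2 ‖x - y‖) * near p.2 x p.1 * F p ^ 2 ∂(scaleMeasure d)
  have hJ : Measurable fun q : E d × E d => J q.1 q.2 := by
    refine Measurable.lintegral_prod_right' (f := fun r : (E d × E d) × E d × ℝ =>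
      ENNReal.ofReal (r.2.2 ^ (3 / 2 - 3 * d : ℝ)) *
      ENNReal.ofReal (min r.2.2 ‖r.1.1 - r.1.2‖) * near r.2.2 r.1.1 r.2.1 * F r.2 ^ 2) ?_
    fun_prop
  have hp : ∀ x y, ‖diffQuot (1 / 2) u (x, y)‖ₑ ^ 2 ≤ ENNReal.ofReal (8 * w) *
      (ENNReal.ofReal (‖x - y‖ ^ (1 / 2 - d : ℝ)) * J x y +
        ENNReal.ofReal (‖y - x‖ ^ (1 / 2 - d : ℝ)) * J y x) := fun x y => by
    rcases eq_or_lt_of_le (norm_nonneg (x - y)) with h0 | h0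
    · have : x = y := by rw [← sub_eq_zero, ← norm_eq_zero, ← h0]
      simp [diffQuot, this]
    have hcs : ‖u x - u y‖ₑ ^ 2 ≤ ENNReal.ofReal (8 * w) *
        ENNReal.ofReal (‖x - y‖ ^ (1 / 2 : ℝ)) * (J x y + J y x) := by
      refine (pow_le_pow_left₀ (by positivity) (h2 x y) 2).trans ?_
      refine (sq_lintegral_mul_le (V := fun p => ENNReal.ofReal (p.2 ^ (d - 3 / 2 : ℝ)))
        (W := fun p => ENNReal.ofReal (p.2 ^ (3 / 2 - d : ℝ)))
        (by fun_prop) (by fun_prop) (by fun_prop) hF ?_).trans ?_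
      · filter_upwards [ae_scaleMeasure] with p hp
        rw [ofReal_rpow_mul_rpow hp.1]; simp
      refine mul_le_mul' (lintegral_weight_diff_le h0) ?_
      rw [← lintegral_add_left (by fun_prop)]
      refine lintegral_mono_ae ?_
      filter_upwards [ae_scaleMeasure] with p hp
      have hp0 := hp.1
      calc _ ≤ ENNReal.ofReal (p.2 ^ (1 - 2 * d : ℝ)) * (ENNReal.ofReal (p.2⁻¹ * min p.2 ‖x - y‖) *
              (near p.2 x p.1 + near p.2 y p.1)) * ENNReal.ofReal (p.2 ^ (3 / 2 - d : ℝ)) *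
              F p ^ 2 := by
            gcongr; exact ofReal_abs_tentKer_sub_le hp0 _ _ _
        _ = (ENNReal.ofReal (p.2 ^ (1 - 2 * d : ℝ)) * ENNReal.ofReal (p.2 ^ (-1 : ℝ)) *
              ENNReal.ofReal (p.2 ^ (3 / 2 - d : ℝ))) * ENNReal.ofReal (min p.2 ‖x - y‖) *
              (near p.2 x p.1 + near p.2 y p.1) * F p ^ 2 := by
            rw [ENNReal.ofReal_mul (by positivity), Real.rpow_neg_one]; ring
        _ = _ := by
            rw [ofReal_rpow_mul_rpow hp0, ofReal_rpow_mul_rpow hp0, norm_sub_rev y x]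
            rw [show (1 - 2 * d + -1 + (3 / 2 - d) : ℝ) = 3 / 2 - 3 * d by ring]
            ring
    have e1 : ‖diffQuot (1 / 2) u (x, y)‖ₑ ^ 2 =
        ‖u x - u y‖ₑ ^ 2 * ENNReal.ofReal (‖x - y‖ ^ (-d : ℝ)) := by
      unfold diffQuot
      rw [div_eq_mul_inv, enorm_mul, mul_pow]
      congr 1
      rw [Real.enorm_of_nonneg (by positivity), ← ENNReal.ofReal_pow (by positivity)]
      congr 1
      rw [← Real.rpow_neg h0.le, ← Real.rpow_natCast, ← Real.rpow_mul h0.le]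
      congr 1; push_cast; ring
    rw [e1]
    refine (mul_le_mul_left hcs _).trans_eq ?_
    rw [norm_sub_rev y x, ← mul_add,
      show (1 / 2 - d : ℝ) = 1 / 2 + -d by ring, ← ofReal_rpow_mul_rpow h0]
    ring
  -- Integrating in `y` first costs `τ^(1/2)`, integrating in `x` over a ball of radius `τ` then
  -- costs `τ^(d-1)`. The total power is `3/2 - 3d + 1/2 + (d - 1) = 1 - 2d`, that of the energy.
  have hT : ∫⁻ x, ∫⁻ y, ENNReal.ofReal (‖x - y‖ ^ (1 / 2 - d : ℝ)) * J x y ∂σ ∂σ ≤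
      ENNReal.ofReal (4 * d * A ^ 2) * scaleEnergy F := by
    calc _ ≤ ∫⁻ x, ∫⁻ p, ENNReal.ofReal (4 * d * A) * (ENNReal.ofReal (p.2 ^ (2 - 3 * d : ℝ)) *
          F p ^ 2) * near p.2 p.1 x ∂(scaleMeasure d) ∂σ := by
          refine lintegral_mono fun x => ?_
          have : ∀ y, ENNReal.ofReal (‖x - y‖ ^ (1 / 2 - d : ℝ)) * J x y =
              ∫⁻ p, ENNReal.ofReal (p.2 ^ (3 / 2 - 3 * d : ℝ)) * near p.2 x p.1 * F p ^ 2 *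
                ENNReal.ofReal (‖x - y‖ ^ (1 / 2 - d : ℝ) * min p.2 ‖x - y‖)
                  ∂(scaleMeasure d) := fun y => by
            rw [← lintegral_const_mul _ (by fun_prop)]
            refine lintegral_congr fun p => ?_
            rw [ENNReal.ofReal_mul (by positivity)]
            ring
          simp_rw [this]
          rw [lintegral_lintegral_swap (Measurable.aemeasurable (by fun_prop))]
          refine lintegral_mono_ae ?_
          filter_upwards [ae_scaleMeasure] with p hp
          rw [lintegral_const_mul _ (by fun_prop)]
          refine (mul_le_mul_right (hA.lintegral_rpow_mul_min_le hd hp.1 x) _).trans_eq ?_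
          rw [ENNReal.ofReal_mul (by positivity), near_comm,
            show (2 - 3 * d : ℝ) = 3 / 2 - 3 * d + 1 / 2 by ring, ← ofReal_rpow_mul_rpow hp.1]
          ring
      _ = ∫⁻ p, ENNReal.ofReal (4 * d * A) * (ENNReal.ofReal (p.2 ^ (2 - 3 * d : ℝ)) *
          F p ^ 2) * σ (Metric.closedBall p.1 p.2) ∂(scaleMeasure d) := by
          rw [lintegral_lintegral_swap (Measurable.aemeasurable (by fun_prop))]
          refine lintegral_congr fun p => ?_
          rw [lintegral_const_mul _ (by fun_prop), lintegral_near]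
      _ ≤ ∫⁻ p, ENNReal.ofReal (4 * d * A ^ 2) *
          (ENNReal.ofReal (p.2 ^ (1 - 2 * d : ℝ)) * F p ^ 2) ∂(scaleMeasure d) := by
          refine lintegral_mono_ae ?_
          filter_upwards [ae_scaleMeasure] with p hp
          have hp0 := hp.1
          refine (mul_le_mul_right (hA.2 _ _ hp0) _).trans_eq ?_
          have eA : ENNReal.ofReal (4 * d * A ^ 2) =
              ENNReal.ofReal (4 * d * A) * ENNReal.ofReal A := by
            rw [← ENNReal.ofReal_mul (by positivity)]; ring_nf
          rw [ENNReal.ofReal_mul hA0, ← Real.rpow_natCast, eA]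
          rw [show (1 - 2 * d : ℝ) = 2 - 3 * d + ((d - 1 : ℕ) : ℝ) by
            push_cast [show 1 ≤ d by omega]; ring, ← ofReal_rpow_mul_rpow hp0]
          ring
      _ = _ := lintegral_const_mul _ (by fun_prop)
  have hm : Measurable fun q : E d × E d => ENNReal.ofReal (‖q.1 - q.2‖ ^ (1 / 2 - d : ℝ)) *
      J q.1 q.2 := by fun_prop
  have hm2 : Measurable fun q : E d × E d => ENNReal.ofReal (‖q.2 - q.1‖ ^ (1 / 2 - d : ℝ)) *
      J q.2 q.1 :=
    Measurable.comp (g := fun q : E d × E d => ENNReal.ofReal (‖q.1 - q.2‖ ^ (1 / 2 - d : ℝ)) *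
      J q.1 q.2) (f := fun q : E d × E d => (q.2, q.1)) hm (by fun_prop)
  have hm3 : ∀ x, Measurable fun y : E d => ENNReal.ofReal (‖x - y‖ ^ (1 / 2 - d : ℝ)) *
      J x y := fun x =>
    Measurable.comp (g := fun q : E d × E d => ENNReal.ofReal (‖q.1 - q.2‖ ^ (1 / 2 - d : ℝ)) *
      J q.1 q.2) (f := fun y : E d => (x, y)) hm (by fun_prop)
  calc _ ≤ ∫⁻ x, ∫⁻ y, ENNReal.ofReal (8 * w) *
      (ENNReal.ofReal (‖x - y‖ ^ (1 / 2 - d : ℝ)) * J x y +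
        ENNReal.ofReal (‖y - x‖ ^ (1 / 2 - d : ℝ)) * J y x) ∂σ ∂σ :=
        lintegral_mono fun x => lintegral_mono fun y => hp x y
    _ = ENNReal.ofReal (8 * w) *
      (∫⁻ x, ∫⁻ y, ENNReal.ofReal (‖x - y‖ ^ (1 / 2 - d : ℝ)) * J x y ∂σ ∂σ +
        ∫⁻ x, ∫⁻ y, ENNReal.ofReal (‖y - x‖ ^ (1 / 2 - d : ℝ)) * J y x ∂σ ∂σ) := by
        rw [← lintegral_add_left hm.lintegral_prod_right,
          ← lintegral_const_mul' _ _ ENNReal.ofReal_ne_top]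
        refine lintegral_congr fun x => ?_
        rw [← lintegral_add_left (hm3 x),
          ← lintegral_const_mul' _ _ ENNReal.ofReal_ne_top]
    _ ≤ ENNReal.ofReal (8 * w) * (ENNReal.ofReal (4 * d * A ^ 2) * scaleEnergy F +
        ENNReal.ofReal (4 * d * A ^ 2) * scaleEnergy F) := by
        gcongr
        rw [lintegral_lintegral_swap hm2.aemeasurable]
        exact hT
    _ = _ := by
        rw [← two_mul, ← mul_assoc, ← mul_assoc, ← ENNReal.ofReal_ofNat 2,
          ← ENNReal.ofReal_mul (by positivity), ← ENNReal.ofReal_mul (by positivity)]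
        congr 2; ring

/-! ### The space `H^s(Γ)` and its dual norm -/

lemma eLpNorm_two_sq {α : Type*} [MeasurableSpace α] (μ : Measure α) (f : α → ℝ) :
    eLpNorm f 2 μ ^ 2 = ∫⁻ x, ‖f x‖ₑ ^ 2 ∂μ := by
  have := eLpNorm_nnreal_pow_eq_lintegral (μ := μ) (f := f) (p := 2) (by norm_num)
  simpa using this

lemma hsNorm_sq {d : ℕ} (Ω : Set (E d)) (s : ℝ) (f : E d → ℝ) :
    hsNorm Ω s f ^ 2 = eLpNorm f 2 (surf Ω) ^ 2 + hsSeminorm Ω s f ^ 2 := by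
  unfold hsNorm
  rw [← ENNReal.rpow_natCast, ← ENNReal.rpow_mul]; norm_num

lemma hsSeminorm_le_hsNorm {d : ℕ} (Ω : Set (E d)) (s : ℝ) (f : E d → ℝ) :
    hsSeminorm Ω s f ≤ hsNorm Ω s f := by
  rw [← ENNReal.pow_le_pow_left_iff two_ne_zero, hsNorm_sq]
  exact le_add_self

lemma eLpNorm_le_hsNorm {d : ℕ} (Ω : Set (E d)) (s : ℝ) (f : E d → ℝ) :
    eLpNorm f 2 (surf Ω) ≤ hsNorm Ω s f := by
  rw [← ENNReal.pow_le_pow_left_iff two_ne_zero, hsNorm_sq]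
  exact le_self_add

lemma hsNorm_le_add {d : ℕ} (Ω : Set (E d)) (s : ℝ) (f : E d → ℝ) :
    hsNorm Ω s f ≤ eLpNorm f 2 (surf Ω) + hsSeminorm Ω s f := by
  rw [← ENNReal.pow_le_pow_left_iff two_ne_zero, hsNorm_sq, add_sq]
  gcongr
  exact le_self_add

lemma diffQuot_add {d : ℕ} (s : ℝ) (f g : E d → ℝ) :
    diffQuot s (f + g) = diffQuot s f + diffQuot s g := by
  funext z; simp only [diffQuot, Pi.add_apply]; ring

lemma diffQuot_smul {d : ℕ} (s c : ℝ) (f : E d → ℝ) :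
    diffQuot s (c • f) = c • diffQuot s f := by
  funext z; simp only [diffQuot, Pi.smul_apply, smul_eq_mul]; ring

lemma diffQuot_congr {d : ℕ} {σ : Measure (E d)} [SFinite σ] (s : ℝ) {f g : E d → ℝ}
    (h : f =ᵐ[σ] g) : diffQuot s f =ᵐ[σ.prod σ] diffQuot s g := by
  have h1 := (Measure.quasiMeasurePreserving_fst (μ := σ) (ν := σ)).ae h
  have h2 := (Measure.quasiMeasurePreserving_snd (μ := σ) (ν := σ)).ae h
  filter_upwards [h1, h2] with z hz1 hz2
  simp only [diffQuot, hz1, hz2]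

lemma aestronglyMeasurable_diffQuot {d : ℕ} {σ : Measure (E d)} [SFinite σ] (s : ℝ)
    {f : E d → ℝ} (h : AEStronglyMeasurable f σ) :
    AEStronglyMeasurable (diffQuot s f) (σ.prod σ) := by
  refine AEStronglyMeasurable.congr ?_ (diffQuot_congr s h.ae_eq_mk).symm
  have hm : Measurable (h.mk f) := h.stronglyMeasurable_mk.measurable
  have : Measurable (diffQuot s (h.mk f)) := by
    unfold diffQuot
    fun_prop
  exact this.aestronglyMeasurable

lemma hsNorm_smul {d : ℕ} (Ω : Set (E d)) (s c : ℝ) (f : E d → ℝ) :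
    hsNorm Ω s (c • f) = ‖c‖ₑ * hsNorm Ω s f := by
  unfold hsNorm hsSeminorm
  rw [diffQuot_smul, eLpNorm_const_smul, eLpNorm_const_smul, mul_pow, mul_pow, ← mul_add,
    ENNReal.mul_rpow_of_nonneg _ _ (by norm_num), ← ENNReal.rpow_natCast, ← ENNReal.rpow_mul]
  norm_num

lemma hsNorm_lt_top {d : ℕ} {Ω : Set (E d)} {s : ℝ} {f : E d → ℝ} (h : f ∈ Hs Ω s) :
    hsNorm Ω s f < ⊤ :=
  (hsNorm_le_add Ω s f).trans_lt (ENNReal.add_lt_top.2 ⟨h.1.2, h.2.2⟩)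

/-- The factor `2` spares Minkowski's inequality for the combined norm; only finiteness of the
operator norm is derived from it. -/
lemma hsNorm_add_le {d : ℕ} {Ω : Set (E d)} {s : ℝ} {f g : E d → ℝ} (hf : f ∈ Hs Ω s)
    (hg : g ∈ Hs Ω s) : hsNorm Ω s (f + g) ≤ 2 * (hsNorm Ω s f + hsNorm Ω s g) := by
  refine (hsNorm_le_add Ω s _).trans ?_
  have h1 := eLpNorm_add_le hf.1.1 hg.1.1 (p := 2) (by norm_num)
  have h2 := eLpNorm_add_le hf.2.1 hg.2.1 (p := 2) (by norm_num)
  rw [hsSeminorm, diffQuot_add]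
  calc _ ≤ (hsNorm Ω s f + hsNorm Ω s g) + (hsNorm Ω s f + hsNorm Ω s g) := by
        refine add_le_add (h1.trans ?_) (h2.trans ?_)
        · exact add_le_add (eLpNorm_le_hsNorm _ _ _) (eLpNorm_le_hsNorm _ _ _)
        · exact add_le_add (hsSeminorm_le_hsNorm _ _ _) (hsSeminorm_le_hsNorm _ _ _)
    _ = _ := (two_mul _).symm

/-- Homogeneity. Finiteness of the dual norm is needed for `v` of norm zero, where the right-hand
side is zero: all multiples of `v` are then admissible in the supremum, which forces `Φ v = 0`. -/
lemma enorm_le_dualNorm_mul {d : ℕ} {Ω : Set (E d)} {Φ : Hs Ω (1 / 2) →ₗ[ℝ] ℝ}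
    (hΦ : dualNorm Ω Φ ≠ ⊤) (v : Hs Ω (1 / 2)) :
    ‖Φ v‖ₑ ≤ dualNorm Ω Φ * hsNorm Ω (1 / 2) v := by
  have key : ∀ c : ℝ, hsNorm Ω (1 / 2) (c • v : Hs Ω (1 / 2)) ≤ 1 →
      ‖c‖ₑ * ‖Φ v‖ₑ ≤ dualNorm Ω Φ := fun c hc => by
    have h : ‖Φ (c • v)‖ₑ ≤ dualNorm Ω Φ := le_iSup₂_of_le (c • v) hc le_rfl
    rwa [map_smul, smul_eq_mul, enorm_mul] at h
  have hN := (hsNorm_lt_top v.2).ne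
  simp only [Submodule.coe_smul, hsNorm_smul] at key
  by_cases h0 : hsNorm Ω (1 / 2) v = 0
  · simp only [h0, mul_zero, zero_le, forall_const] at key ⊢
    by_contra hne
    have hpos : 0 < ‖Φ v‖ₑ := pos_iff_ne_zero.2 fun h => hne h.le
    obtain ⟨n, hn⟩ := ENNReal.exists_nat_mul_gt hpos.ne' hΦ
    have := key n
    rw [Real.enorm_natCast] at this
    exact absurd (this) (not_le.2 hn)
  · have hc : ‖(hsNorm Ω (1 / 2) v).toReal⁻¹‖ₑ = (hsNorm Ω (1 / 2) v)⁻¹ := by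
      rw [Real.enorm_of_nonneg (by positivity), ENNReal.ofReal_inv_of_pos
        (ENNReal.toReal_pos h0 hN), ENNReal.ofReal_toReal hN]
    have := key (hsNorm Ω (1 / 2) v).toReal⁻¹
    rw [hc, ENNReal.inv_mul_cancel h0 hN] at this
    have := this le_rfl
    rwa [mul_comm, ← div_eq_mul_inv, ENNReal.div_le_iff h0 hN] at this

/-- A density as a functional on `H^{1/2}(Γ)`. -/
def pairingₗ {d : ℕ} {Ω : Set (E d)} {ψ : E d → ℝ} (hψ : MemLp ψ 2 (surf Ω)) :
    Hs Ω (1 / 2) →ₗ[ℝ] ℝ where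
  toFun := pairing Ω ψ
  map_add' v w := by
    simp only [pairing, Submodule.coe_add, Pi.add_apply, mul_add]
    exact integral_add (hψ.integrable_mul v.2.1) (hψ.integrable_mul w.2.1)
  map_smul' c v := by
    simp only [pairing, Submodule.coe_smul, Pi.smul_apply, smul_eq_mul, RingHom.id_apply]
    rw [← integral_const_mul]
    congr 1; funext x; ring

lemma dualNorm_pairing_lt_top {d : ℕ} {Ω : Set (E d)} {ψ : E d → ℝ}
    (hψ : MemLp ψ 2 (surf Ω)) : dualNorm Ω (pairing Ω ψ) < ⊤ := by
  refine lt_of_le_of_lt (iSup₂_le fun v hv => ?_) hψ.2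
  have h1 : ‖pairing Ω ψ v‖ₑ ≤ ∫⁻ x, ‖ψ x * (v : E d → ℝ) x‖ₑ ∂(surf Ω) :=
    enorm_integral_le_lintegral_enorm _
  have h2 : eLpNorm (fun x => ψ x * (v : E d → ℝ) x) 1 (surf Ω) ≤
      eLpNorm ψ 2 (surf Ω) * eLpNorm (v : E d → ℝ) 2 (surf Ω) := by
    have := eLpNorm_smul_le_mul_eLpNorm (p := 2) (q := 2) (r := 1) v.2.1.1 hψ.1
    exact this
  rw [eLpNorm_one_eq_lintegral_enorm] at h2
  refine h1.trans (h2.trans ?_)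
  calc _ ≤ eLpNorm ψ 2 (surf Ω) * 1 := by
        gcongr; exact (eLpNorm_le_hsNorm _ _ _).trans hv
    _ = _ := mul_one _

lemma dualNorm_add_le {d : ℕ} {Ω : Set (E d)} (Φ Ψ : Hs Ω (1 / 2) → ℝ) :
    dualNorm Ω (fun v => Φ v + Ψ v) ≤ dualNorm Ω Φ + dualNorm Ω Ψ :=
  iSup₂_le fun v hv => (enorm_add_le _ _).trans
    (add_le_add (le_iSup₂_of_le v hv le_rfl) (le_iSup₂_of_le v hv le_rfl))

lemma dualNorm_neg {d : ℕ} {Ω : Set (E d)} (Φ : Hs Ω (1 / 2) → ℝ) :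
    dualNorm Ω (fun v => - Φ v) = dualNorm Ω Φ := by
  simp [dualNorm]

/-! ### Lipschitz functions on `Γ` -/

/-- The double integral that bounds the `H^{1/2}`-seminorm of Lipschitz functions. -/
def lipConst {d : ℕ} (Ω : Set (E d)) : ℝ≥0∞ :=
  ∫⁻ x, ∫⁻ y, (ENNReal.ofReal (‖x - y‖ ^ (1 / 2 - d : ℝ) * min 1 ‖x - y‖) + 1)
    ∂(surf Ω) ∂(surf Ω)

lemma lipConst_lt_top {d : ℕ} (hd : 2 ≤ d) {Ω : Set (E d)} [IsFiniteMeasure (surf Ω)] {A : ℝ}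
    (hA : UpperRegular A (surf Ω)) : lipConst Ω < ⊤ := by
  have : ∀ x, ∫⁻ y, (ENNReal.ofReal (‖x - y‖ ^ (1 / 2 - d : ℝ) * min 1 ‖x - y‖) + 1) ∂(surf Ω) ≤
      ENNReal.ofReal (4 * d * A * 1 ^ (1 / 2 : ℝ)) + surf Ω univ := fun x => by
    rw [lintegral_add_right _ measurable_const, lintegral_one]
    gcongr
    exact hA.lintegral_rpow_mul_min_le hd one_pos x
  refine (lintegral_mono this).trans_lt ?_
  rw [lintegral_const]
  exact ENNReal.mul_lt_top (ENNReal.add_lt_top.2 ⟨ENNReal.ofReal_lt_top, measure_lt_top _ _⟩)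
    (measure_lt_top _ _)

lemma ae_mem_frontier {d : ℕ} (Ω : Set (E d)) : ∀ᵐ x ∂(surf Ω), x ∈ frontier Ω :=
  ae_restrict_mem isClosed_frontier.measurableSet

/-- The squared difference quotient is at most `a² ‖x - y‖^(2-d)`. The integrand of `lipConst`
dominates that power: by its singular term for `‖x - y‖ ≤ 1` and by the summand `1` otherwise. -/
lemma lipschitz_mem_Hs {d : ℕ} (hd : 2 ≤ d) {Ω : Set (E d)} [IsFiniteMeasure (surf Ω)] {A : ℝ}
    (hA : UpperRegular A (surf Ω)) {v : E d → ℝ} (hv : AEStronglyMeasurable v (surf Ω)) {a : ℝ}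
    (ha : 0 ≤ a) (h0 : ∀ x ∈ frontier Ω, |v x| ≤ a)
    (h1 : ∀ x ∈ frontier Ω, ∀ y ∈ frontier Ω, |v x - v y| ≤ a * ‖x - y‖) :
    v ∈ Hs Ω (1 / 2) ∧ hsNorm Ω (1 / 2) v ≤
      ENNReal.ofReal a * (surf Ω univ + lipConst Ω) ^ (1 / 2 : ℝ) := by
  have hd' : (2 : ℝ) ≤ d := by exact_mod_cast hd
  have e1 : eLpNorm v 2 (surf Ω) ^ 2 ≤ ENNReal.ofReal a ^ 2 * surf Ω univ := by
    rw [eLpNorm_two_sq, ← lintegral_const]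
    refine lintegral_mono_ae ((ae_mem_frontier Ω).mono fun x hx => ?_)
    gcongr
    rw [Real.enorm_eq_ofReal_abs]
    exact ENNReal.ofReal_le_ofReal (h0 x hx)
  have e2 : hsSeminorm Ω (1 / 2) v ^ 2 ≤ ENNReal.ofReal a ^ 2 * lipConst Ω := by
    rw [hsSeminorm, eLpNorm_two_sq, lintegral_prod _
      ((aestronglyMeasurable_diffQuot _ hv).enorm.pow_const _), lipConst,
      ← lintegral_const_mul' _ _ (by simp)]
    refine lintegral_mono_ae ((ae_mem_frontier Ω).mono fun x hx => ?_)
    rw [← lintegral_const_mul' _ _ (by simp)]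
    refine lintegral_mono_ae ((ae_mem_frontier Ω).mono fun y hy => ?_)
    rcases eq_or_lt_of_le (norm_nonneg (x - y)) with h | h
    · have : x = y := by rw [← sub_eq_zero, ← norm_eq_zero, ← h]
      simp [diffQuot, this]
    have h2 : ‖diffQuot (1 / 2) v (x, y)‖ₑ ^ 2 ≤
        ENNReal.ofReal a ^ 2 * ENNReal.ofReal (‖x - y‖ ^ (2 - d : ℝ)) := by
      rw [Real.enorm_eq_ofReal_abs, ← ENNReal.ofReal_pow (abs_nonneg _),
        ← ENNReal.ofReal_pow ha, ← ENNReal.ofReal_mul (by positivity)]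
      refine ENNReal.ofReal_le_ofReal ?_
      have e : ‖x - y‖ ^ (2 - d : ℝ) =
          ‖x - y‖ ^ 2 / (‖x - y‖ ^ (((d : ℝ) - 1) / 2 + 1 / 2)) ^ 2 := by
        rw [← Real.rpow_natCast, ← Real.rpow_natCast, ← Real.rpow_mul h.le, ← Real.rpow_sub h]
        congr 1; push_cast; ring
      rw [e, diffQuot, abs_div, div_pow, ← mul_div_assoc, abs_of_nonneg
        (a := ‖x - y‖ ^ (((d : ℝ) - 1) / 2 + 1 / 2)) (by positivity), ← mul_pow]
      gcongr
      exact h1 x hx y hy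
    refine h2.trans (mul_le_mul_right ?_ _)
    rcases le_total ‖x - y‖ 1 with h3 | h3
    · refine le_add_right (ENNReal.ofReal_le_ofReal ?_)
      rw [min_eq_right h3]
      nth_rewrite 3 [← Real.rpow_one ‖x - y‖]
      rw [← Real.rpow_add h]
      exact Real.rpow_le_rpow_of_exponent_ge h h3 (by linarith)
    · refine le_add_left (ENNReal.ofReal_le_one.2 ?_)
      exact Real.rpow_le_one_of_one_le_of_nonpos h3 (by linarith)
  have hK := lipConst_lt_top hd hA
  have hf1 : eLpNorm v 2 (surf Ω) < ⊤ := by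
    have := e1.trans_lt (ENNReal.mul_lt_top (by simp) (measure_lt_top _ _))
    exact (ENNReal.pow_lt_top_iff.1 this).resolve_right two_ne_zero
  have hf2 : hsSeminorm Ω (1 / 2) v < ⊤ := by
    have := e2.trans_lt (ENNReal.mul_lt_top (by simp) hK)
    exact (ENNReal.pow_lt_top_iff.1 this).resolve_right two_ne_zero
  refine ⟨⟨⟨hv, hf1⟩, ⟨aestronglyMeasurable_diffQuot _ hv, hf2⟩⟩, ?_⟩
  rw [← ENNReal.pow_le_pow_left_iff two_ne_zero, hsNorm_sq, mul_pow,
    ← ENNReal.rpow_natCast (_ ^ (1 / 2 : ℝ)), ← ENNReal.rpow_mul]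
  norm_num
  rw [mul_add]
  exact add_le_add e1 (by norm_num at e2; exact e2)

/-! ### The multiscale potential -/

/-- The integrand of the multiscale representation of the kernel. -/
def scaleKer {d : ℕ} (x y : E d) (p : E d × ℝ) : ℝ :=
  p.2 ^ (1 - 2 * d : ℝ) * tentKer p.2 x p.1 * tentKer p.2 y p.1

/-- The averages of a density. -/
def tentAvg {d : ℕ} (σ : Measure (E d)) (ψ : E d → ℝ) (p : E d × ℝ) : ℝ :=
  ∫ y, tentKer p.2 y p.1 * ψ y ∂σ

/-- The potential of a density for the small-scale kernel. -/
def mainPot {d : ℕ} (σ : Measure (E d)) (ψ : E d → ℝ) (x : E d) : ℝ :=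
  ∫ y, mainKer (x - y) * ψ y ∂σ

lemma measurable_scaleKer_right {d : ℕ} (x : E d) :
    Measurable fun q : E d × E d × ℝ => scaleKer x q.1 q.2 := by
  unfold scaleKer; fun_prop

/-- Justifies the uses of Fubini below. At scale `τ` the volume of a ball, its surface measure and
the prefactor `τ^(1-2d)` cancel exactly, and the scales range over an interval of length one. -/
lemma lintegral_scaleKer_le {d : ℕ} (hd : 2 ≤ d) {A : ℝ} {σ : Measure (E d)} [SFinite σ]
    (hA : UpperRegular A σ) (x : E d) :
    ∫⁻ y, ∫⁻ p, ‖scaleKer x y p‖ₑ ∂(scaleMeasure d) ∂σ ≤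
      ENNReal.ofReal (volume.real (Metric.ball (0 : E d) 1) * A) := by
  have hw0 : 0 ≤ volume.real (Metric.ball (0 : E d) 1) := measureReal_nonneg
  have hA0 := hA.1
  rw [lintegral_lintegral_swap (measurable_scaleKer_right x).enorm.aemeasurable]
  calc _ ≤ ∫⁻ p, ENNReal.ofReal A * (ENNReal.ofReal (p.2 ^ (-d : ℝ)) * near p.2 x p.1)
          ∂(scaleMeasure d) := by
        refine lintegral_mono_ae ?_
        filter_upwards [ae_scaleMeasure] with p hp
        have hp0 := hp.1
        calc _ ≤ ∫⁻ y, ENNReal.ofReal (p.2 ^ (1 - 2 * d : ℝ)) * near p.2 x p.1 *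
                near p.2 p.1 y ∂σ := by
              refine lintegral_mono fun y => ?_
              rw [scaleKer, Real.enorm_of_nonneg (mul_nonneg (mul_nonneg (by positivity)
                (tentKer_nonneg _ _ _)) (tentKer_nonneg _ _ _)), ENNReal.ofReal_mul
                (mul_nonneg (by positivity) (tentKer_nonneg _ _ _)),
                ENNReal.ofReal_mul (by positivity), near_comm p.2 p.1 y]
              gcongr
              · exact ofReal_tentKer_le hp0 _ _
              · exact ofReal_tentKer_le hp0 _ _
          _ ≤ ENNReal.ofReal (p.2 ^ (1 - 2 * d : ℝ)) * near p.2 x p.1 *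
                ENNReal.ofReal (A * p.2 ^ (d - 1)) := by
              rw [lintegral_const_mul _ (by fun_prop), lintegral_near]
              gcongr
              exact hA.2 _ _ hp0
          _ = _ := by
              rw [ENNReal.ofReal_mul hA0, ← Real.rpow_natCast,
                show (-d : ℝ) = 1 - 2 * d + ((d - 1 : ℕ) : ℝ) by
                  push_cast [show 1 ≤ d by omega]; ring, ← ofReal_rpow_mul_rpow hp0]
              ring
    _ ≤ ∫⁻ τ in Ioc (0 : ℝ) 1, ENNReal.ofReal A *
          ENNReal.ofReal (volume.real (Metric.ball (0 : E d) 1)) := by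
        rw [lintegral_scaleMeasure (by fun_prop)]
        refine setLIntegral_mono' measurableSet_Ioc fun τ hτ => ?_
        dsimp only
        rw [lintegral_const_mul _ (by fun_prop), lintegral_const_mul _ (by fun_prop),
          lintegral_near_volume hτ.1, ENNReal.ofReal_mul (by have := hτ.1; positivity), ← mul_assoc
          (ENNReal.ofReal (τ ^ (-d : ℝ))), ofReal_rpow_mul_rpow hτ.1]
        simp
    _ = _ := by
        rw [lintegral_const, Measure.restrict_apply_univ, Real.volume_Ioc, mul_comm
          (volume.real _) A, ENNReal.ofReal_mul hA0]
        simp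

lemma integral_scaleKer_mul {d : ℕ} {σ : Measure (E d)} (x : E d) (ψ : E d → ℝ) (p : E d × ℝ) :
    ∫ y, scaleKer x y p * ψ y ∂σ =
      p.2 ^ (1 - 2 * d : ℝ) * tentKer p.2 x p.1 * tentAvg σ ψ p := by
  unfold tentAvg scaleKer
  rw [← integral_const_mul]
  congr 1; funext y; ring

section
variable {d : ℕ} {A : ℝ} {σ : Measure (E d)} [IsFiniteMeasure σ]

lemma integrable_scaleKer_mul (hd : 2 ≤ d) (hA : UpperRegular A σ) {ψ : E d → ℝ}
    (hψ : Measurable ψ) {M : ℝ} (hM : ∀ y, |ψ y| ≤ M) (x : E d) :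
    Integrable (fun q : E d × E d × ℝ => scaleKer x q.1 q.2 * ψ q.1)
      (σ.prod (scaleMeasure d)) := by
  have hm : Measurable fun q : E d × E d × ℝ => scaleKer x q.1 q.2 := measurable_scaleKer_right x
  have h1 : Integrable (fun q : E d × E d × ℝ => scaleKer x q.1 q.2)
      (σ.prod (scaleMeasure d)) := by
    refine ⟨hm.aestronglyMeasurable, ?_⟩
    rw [HasFiniteIntegral, lintegral_prod _ hm.enorm.aemeasurable]
    exact (lintegral_scaleKer_le hd hA x).trans_lt ENNReal.ofReal_lt_top
  have hψ' : Measurable fun q : E d × E d × ℝ => ψ q.1 := by fun_prop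
  exact h1.mul_bdd hψ'.aestronglyMeasurable (c := M) (Eventually.of_forall fun q => hM q.1)

/-- The exponent `1 - 2 d` is `-(d - 1)` minus the `d` that comes from the volume of the tents. Only
almost every `y` is covered, since integrability in `p` comes from Fubini. -/
lemma ae_integral_scaleKer (hd : 2 ≤ d) (hA : UpperRegular A σ) (x : E d) :
    ∀ᵐ y ∂σ, ∫ p, scaleKer x y p ∂(scaleMeasure d) = mainKer (x - y) := by
  have h := integrable_scaleKer_mul hd hA (ψ := fun _ => 1) measurable_const (M := 1) (by simp) x
  simp only [mul_one] at h
  filter_upwards [h.prod_right_ae] with y hy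
  unfold scaleMeasure at hy ⊢
  rw [integral_prod_symm _ hy, mainKer]
  refine setIntegral_congr_fun measurableSet_Ioc fun τ hτ => ?_
  have hτ0 := hτ.1
  simp only [scaleKer, mul_assoc]
  rw [integral_const_mul, integral_tentKer_mul_tentKer hτ0, ← mul_assoc]
  congr 1
  rw [← Real.rpow_natCast, ← Real.rpow_add hτ0, ← Real.rpow_natCast, ← Real.rpow_neg hτ0.le]
  congr 1
  push_cast [show 1 ≤ d by omega]
  ring

lemma integrable_mainKer_mul (hd : 2 ≤ d) (hA : UpperRegular A σ) {ψ : E d → ℝ}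
    (hψ : Measurable ψ) {M : ℝ} (hM : ∀ y, |ψ y| ≤ M) (x : E d) :
    Integrable (fun y => mainKer (x - y) * ψ y) σ := by
  have h := (integrable_scaleKer_mul hd hA hψ hM x).integral_prod_left
  refine h.congr ?_
  filter_upwards [ae_integral_scaleKer hd hA x] with y hy
  rw [integral_mul_const, hy]

lemma mainPot_eq (hd : 2 ≤ d) (hA : UpperRegular A σ) {ψ : E d → ℝ}
    (hψ : Measurable ψ) {M : ℝ} (hM : ∀ y, |ψ y| ≤ M) (x : E d) :
    mainPot σ ψ x =
      ∫ p, p.2 ^ (1 - 2 * d : ℝ) * tentKer p.2 x p.1 * tentAvg σ ψ p ∂(scaleMeasure d) := by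
  have h := integrable_scaleKer_mul hd hA hψ hM x
  simp_rw [← integral_scaleKer_mul]
  have hsw := integral_integral_swap (f := fun y p => scaleKer x y p * ψ y) h
  rw [← hsw]
  refine integral_congr_ae ?_
  filter_upwards [ae_integral_scaleKer hd hA x] with y hy
  rw [integral_mul_const, hy]

lemma integrable_mainPot_integrand (hd : 2 ≤ d) (hA : UpperRegular A σ) {ψ : E d → ℝ}
    (hψ : Measurable ψ) {M : ℝ} (hM : ∀ y, |ψ y| ≤ M) (x : E d) :
    Integrable (fun p => p.2 ^ (1 - 2 * d : ℝ) * tentKer p.2 x p.1 * tentAvg σ ψ p)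
      (scaleMeasure d) := by
  have h := (integrable_scaleKer_mul hd hA hψ hM x).integral_prod_right
  simpa only [integral_scaleKer_mul] using h

lemma measurable_tentAvg {ψ : E d → ℝ} (hψ : Measurable ψ) : Measurable (tentAvg σ ψ) := by
  have : StronglyMeasurable fun q : (E d × ℝ) × E d => tentKer q.1.2 q.2 q.1.1 * ψ q.2 :=
    Measurable.stronglyMeasurable (by fun_prop)
  exact this.integral_prod_right'.measurable

lemma measurable_mainPot (hd : 2 ≤ d) (hA : UpperRegular A σ) {ψ : E d → ℝ}
    (hψ : Measurable ψ) {M : ℝ} (hM : ∀ y, |ψ y| ≤ M) : Measurable (mainPot σ ψ) := by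
  have h1 := measurable_tentAvg (σ := σ) hψ
  have : StronglyMeasurable fun q : E d × E d × ℝ =>
      q.2.2 ^ (1 - 2 * d : ℝ) * tentKer q.2.2 q.1 q.2.1 * tentAvg σ ψ q.2 :=
    Measurable.stronglyMeasurable (by fun_prop)
  have h2 := (this.integral_prod_right' (ν := scaleMeasure d)).measurable
  have e : mainPot σ ψ = fun x => ∫ p, p.2 ^ (1 - 2 * d : ℝ) * tentKer p.2 x p.1 *
      tentAvg σ ψ p ∂(scaleMeasure d) := funext fun x => mainPot_eq hd hA hψ hM x
  rw [e]
  exact h2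

/-- The energy identity. -/
lemma scaleEnergy_tentAvg (hd : 2 ≤ d) (hA : UpperRegular A σ) {ψ : E d → ℝ}
    (hψ : Measurable ψ) {M : ℝ} (hM : ∀ y, |ψ y| ≤ M) :
    scaleEnergy (fun p => ‖tentAvg σ ψ p‖ₑ) = ENNReal.ofReal (∫ x, ψ x * mainPot σ ψ x ∂σ) := by
  have h1 := measurable_tentAvg (σ := σ) hψ
  have hM0 : 0 ≤ M := (abs_nonneg _).trans (hM 0)
  have hm : Measurable fun q : E d × E d × ℝ =>
      ψ q.1 * (q.2.2 ^ (1 - 2 * d : ℝ) * tentKer q.2.2 q.1 q.2.1 * tentAvg σ ψ q.2) := by fun_prop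
  have hint : Integrable (fun q : E d × E d × ℝ =>
      ψ q.1 * (q.2.2 ^ (1 - 2 * d : ℝ) * tentKer q.2.2 q.1 q.2.1 * tentAvg σ ψ q.2))
      (σ.prod (scaleMeasure d)) := by
    refine ⟨hm.aestronglyMeasurable, ?_⟩
    rw [HasFiniteIntegral, lintegral_prod _ hm.enorm.aemeasurable]
    refine lt_of_le_of_lt (lintegral_mono fun x => ?_ : _ ≤ ∫⁻ x, ENNReal.ofReal M *
      (ENNReal.ofReal M * ENNReal.ofReal (volume.real (Metric.ball (0 : E d) 1) * A)) ∂σ) ?_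
    · calc _ ≤ ∫⁻ p, ENNReal.ofReal M * ∫⁻ y, ‖scaleKer x y p‖ₑ * ENNReal.ofReal M ∂σ
            ∂(scaleMeasure d) := by
            refine lintegral_mono fun p => ?_
            dsimp only
            rw [← integral_scaleKer_mul, enorm_mul]
            refine mul_le_mul' ?_ ((enorm_integral_le_lintegral_enorm _).trans
              (lintegral_mono fun y => ?_))
            · rw [Real.enorm_eq_ofReal_abs]; exact ENNReal.ofReal_le_ofReal (hM x)
            · rw [enorm_mul]
              gcongr
              rw [Real.enorm_eq_ofReal_abs]; exact ENNReal.ofReal_le_ofReal (hM y)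
        _ = ENNReal.ofReal M * (ENNReal.ofReal M * ∫⁻ y, ∫⁻ p, ‖scaleKer x y p‖ₑ
              ∂(scaleMeasure d) ∂σ) := by
            rw [lintegral_lintegral_swap (measurable_scaleKer_right x).enorm.aemeasurable,
              ← lintegral_const_mul' _ _ ENNReal.ofReal_ne_top,
              ← lintegral_const_mul' _ _ ENNReal.ofReal_ne_top]
            refine lintegral_congr fun p => ?_
            rw [lintegral_mul_const' _ _ ENNReal.ofReal_ne_top, mul_comm (∫⁻ y, _ ∂σ)]
        _ ≤ _ := by gcongr; exact lintegral_scaleKer_le hd hA x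
    · rw [lintegral_const]
      exact ENNReal.mul_lt_top (ENNReal.mul_lt_top ENNReal.ofReal_lt_top
        (ENNReal.mul_lt_top ENNReal.ofReal_lt_top ENNReal.ofReal_lt_top)) (measure_lt_top _ _)
  -- Integrating `ψ` against the remaining tent reproduces the average, so the integrand of the
  -- energy is a square.
  have hin : ∀ p : E d × ℝ, ∫ x, ψ x * (p.2 ^ (1 - 2 * d : ℝ) * tentKer p.2 x p.1 *
      tentAvg σ ψ p) ∂σ = p.2 ^ (1 - 2 * d : ℝ) * tentAvg σ ψ p ^ 2 := fun p => by
    rw [show p.2 ^ (1 - 2 * d : ℝ) * tentAvg σ ψ p ^ 2 =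
      p.2 ^ (1 - 2 * d : ℝ) * tentAvg σ ψ p * tentAvg σ ψ p by ring]
    nth_rewrite 3 [tentAvg]
    rw [← integral_const_mul]
    congr 1; funext x; ring
  have hsw := integral_integral_swap (f := fun x p => ψ x * (p.2 ^ (1 - 2 * d : ℝ) *
    tentKer p.2 x p.1 * tentAvg σ ψ p)) hint
  simp only [hin, integral_const_mul, ← mainPot_eq hd hA hψ hM] at hsw
  have hint2 := hint.integral_prod_right
  simp only [hin] at hint2
  rw [hsw, ofReal_integral_eq_lintegral_ofReal hint2]
  · refine lintegral_congr_ae ?_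
    filter_upwards [ae_scaleMeasure] with p hp
    have := hp.1
    rw [ENNReal.ofReal_mul (by positivity), Real.enorm_eq_ofReal_abs,
      ← ENNReal.ofReal_pow (abs_nonneg _), sq_abs]
  · filter_upwards [ae_scaleMeasure] with p hp
    have := hp.1
    simp only [Pi.zero_apply]
    positivity

/-- The trace estimate for the small-scale potential. -/
lemma exists_mainPot_le (hd : 2 ≤ d) (hA : UpperRegular A σ) :
    ∃ C : ℝ≥0∞, C < ⊤ ∧ ∀ ψ : E d → ℝ, Measurable ψ → ∀ M : ℝ, (∀ y, |ψ y| ≤ M) →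
      ∫⁻ x, ‖mainPot σ ψ x‖ₑ ^ 2 ∂σ +
        ∫⁻ x, ∫⁻ y, ‖diffQuot (1 / 2) (mainPot σ ψ) (x, y)‖ₑ ^ 2 ∂σ ∂σ ≤
      C * ENNReal.ofReal (∫ x, ψ x * mainPot σ ψ x ∂σ) := by
  refine ⟨ENNReal.ofReal (4 * volume.real (Metric.ball (0 : E d) 1) * A) +
    ENNReal.ofReal (64 * d * volume.real (Metric.ball (0 : E d) 1) * A ^ 2),
    ENNReal.add_lt_top.2 ⟨ENNReal.ofReal_lt_top, ENNReal.ofReal_lt_top⟩, fun ψ hψ M hM => ?_⟩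
  have hF := (measurable_tentAvg (σ := σ) hψ).enorm
  rw [← scaleEnergy_tentAvg hd hA hψ hM, add_mul]
  refine add_le_add (hA.lintegral_sq_le hd hF fun x => ?_)
    (hA.lintegral_diffQuot_le hd hF fun x y => ?_)
  · rw [mainPot_eq hd hA hψ hM]
    refine (enorm_integral_le_lintegral_enorm _).trans_eq (lintegral_congr_ae ?_)
    filter_upwards [ae_scaleMeasure] with p hp
    have := hp.1
    rw [enorm_mul, enorm_mul, Real.enorm_of_nonneg (by positivity),
      Real.enorm_of_nonneg (tentKer_nonneg _ _ _)]
  · rw [mainPot_eq hd hA hψ hM, mainPot_eq hd hA hψ hM, ← integral_sub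
      (integrable_mainPot_integrand hd hA hψ hM x) (integrable_mainPot_integrand hd hA hψ hM y)]
    refine (enorm_integral_le_lintegral_enorm _).trans_eq (lintegral_congr_ae ?_)
    filter_upwards [ae_scaleMeasure] with p hp
    have := hp.1
    rw [← sub_mul, ← mul_sub, enorm_mul, enorm_mul, Real.enorm_of_nonneg (by positivity),
      Real.enorm_eq_ofReal_abs (tentKer _ _ _ - _)]

end

/-! ### Boundedness of the single-layer operator -/

/-- Removes the diagonal, where the representation of the fundamental solution says nothing. -/
lemma UpperRegular.measure_singleton {d : ℕ} (hd : 2 ≤ d) {A : ℝ} {σ : Measure (E d)}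
    (hA : UpperRegular A σ) (x : E d) : σ {x} = 0 := by
  have ht : Tendsto (fun r : ℝ => ENNReal.ofReal (A * r ^ (d - 1))) (𝓝[>] 0) (𝓝 0) := by
    have : Continuous fun r : ℝ => ENNReal.ofReal (A * r ^ (d - 1)) :=
      ENNReal.continuous_ofReal.comp (by fun_prop)
    have h := this.tendsto 0
    rw [zero_pow (by omega), mul_zero, ENNReal.ofReal_zero] at h
    exact h.mono_left nhdsWithin_le_nhds
  refine le_antisymm (ge_of_tendsto ht ?_) zero_le
  filter_upwards [self_mem_nhdsWithin] with r hr
  exact (measure_mono (by simpa using le_of_lt hr)).trans (hA.2 x r hr)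

section
variable {d : ℕ} {Ω : Set (E d)} [IsFiniteMeasure (surf Ω)] {A : ℝ}

/-- The trace estimate bounds `‖u‖²` by a multiple of `∫ ψ u`, and duality bounds `∫ ψ u` by the
dual norm of `ψ` times `‖u‖`. One factor `‖u‖` cancels because the trace estimate already shows it
to be finite. -/
lemma exists_mainPot_hsNorm_le (hd : 2 ≤ d) (hA : UpperRegular A (surf Ω)) :
    ∃ C : ℝ≥0∞, C < ⊤ ∧ ∀ ψ : E d → ℝ, Measurable ψ → ∀ M : ℝ, (∀ y, |ψ y| ≤ M) →
      mainPot (surf Ω) ψ ∈ Hs Ω (1 / 2) ∧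
      hsNorm Ω (1 / 2) (mainPot (surf Ω) ψ) ≤ C * dualNorm Ω (pairing Ω ψ) := by
  obtain ⟨C, hC, h⟩ := exists_mainPot_le hd hA
  refine ⟨C, hC, fun ψ hψ M hM => ?_⟩
  have h := h ψ hψ M hM
  set u := mainPot (surf Ω) ψ with hu
  have hum : AEStronglyMeasurable u (surf Ω) :=
    (measurable_mainPot hd hA hψ hM).aestronglyMeasurable
  have hsq : hsNorm Ω (1 / 2) u ^ 2 ≤ C * ENNReal.ofReal (∫ x, ψ x * u x ∂(surf Ω)) := by
    rw [hsNorm_sq, hsSeminorm, eLpNorm_two_sq, eLpNorm_two_sq, lintegral_prod _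
      ((aestronglyMeasurable_diffQuot _ hum).enorm.pow_const _)]
    exact h
  have hlt : hsNorm Ω (1 / 2) u < ⊤ := by
    have := hsq.trans_lt (ENNReal.mul_lt_top hC ENNReal.ofReal_lt_top)
    exact (ENNReal.pow_lt_top_iff.1 this).resolve_right two_ne_zero
  have humem : u ∈ Hs Ω (1 / 2) :=
    ⟨⟨hum, (eLpNorm_le_hsNorm Ω (1 / 2) u).trans_lt hlt⟩,
      ⟨aestronglyMeasurable_diffQuot _ hum, (hsSeminorm_le_hsNorm Ω (1 / 2) u).trans_lt hlt⟩⟩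
  refine ⟨humem, ?_⟩
  have hψ2 : MemLp ψ 2 (surf Ω) :=
    MemLp.of_bound hψ.aestronglyMeasurable M (Eventually.of_forall hM)
  have hp := enorm_le_dualNorm_mul (Φ := pairingₗ hψ2) (dualNorm_pairing_lt_top hψ2).ne ⟨u, humem⟩
  have h3 : hsNorm Ω (1 / 2) u ^ 2 ≤ C * dualNorm Ω (pairing Ω ψ) * hsNorm Ω (1 / 2) u := by
    refine hsq.trans ?_
    rw [mul_assoc]
    refine mul_le_mul_right (le_trans ?_ hp) C
    exact Real.ofReal_le_enorm _
  rw [sq] at h3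
  by_cases h0 : hsNorm Ω (1 / 2) u = 0
  · rw [h0]; exact zero_le
  · exact (ENNReal.mul_le_mul_iff_left h0 hlt.ne).1 h3

/-- Potentials of Lipschitz kernels with Lipschitz differences. -/
lemma exists_smoothPot_hsNorm_le (hd : 2 ≤ d) (hΩ : Bornology.IsBounded (frontier Ω))
    (hA : UpperRegular A (surf Ω)) {R : E d → ℝ} {L : ℝ} (hL : 0 ≤ L)
    (h1 : ∀ u v, |R u - R v| ≤ L * ‖u - v‖)
    (h2 : ∀ x x' y y', |R (x - y) - R (x' - y) - (R (x - y') - R (x' - y'))| ≤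
      L * (‖x - x'‖ * ‖y - y'‖)) :
    ∃ C : ℝ≥0∞, C < ⊤ ∧ ∀ ψ : E d → ℝ, Measurable ψ → ∀ M : ℝ, (∀ y, |ψ y| ≤ M) →
      (∀ x, Integrable (fun y => R (x - y) * ψ y) (surf Ω)) ∧
      (fun x => ∫ y, R (x - y) * ψ y ∂(surf Ω)) ∈ Hs Ω (1 / 2) ∧
      hsNorm Ω (1 / 2) (fun x => ∫ y, R (x - y) * ψ y ∂(surf Ω)) ≤
        C * dualNorm Ω (pairing Ω ψ) := by
  obtain ⟨B, hB⟩ := hΩ.subset_closedBall (0 : E d)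
  have hBn : ∀ x ∈ frontier Ω, ‖x‖ ≤ max B 0 := fun x hx =>
    (by simpa using hB hx : ‖x‖ ≤ B).trans (le_max_left _ _)
  set b := max B 0 with hb
  have hb0 : 0 ≤ b := le_max_right _ _
  let a : ℝ := |R 0| + L * (2 * b) + L
  have ha : 0 ≤ a := by positivity
  have hRa : ∀ x ∈ frontier Ω, ∀ y ∈ frontier Ω, |R (x - y)| ≤ a := fun x hx y hy => by
    have e1 := h1 (x - y) 0
    rw [sub_zero] at e1
    have e2 := abs_sub_abs_le_abs_sub (R (x - y)) (R 0)
    have e3 := norm_sub_le x y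
    have e4 := hBn x hx
    have e5 := hBn y hy
    have e6 : L * ‖x - y‖ ≤ L * (2 * b) := by gcongr; linarith
    simp only [a]; linarith
  have hLip : LipschitzWith ⟨L, hL⟩ R := LipschitzWith.of_dist_le_mul fun u v => by
    rw [Real.dist_eq, dist_eq_norm]; exact h1 u v
  have hRc : Continuous R := hLip.continuous
  have hLa : L ≤ a := by simp only [a]; have := abs_nonneg (R 0); nlinarith
  have hvm : ∀ x, AEStronglyMeasurable (fun y => R (x - y)) (surf Ω) := fun x =>
    (by fun_prop : Continuous fun y => R (x - y)).aestronglyMeasurable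
  set K : ℝ≥0∞ := (surf Ω univ + lipConst Ω) ^ (1 / 2 : ℝ) with hK
  have hK' : K < ⊤ := ENNReal.rpow_lt_top_of_nonneg (by norm_num)
    (ENNReal.add_lt_top.2 ⟨measure_lt_top _ _, lipConst_lt_top hd hA⟩).ne
  have hv : ∀ x ∈ frontier Ω, (fun y => R (x - y)) ∈ Hs Ω (1 / 2) ∧
      hsNorm Ω (1 / 2) (fun y => R (x - y)) ≤ ENNReal.ofReal a * K := fun x hx =>
    lipschitz_mem_Hs hd hA (hvm x) ha (hRa x hx) fun y _ y' _ => by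
      refine (h1 _ _).trans ?_
      rw [sub_sub_sub_cancel_left, norm_sub_rev]
      gcongr
  -- Control of double differences makes `y ↦ R (x - y) - R (x' - y)` small in `H^{1/2}(Γ)`, of
  -- order `‖x - x'‖`. Tested with `ψ`, this makes the potential Lipschitz in `x` with a constant
  -- proportional to the dual norm.
  have hdv : ∀ x ∈ frontier Ω, ∀ x' ∈ frontier Ω,
      hsNorm Ω (1 / 2) ((fun y => R (x - y)) - fun y => R (x' - y)) ≤
        ENNReal.ofReal (L * ‖x - x'‖) * K := fun x hx x' hx' => by
    refine (lipschitz_mem_Hs hd hA ((hvm x).sub (hvm x')) (by positivity) (fun y _ => ?_)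
      fun y _ y' _ => ?_).2
    · refine (h1 _ _).trans_eq ?_
      rw [sub_sub_sub_cancel_right]
    · refine (h2 x x' y y').trans_eq ?_
      ring
  refine ⟨ENNReal.ofReal a * K * K, ENNReal.mul_lt_top (ENNReal.mul_lt_top
    ENNReal.ofReal_lt_top hK') hK', fun ψ hψ M hM => ?_⟩
  have hψ2 : MemLp ψ 2 (surf Ω) :=
    MemLp.of_bound hψ.aestronglyMeasurable M (Eventually.of_forall hM)
  have hDt := dualNorm_pairing_lt_top hψ2
  set D := dualNorm Ω (pairing Ω ψ) with hD
  have hint : ∀ x, Integrable (fun y => R (x - y) * ψ y) (surf Ω) := fun x => by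
    refine Integrable.of_bound (C := (|R x| + L * b) * M)
      ((hvm x).mul hψ.aestronglyMeasurable) ?_
    filter_upwards [ae_mem_frontier Ω] with y hy
    rw [Real.norm_eq_abs, abs_mul]
    have e1 := h1 (x - y) x
    rw [sub_sub_cancel_left, norm_neg] at e1
    have e2 := abs_sub_abs_le_abs_sub (R (x - y)) (R x)
    have e3 : L * ‖y‖ ≤ L * b := by gcongr; exact hBn y hy
    refine mul_le_mul (by linarith) (hM y) (abs_nonneg _) (by positivity)
  refine ⟨hint, ?_⟩
  have hr0 : ∀ x ∈ frontier Ω, ‖∫ y, R (x - y) * ψ y ∂(surf Ω)‖ₑ ≤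
      D * (ENNReal.ofReal a * K) := fun x hx => by
    have := enorm_le_dualNorm_mul (Φ := pairingₗ hψ2) hDt.ne ⟨_, (hv x hx).1⟩
    refine le_trans (le_of_eq ?_) (this.trans (mul_le_mul_right (hv x hx).2 _))
    congr 1
    exact integral_congr_ae (Eventually.of_forall fun y => mul_comm _ _)
  have hr1 : ∀ x ∈ frontier Ω, ∀ x' ∈ frontier Ω, ‖(∫ y, R (x - y) * ψ y ∂(surf Ω)) -
      ∫ y, R (x' - y) * ψ y ∂(surf Ω)‖ₑ ≤ D * (ENNReal.ofReal (L * ‖x - x'‖) * K) :=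
    fun x hx x' hx' => by
    have := enorm_le_dualNorm_mul (Φ := pairingₗ hψ2) hDt.ne
      (⟨_, (hv x hx).1⟩ - ⟨_, (hv x' hx').1⟩)
    refine le_trans (le_of_eq ?_) (this.trans (mul_le_mul_right (hdv x hx x' hx') _))
    congr 1
    rw [← integral_sub (hint x) (hint x')]
    exact integral_congr_ae (Eventually.of_forall fun y => by
      change R (x - y) * ψ y - R (x' - y) * ψ y = ψ y * (R (x - y) - R (x' - y)); ring)
  have hrm : AEStronglyMeasurable (fun x => ∫ y, R (x - y) * ψ y ∂(surf Ω)) (surf Ω) := by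
    have : StronglyMeasurable fun q : E d × E d => R (q.1 - q.2) * ψ q.2 :=
      Measurable.stronglyMeasurable (by
        have := hRc.measurable
        fun_prop)
    exact (this.integral_prod_right' (ν := surf Ω)).aestronglyMeasurable
  have hKr : ENNReal.ofReal K.toReal = K := ENNReal.ofReal_toReal hK'.ne
  have hDr : ENNReal.ofReal D.toReal = D := ENNReal.ofReal_toReal hDt.ne
  have := lipschitz_mem_Hs hd hA hrm (a := D.toReal * (a * K.toReal)) (by positivity)
    (fun x hx => ?_) (fun x hx x' hx' => ?_)
  · refine ⟨this.1, this.2.trans_eq ?_⟩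
    rw [ENNReal.ofReal_mul (by positivity), ENNReal.ofReal_mul (by positivity), hKr, hDr, ← hK]
    ring
  · rw [← ENNReal.ofReal_le_ofReal_iff (by positivity), ← Real.enorm_eq_ofReal_abs,
      ENNReal.ofReal_mul (by positivity), ENNReal.ofReal_mul (by positivity), hKr, hDr]
    exact hr0 x hx
  · rw [← ENNReal.ofReal_le_ofReal_iff (by positivity), ← Real.enorm_eq_ofReal_abs]
    refine (hr1 x hx x' hx').trans ?_
    rw [← hKr, ← hDr, ← ENNReal.ofReal_mul (by positivity), ← ENNReal.ofReal_mul (by positivity)]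
    refine ENNReal.ofReal_le_ofReal ?_
    rw [ENNReal.toReal_ofReal (by positivity), ENNReal.toReal_ofReal (by positivity)]
    have : L * ‖x - x'‖ ≤ a * ‖x - x'‖ := by gcongr
    calc _ ≤ D.toReal * (a * ‖x - x'‖ * K.toReal) := by gcongr
      _ = _ := by ring

/-- The single-layer operator on bounded densities. -/
lemma exists_singleLayer_hsNorm_le (hd : 2 ≤ d) (hΩ : Bornology.IsBounded (frontier Ω))
    (hA : UpperRegular A (surf Ω)) :
    ∃ C : ℝ≥0∞, C < ⊤ ∧ ∀ ψ : E d → ℝ, MemLp ψ ⊤ (surf Ω) →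
      (∀ x, Integrable (fun y => fundSol d (x - y) * ψ y) (surf Ω)) ∧
      singleLayer Ω ψ ∈ Hs Ω (1 / 2) ∧
      hsNorm Ω (1 / 2) (singleLayer Ω ψ) ≤ C * dualNorm Ω (pairing Ω ψ) := by
  obtain ⟨c, c₀, hc, hfs⟩ := exists_fundSol_eq hd
  obtain ⟨C₁, hC₁, H₁⟩ := exists_mainPot_hsNorm_le hd hA
  have hI : 0 ≤ ∫ w : E d, tent w := integral_nonneg tent_nonneg
  have hJ := setIntegral_inv_sq_nonneg
  let L₁ := (∫ τ in Ioi (1 : ℝ), (τ ^ 2)⁻¹) * (∫ w : E d, tent w)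
  let L₂ := (∫ τ in Ioi (1 : ℝ), (τ ^ 2)⁻¹) * (2 * volume.real (Metric.closedBall (0 : E d) 1))
  have hL₁ : 0 ≤ L₁ := by positivity
  have hL₂ : 0 ≤ L₂ := by positivity
  obtain ⟨C₂, hC₂, H₂⟩ := exists_smoothPot_hsNorm_le (R := fun x => c * remKer x + c₀)
    (L := c * (L₁ + L₂)) hd hΩ hA (by positivity)
    (fun u v => by
      rw [add_sub_add_right_eq_sub, ← mul_sub, abs_mul, abs_of_pos hc, mul_assoc]
      gcongr
      refine (abs_remKer_sub_le hd u v).trans ?_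
      have := norm_nonneg (u - v)
      exact mul_le_mul_of_nonneg_right (by simp only [L₁] at *; linarith) this)
    (fun x x' y y' => by
      have e : c * remKer (x - y) + c₀ - (c * remKer (x' - y) + c₀) -
          (c * remKer (x - y') + c₀ - (c * remKer (x' - y') + c₀)) =
          c * (remKer (x - y) - remKer (x' - y) - (remKer (x - y') - remKer (x' - y'))) := by ring
      rw [e, abs_mul, abs_of_pos hc, mul_assoc]
      gcongr
      refine (abs_remKer_double_diff_le hd x x' y y').trans ?_
      exact mul_le_mul_of_nonneg_right (by simp only [L₂] at *; linarith) (by positivity))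
  refine ⟨2 * (ENNReal.ofReal c * C₁ + C₂), ENNReal.mul_lt_top (by simp)
    (ENNReal.add_lt_top.2 ⟨ENNReal.mul_lt_top ENNReal.ofReal_lt_top hC₁, hC₂⟩), fun ψ₀ hψ₀ => ?_⟩
  -- a bounded representative
  obtain ⟨ψ, M, hψ, hM, hae⟩ : ∃ (ψ : E d → ℝ) (M : ℝ), Measurable ψ ∧ (∀ y, |ψ y| ≤ M) ∧
      ψ₀ =ᵐ[surf Ω] ψ := by
    set M := (eLpNorm ψ₀ ⊤ (surf Ω)).toReal with hMdef
    have hM0 : 0 ≤ M := ENNReal.toReal_nonneg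
    have hmk := hψ₀.1.stronglyMeasurable_mk.measurable
    refine ⟨fun y => max (-M) (min M (hψ₀.1.mk ψ₀ y)), M, by fun_prop, fun y => ?_, ?_⟩
    · rw [abs_le]
      exact ⟨le_max_left _ _, max_le (by linarith) (min_le_left _ _)⟩
    · filter_upwards [hψ₀.1.ae_eq_mk, ae_le_eLpNormEssSup (f := ψ₀) (μ := surf Ω)] with y hy1 hy2
      have h3 : |ψ₀ y| ≤ M := by
        rw [← eLpNorm_exponent_top] at hy2
        have := ENNReal.toReal_mono hψ₀.2.ne hy2
        rw [toReal_enorm] at this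
        exact this
      rw [← hy1]
      rw [min_eq_right (abs_le.1 h3).2, max_eq_right (abs_le.1 h3).1]
  have hpair : pairing Ω ψ₀ = pairing Ω ψ := funext fun v =>
    integral_congr_ae (hae.mono fun y hy => by simp only [hy])
  have hne : ∀ x : E d, ∀ᵐ y ∂(surf Ω), y ≠ x := fun x => by
    rw [ae_iff]; simpa using hA.measure_singleton hd x
  obtain ⟨hi₂, hm₂, hn₂⟩ := H₂ ψ hψ M hM
  obtain ⟨hm₁, hn₁⟩ := H₁ ψ hψ M hM
  have hi₁ := fun x => integrable_mainKer_mul hd hA hψ hM x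
  have hker : ∀ x, (fun y => fundSol d (x - y) * ψ₀ y) =ᵐ[surf Ω]
      fun y => c * (mainKer (x - y) * ψ y) + (c * remKer (x - y) + c₀) * ψ y := fun x => by
    filter_upwards [hae, hne x] with y hy hyx
    rw [hfs (x - y) (sub_ne_zero.2 hyx.symm), hy]; ring
  have hsl : singleLayer Ω ψ₀ = c • mainPot (surf Ω) ψ +
      fun x => ∫ y, (c * remKer (x - y) + c₀) * ψ y ∂(surf Ω) := by
    funext x
    simp only [singleLayer, Pi.add_apply, Pi.smul_apply, smul_eq_mul, mainPot]
    rw [integral_congr_ae (hker x), integral_add ((hi₁ x).const_mul c) (hi₂ x),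
      integral_const_mul]
  refine ⟨fun x => (((hi₁ x).const_mul c).add (hi₂ x)).congr (hker x).symm, ?_, ?_⟩
  · rw [hsl]
    exact (Hs Ω (1 / 2)).add_mem ((Hs Ω (1 / 2)).smul_mem c hm₁) hm₂
  · rw [hsl, hpair]
    refine (hsNorm_add_le ((Hs Ω (1 / 2)).smul_mem c hm₁) hm₂).trans ?_
    rw [hsNorm_smul, Real.enorm_of_nonneg hc.le]
    calc _ ≤ 2 * (ENNReal.ofReal c * (C₁ * dualNorm Ω (pairing Ω ψ)) +
          C₂ * dualNorm Ω (pairing Ω ψ)) := by gcongr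
      _ = _ := by ring

/-- The bound for bounded densities survives the limit in `IsSingleLayer`, at the price of the
factor `2` from `hsNorm_add_le`. -/
lemma singleLayerNorm_lt_top (hd : 2 ≤ d) (hΩ : Bornology.IsBounded (frontier Ω))
    (hA : UpperRegular A (surf Ω)) : singleLayerNorm Ω < ⊤ := by
  obtain ⟨C, hC, H⟩ := exists_singleLayer_hsNorm_le hd hΩ hA
  refine lt_of_le_of_lt (sInf_le (a := 2 * C) fun Φ h hΦ => ?_) (ENNReal.mul_lt_top (by simp) hC)
  obtain ⟨hh, ψ, hψ, h1, h2⟩ := hΦ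
  have key : ∀ n, hsNorm Ω (1 / 2) h ≤ 2 * (hsNorm Ω (1 / 2) (h - singleLayer Ω (ψ n)) +
      C * (dualNorm Ω Φ + dualNorm Ω fun v => Φ v - pairing Ω (ψ n) v)) := fun n => by
    obtain ⟨-, hm, hn⟩ := H (ψ n) (hψ n)
    have e : h = (h - singleLayer Ω (ψ n)) + singleLayer Ω (ψ n) := by abel
    have e1 : dualNorm Ω (pairing Ω (ψ n)) ≤
        dualNorm Ω Φ + dualNorm Ω fun v => Φ v - pairing Ω (ψ n) v := by
      rw [← dualNorm_neg fun v => Φ v - pairing Ω (ψ n) v]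
      refine le_trans (le_of_eq ?_) (dualNorm_add_le _ _)
      congr 1; funext v; ring
    calc hsNorm Ω (1 / 2) h = hsNorm Ω (1 / 2) ((h - singleLayer Ω (ψ n)) +
          singleLayer Ω (ψ n)) := by rw [← e]
      _ ≤ 2 * (hsNorm Ω (1 / 2) (h - singleLayer Ω (ψ n)) +
          hsNorm Ω (1 / 2) (singleLayer Ω (ψ n))) :=
          hsNorm_add_le ((Hs Ω (1 / 2)).sub_mem hh hm) hm
      _ ≤ _ := by gcongr; exact hn.trans (by gcongr)
  have ht : Tendsto (fun n => 2 * (hsNorm Ω (1 / 2) (h - singleLayer Ω (ψ n)) +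
      C * (dualNorm Ω Φ + dualNorm Ω fun v => Φ v - pairing Ω (ψ n) v))) atTop
      (𝓝 (2 * (0 + C * (dualNorm Ω Φ + 0)))) := by
    refine ENNReal.Tendsto.const_mul (h2.add (ENNReal.Tendsto.const_mul
      (tendsto_const_nhds.add h1) (Or.inr hC.ne))) (Or.inr (by simp))
  have := ge_of_tendsto' ht key
  rwa [zero_add, add_zero, ← mul_assoc] at this

/-- The operator norm bounds the error of a Galerkin approximation. -/
lemma hsSeminorm_sub_singleLayer_le (hd : 2 ≤ d) (hΩ : Bornology.IsBounded (frontier Ω))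
    (hA : UpperRegular A (surf Ω)) {Φ : Hs Ω (1 / 2) →ₗ[ℝ] ℝ} {g φ : E d → ℝ}
    (hΦ : IsSingleLayer Ω Φ g) (hφ : MemLp φ ⊤ (surf Ω)) :
    hsSeminorm Ω (1 / 2) (g - singleLayer Ω φ) ≤
      singleLayerNorm Ω * dualNorm Ω fun v => Φ v - pairing Ω φ v := by
  obtain ⟨C, hC, H⟩ := exists_singleLayer_hsNorm_le hd hΩ hA
  obtain ⟨hh, ψ, hψ, h1, h2⟩ := hΦ
  have hφ2 : MemLp φ 2 (surf Ω) := hφ.mono_exponent le_top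
  -- By linearity on bounded densities, the residual is the image of `Φ - φ`, approximated by the
  -- densities `ψ n - φ`.
  let Ψ : Hs Ω (1 / 2) →ₗ[ℝ] ℝ := Φ - pairingₗ hφ2
  have hsub : ∀ n, singleLayer Ω (ψ n - φ) = singleLayer Ω (ψ n) - singleLayer Ω φ := fun n => by
    funext x
    simp only [singleLayer, Pi.sub_apply, mul_sub]
    exact integral_sub ((H _ (hψ n)).1 x) ((H _ hφ).1 x)
  have hpair : ∀ n v, pairing Ω (ψ n - φ) v = pairing Ω (ψ n) v - pairing Ω φ v := fun n v => by
    have hn2 : MemLp (ψ n) 2 (surf Ω) := (hψ n).mono_exponent le_top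
    simp only [pairing, Pi.sub_apply, sub_mul]
    exact integral_sub (hn2.integrable_mul v.2.1) (hφ2.integrable_mul v.2.1)
  have e1 : ∀ n, (fun v => Ψ v - pairing Ω (ψ n - φ) v) = fun v => Φ v - pairing Ω (ψ n) v :=
    fun n => funext fun v => by
      rw [hpair]
      change Φ v - pairing Ω φ v - _ = _
      ring
  have e2 : ∀ n, (g - singleLayer Ω φ) - singleLayer Ω (ψ n - φ) = g - singleLayer Ω (ψ n) :=
    fun n => by rw [hsub]; abel
  have hΨ : IsSingleLayer Ω Ψ (g - singleLayer Ω φ) := by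
    refine ⟨(Hs Ω (1 / 2)).sub_mem hh (H _ hφ).2.1, fun n => ψ n - φ, fun n => (hψ n).sub hφ, ?_, ?_⟩
    · simpa only [e1] using h1
    · simpa only [e2] using h2
  have hD : dualNorm Ω Ψ ≠ ⊤ := by
    obtain ⟨n, hn⟩ := (h1.eventually (gt_mem_nhds (zero_lt_one' ℝ≥0∞))).exists
    have h3 : dualNorm Ω Ψ ≤ (dualNorm Ω fun v => Ψ v - pairing Ω (ψ n - φ) v) +
        dualNorm Ω (pairing Ω (ψ n - φ)) := by
      refine le_trans (le_of_eq ?_) (dualNorm_add_le _ _)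
      congr 1; funext v; ring
    rw [e1] at h3
    refine (h3.trans_lt (ENNReal.add_lt_top.2 ⟨hn.trans ENNReal.one_lt_top, ?_⟩)).ne
    exact dualNorm_pairing_lt_top (((hψ n).sub hφ).mono_exponent le_top)
  refine (hsSeminorm_le_hsNorm _ _ _).trans ?_
  change _ ≤ singleLayerNorm Ω * dualNorm Ω Ψ
  -- The infimum that defines `singleLayerNorm` is pulled through the product by dividing by the
  -- dual norm. If the latter is zero, one admissible constant suffices; it exists because the
  -- infimum is finite.
  by_cases hD0 : dualNorm Ω Ψ = 0
  · have hne : {C : ℝ≥0∞ | ∀ (Φ : Hs Ω (1 / 2) →ₗ[ℝ] ℝ) (h : E d → ℝ), IsSingleLayer Ω Φ h →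
        hsNorm Ω (1 / 2) h ≤ C * dualNorm Ω Φ}.Nonempty := by
      by_contra h0
      have := singleLayerNorm_lt_top hd hΩ hA
      rw [singleLayerNorm, not_nonempty_iff_eq_empty.1 h0] at this
      simp at this
    obtain ⟨C', hC'⟩ := hne
    have := hC' Ψ _ hΨ
    rw [hD0, mul_zero] at this ⊢
    exact this
  · refine (ENNReal.div_le_iff hD0 hD).1 (le_sInf fun C' hC' => ?_)
    exact (ENNReal.div_le_iff hD0 hD).2 (hC' Ψ _ hΨ)

end

/-! ### Polynomials and geometry on a single simplex -/

/-! ### Lagrange interpolation on simplices -/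

/-- The polynomial `x(x-1)⋯(x-n+1)/n!`. -/
def lagrangeFactor (x : ℝ) (n : ℕ) : ℝ := ∏ j ∈ Finset.range n, (x - j) / (n - j)

/-- Absorption identity of the generalized binomial coefficient; it drives the induction on the
degree. -/
lemma lagrangeFactor_succ (x : ℝ) (n : ℕ) :
    (n + 1) * lagrangeFactor x (n + 1) = x * lagrangeFactor (x - 1) n := by
  unfold lagrangeFactor
  rw [Finset.prod_range_succ']
  have h : ∀ j ∈ Finset.range n, (x - ((j + 1 : ℕ) : ℝ)) / (((n + 1 : ℕ) : ℝ) - ((j + 1 : ℕ) : ℝ)) =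
      (x - 1 - j) / (n - j) := fun j _ => by push_cast; congr 1 <;> ring
  rw [Finset.prod_congr rfl h]
  have : (n : ℝ) + 1 ≠ 0 := by positivity
  push_cast
  field_simp
  ring

@[simp] lemma lagrangeFactor_zero (x : ℝ) : lagrangeFactor x 0 = 1 := by simp [lagrangeFactor]

lemma lagrangeFactor_self (n : ℕ) : lagrangeFactor n n = 1 := by
  unfold lagrangeFactor
  refine Finset.prod_eq_one fun j hj => div_self ?_
  have : j < n := Finset.mem_range.1 hj
  have : (j : ℝ) < n := by exact_mod_cast this
  linarith

lemma lagrangeFactor_of_lt {m n : ℕ} (h : m < n) : lagrangeFactor m n = 0 := by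
  unfold lagrangeFactor
  exact Finset.prod_eq_zero (Finset.mem_range.2 h) (by simp)

lemma lagrangeFactor_eq_zero {n : ℕ} (h : n ≠ 0) : lagrangeFactor 0 n = 0 := by
  have := lagrangeFactor_of_lt (Nat.pos_of_ne_zero h)
  simpa using this

section
variable {V : Type*} [DecidableEq V]

/-- The Lagrange polynomials in scaled barycentric coordinates. -/
def lagrangePoly (S : Finset V) (k : V → ℕ) (t : V → ℝ) : ℝ := ∏ v ∈ S, lagrangeFactor (t v) (k v)

/-- The value of an affine form. -/
def formEval (S : Finset V) (t : V → ℝ) (l : (V → ℝ) × ℝ) : ℝ := ∑ v ∈ S, l.1 v * t v + l.2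

/-- Indices with `k u = 0` carry weight zero; the others are the indices of total `q`, raised by one
at `u`. -/
lemma sum_piAntidiag_succ (S : Finset V) (q : ℕ) {u : V} (hu : u ∈ S) (F : (V → ℕ) → ℝ) :
    ∑ k ∈ S.piAntidiag (q + 1), (k u : ℝ) * F k =
      ∑ k ∈ S.piAntidiag q, ((k u : ℝ) + 1) * F (k + Pi.single u 1) := by
  symm
  rw [← Finset.sum_filter_add_sum_filter_not (S.piAntidiag (q + 1)) (fun k => k u ≠ 0)]
  have h0 : ∑ k ∈ (S.piAntidiag (q + 1)).filter (fun k => ¬ k u ≠ 0), (k u : ℝ) * F k = 0 :=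
    Finset.sum_eq_zero fun k hk => by
      have := (Finset.mem_filter.1 hk).2
      rw [not_not.1 this]; simp
  rw [h0, add_zero]
  have hs : ∀ k : V → ℕ, ∑ v ∈ S, (k + Pi.single u 1 : V → ℕ) v = ∑ v ∈ S, k v + 1 := fun k => by
    simp only [Pi.add_apply, Finset.sum_add_distrib, Pi.single_apply]
    rw [Finset.sum_ite_eq' S u, if_pos hu]
  refine Finset.sum_bij (fun k _ => k + Pi.single u 1) (fun k hk => ?_) (fun k _ k' _ h => ?_)
    (fun k hk => ?_) (fun k _ => ?_)
  · rw [Finset.mem_piAntidiag] at hk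
    rw [Finset.mem_filter, Finset.mem_piAntidiag]
    refine ⟨⟨by rw [← hk.1]; exact hs k, fun v hv => ?_⟩, by simp⟩
    by_contra hvS
    have h1 : k v = 0 := by by_contra h; exact hvS (hk.2 v h)
    have h2 : v ≠ u := fun h => hvS (h ▸ hu)
    simp [h1, h2] at hv
  · exact add_right_cancel h
  · rw [Finset.mem_filter, Finset.mem_piAntidiag] at hk
    have e : k - Pi.single u 1 + Pi.single u 1 = k := by
      funext v
      by_cases h : v = u
      · subst h; simp; have := hk.2; omega
      · simp [h]
    refine ⟨k - Pi.single u 1, ?_, e⟩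
    rw [Finset.mem_piAntidiag]
    constructor
    · have := hs (k - Pi.single u 1)
      rw [e] at this
      have h2 := hk.1.1
      change ∑ v ∈ S, (k - Pi.single u 1 : V → ℕ) v = q
      change ∑ v ∈ S, k v = q + 1 at h2
      omega
    · intro v hv
      refine hk.1.2 v fun h => hv ?_
      simp [h]
  · simp

lemma lagrangePoly_add_single (S : Finset V) {u : V} (hu : u ∈ S) (k : V → ℕ) (t : V → ℝ) :
    ((k u : ℝ) + 1) * lagrangePoly S (k + Pi.single u 1) t =
      t u * lagrangePoly S k (t - Pi.single u 1) := by
  unfold lagrangePoly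
  rw [← Finset.mul_prod_erase S _ hu, ← Finset.mul_prod_erase S _ hu, ← mul_assoc, ← mul_assoc]
  congr 1
  · simp only [Pi.add_apply, Pi.sub_apply, Pi.single_eq_same]
    exact lagrangeFactor_succ _ _
  · refine Finset.prod_congr rfl fun v hv => ?_
    have h : v ≠ u := Finset.ne_of_mem_erase hv
    simp [h]

/-- Products of at most `q` affine forms are reproduced by Lagrange interpolation. -/
lemma sum_formProd_mul_lagrangePoly (S : Finset V) (q : ℕ) :
    ∀ (M : Multiset ((V → ℝ) × ℝ)), M.card ≤ q → ∀ t : V → ℝ, ∑ v ∈ S, t v = q →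
      ∑ k ∈ S.piAntidiag q, (M.map (formEval S fun v => (k v : ℝ))).prod * lagrangePoly S k t =
        (M.map (formEval S t)).prod := by
  induction q with
  | zero =>
    intro M hM t ht
    have : M = 0 := by simpa using hM
    subst this
    simp [lagrangePoly]
  | succ q ih =>
    have main : ∀ (l : (V → ℝ) × ℝ) (M : Multiset ((V → ℝ) × ℝ)), M.card ≤ q → ∀ t : V → ℝ,
        ∑ v ∈ S, t v = (q + 1 : ℕ) → ∑ k ∈ S.piAntidiag (q + 1),
          ((l ::ₘ M).map (formEval S fun v => (k v : ℝ))).prod * lagrangePoly S k t =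
        ((l ::ₘ M).map (formEval S t)).prod := by
      intro l M hM t ht
      have hq : ((q + 1 : ℕ) : ℝ) ≠ 0 := by positivity
      -- The constraint on the coordinate sum homogenizes the affine form into a combination of the
      -- coordinates.
      have hl : ∀ s : V → ℝ, ∑ v ∈ S, s v = (q + 1 : ℕ) →
          formEval S s l = ∑ v ∈ S, (l.1 v + l.2 / (q + 1 : ℕ)) * s v := fun s hs => by
        simp only [add_mul, Finset.sum_add_distrib, formEval, ← Finset.mul_sum, hs]
        rw [div_mul_cancel₀ _ hq]
      -- Absorbing the factor `k u` shifts indices and arguments by one at `u`; the constant terms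
      -- of the remaining forms compensate for this shift.
      let M' : V → Multiset ((V → ℝ) × ℝ) := fun u => M.map fun l => (l.1, l.2 + l.1 u)
      have hM' : ∀ u ∈ S, ∀ s : V → ℝ, ((M' u).map (formEval S (s - Pi.single u 1))).prod =
          (M.map (formEval S s)).prod := fun u hu s => by
        simp only [M', Multiset.map_map]
        congr 1
        refine Multiset.map_congr rfl fun l _ => ?_
        simp only [formEval, Function.comp_apply, Pi.sub_apply, mul_sub, Finset.sum_sub_distrib,
          Pi.single_apply, mul_ite, mul_one, mul_zero, Finset.sum_ite_eq', if_pos hu]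
        ring
      have hu : ∀ u ∈ S, ∑ k ∈ S.piAntidiag (q + 1), (k u : ℝ) *
          ((M.map (formEval S fun v => (k v : ℝ))).prod * lagrangePoly S k t) =
          t u * (M.map (formEval S t)).prod := fun u hu => by
        rw [sum_piAntidiag_succ S q hu, ← hM' u hu t, ← ih (M' u) (by simpa [M'] using hM)
          (t - Pi.single u 1), Finset.mul_sum]
        · refine Finset.sum_congr rfl fun k _ => ?_
          have e : (fun v => (k v : ℝ)) = (fun v => ((k + Pi.single u 1 : V → ℕ) v : ℝ)) -
              Pi.single u 1 := by
            funext v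
            by_cases h : v = u
            · subst h; simp
            · simp [h]
          rw [e, hM' u hu, mul_left_comm, lagrangePoly_add_single S hu]
          ring
        · simp only [Pi.sub_apply, Finset.sum_sub_distrib, ht, Pi.single_apply,
            Finset.sum_ite_eq', if_pos hu]
          push_cast; ring
      calc _ = ∑ k ∈ S.piAntidiag (q + 1), ∑ u ∈ S, (l.1 u + l.2 / (q + 1 : ℕ)) * ((k u : ℝ) *
            ((M.map (formEval S fun v => (k v : ℝ))).prod * lagrangePoly S k t)) := by
            refine Finset.sum_congr rfl fun k hk => ?_
            have hk1 : ∑ v ∈ S, (k v : ℝ) = (q + 1 : ℕ) := by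
              rw [← (Finset.mem_piAntidiag.1 hk).1]; push_cast; rfl
            rw [Multiset.map_cons, Multiset.prod_cons, hl _ hk1, Finset.sum_mul, Finset.sum_mul]
            exact Finset.sum_congr rfl fun u _ => by ring
        _ = _ := by
            rw [Finset.sum_comm, Multiset.map_cons, Multiset.prod_cons, hl t ht, Finset.sum_mul]
            refine Finset.sum_congr rfl fun u hu' => ?_
            rw [← Finset.mul_sum, hu u hu', mul_assoc]
    intro M hM t ht
    rcases Multiset.empty_or_exists_mem M with rfl | ⟨l, hl⟩
    -- The empty product is treated by inserting the constant form one.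
    · have := main (0, 1) 0 (by simp) t ht
      simpa [formEval] using this
    · obtain ⟨M', rfl⟩ := Multiset.exists_cons_of_mem hl
      exact main l M' (by simpa using hM) t ht

end

/-- The point with the given barycentric weights. -/
def baryPoint {d : ℕ} (S : Finset (E d)) (w : E d → ℝ) : E d := ∑ v ∈ S, w v • v

/-- Lagrange interpolation reproduces polynomials of degree at most `q`. -/
theorem eval_baryPoint {d : ℕ} [DecidableEq (E d)] (S : Finset (E d)) {q : ℕ} (hq : 1 ≤ q)
    {P : MvPolynomial (Fin d) ℝ} (hP : P.totalDegree ≤ q) {w : E d → ℝ} (hw : ∑ v ∈ S, w v = 1) :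
    MvPolynomial.eval (fun i => baryPoint S w i) P = ∑ k ∈ S.piAntidiag q,
      MvPolynomial.eval (fun i => baryPoint S (fun v => (k v : ℝ) / q) i) P *
        lagrangePoly S k (fun v => q * w v) := by
  have hq0 : (q : ℝ) ≠ 0 := by positivity
  -- Cartesian coordinates as linear forms in the scaled barycentric weights `t = q w`; a monomial
  -- becomes a product of at most `q` of them.
  let l : Fin d → (E d → ℝ) × ℝ := fun i => (fun v => v i / q, 0)
  have hl : ∀ (t : E d → ℝ) (i : Fin d),
      baryPoint S (fun v => t v / q) i = formEval S t (l i) := fun t i => by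
    simp only [baryPoint, formEval, l, add_zero]
    rw [show (∑ v ∈ S, (t v / q) • v : E d) i = ∑ v ∈ S, ((t v / q) • v : E d) i by
      simp]
    refine Finset.sum_congr rfl fun v _ => ?_
    simp only [PiLp.smul_apply, smul_eq_mul]
    ring
  have hev : ∀ t : E d → ℝ, MvPolynomial.eval (fun i => baryPoint S (fun v => t v / q) i) P =
      ∑ m ∈ P.support, P.coeff m * (((Finsupp.toMultiset m).map l).map (formEval S t)).prod :=
    fun t => by
      rw [MvPolynomial.eval_eq']
      refine Finset.sum_congr rfl fun m _ => ?_
      rw [Multiset.map_map, Finsupp.toMultiset_map, Finsupp.prod_toMultiset,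
        Finsupp.prod_mapDomain_index (by simp) (by intros; rw [pow_add])]
      · rw [Finsupp.prod_fintype _ _ (by simp)]
        congr 1
        exact Finset.prod_congr rfl fun i _ => by rw [hl]; rfl
  have e1 : baryPoint S w = baryPoint S (fun v => (q * w v) / q) := by
    congr 1; funext v; field_simp
  rw [e1, hev]
  simp only [hev (fun v => (_ : ℕ))]
  simp only [Finset.sum_mul]
  rw [Finset.sum_comm]
  refine Finset.sum_congr rfl fun m hm => ?_
  rw [← sum_formProd_mul_lagrangePoly S q ((Finsupp.toMultiset m).map l), Finset.mul_sum]
  · exact Finset.sum_congr rfl fun k _ => by ring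
  · rw [Multiset.card_map, Finsupp.card_toMultiset]
    exact (MvPolynomial.le_totalDegree hm).trans hP
  · rw [← Finset.mul_sum, hw, mul_one]

lemma lagrangePoly_node_self {V : Type*} [DecidableEq V] (S : Finset V) (k : V → ℕ) :
    lagrangePoly S k (fun v => (k v : ℝ)) = 1 :=
  Finset.prod_eq_one fun _ _ => lagrangeFactor_self _

/-- Of two different indices with the same total, `k` exceeds `k'` at some vertex, and the factor of
that vertex vanishes. -/
lemma lagrangePoly_node_of_ne {V : Type*} [DecidableEq V] {S : Finset V} {q : ℕ} {k k' : V → ℕ}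
    (hk : k ∈ S.piAntidiag q) (hk' : k' ∈ S.piAntidiag q) (h : k ≠ k') :
    lagrangePoly S k (fun v => (k' v : ℝ)) = 0 := by
  obtain ⟨v, hv, hlt⟩ : ∃ v ∈ S, k' v < k v := by
    by_contra! hcon
    rw [Finset.mem_piAntidiag] at hk hk'
    have he := (Finset.sum_eq_sum_iff_of_le hcon).1 (hk.1.trans hk'.1.symm)
    refine h (funext fun v => ?_)
    by_cases hvS : v ∈ S
    · exact he v hvS
    · have h1 : k v = 0 := by by_contra h; exact hvS (hk.2 v h)
      have h2 : k' v = 0 := by by_contra h; exact hvS (hk'.2 v h)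
      rw [h1, h2]
  exact Finset.prod_eq_zero hv (lagrangeFactor_of_lt hlt)

/-! ### Lipschitz bounds -/

lemma abs_prod_sub_prod_le {α : Type*} (s : Finset α) {a b : α → ℝ} {B ε : ℝ} (hB : 1 ≤ B)
    (ha : ∀ i ∈ s, |a i| ≤ B) (hb : ∀ i ∈ s, |b i| ≤ B) (hε : ∀ i ∈ s, |a i - b i| ≤ ε) :
    |∏ i ∈ s, a i - ∏ i ∈ s, b i| ≤ s.card * B ^ s.card * ε ∧ |∏ i ∈ s, a i| ≤ B ^ s.card ∧
      |∏ i ∈ s, b i| ≤ B ^ s.card := by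
  classical
  induction s using Finset.induction_on with
  | empty => simp
  | insert i s hi ih =>
    obtain ⟨h1, h2, h3⟩ := ih (fun j hj => ha j (Finset.mem_insert_of_mem hj))
      (fun j hj => hb j (Finset.mem_insert_of_mem hj))
      (fun j hj => hε j (Finset.mem_insert_of_mem hj))
    have ha' := ha i (Finset.mem_insert_self _ _)
    have hb' := hb i (Finset.mem_insert_self _ _)
    have hε' := hε i (Finset.mem_insert_self _ _)
    have hε0 : 0 ≤ ε := (abs_nonneg _).trans hε'
    rw [Finset.prod_insert hi, Finset.prod_insert hi, Finset.card_insert_of_notMem hi]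
    have hBs : 0 ≤ B ^ s.card := by positivity
    refine ⟨?_, ?_, ?_⟩
    · have e : a i * ∏ j ∈ s, a j - b i * ∏ j ∈ s, b j =
          a i * (∏ j ∈ s, a j - ∏ j ∈ s, b j) + (a i - b i) * ∏ j ∈ s, b j := by ring
      rw [e]
      refine (abs_add_le _ _).trans ?_
      rw [abs_mul, abs_mul]
      have e1 : |a i| * |∏ j ∈ s, a j - ∏ j ∈ s, b j| ≤ B * (s.card * B ^ s.card * ε) :=
        mul_le_mul ha' h1 (abs_nonneg _) (by linarith)
      have e2 : |a i - b i| * |∏ j ∈ s, b j| ≤ ε * B ^ s.card :=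
        mul_le_mul hε' h3 (abs_nonneg _) hε0
      have e3 : ε * B ^ s.card ≤ B * (B ^ s.card * ε) := by
        have : 0 ≤ B ^ s.card * ε := by positivity
        nlinarith
      push_cast
      rw [pow_succ]
      nlinarith
    · rw [abs_mul, pow_succ, mul_comm]
      exact mul_le_mul h2 ha' (abs_nonneg _) hBs
    · rw [abs_mul, pow_succ, mul_comm]
      exact mul_le_mul h3 hb' (abs_nonneg _) hBs

/-- The Lagrange polynomials are bounded and Lipschitz in the barycentric coordinates. -/
lemma abs_lagrangePoly_sub_le {V : Type*} [DecidableEq V] {S : Finset V} {q : ℕ} (hq : 1 ≤ q)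
    {k : V → ℕ} (hk : k ∈ S.piAntidiag q) {w w' : V → ℝ} {ε : ℝ}
    (hw : ∀ v ∈ S, w v ∈ Icc (0 : ℝ) 1) (hw' : ∀ v ∈ S, w' v ∈ Icc (0 : ℝ) 1)
    (hε : ∀ v ∈ S, |w v - w' v| ≤ ε) :
    |lagrangePoly S k (fun v => q * w v) - lagrangePoly S k (fun v => q * w' v)| ≤
      q * (q : ℝ) ^ q * (q * ε) := by
  have hq' : (1 : ℝ) ≤ q := by exact_mod_cast hq
  rw [Finset.mem_piAntidiag] at hk
  have hkv : ∀ v ∈ S, k v ≤ q := fun v hv => by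
    rw [← hk.1]; exact Finset.single_le_sum (f := k) (fun _ _ => Nat.zero_le _) hv
  unfold lagrangePoly lagrangeFactor
  -- As one product it has exactly `∑ k v = q` factors, each bounded by `q`.
  rw [Finset.prod_sigma', Finset.prod_sigma']
  have hcard : (S.sigma fun v => Finset.range (k v)).card = q := by
    rw [Finset.card_sigma]; simp only [Finset.card_range]; exact hk.1
  have hden : ∀ x ∈ S.sigma fun v => Finset.range (k v), (1 : ℝ) ≤ (k x.1 : ℝ) - x.2 :=
    fun x hx => by
      have := Finset.mem_range.1 (Finset.mem_sigma.1 hx).2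
      have : (x.2 : ℝ) + 1 ≤ k x.1 := by exact_mod_cast this
      linarith
  have hb : ∀ (u : V → ℝ), (∀ v ∈ S, u v ∈ Icc (0 : ℝ) 1) →
      ∀ x ∈ S.sigma fun v => Finset.range (k v), |(q * u x.1 - x.2) / (k x.1 - x.2)| ≤ q :=
    fun u hu x hx => by
      have h1 := hden x hx
      have h2 := hu x.1 (Finset.mem_sigma.1 hx).1
      have h3 : (k x.1 : ℝ) ≤ q := by exact_mod_cast hkv x.1 (Finset.mem_sigma.1 hx).1
      have h4 : (0 : ℝ) ≤ (x.2 : ℝ) := by positivity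
      rw [abs_div, abs_of_pos (by linarith : (0 : ℝ) < k x.1 - x.2)]
      refine (div_le_self (abs_nonneg _) h1).trans ?_
      rw [abs_le]
      constructor
      · nlinarith [h2.1]
      · nlinarith [h2.2]
  have := (abs_prod_sub_prod_le (S.sigma fun v => Finset.range (k v))
    (a := fun x => (q * w x.1 - x.2) / (k x.1 - x.2))
    (b := fun x => (q * w' x.1 - x.2) / (k x.1 - x.2)) (ε := q * ε) hq' (hb w hw) (hb w' hw')
    (fun x hx => by
      have h1 := hden x hx
      rw [← sub_div, abs_div, abs_of_pos (by linarith : (0 : ℝ) < k x.1 - x.2)]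
      refine (div_le_self (abs_nonneg _) h1).trans ?_
      rw [sub_sub_sub_cancel_right, ← mul_sub, abs_mul, Nat.abs_cast]
      exact mul_le_mul_of_nonneg_left (hε x.1 (Finset.mem_sigma.1 hx).1) (by linarith))).1
  rwa [hcard] at this

/-! ### Barycentric coordinates -/

/-- `T` is the vertex set of a nondegenerate `d`-simplex. -/
def IsSimplex {d : ℕ} (T : Finset (E d)) : Prop :=
  T.card = d + 1 ∧ AffineIndependent ℝ ((↑) : T → E d)

/-- The vertices of a simplex as an affine basis. -/
def IsSimplex.basis {d : ℕ} {T : Finset (E d)} (hT : IsSimplex T) : AffineBasis T ℝ (E d) :=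
  ⟨(↑), hT.2, (hT.2.affineSpan_eq_top_iff_card_eq_finrank_add_one).2 (by simp [hT.1])⟩

open Classical in
/-- The barycentric coordinate of the vertex `v` of `T`; it vanishes if `v ∉ T`. -/
def bary {d : ℕ} (T : Finset (E d)) (v : E d) : E d →ᵃ[ℝ] ℝ :=
  if h : IsSimplex T ∧ v ∈ T then h.1.basis.coord ⟨v, h.2⟩ else 0

section
variable {d : ℕ} {T : Finset (E d)}

lemma bary_of_notMem {v : E d} (hv : v ∉ T) (x : E d) : bary T v x = 0 := by simp [bary, hv]

lemma IsSimplex.bary_coe (hT : IsSimplex T) (v : T) : bary T v = hT.basis.coord v := by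
  simp [bary, hT]

lemma IsSimplex.sum_bary (hT : IsSimplex T) (x : E d) : ∑ v ∈ T, bary T v x = 1 := by
  rw [← Finset.sum_coe_sort]
  simp_rw [hT.bary_coe]
  exact hT.basis.sum_coord_apply_eq_one x

lemma IsSimplex.baryPoint_bary (hT : IsSimplex T) (x : E d) :
    baryPoint T (fun v => bary T v x) = x := by
  rw [baryPoint, ← Finset.sum_coe_sort T (fun v => bary T v x • v)]
  simp_rw [hT.bary_coe]
  exact hT.basis.linear_combination_coord_eq_self x

lemma IsSimplex.bary_baryPoint (hT : IsSimplex T) {w : E d → ℝ} (hw : ∑ v ∈ T, w v = 1) {v : E d}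
    (hv : v ∈ T) : bary T v (baryPoint T w) = w v := by
  have hw' : ∑ u : T, w u = 1 := by rwa [Finset.sum_coe_sort]
  have e : baryPoint T w =
      Finset.univ.affineCombination ℝ (hT.basis : T → E d) (fun u : T => w u) := by
    rw [Finset.affineCombination_eq_linear_combination _ _ _ hw', baryPoint,
      ← Finset.sum_coe_sort T (fun v => w v • v)]
    rfl
  rw [hT.bary_coe ⟨v, hv⟩, e, hT.basis.coord_apply_combination_of_mem (Finset.mem_univ _) hw']

lemma baryPoint_subset {S : Finset (E d)} (hST : S ⊆ T) {w : E d → ℝ} (hw : ∀ v ∉ S, w v = 0) :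
    baryPoint T w = baryPoint S w :=
  (Finset.sum_subset hST fun _ _ hv => by rw [hw _ hv, zero_smul]).symm

lemma baryPoint_mem_convexHull {S : Finset (E d)} {w : E d → ℝ} (h0 : ∀ v ∈ S, 0 ≤ w v)
    (h1 : ∑ v ∈ S, w v = 1) : baryPoint S w ∈ cell S :=
  (convex_convexHull ℝ _).sum_mem h0 h1 fun _ hv => subset_convexHull ℝ _ hv

/-- Faces in terms of barycentric coordinates. -/
lemma IsSimplex.mem_face_iff (hT : IsSimplex T) {S : Finset (E d)} (hST : S ⊆ T) {x : E d} :
    x ∈ cell S ↔ (∀ v ∈ T, 0 ≤ bary T v x) ∧ ∀ v ∉ S, bary T v x = 0 := by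
  classical
  constructor
  · intro hx
    obtain ⟨w, h0, h1, rfl⟩ := Finset.mem_convexHull'.1 hx
    set w' : E d → ℝ := fun v => if v ∈ S then w v else 0 with hw'
    have e1 : ∑ v ∈ T, w' v = 1 := by
      rw [← h1, ← Finset.sum_subset hST fun v _ hv => by simp [hw', hv]]
      exact Finset.sum_congr rfl fun v hv => by simp [hw', hv]
    have e2 : ∑ v ∈ S, w v • v = baryPoint T w' := by
      rw [baryPoint_subset hST (by simp +contextual [hw'])]
      exact Finset.sum_congr rfl fun v hv => by simp [hw', hv]
    rw [e2]
    refine ⟨fun v hv => ?_, fun v hv => ?_⟩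
    · rw [hT.bary_baryPoint e1 hv]
      by_cases h : v ∈ S
      · simpa [hw', h] using h0 v h
      · simp [hw', h]
    · by_cases h : v ∈ T
      · rw [hT.bary_baryPoint e1 h]; simp [hw', hv]
      · exact bary_of_notMem h _
  · rintro ⟨h0, h1⟩
    have e := hT.baryPoint_bary x
    rw [baryPoint_subset hST h1] at e
    rw [← e]
    refine baryPoint_mem_convexHull (fun v hv => h0 v (hST hv)) ?_
    rw [Finset.sum_subset hST fun v _ hv => h1 v hv, hT.sum_bary]

lemma IsSimplex.mem_cell_iff (hT : IsSimplex T) {x : E d} :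
    x ∈ cell T ↔ ∀ v ∈ T, 0 ≤ bary T v x :=
  (hT.mem_face_iff subset_rfl).trans (and_iff_left fun _ hv => bary_of_notMem hv x)

lemma IsSimplex.bary_nonneg (hT : IsSimplex T) {x : E d} (hx : x ∈ cell T) (v : E d) :
    0 ≤ bary T v x := by
  by_cases hv : v ∈ T
  · exact hT.mem_cell_iff.1 hx v hv
  · rw [bary_of_notMem hv]

lemma IsSimplex.bary_le_one (hT : IsSimplex T) {x : E d} (hx : x ∈ cell T) (v : E d) :
    bary T v x ≤ 1 := by
  by_cases hv : v ∈ T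
  · rw [← hT.sum_bary x]
    exact Finset.single_le_sum (f := fun v => bary T v x) (fun u _ => hT.bary_nonneg hx u) hv
  · rw [bary_of_notMem hv]; exact zero_le_one

lemma IsSimplex.bary_self (hT : IsSimplex T) {v : E d} (hv : v ∈ T) : bary T v v = 1 := by
  rw [hT.bary_coe ⟨v, hv⟩]
  exact hT.basis.coord_apply_eq ⟨v, hv⟩

lemma IsSimplex.bary_of_ne (hT : IsSimplex T) {v u : E d} (hu : u ∈ T) (h : v ≠ u) :
    bary T v u = 0 := by
  by_cases hv : v ∈ T
  · rw [hT.bary_coe ⟨v, hv⟩]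
    exact hT.basis.coord_apply_ne (i := ⟨v, hv⟩) (j := ⟨u, hu⟩) fun e => h (congrArg Subtype.val e)
  · exact bary_of_notMem hv u

/-- The interior of a simplex in terms of barycentric coordinates. -/
lemma IsSimplex.interior_cell (hT : IsSimplex T) :
    interior (cell T) = {x | ∀ v ∈ T, 0 < bary T v x} := by
  have h := hT.basis.interior_convexHull
  have e : range hT.basis = (T : Set (E d)) := by
    change range ((↑) : T → E d) = _
    exact Subtype.range_coe
  rw [e] at h
  rw [h]
  ext x
  simp only [mem_ofPred_eq, Subtype.forall, ← hT.bary_coe]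

lemma IsSimplex.interior_cell_nonempty (hT : IsSimplex T) : (interior (cell T)).Nonempty := by
  refine ⟨baryPoint T (fun _ => ((T.card : ℝ))⁻¹), ?_⟩
  have hc : (0 : ℝ) < T.card := by rw [hT.1]; positivity
  have e : ∑ _v ∈ T, ((T.card : ℝ))⁻¹ = 1 := by
    rw [Finset.sum_const, nsmul_eq_mul, mul_inv_cancel₀ hc.ne']
  rw [hT.interior_cell]
  intro v hv
  rw [hT.bary_baryPoint e hv]
  positivity

lemma isCompact_cell (T : Finset (E d)) : IsCompact (cell T) :=
  Set.Finite.isCompact_convexHull (𝕜 := ℝ) T.finite_toSet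

lemma isClosed_cell (T : Finset (E d)) : IsClosed (cell T) := (isCompact_cell T).isClosed

lemma measurableSet_cell (T : Finset (E d)) : MeasurableSet (cell T) := (isClosed_cell T).measurableSet

lemma dist_le_diam_cell {x y : E d} (hx : x ∈ cell T) (hy : y ∈ cell T) :
    dist x y ≤ Metric.diam (cell T) :=
  Metric.dist_le_diam_of_mem (isCompact_cell T).isBounded hx hy

lemma IsSimplex.volume_pos (hT : IsSimplex T) : 0 < volume.real (cell T) := by
  have h1 : 0 < volume (cell T) :=
    (isOpen_interior.measure_pos _ hT.interior_cell_nonempty).trans_le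
      (measure_mono interior_subset)
  exact ENNReal.toReal_pos h1.ne' (isCompact_cell T).measure_lt_top.ne

/-! ### Shape regularity -/

/-- A set inside a slab and a ball has small volume. -/
lemma volume_slab_le (hd : 1 ≤ d) {A : Set (E d)} {g p : E d} {h : ℝ} (hh : 0 ≤ h)
    (hg : ‖g‖ = 1) {a b : ℝ} (hab : a ≤ b) (hslab : ∀ x ∈ A, inner ℝ g x ∈ Icc a b)
    (hball : ∀ x ∈ A, dist x p ≤ h) :
    volume A ≤ ENNReal.ofReal ((b - a) * (2 * h) ^ (d - 1)) := by
  obtain ⟨m, rfl⟩ : ∃ m, d = m + 1 := ⟨d - 1, by omega⟩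
  -- In an orthonormal basis that starts with `g`, the slab and the ball give a box with one short
  -- edge.
  obtain ⟨B, hB⟩ := Orthonormal.exists_orthonormalBasis_extension_of_card_eq (𝕜 := ℝ)
    (E := E (m + 1)) (ι := Fin (m + 1)) (by simp) (v := fun _ => g) (s := {0}) (by
      rw [orthonormal_subsingleton_iff]
      intro i; simpa using hg)
  have hB0 : B 0 = g := hB 0 rfl
  set lo : Fin (m + 1) → ℝ := fun i => if i = 0 then a else inner ℝ (B i) p - h
  set hi : Fin (m + 1) → ℝ := fun i => if i = 0 then b else inner ℝ (B i) p + h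
  have hsub : A ⊆ (fun x => WithLp.ofLp (B.repr x)) ⁻¹' Icc lo hi := by
    intro x hx
    rw [mem_preimage, mem_Icc]
    have key : ∀ i, lo i ≤ WithLp.ofLp (B.repr x) i ∧ WithLp.ofLp (B.repr x) i ≤ hi i := by
      intro i
      have e : WithLp.ofLp (B.repr x) i = inner ℝ (B i) x := B.repr_apply_apply x i
      rw [e]
      by_cases h0 : i = 0
      · subst h0
        simp only [lo, hi, if_true, hB0]
        exact hslab x hx
      · simp only [lo, hi, if_neg h0]
        have h1 : |inner ℝ (B i) x - inner ℝ (B i) p| ≤ h := by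
          rw [← inner_sub_right]
          refine (abs_real_inner_le_norm _ _).trans ?_
          rw [B.norm_eq_one, one_mul, ← dist_eq_norm]
          exact hball x hx
        rw [abs_le] at h1
        constructor <;> linarith [h1.1, h1.2]
    exact ⟨fun i => (key i).1, fun i => (key i).2⟩
  refine (measure_mono hsub).trans ?_
  have hmp : MeasurePreserving (fun x => WithLp.ofLp (B.repr x)) (volume : Measure (E (m + 1)))
      (volume : Measure (Fin (m + 1) → ℝ)) :=
    (PiLp.volume_preserving_ofLp (Fin (m + 1))).comp B.measurePreserving_repr
  rw [hmp.measure_preimage measurableSet_Icc.nullMeasurableSet, Real.volume_Icc_pi,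
    ← ENNReal.ofReal_prod_of_nonneg]
  · refine ENNReal.ofReal_le_ofReal (le_of_eq ?_)
    rw [Fin.prod_univ_succ]
    have : ∀ i : Fin m, hi i.succ - lo i.succ = 2 * h := fun i => by
      simp only [lo, hi, Fin.succ_ne_zero, if_false]; ring
    rw [Finset.prod_congr rfl fun i _ => this i]
    simp [lo, hi]
  · intro i _
    by_cases h0 : i = 0
    · simp only [lo, hi, if_pos h0]; linarith
    · simp only [lo, hi, if_neg h0]; linarith

/-- `κ`-shape regularity of a single simplex. -/
def IsRegularSimplex (κ : ℝ) (T : Finset (E d)) : Prop :=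
  IsSimplex T ∧ Metric.diam (cell T) ^ d ≤ κ * volume.real (cell T)

lemma IsSimplex.diam_pos (hd : 1 ≤ d) (hT : IsSimplex T) : 0 < Metric.diam (cell T) := by
  have h2 : 1 < T.card := by rw [hT.1]; omega
  obtain ⟨u, hu, v, hv, huv⟩ := Finset.one_lt_card.1 h2
  exact (dist_pos.2 huv).trans_le
    (dist_le_diam_cell (subset_convexHull ℝ _ hu) (subset_convexHull ℝ _ hv))

/-- The barycentric coordinates of a regular simplex have small gradients. -/
lemma IsRegularSimplex.abs_bary_sub_le (hd : 1 ≤ d) {κ : ℝ} (hT : IsRegularSimplex κ T)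
    (v x y : E d) :
    |bary T v x - bary T v y| ≤ 2 ^ (d - 1) * κ / Metric.diam (cell T) * dist x y := by
  have hdiam := hT.1.diam_pos hd
  have hvol := hT.1.volume_pos
  have hκ : 0 ≤ κ := by
    by_contra hκ
    have := hT.2
    have h2 : κ * volume.real (cell T) < 0 := mul_neg_of_neg_of_pos (not_le.1 hκ) hvol
    have : 0 ≤ Metric.diam (cell T) ^ d := by positivity
    linarith
  obtain ⟨g, hg⟩ : ∃ g : E d, ∀ x y, bary T v x - bary T v y = inner ℝ g (x - y) := by
    refine ⟨(InnerProductSpace.toDual ℝ (E d)).symm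
      (LinearMap.toContinuousLinearMap (bary T v).linear), fun x y => ?_⟩
    rw [InnerProductSpace.toDual_symm_apply]
    have := (bary T v).linearMap_vsub x y
    simpa using this.symm
  have hgn : ‖g‖ ≤ 2 ^ (d - 1) * κ / Metric.diam (cell T) := by
    rcases eq_or_ne g 0 with rfl | hg0
    · rw [norm_zero]; positivity
    have hgpos : 0 < ‖g‖ := norm_pos_iff.2 hg0
    obtain ⟨p, hp⟩ : (cell T).Nonempty := hT.1.interior_cell_nonempty.mono interior_subset
    have hb := hT.1.bary_nonneg hp v
    -- The coordinate stays in `[0, 1]` on `T`, so `T` lies in a slab of width `1 / ‖g‖` orthogonal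
    -- to its gradient `g`. A large gradient would make `T` too thin for its regularity.
    have key := volume_slab_le (A := cell T) (g := (‖g‖)⁻¹ • g) (p := p)
      (h := Metric.diam (cell T)) hd hdiam.le (by rw [norm_smul, norm_inv, norm_norm]; field_simp)
      (a := ‖g‖⁻¹ * (inner ℝ g p - bary T v p)) (b := ‖g‖⁻¹ * (inner ℝ g p - bary T v p + 1))
      (by gcongr; linarith) (by
        intro z hz
        have e1 := hg z p
        have e2 := hT.1.bary_nonneg hz v
        have e3 := hT.1.bary_le_one hz v
        rw [inner_sub_right] at e1
        rw [real_inner_smul_left, mem_Icc]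
        constructor <;> gcongr <;> linarith) (fun z hz => dist_le_diam_cell hz hp)
    have key2 : volume.real (cell T) ≤ ‖g‖⁻¹ * (2 * Metric.diam (cell T)) ^ (d - 1) := by
      refine ENNReal.toReal_le_of_le_ofReal (by positivity) (key.trans (le_of_eq ?_))
      congr 1; ring
    have key3 : Metric.diam (cell T) ^ d ≤
        κ * (‖g‖⁻¹ * (2 * Metric.diam (cell T)) ^ (d - 1)) :=
      hT.2.trans (mul_le_mul_of_nonneg_left key2 hκ)
    obtain ⟨m, rfl⟩ : ∃ m, d = m + 1 := ⟨d - 1, by omega⟩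
    rw [Nat.add_sub_cancel] at *
    rw [le_div_iff₀ hdiam]
    rw [mul_pow, pow_succ] at key3
    have h4 : Metric.diam (cell T) ≤ κ * (‖g‖⁻¹ * 2 ^ m) := by
      have hp : 0 < Metric.diam (cell T) ^ m := by positivity
      refine le_of_mul_le_mul_left ?_ hp
      calc _ ≤ _ := key3
        _ = _ := by ring
    calc ‖g‖ * Metric.diam (cell T) ≤ ‖g‖ * (κ * (‖g‖⁻¹ * 2 ^ m)) := by gcongr
      _ = 2 ^ m * κ := by field_simp
  rw [hg]
  refine (abs_real_inner_le_norm _ _).trans ?_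
  rw [dist_eq_norm]
  gcongr

/-- The vertices of a regular simplex are well separated. -/
lemma IsRegularSimplex.diam_le_dist (hd : 1 ≤ d) {κ : ℝ} (hT : IsRegularSimplex κ T) {u v : E d}
    (hu : u ∈ T) (hv : v ∈ T) (huv : u ≠ v) :
    Metric.diam (cell T) ≤ 2 ^ (d - 1) * κ * dist u v := by
  have h := hT.abs_bary_sub_le hd u u v
  rw [hT.1.bary_self hu, hT.1.bary_of_ne hv huv, sub_zero, abs_one, div_mul_eq_mul_div,
    le_div_iff₀ (hT.1.diam_pos hd), one_mul] at h
  exact h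

end

/-! ### Conforming meshes and their behaviour at the boundary -/

/-! ### Conforming meshes -/

section
variable {d : ℕ} {Ω₀ : Set (E d)} {𝓣 : Finset (Finset (E d))}

lemma IsMesh.isSimplex (h : IsMesh Ω₀ 𝓣) {T : Finset (E d)} (hT : T ∈ 𝓣) : IsSimplex T :=
  ⟨h.card_eq T hT, h.affineIndependent T hT⟩

/-- Barycentric coordinates of neighbouring elements agree on their intersection. -/
lemma IsMesh.bary_eq (h : IsMesh Ω₀ 𝓣) {T T' : Finset (E d)} (hT : T ∈ 𝓣) (hT' : T' ∈ 𝓣)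
    {x : E d} (hx : x ∈ cell T) (hx' : x ∈ cell T') (v : E d) : bary T v x = bary T' v x := by
  classical
  have hS : x ∈ cell (T ∩ T') := by
    have : x ∈ cell T ∩ cell T' := ⟨hx, hx'⟩
    rwa [h.conforming T hT T' hT', ← Finset.coe_inter] at this
  have h0 := (((h.isSimplex hT).mem_face_iff Finset.inter_subset_left).1 hS).2
  by_cases hv : v ∈ T'
  · have e : x = baryPoint T' (fun v => bary T v x) := by
      rw [baryPoint_subset (Finset.inter_subset_right (s₁ := T)) h0,
        ← baryPoint_subset Finset.inter_subset_left h0, (h.isSimplex hT).baryPoint_bary]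
    have e1 : ∑ v ∈ T', bary T v x = 1 := by
      rw [← Finset.sum_subset (Finset.inter_subset_right (s₁ := T)) fun v _ hv => h0 v hv,
        Finset.sum_subset (Finset.inter_subset_left) fun v _ hv => h0 v hv,
        (h.isSimplex hT).sum_bary]
    have := (h.isSimplex hT').bary_baryPoint e1 hv
    rw [← e] at this
    exact this.symm
  · rw [bary_of_notMem hv, h0 v fun h => hv (Finset.mem_inter.1 h).2]

open Classical in
/-- Faces of elements intersect in the face spanned by the common vertices. -/
lemma IsMesh.mem_cell_inter (h : IsMesh Ω₀ 𝓣) {T T' S S' : Finset (E d)} (hT : T ∈ 𝓣)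
    (hT' : T' ∈ 𝓣) (hS : S ⊆ T) (hS' : S' ⊆ T') {x : E d} (hx : x ∈ cell S) (hx' : x ∈ cell S') :
    x ∈ cell (S ∩ S') := by
  have e1 := ((h.isSimplex hT).mem_face_iff hS).1 hx
  have e2 := ((h.isSimplex hT').mem_face_iff hS').1 hx'
  refine ((h.isSimplex hT).mem_face_iff (Finset.inter_subset_left.trans hS)).2
    ⟨e1.1, fun v hv => ?_⟩
  by_cases hvS : v ∈ S
  · rw [h.bary_eq hT hT' (convexHull_mono (by exact_mod_cast hS) hx)
      (convexHull_mono (by exact_mod_cast hS') hx')]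
    exact e2.2 v fun h => hv (Finset.mem_inter.2 ⟨hvS, h⟩)
  · exact e1.2 v hvS

lemma cell_mono {S T : Finset (E d)} (h : S ⊆ T) : cell S ⊆ cell T :=
  convexHull_mono (by exact_mod_cast h)

/-! ### Lagrange nodes -/

open Classical in
lemma mem_nodes {q : ℕ} {z : E d} : z ∈ nodes q 𝓣 ↔
    ∃ T ∈ 𝓣, ∃ k ∈ T.piAntidiag q, baryPoint T (fun v => (k v : ℝ) / q) = z := by
  simp [nodes, baryPoint]

open Classical in
lemma sum_node {S : Finset (E d)} {q : ℕ} (hq : 1 ≤ q) {k : E d → ℕ} (hk : k ∈ S.piAntidiag q) :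
    ∑ v ∈ S, (k v : ℝ) / q = 1 := by
  rw [← Finset.sum_div, ← Nat.cast_sum, (Finset.mem_piAntidiag.1 hk).1]
  exact div_self (by positivity)

open Classical in
lemma node_mem_cell {S : Finset (E d)} {q : ℕ} (hq : 1 ≤ q) {k : E d → ℕ}
    (hk : k ∈ S.piAntidiag q) : baryPoint S (fun v => (k v : ℝ) / q) ∈ cell S :=
  baryPoint_mem_convexHull (fun v _ => by positivity) (sum_node hq hk)

open Classical in
lemma piAntidiag_subset {S T : Finset (E d)} (hST : S ⊆ T) {q : ℕ} {k : E d → ℕ}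
    (hk : k ∈ S.piAntidiag q) : k ∈ T.piAntidiag q := by
  rw [Finset.mem_piAntidiag] at *
  refine ⟨?_, fun v hv => hST (hk.2 v hv)⟩
  rw [← hk.1]
  exact (Finset.sum_subset hST fun v _ hv => by_contra fun h => hv (hk.2 v h)).symm

open Classical in
lemma baryPoint_node_subset {S T : Finset (E d)} (hST : S ⊆ T) {q : ℕ} {k : E d → ℕ}
    (hk : k ∈ S.piAntidiag q) :
    baryPoint T (fun v => (k v : ℝ) / q) = baryPoint S (fun v => (k v : ℝ) / q) :=
  baryPoint_subset hST fun v hv => by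
    have : k v = 0 := by_contra fun h => hv ((Finset.mem_piAntidiag.1 hk).2 v h)
    simp [this]

open Classical in
lemma IsSimplex.bary_node {T : Finset (E d)} (hT : IsSimplex T) {q : ℕ} (hq : 1 ≤ q)
    {k : E d → ℕ} (hk : k ∈ T.piAntidiag q) (v : E d) :
    bary T v (baryPoint T (fun v => (k v : ℝ) / q)) = k v / q := by
  by_cases hv : v ∈ T
  · exact hT.bary_baryPoint (sum_node hq hk) hv
  · have : k v = 0 := by_contra fun h => hv ((Finset.mem_piAntidiag.1 hk).2 v h)
    rw [bary_of_notMem hv, this]; simp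

open Classical in
lemma node_mem_nodes {S T : Finset (E d)} (hT : T ∈ 𝓣) (hST : S ⊆ T) {q : ℕ} {k : E d → ℕ}
    (hk : k ∈ S.piAntidiag q) : baryPoint S (fun v => (k v : ℝ) / q) ∈ nodes q 𝓣 :=
  mem_nodes.2 ⟨T, hT, k, piAntidiag_subset hST hk, baryPoint_node_subset hST hk⟩

open Classical in
/-- A Lagrange node that lies in an element is one of the nodes of this element. -/
lemma IsMesh.exists_piAntidiag (h : IsMesh Ω₀ 𝓣) {q : ℕ} (hq : 1 ≤ q) {z : E d}
    (hz : z ∈ nodes q 𝓣) {T S : Finset (E d)} (hT : T ∈ 𝓣) (hST : S ⊆ T) (hzS : z ∈ cell S) :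
    ∃ k ∈ S.piAntidiag q, baryPoint S (fun v => (k v : ℝ) / q) = z := by
  obtain ⟨T', hT', k, hk, rfl⟩ := mem_nodes.1 hz
  set z := baryPoint T' (fun v => (k v : ℝ) / q) with hzdef
  have hb : ∀ v, bary T v z = k v / q := fun v => by
    rw [h.bary_eq hT hT' (cell_mono hST hzS) (node_mem_cell hq hk),
      (h.isSimplex hT').bary_node hq hk]
  have h0 := (((h.isSimplex hT).mem_face_iff hST).1 hzS).2
  have hq' : (q : ℝ) ≠ 0 := by positivity
  have hsupp : ∀ v, k v ≠ 0 → v ∈ S := fun v hv => by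
    by_contra hvS
    have := h0 v hvS
    rw [hb, div_eq_zero_iff, Nat.cast_eq_zero] at this
    exact this.elim hv hq'
  have hkS : k ∈ S.piAntidiag q := by
    rw [Finset.mem_piAntidiag]
    refine ⟨?_, hsupp⟩
    have e := (h.isSimplex hT).sum_bary z
    simp_rw [hb] at e
    rw [← Finset.sum_div, div_eq_one_iff_eq hq', ← Nat.cast_sum, Nat.cast_inj] at e
    rw [← e]
    exact Finset.sum_subset hST fun v _ hv => by_contra fun h => hv (hsupp v h)
  refine ⟨k, hkS, ?_⟩
  rw [← baryPoint_node_subset hST hkS]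
  conv_rhs => rw [← (h.isSimplex hT).baryPoint_bary z]
  congr 1
  funext v
  exact (hb v).symm

/-! ### Piecewise polynomials -/

lemma exists_affine_poly (f : E d →ᵃ[ℝ] ℝ) : ∃ P : MvPolynomial (Fin d) ℝ, P.totalDegree ≤ 1 ∧
    ∀ x : E d, MvPolynomial.eval (fun i => x i) P = f x := by
  refine ⟨∑ i, MvPolynomial.C (f.linear (EuclideanSpace.single i 1)) * MvPolynomial.X i +
    MvPolynomial.C (f 0), ?_, fun x => ?_⟩
  · refine (MvPolynomial.totalDegree_add _ _).trans (max_le ?_ (by simp))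
    refine MvPolynomial.totalDegree_finsetSum_le fun i _ => ?_
    refine (MvPolynomial.totalDegree_mul _ _).trans ?_
    simp
  · have e : f x = f.linear x + f 0 := by
      have := f.map_vadd 0 x
      simpa using this
    rw [e]
    have e2 : x = ∑ i, x i • EuclideanSpace.single i (1 : ℝ) := by
      ext j; simp [Pi.single_apply]
    conv_rhs => rw [e2, map_sum]
    simp [mul_comm]

lemma exists_lagrangePoly (T : Finset (E d)) (k : E d → ℕ) (q : ℕ) :
    ∃ P : MvPolynomial (Fin d) ℝ, P.totalDegree ≤ ∑ v ∈ T, k v ∧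
    ∀ x : E d, MvPolynomial.eval (fun i => x i) P = lagrangePoly T k (fun v => q * bary T v x) := by
  choose A hA hA' using fun v => exists_affine_poly (bary T v)
  refine ⟨∏ v ∈ T, ∏ j ∈ Finset.range (k v), MvPolynomial.C ((k v - j : ℝ)⁻¹) *
    (MvPolynomial.C (q : ℝ) * A v - MvPolynomial.C (j : ℝ)), ?_, fun x => ?_⟩
  · refine (MvPolynomial.totalDegree_finsetProd _ _).trans (Finset.sum_le_sum fun v _ => ?_)
    refine (MvPolynomial.totalDegree_finsetProd _ _).trans ?_
    refine (Finset.sum_le_card_nsmul _ _ 1 fun j _ => ?_).trans (by simp)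
    refine (MvPolynomial.totalDegree_mul _ _).trans ?_
    rw [MvPolynomial.totalDegree_C, zero_add]
    refine (MvPolynomial.totalDegree_sub _ _).trans
      (max_le ?_ ((MvPolynomial.totalDegree_C _).le.trans zero_le_one))
    refine (MvPolynomial.totalDegree_mul _ _).trans ?_
    rw [MvPolynomial.totalDegree_C, zero_add]
    exact hA v
  · rw [lagrangePoly, map_prod]
    refine Finset.prod_congr rfl fun v _ => ?_
    rw [lagrangeFactor, map_prod]
    refine Finset.prod_congr rfl fun j _ => ?_
    rw [map_mul, map_sub, map_mul, hA']
    simp only [MvPolynomial.eval_C]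
    rw [div_eq_inv_mul]

open Classical in
/-- Lagrange interpolation of a piecewise polynomial on a face of an element. -/
lemma IsFEM.eq_sum (h : IsMesh Ω₀ 𝓣) {q : ℕ} (hq : 1 ≤ q) {w : E d → ℝ} (hw : IsFEM q 𝓣 w)
    {S T : Finset (E d)} (hT : T ∈ 𝓣) (hST : S ⊆ T) {x : E d} (hx : x ∈ cell S) :
    w x = ∑ k ∈ S.piAntidiag q, w (baryPoint S (fun v => (k v : ℝ) / q)) *
      lagrangePoly S k (fun v => q * bary T v x) := by
  obtain ⟨P, hP, hPw⟩ := hw.1 T hT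
  have h0 := (((h.isSimplex hT).mem_face_iff hST).1 hx).2
  have e1 : ∑ v ∈ S, bary T v x = 1 := by
    rw [Finset.sum_subset hST fun v _ hv => h0 v hv, (h.isSimplex hT).sum_bary]
  have e2 : baryPoint S (fun v => bary T v x) = x := by
    rw [← baryPoint_subset hST h0, (h.isSimplex hT).baryPoint_bary]
  have e3 := eval_baryPoint S hq hP e1
  rw [e2] at e3
  rw [hPw x (cell_mono hST hx), e3]
  exact Finset.sum_congr rfl fun k hk => by rw [hPw _ (cell_mono hST (node_mem_cell hq hk))]

lemma IsPolyOn.add {q : ℕ} {S : Set (E d)} {v w : E d → ℝ} (hv : IsPolyOn q S v)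
    (hw : IsPolyOn q S w) : IsPolyOn q S (v + w) := by
  obtain ⟨P, hP, hP'⟩ := hv
  obtain ⟨Q, hQ, hQ'⟩ := hw
  exact ⟨P + Q, (MvPolynomial.totalDegree_add _ _).trans (max_le hP hQ), fun x hx => by
    rw [Pi.add_apply, hP' x hx, hQ' x hx, map_add]⟩

lemma IsPolyOn.smul {q : ℕ} {S : Set (E d)} {v : E d → ℝ} (hv : IsPolyOn q S v) (c : ℝ) :
    IsPolyOn q S (fun x => c * v x) := by
  obtain ⟨P, hP, hP'⟩ := hv
  exact ⟨MvPolynomial.C c * P, (MvPolynomial.totalDegree_mul _ _).trans (by simpa using hP),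
    fun x hx => by
      beta_reduce
      rw [hP' x hx, map_mul, MvPolynomial.eval_C]⟩

lemma IsFEM.sum {q : ℕ} {ι : Type*} (s : Finset ι) (c : ι → ℝ) {v : ι → E d → ℝ}
    (hv : ∀ i ∈ s, IsFEM q 𝓣 (v i)) : IsFEM q 𝓣 (fun x => ∑ i ∈ s, c i * v i x) := by
  classical
  induction s using Finset.induction_on with
  | empty => exact ⟨fun T _ => ⟨0, by simp, by simp⟩, by simp⟩
  | insert a s ha ih =>
    have h1 := ih fun i hi => hv i (Finset.mem_insert_of_mem hi)
    have h2 := hv a (Finset.mem_insert_self _ _)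
    simp_rw [Finset.sum_insert ha]
    exact ⟨fun T hT => ((h2.1 T hT).smul _).add (h1.1 T hT), fun x hx => by
      beta_reduce
      rw [h2.2 x hx, mul_zero, zero_add]; exact h1.2 x hx⟩

/-! ### The nodal basis -/

open Classical in
/-- The barycentric coordinates of a mesh, i.e. the hat functions. -/
def hat (𝓣 : Finset (Finset (E d))) (v x : E d) : ℝ :=
  if h : ∃ T ∈ 𝓣, x ∈ cell T then bary h.choose v x else 0

lemma IsMesh.hat_eq (h : IsMesh Ω₀ 𝓣) {T : Finset (E d)} (hT : T ∈ 𝓣) {x : E d} (hx : x ∈ cell T)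
    (v : E d) : hat 𝓣 v x = bary T v x := by
  have hex : ∃ T ∈ 𝓣, x ∈ cell T := ⟨T, hT, hx⟩
  rw [hat, dif_pos hex]
  exact h.bary_eq hex.choose_spec.1 hT hex.choose_spec.2 hx v

lemma lagrangePoly_subset {V : Type*} {S U : Finset V} (hSU : S ⊆ U) {k : V → ℕ} {t : V → ℝ}
    (hk : ∀ v ∈ U, v ∉ S → k v = 0) : lagrangePoly U k t = lagrangePoly S k t :=
  (Finset.prod_subset hSU fun v hv hvS => by rw [hk v hv hvS, lagrangeFactor_zero]).symm

lemma lagrangePoly_eq_zero {V : Type*} {S : Finset V} {k : V → ℕ} {t : V → ℝ} {v : V}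
    (hv : v ∈ S) (hk : k v ≠ 0) (ht : t v = 0) : lagrangePoly S k t = 0 :=
  Finset.prod_eq_zero hv (by rw [ht, lagrangeFactor_eq_zero hk])

-- One formula serves all elements: the Lagrange polynomial in the hat functions of all mesh
-- vertices, consistent by conformity. On an element that lacks a vertex in the support of `k` it
-- vanishes; on the others it has degree at most `∑ k v ≤ q`.
open Classical in
lemma IsMesh.exists_nodalBasis (h : IsMesh Ω₀ 𝓣) {q : ℕ} (hq : 1 ≤ q) {z : E d}
    (hz : z ∈ nodes q 𝓣) :
    ∃ v, IsFEM q 𝓣 v ∧ ∀ z' ∈ nodes q 𝓣, v z' = if z' = z then 1 else 0 := by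
  obtain ⟨T₀, hT₀, k, hk, rfl⟩ := mem_nodes.1 hz
  have hq' : (q : ℝ) ≠ 0 := by positivity
  set U : Finset (E d) := 𝓣.biUnion id with hU
  have hTU : ∀ T ∈ 𝓣, T ⊆ U := fun T hT => Finset.subset_biUnion_of_mem id hT
  set ζ : E d → ℝ := fun x =>
    if ∃ T ∈ 𝓣, x ∈ cell T then lagrangePoly U k (fun v => q * hat 𝓣 v x) else 0 with hζ
  have hζT : ∀ T ∈ 𝓣, ∀ x ∈ cell T, ζ x = lagrangePoly U k (fun v => q * bary T v x) := by
    intro T hT x hx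
    simp only [hζ]
    rw [if_pos ⟨T, hT, hx⟩]
    simp_rw [h.hat_eq hT hx]
  refine ⟨ζ, ⟨fun T hT => ?_, fun x hx => ?_⟩, fun z' hz' => ?_⟩
  · by_cases hkT : ∀ v ∈ U, v ∉ T → k v = 0
    · obtain ⟨P, hP, hP'⟩ := exists_lagrangePoly T k q
      refine ⟨P, hP.trans ?_, fun x hx => ?_⟩
      · calc ∑ v ∈ T, k v ≤ ∑ v ∈ U, k v := Finset.sum_le_sum_of_subset (hTU T hT)
          _ = ∑ v ∈ T₀, k v := (Finset.sum_subset (hTU T₀ hT₀) fun v _ hv => by_contra fun h =>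
              hv ((Finset.mem_piAntidiag.1 hk).2 v h)).symm
          _ ≤ q := (Finset.mem_piAntidiag.1 hk).1.le
      · rw [hζT T hT x hx, hP', lagrangePoly_subset (hTU T hT) hkT]
    · push Not at hkT
      obtain ⟨v, hvU, hvT, hkv⟩ := hkT
      refine ⟨0, by simp, fun x hx => ?_⟩
      rw [hζT T hT x hx, map_zero]
      exact lagrangePoly_eq_zero hvU hkv (by rw [bary_of_notMem hvT, mul_zero])
  · simp only [hζ]
    rw [if_neg]
    rintro ⟨T, hT, hxT⟩
    exact hx T hT hxT
  · obtain ⟨T', hT', k', hk', rfl⟩ := mem_nodes.1 hz'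
    have hkU := piAntidiag_subset (hTU _ hT₀) hk
    have hkU' := piAntidiag_subset (hTU _ hT') hk'
    have e : ζ (baryPoint T' fun v => (k' v : ℝ) / q) = lagrangePoly U k (fun v => (k' v : ℝ)) := by
      rw [hζT T' hT' _ (node_mem_cell hq hk')]
      simp_rw [(h.isSimplex hT').bary_node hq hk', mul_div_cancel₀ _ hq']
    rw [e]
    by_cases hkk : k' = k
    · subst hkk
      rw [if_pos, lagrangePoly_node_self]
      rw [← baryPoint_node_subset (hTU _ hT') hk', ← baryPoint_node_subset (hTU _ hT₀) hk]
    · rw [lagrangePoly_node_of_ne hkU hkU' (Ne.symm hkk), if_neg]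
      intro hzz
      apply hkk
      funext v
      have e1 := (h.isSimplex hT').bary_node hq hk' v
      have e2 := (h.isSimplex hT₀).bary_node hq hk v
      rw [hzz, h.bary_eq hT' hT₀ (hzz ▸ node_mem_cell hq hk') (node_mem_cell hq hk), e2] at e1
      field_simp at e1
      exact_mod_cast e1.symm

open Classical in
lemma IsMesh.nodalBasis_spec (h : IsMesh Ω₀ 𝓣) {q : ℕ} (hq : 1 ≤ q) {z : E d}
    (hz : z ∈ nodes q 𝓣) : IsFEM q 𝓣 (nodalBasis q 𝓣 z) ∧
      ∀ z' ∈ nodes q 𝓣, nodalBasis q 𝓣 z z' = if z' = z then 1 else 0 :=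
  Classical.epsilon_spec (h.exists_nodalBasis hq hz)

open Classical in
/-- The nodal basis functions on a face of an element. -/
lemma IsMesh.nodalBasis_eq (h : IsMesh Ω₀ 𝓣) {q : ℕ} (hq : 1 ≤ q) {S T : Finset (E d)}
    (hT : T ∈ 𝓣) (hST : S ⊆ T) {k : E d → ℕ} (hk : k ∈ S.piAntidiag q) {x : E d}
    (hx : x ∈ cell S) : nodalBasis q 𝓣 (baryPoint S (fun v => (k v : ℝ) / q)) x =
      lagrangePoly S k (fun v => q * bary T v x) := by
  obtain ⟨h1, h2⟩ := h.nodalBasis_spec hq (node_mem_nodes hT hST hk)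
  rw [h1.eq_sum h hq hT hST hx, Finset.sum_eq_single k]
  · rw [h2 _ (node_mem_nodes hT hST hk), if_pos rfl, one_mul]
  · intro k' hk' hne
    rw [h2 _ (node_mem_nodes hT hST hk'), if_neg, zero_mul]
    intro e
    apply hne
    funext v
    have e1 := (h.isSimplex hT).bary_node hq (piAntidiag_subset hST hk') v
    have e2 := (h.isSimplex hT).bary_node hq (piAntidiag_subset hST hk) v
    rw [baryPoint_node_subset hST hk', e, ← baryPoint_node_subset hST hk, e2] at e1
    have hq' : (q : ℝ) ≠ 0 := by positivity
    field_simp at e1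
    exact_mod_cast e1.symm
  · exact fun h => absurd hk h

end

/-! ### Lipschitz domains near the boundary -/

section
variable {d : ℕ} {Ω Ω₀ : Set (E d)}

lemma IsLipschitzDomain.disjoint_frontier (hΩ : IsLipschitzDomain Ω) {x : E d}
    (hx : x ∈ frontier Ω) : x ∉ Ω := by
  rw [hΩ.isOpen.frontier_eq] at hx; exact hx.2

lemma notMem_closure_of_below {x ν : E d} {γ : E d → ℝ} {L : ℝ≥0} {ρ : ℝ}
    (hγ : LipschitzWith L γ)
    (hgr : ∀ y ∈ Metric.ball x ρ, (y ∈ Ω ↔ γ y < inner ℝ ν y)) {y : E d}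
    (hy : y ∈ Metric.ball x ρ) (hlt : inner ℝ ν y < γ y) : y ∉ closure Ω := by
  intro hcl
  have hop : IsOpen (Metric.ball x ρ ∩ {y | inner ℝ ν y < γ y}) :=
    Metric.isOpen_ball.inter (isOpen_lt (by fun_prop) hγ.continuous)
  obtain ⟨w, hw, hwΩ⟩ := mem_closure_iff.1 hcl _ hop ⟨hy, hlt⟩
  exact lt_asymm hw.2 ((hgr w hw.1).1 hwΩ)

lemma le_of_mem_closure {x ν : E d} {γ : E d → ℝ} {L : ℝ≥0} {ρ : ℝ} (hγ : LipschitzWith L γ)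
    (hgr : ∀ y ∈ Metric.ball x ρ, (y ∈ Ω ↔ γ y < inner ℝ ν y)) {y : E d}
    (hy : y ∈ Metric.ball x ρ) (hcl : y ∈ closure Ω) : γ y ≤ inner ℝ ν y :=
  not_lt.1 fun h => notMem_closure_of_below hγ hgr hy h hcl

/-- Directly below the graph there are no points of the closure, so no boundary point is interior to
it. Membership in the domain can thus be verified by covering a neighbourhood with closed elements.
-/
lemma IsLipschitzDomain.interior_closure (hΩ : IsLipschitzDomain Ω) :
    interior (closure Ω) = Ω := by
  refine Subset.antisymm (fun x hx => ?_) hΩ.isOpen.subset_interior_closure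
  by_contra hxΩ
  have hxf : x ∈ frontier Ω := by
    rw [hΩ.isOpen.frontier_eq]; exact ⟨interior_subset hx, hxΩ⟩
  obtain ⟨ν, γ, L, ρ, hν, hρ, hL, hinv, hgr⟩ := hΩ.graph x hxf
  have hle : inner ℝ ν x ≤ γ x := not_lt.1 fun h => hxΩ ((hgr x (Metric.mem_ball_self hρ)).2 h)
  obtain ⟨ε, hε, hball⟩ := Metric.isOpen_iff.1 isOpen_interior x hx
  set t := min ε ρ / 2 with ht
  have ht0 : 0 < t := by have := lt_min hε hρ; positivity
  have htε : t < ε := by have := min_le_left ε ρ; linarith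
  have htρ : t < ρ := by have := min_le_right ε ρ; linarith
  have hdist : dist (x + (-t) • ν) x = t := by
    rw [dist_eq_norm, add_sub_cancel_left, norm_smul, hν, mul_one, norm_neg, Real.norm_of_nonneg ht0.le]
  refine notMem_closure_of_below hL hgr (y := x + (-t) • ν) (by rw [Metric.mem_ball, hdist]; exact htρ)
    ?_ (interior_subset (hball (by rw [Metric.mem_ball, hdist]; exact htε)))
  rw [hinv, inner_add_right, inner_smul_right, real_inner_self_eq_norm_sq, hν]
  linarith

lemma subset_of_disjoint_frontier (hΩ : IsOpen Ω) {P : Set (E d)} (hP : IsPreconnected P) {p : E d}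
    (hp : p ∈ P) (hpΩ : p ∈ Ω) (hdisj : ∀ y ∈ P, y ∉ frontier Ω) : P ⊆ Ω := by
  intro y hy
  by_contra hyΩ
  have hcase : ∀ w ∈ P, w ∉ Ω → w ∈ (closure Ω)ᶜ := fun w hw h hcl =>
    hdisj w hw (by rw [hΩ.frontier_eq]; exact ⟨hcl, h⟩)
  obtain ⟨w, -, hw1, hw2⟩ := hP Ω (closure Ω)ᶜ hΩ isClosed_closure.isOpen_compl
    (fun w hw => or_iff_not_imp_left.2 (hcase w hw)) ⟨p, hp, hpΩ⟩ ⟨y, hy, hcase y hy hyΩ⟩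
  exact hw2 (subset_closure hw1)

/-- If a Lipschitz domain `Ω₀` touches the boundary of `Ω ⊇ Ω₀` with its own boundary, the rest
of the boundary of `Ω₀` stays away from the boundary of `Ω`. -/
lemma isClosed_frontier_diff (hΩ : IsLipschitzDomain Ω) (hΩ₀ : IsLipschitzDomain Ω₀)
    (hsub : Ω₀ ⊆ Ω) (hfr : frontier Ω ⊆ frontier Ω₀) : IsClosed (frontier Ω₀ \ frontier Ω) := by
  rw [← isOpen_compl_iff, isOpen_iff_mem_nhds]
  intro x hx
  by_cases hxΓ : x ∈ frontier Ω
  swap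
  · have hx0 : x ∈ (frontier Ω₀)ᶜ := fun h => hx ⟨h, hxΓ⟩
    exact mem_of_superset (isClosed_frontier.isOpen_compl.mem_nhds hx0) fun y hy h => hy h.1
  have hx₀ := hfr hxΓ
  obtain ⟨ν, γ, L, ρ, hν, hρ, hL, hinv, hgr⟩ := hΩ₀.graph x hx₀
  have hxle : inner ℝ ν x ≤ γ x := not_lt.1 fun h =>
    hΩ₀.disjoint_frontier hx₀ ((hgr x (Metric.mem_ball_self hρ)).2 h)
  set ε : ℝ := ρ / (4 * (L + 1)) with hε
  have hε0 : 0 < ε := by positivity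
  have hLε : L * ε + ε = ρ / 4 := by rw [hε]; field_simp
  have hLε0 : 0 ≤ L * ε := by positivity
  -- Points strictly below the graph of `∂Ω₀` are outside the closure of `Ω₀`, hence not in `∂Ω ⊆
  -- ∂Ω₀`. Segments going down from the graph or from below it can meet `∂Ω` in their first point
  -- only.
  have hdown : ∀ y ∈ Metric.ball x ε, inner ℝ ν y ≤ γ y → ∀ t ∈ Ioc 0 (ρ / 2),
      y + (-t) • ν ∉ closure Ω₀ := by
    intro y hy hle t ht
    refine notMem_closure_of_below hL hgr ?_ ?_
    · rw [Metric.mem_ball]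
      calc dist (y + (-t) • ν) x ≤ dist (y + (-t) • ν) y + dist y x := dist_triangle _ _ _
        _ < t + ε := by
          refine add_lt_add_of_le_of_lt (le_of_eq ?_) hy
          rw [dist_eq_norm, add_sub_cancel_left, norm_smul, hν, mul_one, norm_neg,
            Real.norm_of_nonneg ht.1.le]
        _ ≤ ρ := by linarith [ht.2]
    · rw [hinv, inner_add_right, inner_smul_right, real_inner_self_eq_norm_sq, hν]
      linarith [ht.1]
  have hfr' : ∀ y, y ∉ closure Ω₀ → y ∉ frontier Ω := fun y hy h =>
    hy (frontier_subset_closure (hfr h))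
  have hbot : ∀ y ∈ Metric.ball (x + (-(ρ / 2)) • ν) ε, y ∉ frontier Ω := by
    intro y hy
    refine hfr' y (notMem_closure_of_below hL hgr ?_ ?_)
    · rw [Metric.mem_ball] at hy ⊢
      calc dist y x ≤ dist y (x + (-(ρ / 2)) • ν) + dist (x + (-(ρ / 2)) • ν) x :=
            dist_triangle _ _ _
        _ < ε + ρ / 2 := by
          refine add_lt_add_of_lt_of_le hy (le_of_eq ?_)
          rw [dist_eq_norm, add_sub_cancel_left, norm_smul, hν, mul_one, norm_neg,
            Real.norm_of_nonneg (by positivity)]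
        _ ≤ ρ := by linarith
    · have h1 := hL.dist_le_mul y (x + (-(ρ / 2)) • ν)
      rw [hinv, Real.dist_eq] at h1
      have h2 : |inner ℝ ν (y - (x + (-(ρ / 2)) • ν))| ≤ dist y (x + (-(ρ / 2)) • ν) := by
        refine (abs_real_inner_le_norm _ _).trans ?_
        rw [hν, one_mul, dist_eq_norm]
      rw [inner_sub_right, inner_add_right, inner_smul_right, real_inner_self_eq_norm_sq, hν] at h2
      rw [Metric.mem_ball] at hy
      have h3 : L * dist y (x + (-(ρ / 2)) • ν) ≤ L * ε := by gcongr
      have h4 := (abs_le.1 h1).1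
      have h5 := (abs_le.1 h2).2
      linarith
  have hseg : ∀ y, y ∈ Metric.ball x ε → inner ℝ ν y ≤ γ y →
      ∀ t ∈ Ioc (0 : ℝ) (ρ / 2), ∀ s ∈ Icc t (ρ / 2), y + (-s) • ν ∉ frontier Ω :=
    fun y hy hle t ht s hs => hfr' _ (hdown y hy hle s ⟨ht.1.trans_le hs.1, hs.2⟩)
  have hmem : ∀ y ∈ Metric.ball x ε, y + (-(ρ / 2)) • ν ∈ Metric.ball (x + (-(ρ / 2)) • ν) ε := by
    intro y hy
    rwa [Metric.mem_ball, dist_add_right]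
  have hpath : ∀ (y : E d) (a b : ℝ), IsPreconnected ((fun s : ℝ => y + (-s) • ν) '' Icc a b) :=
    fun y a b => isPreconnected_Icc.image _ (by fun_prop)
  -- A point `y` of `∂Ω₀ \ ∂Ω` near `x` belongs to `Ω`. The segment down from `y` puts the whole
  -- lower ball into `Ω`, and segments back up from there put all points near `x` into the closure
  -- of `Ω`. Then `x` would be interior to that closure, that is, a point of `Ω`.
  refine mem_of_superset (Metric.ball_mem_nhds x hε0) fun y hy hyd => ?_
  have hyΩ : y ∈ Ω := by
    have h1 : y ∈ closure Ω := closure_mono hsub (frontier_subset_closure hyd.1)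
    by_contra h2
    exact hyd.2 (by rw [hΩ.isOpen.frontier_eq]; exact ⟨h1, h2⟩)
  have hyx : y ∈ Metric.ball x ρ := Metric.ball_subset_ball (by linarith) hy
  have hyle : inner ℝ ν y ≤ γ y := not_lt.1 fun h =>
    hΩ₀.disjoint_frontier hyd.1 ((hgr y hyx).2 h)
  have hyend : y + (-(ρ / 2)) • ν ∈ Ω := by
    refine subset_of_disjoint_frontier hΩ.isOpen (hpath y 0 (ρ / 2)) (p := y)
      ⟨0, ⟨le_rfl, by positivity⟩, by simp⟩ hyΩ ?_ ⟨ρ / 2, ⟨by positivity, le_rfl⟩, rfl⟩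
    rintro _ ⟨s, hs, rfl⟩
    rcases hs.1.eq_or_lt with h0 | h0
    · rw [← h0]; simpa using hyd.2
    · exact hseg y hy hyle s ⟨h0, hs.2⟩ s ⟨le_rfl, hs.2⟩
  have hballΩ : Metric.ball (x + (-(ρ / 2)) • ν) ε ⊆ Ω :=
    subset_of_disjoint_frontier hΩ.isOpen (convex_ball _ _).isPreconnected (hmem y hy) hyend hbot
  have hcl : Metric.ball x ε ⊆ closure Ω := by
    intro p hp
    have hpx : p ∈ Metric.ball x ρ := Metric.ball_subset_ball (by linarith) hp
    by_cases hpΩ : γ p < inner ℝ ν p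
    · exact subset_closure (hsub ((hgr p hpx).2 hpΩ))
    have hple := not_lt.1 hpΩ
    rw [Metric.mem_closure_iff]
    intro δ hδ
    set t := min (δ / 2) (ρ / 2) with ht
    have ht0 : 0 < t := lt_min (by positivity) (by positivity)
    have htρ : t ≤ ρ / 2 := min_le_right _ _
    refine ⟨p + (-t) • ν, ?_, ?_⟩
    · refine subset_of_disjoint_frontier hΩ.isOpen (hpath p t (ρ / 2)) (p := p + (-(ρ / 2)) • ν)
        ⟨ρ / 2, ⟨htρ, le_rfl⟩, rfl⟩ (hballΩ (hmem p hp)) ?_ ⟨t, ⟨le_rfl, htρ⟩, rfl⟩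
      rintro _ ⟨s, hs, rfl⟩
      exact hseg p hp hple t ⟨ht0, htρ⟩ s hs
    · rw [dist_eq_norm, sub_add_cancel_left, norm_neg, norm_smul, hν, mul_one, norm_neg,
        Real.norm_of_nonneg ht0.le]
      have := min_le_left (δ / 2) (ρ / 2)
      linarith
  have : x ∈ interior (closure Ω) := mem_interior.2
    ⟨_, hcl, Metric.isOpen_ball, Metric.mem_ball_self hε0⟩
  rw [hΩ.interior_closure] at this
  exact hΩ.disjoint_frontier hxΓ this

/-- Nearby points of a Lipschitz domain can be joined locally. -/
lemma IsLipschitzDomain.exists_preconnected (hΩ : IsLipschitzDomain Ω) {z : E d}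
    (hz : z ∈ frontier Ω) {δ : ℝ} (hδ : 0 < δ) :
    ∃ ε > 0, ∀ a ∈ Ω ∩ Metric.ball z ε, ∀ b ∈ Ω ∩ Metric.ball z ε, ∃ P : Set (E d),
      IsPreconnected P ∧ a ∈ P ∧ b ∈ P ∧ P ⊆ Ω ∩ Metric.ball z δ := by
  obtain ⟨ν, γ, L, ρ, hν, hρ, hL, hinv, hgr⟩ := hΩ.graph z hz
  have hzle := le_of_mem_closure hL hgr (Metric.mem_ball_self hρ) (frontier_subset_closure hz)
  set ε : ℝ := min δ ρ / (4 * (L + 1)) with hε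
  set τ : ℝ := min δ ρ / 2 with hτ
  have hm : 0 < min δ ρ := lt_min hδ hρ
  have hε0 : 0 < ε := by positivity
  have hτ0 : 0 < τ := by positivity
  have hLε : L * ε + ε = min δ ρ / 4 := by rw [hε]; field_simp
  have hLε0 : 0 ≤ L * ε := by positivity
  have hnear : ∀ p ∈ Metric.ball z ε, ∀ t ∈ Icc 0 τ, p + t • ν ∈ Metric.ball z (min δ ρ) := by
    intro p hp t ht
    rw [Metric.mem_ball] at *
    calc dist (p + t • ν) z ≤ dist (p + t • ν) p + dist p z := dist_triangle _ _ _
      _ < t + ε := by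
        refine add_lt_add_of_le_of_lt (le_of_eq ?_) hp
        rw [dist_eq_norm, add_sub_cancel_left, norm_smul, hν, mul_one, Real.norm_of_nonneg ht.1]
      _ ≤ min δ ρ := by linarith [ht.2]
  have hup : ∀ p ∈ Ω ∩ Metric.ball z ε, ∀ t ∈ Icc 0 τ, p + t • ν ∈ Ω ∩ Metric.ball z δ := by
    intro p hp t ht
    have h1 := hnear p hp.2 t ht
    refine ⟨(hgr _ (Metric.ball_subset_ball (min_le_right _ _) h1)).2 ?_,
      Metric.ball_subset_ball (min_le_left _ _) h1⟩
    have h2 := (hgr p (Metric.ball_subset_ball (by linarith [min_le_right δ ρ]) hp.2)).1 hp.1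
    rw [hinv, inner_add_right, inner_smul_right, real_inner_self_eq_norm_sq, hν]
    linarith [ht.1]
  have htop : (fun p => p + τ • ν) '' Metric.ball z ε ⊆ Ω ∩ Metric.ball z δ := by
    rintro _ ⟨p, hp, rfl⟩
    have h1 := hnear p hp τ ⟨hτ0.le, le_rfl⟩
    refine ⟨(hgr _ (Metric.ball_subset_ball (min_le_right _ _) h1)).2 ?_,
      Metric.ball_subset_ball (min_le_left _ _) h1⟩
    rw [hinv, inner_add_right, inner_smul_right, real_inner_self_eq_norm_sq, hν]
    have h2 := hL.dist_le_mul p z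
    rw [Real.dist_eq] at h2
    have h3 : |inner ℝ ν (p - z)| ≤ dist p z := by
      refine (abs_real_inner_le_norm _ _).trans ?_
      rw [hν, one_mul, dist_eq_norm]
    rw [inner_sub_right] at h3
    rw [Metric.mem_ball] at hp
    have h4 : L * dist p z ≤ L * ε := by gcongr
    have h5 := (abs_le.1 h2).2
    have h6 := (abs_le.1 h3).1
    linarith
  refine ⟨ε, hε0, fun a ha b hb => ?_⟩
  have hpath : ∀ y : E d, IsPreconnected ((fun s : ℝ => y + s • ν) '' Icc 0 τ) :=
    fun y => isPreconnected_Icc.image _ (by fun_prop)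
  have hmid : IsPreconnected ((fun p => p + τ • ν) '' Metric.ball z ε) :=
    (convex_ball z ε).isPreconnected.image _ (by fun_prop)
  have hτm : τ ∈ Icc 0 τ := ⟨hτ0.le, le_rfl⟩
  have h0m : (0 : ℝ) ∈ Icc 0 τ := ⟨le_rfl, hτ0.le⟩
  -- Up from `a`, across the ball translated by `τ • ν`, which lies above the graph, and down to
  -- `b`.
  refine ⟨((fun s : ℝ => a + s • ν) '' Icc 0 τ ∪ (fun p => p + τ • ν) '' Metric.ball z ε) ∪
    (fun s : ℝ => b + s • ν) '' Icc 0 τ, ?_, ?_, ?_, ?_⟩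
  · refine IsPreconnected.union (b + τ • ν) (Or.inr ⟨b, hb.2, rfl⟩) ⟨τ, hτm, rfl⟩ ?_ (hpath b)
    exact IsPreconnected.union (a + τ • ν) ⟨τ, hτm, rfl⟩ ⟨a, ha.2, rfl⟩ (hpath a) hmid
  · exact Or.inl (Or.inl ⟨0, h0m, by simp⟩)
  · exact Or.inr ⟨0, h0m, by simp⟩
  · refine union_subset (union_subset ?_ htop) ?_
    · rintro _ ⟨s, hs, rfl⟩; exact hup a ha s hs
    · rintro _ ⟨s, hs, rfl⟩; exact hup b hb s hs

end

/-! ### The elements of a mesh at a point -/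

section
variable {d : ℕ} {Ω Ω₀ : Set (E d)} {𝓣 : Finset (Finset (E d))}

lemma IsMesh.cell_subset (h : IsMesh Ω₀ 𝓣) {T : Finset (E d)} (hT : T ∈ 𝓣) :
    cell T ⊆ closure Ω₀ := by
  rw [← h.cover]
  exact subset_biUnion_of_mem (u := fun T => cell T) hT

lemma IsMesh.exists_cell (h : IsMesh Ω₀ 𝓣) {x : E d} (hx : x ∈ closure Ω₀) :
    ∃ T ∈ 𝓣, x ∈ cell T := by
  rw [← h.cover] at hx
  simpa using hx

/-- Elements that come close to `x` contain `x`. -/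
lemma eventually_mem_cell (𝓣 : Finset (Finset (E d))) (x : E d) :
    ∀ᶠ y in 𝓝 x, ∀ T ∈ 𝓣, y ∈ cell T → x ∈ cell T := by
  rw [Finset.eventually_all]
  intro T _
  by_cases hx : x ∈ cell T
  · exact Eventually.of_forall fun _ _ => hx
  · filter_upwards [(isClosed_cell T).isOpen_compl.mem_nhds hx] with y hy h
    exact absurd h hy

lemma interior_cell_subset (hΩ₀ : IsLipschitzDomain Ω₀) (h : IsMesh Ω₀ 𝓣) {T : Finset (E d)}
    (hT : T ∈ 𝓣) : interior (cell T) ⊆ Ω₀ := by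
  rw [← hΩ₀.interior_closure]
  exact interior_mono (h.cell_subset hT)

/-- If a face meets the domain, then its relative interior is contained in the domain. -/
lemma mem_of_face_inter (hΩ₀ : IsLipschitzDomain Ω₀) (h : IsMesh Ω₀ 𝓣) {S T : Finset (E d)}
    (hT : T ∈ 𝓣) (hST : S ⊆ T) {x y : E d} (hx : x ∈ cell S) (hpos : ∀ v ∈ S, 0 < bary T v x)
    (hy : y ∈ cell S) (hyΩ : y ∈ Ω₀) : x ∈ Ω₀ := by
  have hTs := h.isSimplex hT
  -- a point of the relative interior in the domain
  obtain ⟨y', hy', hy'Ω, hy'pos⟩ : ∃ y' ∈ cell S, y' ∈ Ω₀ ∧ ∀ v ∈ S, 0 < bary T v y' := by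
    have hcont : Tendsto (fun t : ℝ => AffineMap.lineMap y x t) (𝓝[>] 0) (𝓝 y) := by
      have : Continuous fun t : ℝ => (AffineMap.lineMap y x t : E d) :=
        AffineMap.lineMap_continuous
      have h2 := this.tendsto 0
      rw [AffineMap.lineMap_apply_zero] at h2
      exact h2.mono_left nhdsWithin_le_nhds
    have h1 : ∀ᶠ t : ℝ in 𝓝[>] 0, AffineMap.lineMap y x t ∈ Ω₀ :=
      hcont.eventually (hΩ₀.isOpen.mem_nhds hyΩ)
    have h2 : ∀ᶠ t : ℝ in 𝓝[>] 0, t ∈ Ioo (0 : ℝ) 1 := Ioo_mem_nhdsGT one_pos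
    obtain ⟨t, ht1, ht2⟩ := (h1.and h2).exists
    refine ⟨_, (convex_convexHull ℝ _).segment_subset hy hx ?_, ht1, fun v hv => ?_⟩
    · rw [segment_eq_image_lineMap]
      exact ⟨t, ⟨ht2.1.le, ht2.2.le⟩, rfl⟩
    · rw [AffineMap.apply_lineMap, AffineMap.lineMap_apply_module]
      have := hTs.bary_nonneg (cell_mono hST hy) v
      have h3 := hpos v hv
      have h4 := mul_pos ht2.1 h3
      have h5 := mul_nonneg (sub_nonneg.2 ht2.2.le) this
      simp only [smul_eq_mul]
      linarith
  obtain ⟨m, hm, hmle⟩ : ∃ m > 0, ∀ v ∈ S, m ≤ bary T v x := by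
    have : ∀ᶠ m : ℝ in 𝓝[>] 0, ∀ v ∈ S, m ≤ bary T v x := by
      rw [Finset.eventually_all]
      intro v hv
      filter_upwards [Ioo_mem_nhdsGT (hpos v hv)] with m hm using hm.2.le
    obtain ⟨m, hm1, hm2⟩ := (this.and self_mem_nhdsWithin).exists
    exact ⟨m, hm2, hm1⟩
  have hxface := (hTs.mem_face_iff hST).1 hx
  have hyface := (hTs.mem_face_iff hST).1 hy'
  -- The line from `y'` through `x` is prolonged slightly beyond `x`; the bound `m` on the
  -- coordinates of `x` keeps `p` in the face.
  set p : E d := AffineMap.lineMap x y' (-m) with hp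
  have hbp : ∀ v, bary T v p = (1 + m) * bary T v x - m * bary T v y' := fun v => by
    rw [hp, AffineMap.apply_lineMap, AffineMap.lineMap_apply_module]
    simp only [smul_eq_mul]; ring
  have hpS : p ∈ cell S := by
    refine (hTs.mem_face_iff hST).2 ⟨fun v hv => ?_, fun v hv => ?_⟩
    · rw [hbp]
      by_cases hvS : v ∈ S
      · have h1 := hmle v hvS
        have h2 := hTs.bary_le_one (cell_mono hST hy') v
        nlinarith [hTs.bary_nonneg (cell_mono hST hx) v]
      · rw [hxface.2 v hvS, hyface.2 v hvS]; simp
    · rw [hbp, hxface.2 v hv, hyface.2 v hv]; simp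
  have hm1 : (1 + m : ℝ) ≠ 0 := by positivity
  have hxp : x = (1 / (1 + m)) • p + (m / (1 + m)) • y' := by
    rw [hp, AffineMap.lineMap_apply_module]
    match_scalars <;> field_simp <;> ring
  -- points near `x`
  set Φ : E d → E d := fun x' => ((1 + m) / m) • (x' - (1 / (1 + m)) • p) with hΦ
  have hΦx : Φ x = y' := by
    rw [hΦ]; beta_reduce
    conv_lhs => rw [hxp]
    match_scalars <;> field_simp <;> ring
  have hΦt : Tendsto Φ (𝓝 x) (𝓝 y') := by
    rw [← hΦx]
    exact Continuous.tendsto (by fun_prop) x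
  -- `Φ` is the homothety with centre `p` that takes `x` to `y'`. For `x'` near `x`, an element
  -- containing `Φ x'` also contains `y'`, hence all vertices of `S`, hence `p` and, by convexity,
  -- `x'`. So the mesh covers a neighbourhood of `x`.
  have hev : ∀ᶠ x' in 𝓝 x, x' ∈ closure Ω₀ := by
    filter_upwards [hΦt.eventually (hΩ₀.isOpen.mem_nhds hy'Ω),
      hΦt.eventually (eventually_mem_cell 𝓣 y')] with x' h1 h2
    obtain ⟨T', hT', hΦT'⟩ := h.exists_cell (subset_closure h1)
    have hyT' := h2 T' hT' hΦT'
    have hST' : S ⊆ T' := fun v hv => by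
      by_contra hvT'
      have := hy'pos v hv
      rw [h.bary_eq hT hT' (cell_mono hST hy') hyT', bary_of_notMem hvT'] at this
      exact lt_irrefl _ this
    have e : x' = (1 / (1 + m)) • p + (m / (1 + m)) • Φ x' := by
      rw [hΦ]; beta_reduce
      match_scalars <;> field_simp <;> ring
    refine h.cell_subset hT' ?_
    rw [e]
    exact convex_convexHull ℝ _ (cell_mono hST' hpS) hΦT' (by positivity) (by positivity)
      (by field_simp)
  have : x ∈ interior (closure Ω₀) := mem_interior_iff_mem_nhds.2 hev
  rwa [hΩ₀.interior_closure] at this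

open Classical in
/-- The vertices of the face of `T` whose relative interior contains `x`. -/
def carrier (T : Finset (E d)) (x : E d) : Finset (E d) := T.filter fun v => 0 < bary T v x

lemma carrier_subset (T : Finset (E d)) (x : E d) : carrier T x ⊆ T := Finset.filter_subset _ _

lemma IsSimplex.mem_carrier {T : Finset (E d)} (hT : IsSimplex T) {x : E d} (hx : x ∈ cell T) :
    x ∈ cell (carrier T x) := by
  classical
  refine (hT.mem_face_iff (carrier_subset T x)).2 ⟨fun v _ => hT.bary_nonneg hx v, fun v hv => ?_⟩
  by_cases hvT : v ∈ T
  · refine le_antisymm (not_lt.1 fun h => hv ?_) (hT.bary_nonneg hx v)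
    exact Finset.mem_filter.2 ⟨hvT, h⟩
  · exact bary_of_notMem hvT x

lemma bary_pos_of_mem_carrier {T : Finset (E d)} {x v : E d} (hv : v ∈ carrier T x) :
    0 < bary T v x := by
  classical
  exact (Finset.mem_filter.1 hv).2

/-- The face whose relative interior contains a boundary point belongs to the boundary. -/
lemma carrier_subset_frontier (hΩ₀ : IsLipschitzDomain Ω₀) (h : IsMesh Ω₀ 𝓣) {T : Finset (E d)}
    (hT : T ∈ 𝓣) {x : E d} (hx : x ∈ cell T) (hxf : x ∈ frontier Ω₀) :
    cell (carrier T x) ⊆ frontier Ω₀ := by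
  intro y hy
  rw [hΩ₀.isOpen.frontier_eq]
  refine ⟨h.cell_subset hT (cell_mono (carrier_subset T x) hy), fun hyΩ => ?_⟩
  exact hΩ₀.disjoint_frontier hxf (mem_of_face_inter hΩ₀ h hT (carrier_subset T x)
    ((h.isSimplex hT).mem_carrier hx) (fun v hv => bary_pos_of_mem_carrier hv) hy hyΩ)

/-- A face in the boundary of `Ω₀` that meets `Γ` is contained in `Γ`. -/
lemma cell_subset_frontier (hΩ : IsLipschitzDomain Ω) (hΩ₀ : IsLipschitzDomain Ω₀)
    (hsub : Ω₀ ⊆ Ω) (hfr : frontier Ω ⊆ frontier Ω₀) {S : Finset (E d)}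
    (hS : cell S ⊆ frontier Ω₀) {x : E d} (hx : x ∈ cell S) (hxΓ : x ∈ frontier Ω) :
    cell S ⊆ frontier Ω := by
  intro y hy
  by_contra hyΓ
  -- The face is connected and covered by two disjoint closed sets, namely `∂Ω` and `∂Ω₀ \ ∂Ω`.
  obtain ⟨w, -, hw1, hw2⟩ := isPreconnected_closed_iff.1 (convex_convexHull ℝ (S : Set (E d))).isPreconnected
    _ _ isClosed_frontier (isClosed_frontier_diff hΩ hΩ₀ hsub hfr)
    (fun w hw => by
      by_cases hwΓ : w ∈ frontier Ω
      · exact Or.inl hwΓ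
      · exact Or.inr ⟨hS hw, hwΓ⟩) ⟨x, hx, hxΓ⟩ ⟨y, hy, hS hy, hyΓ⟩
  exact hw2.2 hw1

open Classical in
lemma mem_bdryMesh {F : Finset (E d)} : F ∈ bdryMesh Ω 𝓣 ↔
    (∃ T ∈ 𝓣, F ⊆ T ∧ F.card = d) ∧ cell F ⊆ frontier Ω := by
  simp [bdryMesh, Finset.mem_powersetCard]

open Classical in
/-- `Γ` is covered by the boundary mesh and lower dimensional faces. -/
lemma frontier_subset_bdryMesh (hΩ : IsLipschitzDomain Ω) (hΩ₀ : IsLipschitzDomain Ω₀)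
    (hsub : Ω₀ ⊆ Ω) (hfr : frontier Ω ⊆ frontier Ω₀) (h : IsMesh Ω₀ 𝓣) {x : E d}
    (hx : x ∈ frontier Ω) : (∃ F ∈ bdryMesh Ω 𝓣, x ∈ cell F) ∨
      ∃ F ∈ (𝓣.biUnion Finset.powerset).filter (fun F => F.card < d), x ∈ cell F := by
  obtain ⟨T, hT, hxT⟩ := h.exists_cell (frontier_subset_closure (hfr hx))
  have hc := carrier_subset_frontier hΩ₀ h hT hxT (hfr hx)
  have hxc := (h.isSimplex hT).mem_carrier hxT
  rcases lt_trichotomy (carrier T x).card d with hlt | heq | hgt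
  · right
    refine ⟨carrier T x, Finset.mem_filter.2 ⟨Finset.mem_biUnion.2 ⟨T, hT, ?_⟩, hlt⟩, hxc⟩
    exact Finset.mem_powerset.2 (carrier_subset T x)
  · left
    exact ⟨carrier T x, mem_bdryMesh.2 ⟨⟨T, hT, carrier_subset T x, heq⟩,
      cell_subset_frontier hΩ hΩ₀ hsub hfr hc hxc hx⟩, hxc⟩
  · exfalso
    have e : carrier T x = T := Finset.eq_of_subset_of_card_le (carrier_subset T x) (by
      rw [h.card_eq T hT]; exact hgt)
    obtain ⟨y, hy⟩ := (h.isSimplex hT).interior_cell_nonempty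
    rw [e] at hc
    exact hΩ₀.disjoint_frontier (hc (interior_subset hy)) (interior_cell_subset hΩ₀ h hT hy)

/-- Different elements overlap in a null set. -/
lemma IsMesh.volume_inter (h : IsMesh Ω₀ 𝓣) {T T' : Finset (E d)} (hT : T ∈ 𝓣) (hT' : T' ∈ 𝓣)
    (hne : T ≠ T') : volume (cell T ∩ cell T') = 0 := by
  classical
  obtain ⟨v, hvT, hvT'⟩ : ∃ v ∈ T, v ∉ T' := by
    by_contra! hcon
    exact hne (Finset.eq_of_subset_of_card_le hcon (by rw [h.card_eq T hT, h.card_eq T' hT']))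
  refine measure_mono_null ?_ ((convex_convexHull ℝ (T : Set (E d))).addHaar_frontier volume)
  rintro x ⟨hx, hx'⟩
  rw [(isClosed_cell T).frontier_eq, (h.isSimplex hT).interior_cell]
  refine ⟨hx, fun hpos => ?_⟩
  have := hpos v hvT
  rw [h.bary_eq hT hT' hx hx', bary_of_notMem hvT'] at this
  exact lt_irrefl _ this

lemma IsShapeRegular.isRegularSimplex (hd : 1 ≤ d) {κ : ℝ} (h : IsMesh Ω₀ 𝓣)
    (hκ : IsShapeRegular κ 𝓣) {T : Finset (E d)} (hT : T ∈ 𝓣) : IsRegularSimplex (|κ| ^ d) T := by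
  refine ⟨h.isSimplex hT, ?_⟩
  have h0 : (0 : ℝ) ≤ volume.real (cell T) := measureReal_nonneg
  calc Metric.diam (cell T) ^ d
      ≤ (|κ| * (volume.real (cell T)) ^ (1 / (d : ℝ))) ^ d := by
        refine pow_le_pow_left₀ Metric.diam_nonneg ((hκ T hT).trans ?_) d
        gcongr
        exact le_abs_self κ
    _ = _ := by
        rw [mul_pow, ← Real.rpow_natCast (_ ^ (1 / (d : ℝ))), ← Real.rpow_mul h0,
          one_div_mul_cancel (by positivity), Real.rpow_one]

/-- The number of elements at a point is bounded. -/
lemma card_cells_le {κ : ℝ} (hκ0 : 0 ≤ κ) (h : IsMesh Ω₀ 𝓣) (hd : 1 ≤ d)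
    (hκ : ∀ T ∈ 𝓣, IsRegularSimplex κ T) {z : E d} {F : Finset (Finset (E d))} (hF : F ⊆ 𝓣)
    (hz : ∀ T ∈ F, z ∈ cell T) :
    (F.card : ℝ) ≤ κ * volume.real (Metric.closedBall (0 : E d) 1) := by
  rcases F.eq_empty_or_nonempty with rfl | hne
  · simp only [Finset.card_empty, Nat.cast_zero]; positivity
  have : Nonempty (Fin d) := ⟨⟨0, hd⟩⟩
  obtain ⟨T₀, hT₀, hmin⟩ := F.exists_min_image (fun T => Metric.diam (cell T)) hne
  set ε := Metric.diam (cell T₀) with hε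
  have hpos : ∀ T ∈ F, 0 < Metric.diam (cell T) := fun T hT => (hκ T (hF hT)).1.diam_pos hd
  have hε0 : 0 < ε := hpos T₀ hT₀
  -- Each element is shrunk towards `z` to the smallest diameter `ε`. The copies stay inside their
  -- elements, so they overlap in null sets; they lie in a ball of radius `ε` and have volume at
  -- least of order `ε^d`. No comparability of diameters is presupposed.
  set A : Finset (E d) → Set (E d) := fun T =>
    AffineMap.homothety z (ε / Metric.diam (cell T)) '' cell T with hA
  have hc : ∀ T ∈ F, 0 ≤ ε / Metric.diam (cell T) ∧ ε / Metric.diam (cell T) ≤ 1 := fun T hT =>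
    ⟨by positivity, (div_le_one (hpos T hT)).2 (hmin T hT)⟩
  have hAcell : ∀ T ∈ F, A T ⊆ cell T := by
    rintro T hT _ ⟨y, hy, rfl⟩
    rw [AffineMap.homothety_eq_lineMap]
    exact (convex_convexHull ℝ _).segment_subset (hz T hT) hy (by
      rw [segment_eq_image_lineMap]
      exact ⟨_, ⟨(hc T hT).1, (hc T hT).2⟩, rfl⟩)
  have hAball : ∀ T ∈ F, A T ⊆ Metric.closedBall z ε := by
    rintro T hT _ ⟨y, hy, rfl⟩
    rw [AffineMap.homothety_eq_lineMap, Metric.mem_closedBall, dist_lineMap_left,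
      Real.norm_of_nonneg (hc T hT).1, div_mul_eq_mul_div, div_le_iff₀ (hpos T hT)]
    exact mul_le_mul_of_nonneg_left (dist_le_diam_cell (hz T hT) hy) hε0.le
  have hAc : ∀ T, IsCompact (A T) := fun T =>
    (isCompact_cell T).image (AffineMap.continuous_of_finiteDimensional _)
  have hAvol : ∀ T ∈ F, ε ^ d ≤ κ * volume.real (A T) := by
    intro T hT
    have e : volume.real (A T) = (ε / Metric.diam (cell T)) ^ d * volume.real (cell T) := by
      rw [measureReal_def, Measure.addHaar_image_homothety, ENNReal.toReal_mul,
        ENNReal.toReal_ofReal (abs_nonneg _), finrank_euclideanSpace_fin,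
        abs_of_nonneg (pow_nonneg (hc T hT).1 _)]
      rfl
    rw [e, div_pow]
    have h1 := (hκ T (hF hT)).2
    have h2 := pow_pos (hpos T hT) d
    calc ε ^ d = ε ^ d / Metric.diam (cell T) ^ d * Metric.diam (cell T) ^ d := by field_simp
      _ ≤ ε ^ d / Metric.diam (cell T) ^ d * (κ * volume.real (cell T)) := by gcongr
      _ = _ := by ring
  have hsum : ∑ T ∈ F, volume.real (A T) ≤ volume.real (Metric.closedBall z ε) := by
    rw [← measureReal_biUnion_finset₀ (h := fun T _ => (hAc T).measure_lt_top.ne)]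
    · exact measureReal_mono (iUnion₂_subset hAball) measure_closedBall_lt_top.ne
    · intro T hT T' hT' hne
      exact measure_mono_null (inter_subset_inter (hAcell T hT) (hAcell T' hT'))
        (h.volume_inter (hF hT) (hF hT') hne)
    · exact fun T _ => (hAc T).measurableSet.nullMeasurableSet
  have hball : volume.real (Metric.closedBall z ε) =
      ε ^ d * volume.real (Metric.closedBall (0 : E d) 1) := by
    rw [Measure.addHaar_real_closedBall _ _ hε0.le, finrank_euclideanSpace_fin,
      Measure.addHaar_real_closedBall _ (0 : E d) zero_le_one, one_pow, one_mul]
  have h3 : F.card * ε ^ d ≤ κ * (ε ^ d * volume.real (Metric.closedBall (0 : E d) 1)) := by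
    calc (F.card : ℝ) * ε ^ d = ∑ _T ∈ F, ε ^ d := by rw [Finset.sum_const, nsmul_eq_mul]
      _ ≤ ∑ T ∈ F, κ * volume.real (A T) := Finset.sum_le_sum hAvol
      _ ≤ _ := by rw [← Finset.mul_sum, ← hball]; exact mul_le_mul_of_nonneg_left hsum hκ0
  have h4 : 0 < ε ^ d := by positivity
  refine le_of_mul_le_mul_right ?_ h4
  linarith

open Classical in
/-- Elements of `𝓣` that contain `z`; they are adjacent if they share an edge. -/
def starGraph (𝓣 : Finset (Finset (E d))) (z : E d) :
    SimpleGraph {T // T ∈ 𝓣.filter fun T => z ∈ cell T} where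
  Adj T T' := T ≠ T' ∧ 2 ≤ (T.1 ∩ T'.1).card
  symm.symm T T' hTT' := ⟨hTT'.1.symm, by rw [Finset.inter_comm]; exact hTT'.2⟩
  loopless.irrefl T hTT := hTT.1 rfl

/-- The elements at a boundary point are connected via common edges. -/
lemma starGraph_preconnected (hΩ₀ : IsLipschitzDomain Ω₀) (h : IsMesh Ω₀ 𝓣) {z : E d}
    (hz : z ∈ frontier Ω₀) : (starGraph 𝓣 z).Preconnected := by
  classical
  set W := 𝓣.filter fun T => z ∈ cell T with hW
  intro a b
  by_contra hab
  set UA : Set (E d) := ⋃ c ∈ {c : {T // T ∈ W} | (starGraph 𝓣 z).Reachable a c}, cell c.1 with hUA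
  set UB : Set (E d) := ⋃ c ∈ {c : {T // T ∈ W} | ¬ (starGraph 𝓣 z).Reachable a c}, cell c.1 with hUB
  have hcA : IsClosed UA := (toFinite _).isClosed_biUnion fun c _ => isClosed_cell c.1
  have hcB : IsClosed UB := (toFinite _).isClosed_biUnion fun c _ => isClosed_cell c.1
  -- Elements from different classes share at most one vertex. Their intersection contains `z`, so
  -- it is `z` alone.
  have hAB : UA ∩ UB ⊆ {z} := by
    rintro x ⟨hxA, hxB⟩
    obtain ⟨c, hc, hxc⟩ := mem_iUnion₂.1 hxA
    obtain ⟨c', hc', hxc'⟩ := mem_iUnion₂.1 hxB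
    have hcW := Finset.mem_filter.1 c.2
    have hcW' := Finset.mem_filter.1 c'.2
    have hne : c ≠ c' := fun e => hc' (e ▸ hc)
    have hcard : (c.1 ∩ c'.1).card ≤ 1 := by
      by_contra hcon
      have hadj : (starGraph 𝓣 z).Adj c c' := ⟨hne, by omega⟩
      exact hc' (SimpleGraph.Reachable.trans hc hadj.reachable)
    have hx := h.mem_cell_inter hcW.1 hcW'.1 subset_rfl subset_rfl hxc hxc'
    have hzz := h.mem_cell_inter hcW.1 hcW'.1 subset_rfl subset_rfl hcW.2 hcW'.2
    obtain ⟨v, hv⟩ := Finset.card_le_one_iff_subset_singleton.1 hcard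
    have hx1 := cell_mono hv hx
    have hz1 := cell_mono hv hzz
    rw [cell, Finset.coe_singleton, convexHull_singleton, mem_singleton_iff] at hx1 hz1
    rw [mem_singleton_iff, hx1, hz1]
  obtain ⟨δ, hδ, hball⟩ := Metric.eventually_nhds_iff_ball.1 (eventually_mem_cell 𝓣 z)
  obtain ⟨ε, hε, hP⟩ := hΩ₀.exists_preconnected hz hδ
  have hpt : ∀ c : {T // T ∈ W}, ∃ p ∈ Ω₀ ∩ Metric.ball z ε, p ∈ cell c.1 := by
    intro c
    have hcW := Finset.mem_filter.1 c.2
    have hcl : z ∈ closure (interior (cell c.1)) := by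
      rw [(convex_convexHull ℝ _).closure_interior_eq_closure_of_nonempty_interior
        (h.isSimplex hcW.1).interior_cell_nonempty]
      exact subset_closure hcW.2
    obtain ⟨p, hp, hpz⟩ := Metric.mem_closure_iff.1 hcl ε hε
    exact ⟨p, ⟨interior_cell_subset hΩ₀ h hcW.1 hp, by rwa [Metric.mem_ball, dist_comm]⟩,
      interior_subset hp⟩
  obtain ⟨p, hp, hpa⟩ := hpt a
  obtain ⟨p', hp', hpb⟩ := hpt b
  -- A connected subset of `Ω₀` near `z` joins both classes. It must meet both unions in a common
  -- point, which can only be `z`, but `z` is not in `Ω₀`.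
  obtain ⟨P, hPc, hpP, hpP', hPsub⟩ := hP p hp p' hp'
  obtain ⟨w, hwP, hwA, hwB⟩ := isPreconnected_closed_iff.1 hPc UA UB hcA hcB (fun w hw => by
      have h1 := hPsub hw
      obtain ⟨T, hT, hwT⟩ := h.exists_cell (subset_closure h1.1)
      have hTW : T ∈ W := Finset.mem_filter.2 ⟨hT, hball w h1.2 T hT hwT⟩
      by_cases hr : (starGraph 𝓣 z).Reachable a ⟨T, hTW⟩
      · exact Or.inl (mem_iUnion₂.2 ⟨⟨T, hTW⟩, hr, hwT⟩)
      · exact Or.inr (mem_iUnion₂.2 ⟨⟨T, hTW⟩, hr, hwT⟩))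
    ⟨p, hpP, mem_iUnion₂.2 ⟨a, SimpleGraph.Reachable.refl a, hpa⟩⟩
    ⟨p', hpP', mem_iUnion₂.2 ⟨b, hab, hpb⟩⟩
  have := hAB ⟨hwA, hwB⟩
  rw [mem_singleton_iff] at this
  exact hΩ₀.disjoint_frontier hz (this ▸ (hPsub hwP).1)

/-- Elements at a boundary point have comparable diameters. -/
lemma diam_le_diam {κ : ℝ} (hd : 1 ≤ d) (hκ1 : 1 ≤ κ) (hΩ₀ : IsLipschitzDomain Ω₀)
    (h : IsMesh Ω₀ 𝓣) (hκ : ∀ T ∈ 𝓣, IsRegularSimplex κ T) {z : E d} (hz : z ∈ frontier Ω₀)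
    {T T' : Finset (E d)} (hT : T ∈ 𝓣) (hT' : T' ∈ 𝓣) (hzT : z ∈ cell T) (hzT' : z ∈ cell T') :
    Metric.diam (cell T) ≤
      (2 ^ (d - 1) * κ) ^ ⌊κ * volume.real (Metric.closedBall (0 : E d) 1)⌋₊ *
        Metric.diam (cell T') := by
  classical
  set W := 𝓣.filter fun T => z ∈ cell T with hW
  have hone : 1 ≤ 2 ^ (d - 1) * κ := one_le_mul_of_one_le_of_one_le (one_le_pow₀ one_le_two) hκ1
  -- By regularity each edge of an element is comparable to its diameter, so passing to an element
  -- with a common edge costs a factor `2^(d-1) κ`. A path visits each element at most once, and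
  -- their number is bounded.
  have hwalk : ∀ (a b : {T // T ∈ W}) (p : (starGraph 𝓣 z).Walk a b),
      Metric.diam (cell a.1) ≤ (2 ^ (d - 1) * κ) ^ p.length * Metric.diam (cell b.1) := by
    intro a b p
    induction p with
    | nil => simp
    | @cons a b c hadj p ih =>
      obtain ⟨u, hu, v, hv, huv⟩ := Finset.one_lt_card.1 hadj.2
      rw [Finset.mem_inter] at hu hv
      have h1 := (hκ a.1 (Finset.mem_filter.1 a.2).1).diam_le_dist hd hu.1 hv.1 huv
      have h2 : dist u v ≤ Metric.diam (cell b.1) :=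
        dist_le_diam_cell (subset_convexHull ℝ _ hu.2) (subset_convexHull ℝ _ hv.2)
      rw [SimpleGraph.Walk.length_cons, pow_succ', mul_assoc]
      calc _ ≤ _ := h1
        _ ≤ _ := by gcongr; exact h2.trans ih
  obtain ⟨p, hp⟩ := (starGraph_preconnected hΩ₀ h hz ⟨T, Finset.mem_filter.2 ⟨hT, hzT⟩⟩
    ⟨T', Finset.mem_filter.2 ⟨hT', hzT'⟩⟩).exists_isPath
  refine (hwalk _ _ p).trans ?_
  have hlen := hp.length_lt
  rw [Fintype.card_coe] at hlen
  have hcard := card_cells_le (zero_le_one.trans hκ1) h hd hκ (z := z) (F := W)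
    (Finset.filter_subset _ _) fun T hT => (Finset.mem_filter.1 hT).2
  have : p.length ≤ ⌊κ * volume.real (Metric.closedBall (0 : E d) 1)⌋₊ :=
    hlen.le.trans (Nat.le_floor hcard)
  gcongr

end

/-! ### Facets: surface measure, inverse estimate and Poincaré inequality -/

/-! ### The reference simplex -/

/-- The reference simplex of dimension `m`. -/
def refSimplex (m : ℕ) : Set (E m) := {y | (∀ i, 0 ≤ y i) ∧ ∑ i, y i ≤ 1}

/-- The barycentric coordinates of the reference simplex. -/
def refCoord {m : ℕ} (y : E m) : Fin (m + 1) → ℝ := Fin.cons (1 - ∑ i, y i) (fun i => y i)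

@[simp] lemma refCoord_zero {m : ℕ} (y : E m) : refCoord y 0 = 1 - ∑ i, y i := rfl

@[simp] lemma refCoord_succ {m : ℕ} (y : E m) (i : Fin m) : refCoord y i.succ = y i := rfl

lemma sum_refCoord {m : ℕ} (y : E m) : ∑ j, refCoord y j = 1 := by
  simp [Fin.sum_univ_succ]

lemma continuous_refCoord {m : ℕ} (j : Fin (m + 1)) : Continuous fun y : E m => refCoord y j := by
  refine Fin.cases ?_ (fun i => ?_) j
  · simp only [refCoord_zero]; fun_prop
  · simp only [refCoord_succ]; fun_prop

lemma mem_refSimplex_iff {m : ℕ} {y : E m} : y ∈ refSimplex m ↔ ∀ j, 0 ≤ refCoord y j := by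
  rw [Fin.forall_fin_succ]
  simp only [refCoord_zero, refCoord_succ, sub_nonneg]
  exact and_comm

lemma isClosed_refSimplex (m : ℕ) : IsClosed (refSimplex m) := by
  have : refSimplex m = ⋂ j, {y | 0 ≤ refCoord y j} := by
    ext y; simp [mem_refSimplex_iff]
  rw [this]
  exact isClosed_iInter fun j => isClosed_le continuous_const (continuous_refCoord j)

lemma isCompact_refSimplex (m : ℕ) : IsCompact (refSimplex m) := by
  refine Metric.isCompact_of_isClosed_isBounded (isClosed_refSimplex m) ?_
  refine Metric.isBounded_closedBall (x := (0 : E m)) (r := 1) |>.subset fun y hy => ?_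
  rw [mem_closedBall_zero_iff, EuclideanSpace.norm_eq, Real.sqrt_le_one]
  calc ∑ i, ‖y i‖ ^ 2 ≤ ∑ i, y i := by
        refine Finset.sum_le_sum fun i _ => ?_
        have h0 := hy.1 i
        have h1 : y i ≤ 1 := (Finset.single_le_sum (f := fun i => y i)
          (fun i _ => hy.1 i) (Finset.mem_univ i)).trans hy.2
        rw [Real.norm_of_nonneg h0]
        nlinarith
    _ ≤ 1 := hy.2

lemma convex_refSimplex (m : ℕ) : Convex ℝ (refSimplex m) := by
  intro x hx y hy a b ha hb hab
  refine ⟨fun i => ?_, ?_⟩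
  · simp only [PiLp.add_apply, PiLp.smul_apply, smul_eq_mul]
    have := mul_nonneg ha (hx.1 i)
    have := mul_nonneg hb (hy.1 i)
    positivity
  · simp only [PiLp.add_apply, PiLp.smul_apply, smul_eq_mul, Finset.sum_add_distrib,
      ← Finset.mul_sum]
    calc _ ≤ a * 1 + b * 1 := by gcongr; exacts [hx.2, hy.2]
      _ = 1 := by linarith

/-- Lets a continuous function that vanishes almost everywhere on the simplex be evaluated at its
nodes, which include boundary points. -/
lemma refSimplex_subset_closure_interior (m : ℕ) :
    refSimplex m ⊆ closure (interior (refSimplex m)) := by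
  rw [(convex_refSimplex m).closure_interior_eq_closure_of_nonempty_interior]
  · exact subset_closure
  refine ⟨WithLp.toLp 2 fun _ => 1 / (m + 1 : ℝ), ?_⟩
  rw [mem_interior]
  refine ⟨⋂ j, {y | 0 < refCoord y j}, fun y hy => ?_, ?_, ?_⟩
  · rw [mem_iInter] at hy
    exact mem_refSimplex_iff.2 fun j => (hy j).le
  · exact isOpen_iInter_of_finite fun j => isOpen_lt continuous_const (continuous_refCoord j)
  · rw [mem_iInter]
    refine Fin.cases ?_ fun i => ?_
    · simp only [mem_ofPred_eq, refCoord_zero, Finset.sum_const, Finset.card_univ,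
        Fintype.card_fin, nsmul_eq_mul, sub_pos]
      rw [mul_one_div, div_lt_one (by positivity)]
      linarith
    · simp only [mem_ofPred_eq, refCoord_succ]
      positivity

/-- The parametrization of a simplex. -/
def simplexParam {d n : ℕ} {S : Finset (E d)} (e : Fin (n + 1) ≃ S) (y : E n) : E d :=
  ∑ j, refCoord y j • (e j : E d)

section
variable {d n : ℕ} {S : Finset (E d)}

lemma exists_lipschitzWith_simplexParam (e : Fin (n + 1) ≃ S) :
    ∃ L : ℝ≥0, LipschitzWith L (simplexParam e) := by
  set A : E n →L[ℝ] E d :=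
    ∑ i, (EuclideanSpace.proj i : E n →L[ℝ] ℝ).smulRight ((e i.succ : E d) - e 0) with hA
  have h : simplexParam e = fun y => (e 0 : E d) + A y := by
    funext y
    have hp : ∀ i, (EuclideanSpace.proj i : E n →L[ℝ] ℝ) y = y i := fun _ => rfl
    simp only [simplexParam, Fin.sum_univ_succ, refCoord_zero, refCoord_succ, hA,
      sum_apply, ContinuousLinearMap.smulRight_apply, hp,
      smul_sub, Finset.sum_sub_distrib, sub_smul, one_smul, Finset.sum_smul]
    abel
  refine ⟨‖A‖₊, ?_⟩
  rw [h]
  refine LipschitzWith.of_dist_le_mul fun x y => ?_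
  rw [dist_add_left]
  exact A.lipschitz.dist_le_mul x y

lemma simplexParam_eq_baryPoint (e : Fin (n + 1) ≃ S) (y : E n) {w : E d → ℝ}
    (hw : ∀ j, w (e j) = refCoord y j) : simplexParam e y = baryPoint S w := by
  rw [baryPoint, ← Finset.sum_coe_sort S (fun v => w v • v), simplexParam]
  exact Fintype.sum_equiv e _ _ fun j => by rw [hw]

lemma sum_eq_one_of_refCoord (e : Fin (n + 1) ≃ S) (y : E n) {w : E d → ℝ}
    (hw : ∀ j, w (e j) = refCoord y j) : ∑ v ∈ S, w v = 1 := by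
  rw [← Finset.sum_coe_sort S, ← sum_refCoord y]
  exact (Fintype.sum_equiv e _ _ fun j => (hw j).symm).symm

open Classical in
/-- The weights of the vertices of `S`. -/
def simplexWeight (e : Fin (n + 1) ≃ S) (y : E n) (v : E d) : ℝ :=
  if h : v ∈ S then refCoord y (e.symm ⟨v, h⟩) else 0

lemma simplexWeight_coe (e : Fin (n + 1) ≃ S) (y : E n) (j : Fin (n + 1)) :
    simplexWeight e y (e j) = refCoord y j := by
  simp [simplexWeight]

lemma simplexParam_mem (e : Fin (n + 1) ≃ S) {y : E n} (hy : y ∈ refSimplex n) :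
    simplexParam e y ∈ cell S := by
  rw [simplexParam_eq_baryPoint e y (simplexWeight_coe e y)]
  refine baryPoint_mem_convexHull (fun v hv => ?_)
    (sum_eq_one_of_refCoord e y (simplexWeight_coe e y))
  rw [simplexWeight, dif_pos hv]
  exact mem_refSimplex_iff.1 hy _

lemma exists_simplexParam (e : Fin (n + 1) ≃ S) {x : E d} (hx : x ∈ cell S) :
    ∃ y ∈ refSimplex n, simplexParam e y = x := by
  obtain ⟨w, h0, h1, rfl⟩ := Finset.mem_convexHull'.1 hx
  set y : E n := WithLp.toLp 2 fun i => w (e i.succ) with hy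
  have hsum : ∑ j, w (e j) = 1 := by
    rw [← h1, ← Finset.sum_coe_sort S]
    exact Fintype.sum_equiv e _ _ fun j => rfl
  have hw : ∀ j, w (e j) = refCoord y j := by
    refine Fin.cases ?_ fun i => rfl
    rw [Fin.sum_univ_succ] at hsum
    rw [refCoord_zero]
    simp only [hy]
    linarith
  refine ⟨y, mem_refSimplex_iff.2 fun j => ?_, simplexParam_eq_baryPoint e y hw⟩
  rw [← hw]
  exact h0 _ (e j).2

/-! ### Surface measure of faces -/

lemma euclideanHausdorffMeasure_image_le {X Y : Type*} [MetricSpace X] [MetricSpace Y]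
    [MeasurableSpace X] [BorelSpace X] [MeasurableSpace Y] [BorelSpace Y] {f : X → Y} {s : Set X}
    {L : ℝ≥0} (hf : LipschitzOnWith L f s) (m : ℕ) :
    Measure.euclideanHausdorffMeasure m (f '' s) ≤
      (L : ℝ≥0∞) ^ m * Measure.euclideanHausdorffMeasure m s := by
  rw [Measure.euclideanHausdorffMeasure_def, Measure.euclideanHausdorffMeasure_def,
    Measure.smul_apply, Measure.smul_apply, ENNReal.smul_def, ENNReal.smul_def, smul_eq_mul,
    smul_eq_mul, mul_left_comm, ← ENNReal.rpow_natCast]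
  gcongr
  exact hf.hausdorffMeasure_image_le (Nat.cast_nonneg m)

lemma measure_cell_lt_top (hS : S.card = n + 1) :
    Measure.euclideanHausdorffMeasure n (cell S) < ⊤ := by
  have e : Fin (n + 1) ≃ S := (S.equivFinOfCardEq hS).symm
  obtain ⟨L, hL⟩ := exists_lipschitzWith_simplexParam e
  have hsub : cell S ⊆ simplexParam e '' refSimplex n := fun x hx => by
    obtain ⟨y, hy, rfl⟩ := exists_simplexParam e hx
    exact ⟨y, hy, rfl⟩
  refine (measure_mono hsub).trans_lt
    ((euclideanHausdorffMeasure_image_le hL.lipschitzOnWith n).trans_lt ?_)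
  rw [EuclideanSpace.euclideanHausdorffMeasure_eq_volume]
  exact ENNReal.mul_lt_top (by simp) (isCompact_refSimplex n).measure_lt_top

/-- Lower dimensional faces are null sets. -/
lemma measure_cell_eq_zero {m : ℕ} (hS : S.card ≤ m) :
    Measure.euclideanHausdorffMeasure m (cell S) = 0 := by
  rcases S.eq_empty_or_nonempty with rfl | hne
  · rw [cell, Finset.coe_empty, convexHull_empty, measure_empty]
  obtain ⟨n, hn⟩ : ∃ n, S.card = n + 1 :=
    ⟨S.card - 1, by have := Finset.card_pos.2 hne; omega⟩
  -- A set of finite `n`-dimensional measure is null in every larger dimension.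
  refine (Measure.euclideanHausdorffMeasure_zero_or_top (show n < m by omega) _).resolve_right ?_
  exact (measure_cell_lt_top hn).ne

end

/-! ### Facets -/

section
variable {m : ℕ} {T F : Finset (E (m + 1))} {κ : ℝ}

/-- Coordinates on a facet of a simplex. -/
def facetChart (T : Finset (E (m + 1))) (e : Fin (m + 1) ≃ F) (x : E (m + 1)) : E m :=
  WithLp.toLp 2 fun i => bary T (e i.succ) x

/-- The Lipschitz constant of order `1 / diam` is the source of all powers of the diameter in the
inverse estimate. -/
lemma facetChart_lipschitz (hκ0 : 0 ≤ κ) (hT : IsRegularSimplex κ T) (e : Fin (m + 1) ≃ F) :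
    LipschitzWith (m * (2 ^ m * κ / Metric.diam (cell T))).toNNReal (facetChart T e) := by
  have hd := hT.1.diam_pos (Nat.succ_pos m)
  refine LipschitzWith.of_dist_le_mul fun x y => ?_
  rw [Real.coe_toNNReal _ (by positivity), EuclideanSpace.dist_eq]
  refine Real.sqrt_le_iff.2 ⟨by positivity, ?_⟩
  have hb : ∀ i : Fin m, |bary T (e i.succ) x - bary T (e i.succ) y| ≤
      2 ^ m * κ / Metric.diam (cell T) * dist x y :=
    fun i => hT.abs_bary_sub_le (Nat.succ_pos m) (e i.succ) x y
  set B := 2 ^ m * κ / Metric.diam (cell T) * dist x y with hB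
  have hB0 : 0 ≤ B := by positivity
  calc ∑ i, dist ((facetChart T e x) i) ((facetChart T e y) i) ^ 2
      ≤ ∑ _i : Fin m, B ^ 2 := Finset.sum_le_sum fun i _ =>
        pow_le_pow_left₀ dist_nonneg (hb i) 2
    _ = m * B ^ 2 := by simp
    _ ≤ (m * B) ^ 2 := by
      rw [mul_pow (m : ℝ) B 2]
      have hm : (m : ℝ) ≤ (m : ℝ) ^ 2 := by exact_mod_cast Nat.le_self_pow two_ne_zero m
      exact mul_le_mul_of_nonneg_right hm (sq_nonneg B)
    _ = _ := by rw [hB]; ring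

lemma refCoord_facetChart (hT : IsSimplex T) (hFT : F ⊆ T) (e : Fin (m + 1) ≃ F) {x : E (m + 1)}
    (hx : x ∈ cell F) (j : Fin (m + 1)) : refCoord (facetChart T e x) j = bary T (e j) x := by
  have h0 := ((hT.mem_face_iff hFT).1 hx).2
  have hsum : ∑ j, bary T (e j) x = 1 := by
    rw [← hT.sum_bary x, ← Finset.sum_subset hFT fun v _ hv => h0 v hv, ← Finset.sum_coe_sort F]
    exact Fintype.sum_equiv e _ _ fun j => rfl
  revert j
  refine Fin.cases ?_ fun i => rfl
  rw [Fin.sum_univ_succ] at hsum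
  rw [refCoord_zero]
  change 1 - ∑ i : Fin m, bary T (e i.succ) x = _
  linarith

lemma facetChart_simplexParam (hT : IsSimplex T) (hFT : F ⊆ T) (e : Fin (m + 1) ≃ F) {y : E m} :
    facetChart T e (simplexParam e y) = y := by
  have h1 := simplexWeight_coe e y
  have hout : ∀ v ∉ F, simplexWeight e y v = 0 := fun v hv => by simp [simplexWeight, hv]
  have h2 := sum_eq_one_of_refCoord e y h1
  rw [Finset.sum_subset hFT fun v _ hv => hout v hv] at h2
  ext i
  change bary T (e i.succ) (simplexParam e y) = y i
  rw [simplexParam_eq_baryPoint e y h1, ← baryPoint_subset hFT hout,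
    hT.bary_baryPoint h2 (hFT (e i.succ).2), h1, refCoord_succ]

/-- The surface measure on a facet dominates the Lebesgue measure in the coordinates. -/
lemma volume_refSimplex_le (hT : IsSimplex T) (hFT : F ⊆ T) (e : Fin (m + 1) ≃ F) {L : ℝ≥0}
    (hL : LipschitzWith L (facetChart T e)) :
    (volume : Measure (E m)).restrict (refSimplex m) ≤ ((L : ℝ≥0∞) ^ m) •
      (((Measure.euclideanHausdorffMeasure m).restrict (cell F)).map (facetChart T e)) := by
  refine Measure.le_iff.2 fun B hB => ?_
  rw [Measure.restrict_apply hB, Measure.smul_apply,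
    Measure.map_apply hL.continuous.measurable hB,
    Measure.restrict_apply (hL.continuous.measurable hB), smul_eq_mul,
    ← EuclideanSpace.euclideanHausdorffMeasure_eq_volume]
  -- The chart is Lipschitz and inverts the parametrization, so it enlarges Hausdorff measure by at
  -- most `L^m`. This one-sided comparison makes an area formula unnecessary.
  refine le_trans (measure_mono ?_) (euclideanHausdorffMeasure_image_le hL.lipschitzOnWith m)
  rintro y ⟨hyB, hy⟩
  have := facetChart_simplexParam hT hFT e (y := y)
  exact ⟨simplexParam e y, ⟨by rwa [mem_preimage, this], simplexParam_mem e hy⟩, this⟩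

/-- Facets are upper Ahlfors regular. -/
lemma exists_measure_cell_inter_le (hκ0 : 0 ≤ κ) (hT : IsRegularSimplex κ T) (hFT : F ⊆ T)
    (hF : F.card = m + 1) :
    ∃ A : ℝ, 0 ≤ A ∧ ∀ (x : E (m + 1)) (r : ℝ), 0 < r →
      Measure.euclideanHausdorffMeasure m (cell F ∩ Metric.closedBall x r) ≤
        ENNReal.ofReal (A * r ^ m) := by
  have e : Fin (m + 1) ≃ F := (F.equivFinOfCardEq hF).symm
  obtain ⟨M, hM⟩ := exists_lipschitzWith_simplexParam e
  have hL := facetChart_lipschitz hκ0 hT e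
  set L := (m * (2 ^ m * κ / Metric.diam (cell T))).toNNReal with hLdef
  refine ⟨(M : ℝ) ^ m * (L : ℝ) ^ m * volume.real (Metric.closedBall (0 : E m) 1), by positivity,
    fun x r hr => ?_⟩
  have hsub : cell F ∩ Metric.closedBall x r ⊆
      simplexParam e '' Metric.closedBall (facetChart T e x) (L * r) := by
    rintro w ⟨hw, hwx⟩
    obtain ⟨y, hy, rfl⟩ := exists_simplexParam e hw
    refine ⟨y, ?_, rfl⟩
    have h1 := hL.dist_le_mul (simplexParam e y) x
    rw [facetChart_simplexParam hT.1 hFT] at h1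
    exact h1.trans (by gcongr; exact hwx)
  refine (measure_mono hsub).trans
    ((euclideanHausdorffMeasure_image_le hM.lipschitzOnWith m).trans ?_)
  rw [EuclideanSpace.euclideanHausdorffMeasure_eq_volume,
    Measure.addHaar_closedBall' _ _ (by positivity), finrank_euclideanSpace_fin,
    ← ofReal_measureReal (measure_closedBall_lt_top.ne), ← ENNReal.ofReal_coe_nnreal,
    ← ENNReal.ofReal_pow (by positivity), ← ENNReal.ofReal_mul (by positivity),
    ← ENNReal.ofReal_mul (by positivity)]
  refine ENNReal.ofReal_le_ofReal (le_of_eq ?_)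
  rw [mul_pow]; ring

end

/-! ### The inverse estimate -/

lemma continuous_lagrangePoly {X V : Type*} [TopologicalSpace X] (S : Finset V) (k : V → ℕ)
    {t : X → V → ℝ} (ht : ∀ v, Continuous fun x => t x v) :
    Continuous fun x => lagrangePoly S k (t x) := by
  unfold lagrangePoly lagrangeFactor
  refine continuous_finsetProd _ fun v _ => continuous_finsetProd _ fun j _ => ?_
  exact ((ht v).sub continuous_const).div_const _

/-- A polynomial on the reference simplex with given nodal values. -/
def refPoly {m : ℕ} (q : ℕ) (c : (Fin (m + 1) → ℕ) → ℝ) (y : E m) : ℝ :=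
  ∑ k ∈ (Finset.univ : Finset (Fin (m + 1))).piAntidiag q,
    c k * lagrangePoly Finset.univ k (fun j => q * refCoord y j)

lemma continuous_refPoly {m : ℕ} (q : ℕ) (c : (Fin (m + 1) → ℕ) → ℝ) :
    Continuous (refPoly (m := m) q c) :=
  continuous_finsetSum _ fun _ _ => continuous_const.mul
    (continuous_lagrangePoly _ _ fun j => (continuous_refCoord j).const_mul (q : ℝ))

lemma refPoly_congr {m q : ℕ} {c c' : (Fin (m + 1) → ℕ) → ℝ}
    (h : ∀ k ∈ (Finset.univ : Finset (Fin (m + 1))).piAntidiag q, c k = c' k) (y : E m) :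
    refPoly q c y = refPoly q c' y :=
  Finset.sum_congr rfl fun k hk => by rw [h k hk]

lemma refPoly_node {m q : ℕ} (hq : 1 ≤ q) (c : (Fin (m + 1) → ℕ) → ℝ) {k : Fin (m + 1) → ℕ}
    (hk : k ∈ (Finset.univ : Finset (Fin (m + 1))).piAntidiag q) :
    ∃ y ∈ refSimplex m, refPoly q c y = c k := by
  have hq' : (q : ℝ) ≠ 0 := by positivity
  set y : E m := WithLp.toLp 2 fun i => (k i.succ : ℝ) / q with hy
  have hsum : ∑ j, (k j : ℝ) / q = 1 := by
    rw [← Finset.sum_div, ← Nat.cast_sum, (Finset.mem_piAntidiag.1 hk).1, div_self hq']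
  have hyk : ∀ j, refCoord y j = k j / q := by
    refine Fin.cases ?_ fun i => rfl
    rw [Fin.sum_univ_succ] at hsum
    rw [refCoord_zero]
    simp only [hy]
    linarith
  refine ⟨y, mem_refSimplex_iff.2 fun j => by rw [hyk]; positivity, ?_⟩
  have e : (fun j => q * refCoord y j) = fun j => (k j : ℝ) := by
    funext j; rw [hyk]; field_simp
  rw [refPoly, e, Finset.sum_eq_single k]
  · rw [lagrangePoly_node_self, mul_one]
  · intro k' hk' hne
    rw [lagrangePoly_node_of_ne hk' hk hne, mul_zero]
  · exact fun h => absurd hk h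

/-- The inverse estimate on the reference simplex. -/
lemma exists_refPoly_le (m : ℕ) {q : ℕ} (hq : 1 ≤ q) :
    ∃ C : ℝ, 0 < C ∧ ∀ (c : (Fin (m + 1) → ℕ) → ℝ),
      ∀ k ∈ (Finset.univ : Finset (Fin (m + 1))).piAntidiag q,
        c k ^ 2 ≤ C * ∫ y in refSimplex m, refPoly q c y ^ 2 := by
  classical
  set I := (Finset.univ : Finset (Fin (m + 1))).piAntidiag q with hI
  set ext : (I → ℝ) → (Fin (m + 1) → ℕ) → ℝ := fun c k => if h : k ∈ I then c ⟨k, h⟩ else 0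
  have hext : ∀ (c : I → ℝ) (k : I), ext c k = c k := fun c k => by simp [ext]
  -- A continuous quadratic functional of the nodal values. It is definite, because a polynomial
  -- vanishing on the simplex has vanishing nodal values; its minimum on the unit sphere then yields
  -- the constant.
  set N : (I → ℝ) → ℝ := fun c => ∫ y in refSimplex m, refPoly q (ext c) y ^ 2 with hN
  have hcont : Continuous N := by
    refine continuous_parametric_integral_of_continuous
      (f := fun c y => refPoly q (ext c) y ^ 2) ?_ (isCompact_refSimplex m)
    refine Continuous.pow ?_ 2
    refine continuous_finsetSum _ fun k hk => Continuous.mul ?_ ?_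
    · have : (fun p : (I → ℝ) × E m => ext p.1 k) = fun p => p.1 ⟨k, hk⟩ := by
        funext p; exact hext p.1 ⟨k, hk⟩
      rw [this]
      fun_prop
    · exact continuous_lagrangePoly _ _ fun j =>
        ((continuous_refCoord j).comp continuous_snd).const_mul (q : ℝ)
  have hint : ∀ c, IntegrableOn (fun y => refPoly (m := m) q c y ^ 2) (refSimplex m) := fun c =>
    ((continuous_refPoly q c).pow 2).continuousOn.integrableOn_compact (isCompact_refSimplex m)
  have hpos : ∀ c : I → ℝ, c ≠ 0 → 0 < N c := by
    intro c hc
    refine lt_of_le_of_ne (integral_nonneg fun y => sq_nonneg _) fun h0 => hc ?_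
    have h1 := (setIntegral_eq_zero_iff_of_nonneg_ae (Eventually.of_forall fun y => sq_nonneg _)
      (hint (ext c))).1 h0.symm
    have h2 : EqOn (fun y => refPoly q (ext c) y ^ 2) (0 : E m → ℝ) (refSimplex m) :=
      Measure.eqOn_of_ae_eq h1 ((continuous_refPoly q _).pow 2).continuousOn
        continuousOn_const (refSimplex_subset_closure_interior m)
    funext k
    obtain ⟨y, hy, hyk⟩ := refPoly_node hq (ext c) k.2
    have := h2 hy
    simp only [Pi.zero_apply] at this
    rw [hyk, hext] at this
    exact pow_eq_zero_iff two_ne_zero |>.1 this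
  have hhom : ∀ (t : ℝ) (c : I → ℝ), N (t • c) = t ^ 2 * N c := by
    intro t c
    simp only [hN]
    rw [← integral_const_mul]
    congr 1
    funext y
    rw [← mul_pow]
    congr 1
    rw [refPoly, refPoly, Finset.mul_sum]
    refine Finset.sum_congr rfl fun k hk => ?_
    rw [show ext (t • c) k = t * ext c k by simp [ext]]
    ring
  have hbound : ∃ C : ℝ, 0 < C ∧ ∀ c : I → ℝ, ‖c‖ ^ 2 ≤ C * N c := by
    rcases (Metric.sphere (0 : I → ℝ) 1).eq_empty_or_nonempty with hemp | hne
    · refine ⟨1, one_pos, fun c => ?_⟩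
      have : c = 0 := by
        by_contra hc
        have : ‖c‖⁻¹ • c ∈ Metric.sphere (0 : I → ℝ) 1 := by
          rw [mem_sphere_zero_iff_norm, norm_smul, norm_inv, norm_norm,
            inv_mul_cancel₀ (norm_ne_zero_iff.2 hc)]
        rw [hemp] at this
        exact this
      rw [this, norm_zero]
      have : 0 ≤ N 0 := integral_nonneg fun y => sq_nonneg _
      linarith
    · obtain ⟨c₀, hc₀, hmin⟩ := (isCompact_sphere (0 : I → ℝ) 1).exists_isMinOn hne
        hcont.continuousOn
      have hN₀ : 0 < N c₀ := hpos c₀ fun h => by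
        rw [h, mem_sphere_zero_iff_norm, norm_zero] at hc₀
        exact zero_ne_one hc₀
      refine ⟨(N c₀)⁻¹, by positivity, fun c => ?_⟩
      rcases eq_or_ne c 0 with rfl | hc
      · rw [norm_zero]
        have h0 : 0 ≤ N 0 := integral_nonneg fun y => sq_nonneg _
        rw [zero_pow two_ne_zero]
        exact mul_nonneg (inv_nonneg.2 hN₀.le) h0
      have hcn : 0 < ‖c‖ := norm_pos_iff.2 hc
      have h1 : N c₀ ≤ N (‖c‖⁻¹ • c) := hmin (by
        rw [mem_sphere_zero_iff_norm, norm_smul, norm_inv, norm_norm, inv_mul_cancel₀ hcn.ne'])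
      rw [hhom, inv_pow] at h1
      rw [inv_mul_eq_div, le_div_iff₀ hN₀]
      calc ‖c‖ ^ 2 * N c₀ ≤ ‖c‖ ^ 2 * ((‖c‖ ^ 2)⁻¹ * N c) := by gcongr
        _ = N c := by field_simp
  obtain ⟨C, hC, hCN⟩ := hbound
  refine ⟨C, hC, fun c k hk => ?_⟩
  have h1 := hCN fun k => c k
  have h2 : N (fun k => c k) = ∫ y in refSimplex m, refPoly q c y ^ 2 := by
    simp only [hN]
    congr 1
    funext y
    rw [refPoly_congr (c' := c) (fun k hk => hext (fun k => c k) ⟨k, hk⟩)]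
  rw [h2] at h1
  refine le_trans ?_ h1
  rw [← sq_abs]
  exact pow_le_pow_left₀ (abs_nonneg _) (norm_le_pi_norm (fun k : I => c k) ⟨k, hk⟩) 2

section
variable {m : ℕ} {T F : Finset (E (m + 1))} {κ : ℝ}

lemma sum_piAntidiag_equiv {V : Type*} [DecidableEq V] {F : Finset V} (e : Fin (m + 1) ≃ F) (q : ℕ)
    (g : (Fin (m + 1) → ℕ) → ℝ) :
    ∑ k ∈ F.piAntidiag q, g (fun j => k (e j)) =
      ∑ k ∈ (Finset.univ : Finset (Fin (m + 1))).piAntidiag q, g k := by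
  refine Finset.sum_bij' (i := fun k _ j => k (e j))
    (j := fun k _ v => if h : v ∈ F then k (e.symm ⟨v, h⟩) else 0) ?_ ?_ ?_ ?_ ?_
  · intro k hk
    rw [Finset.mem_piAntidiag] at hk ⊢
    refine ⟨?_, fun _ _ => Finset.mem_univ _⟩
    rw [← hk.1, ← Finset.sum_coe_sort F]
    exact Fintype.sum_equiv e _ _ fun j => rfl
  · intro k hk
    rw [Finset.mem_piAntidiag] at hk ⊢
    refine ⟨?_, fun v hv => by_contra fun h => hv (by simp [h])⟩
    rw [← hk.1, ← Finset.sum_coe_sort F]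
    exact (Fintype.sum_equiv e _ _ fun j => by simp).symm
  · intro k hk
    funext v
    by_cases hv : v ∈ F
    · simp [hv]
    · simp only [hv, dif_neg, not_false_eq_true]
      by_contra h
      exact hv ((Finset.mem_piAntidiag.1 hk).2 v (Ne.symm h))
  · intro k hk
    funext j
    simp
  · intro k hk
    rfl

open Classical in
/-- The inverse estimate on facets. -/
lemma exists_facet_inverse (m : ℕ) {q : ℕ} (hq : 1 ≤ q) (hκ0 : 0 < κ) :
    ∃ C : ℝ, 0 < C ∧ ∀ {T F : Finset (E (m + 1))}, IsRegularSimplex κ T → F ⊆ T →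
      F.card = m + 1 → ∀ P : MvPolynomial (Fin (m + 1)) ℝ, P.totalDegree ≤ q →
      ∀ k ∈ F.piAntidiag q,
        Metric.diam (cell T) ^ m *
          MvPolynomial.eval (fun i => baryPoint F (fun v => (k v : ℝ) / q) i) P ^ 2 ≤
        C * ∫ x in cell F, MvPolynomial.eval (fun i => x i) P ^ 2
          ∂(Measure.euclideanHausdorffMeasure m) := by
  obtain ⟨C, hC, hCN⟩ := exists_refPoly_le m hq
  refine ⟨C * (m * (2 ^ m * κ)) ^ m + 1, by positivity, fun {T F} hT hFT hF P hP k hk => ?_⟩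
  have e : Fin (m + 1) ≃ F := (F.equivFinOfCardEq hF).symm
  have hd := hT.1.diam_pos (Nat.succ_pos m)
  set h := Metric.diam (cell T) with hh
  set c : (Fin (m + 1) → ℕ) → ℝ := fun k =>
    MvPolynomial.eval (fun i => (∑ j, ((k j : ℝ) / q) • (e j : E (m + 1)) : E (m + 1)) i) P with hc
  have hcF : ∀ k : E (m + 1) → ℕ, c (fun j => k (e j)) =
      MvPolynomial.eval (fun i => baryPoint F (fun v => (k v : ℝ) / q) i) P := fun k => by
    have : ∑ j, ((k (e j) : ℝ) / q) • (e j : E (m + 1)) = baryPoint F (fun v => (k v : ℝ) / q) := by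
      rw [baryPoint, ← Finset.sum_coe_sort F (fun v => ((k v : ℝ) / q) • v)]
      exact Fintype.sum_equiv e _ _ fun j => rfl
    simp only [hc, this]
  have hLip := facetChart_lipschitz hκ0.le hT e
  set L := (m * (2 ^ m * κ / h)).toNNReal with hL
  have hLr : (L : ℝ) = m * (2 ^ m * κ / h) := Real.coe_toNNReal _ (by positivity)
  have hpoly : ∀ x ∈ cell F, refPoly q c (facetChart T e x) = MvPolynomial.eval (fun i => x i) P := by
    intro x hx
    have h0 := ((hT.1.mem_face_iff hFT).1 hx).2
    have e1 : ∑ v ∈ F, bary T v x = 1 := by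
      rw [Finset.sum_subset hFT fun v _ hv => h0 v hv, hT.1.sum_bary]
    have e2 : baryPoint F (fun v => bary T v x) = x := by
      rw [← baryPoint_subset hFT h0, hT.1.baryPoint_bary]
    have e3 := eval_baryPoint F hq hP e1
    rw [e2] at e3
    rw [e3, refPoly, ← sum_piAntidiag_equiv e q]
    refine Finset.sum_congr rfl fun k _ => ?_
    rw [hcF]
    congr 1
    rw [lagrangePoly, lagrangePoly, ← Finset.prod_coe_sort F]
    exact Fintype.prod_equiv e _ _ fun j => by rw [refCoord_facetChart hT.1 hFT e hx]
  have hcompact := isCompact_cell F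
  have hfin : Measure.euclideanHausdorffMeasure m (cell F) < ⊤ := measure_cell_lt_top hF
  have hcont : Continuous fun x : E (m + 1) => MvPolynomial.eval (fun i => x i) P ^ 2 :=
    ((MvPolynomial.continuous_eval P).comp (by fun_prop)).pow 2
  have hint : IntegrableOn (fun x : E (m + 1) => MvPolynomial.eval (fun i => x i) P ^ 2) (cell F)
      (Measure.euclideanHausdorffMeasure m) := by
    have : IsFiniteMeasure ((Measure.euclideanHausdorffMeasure m).restrict (cell F)) :=
      ⟨by rwa [Measure.restrict_apply_univ]⟩
    obtain ⟨B, hB⟩ := hcompact.exists_bound_of_continuousOn hcont.continuousOn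
    refine Integrable.of_bound hcont.aestronglyMeasurable B ?_
    exact (ae_restrict_iff' hcompact.measurableSet).2 (Eventually.of_forall hB)
  -- Passing to the reference simplex costs `L^m`, which is of order `diam^(-m)`.
  have key : ∫ y in refSimplex m, refPoly q c y ^ 2 ≤
      (L : ℝ) ^ m * ∫ x in cell F, MvPolynomial.eval (fun i => x i) P ^ 2
        ∂(Measure.euclideanHausdorffMeasure m) := by
    rw [integral_eq_lintegral_of_nonneg_ae (Eventually.of_forall fun y => sq_nonneg _)
      ((continuous_refPoly q c).pow 2).aestronglyMeasurable,
      integral_eq_lintegral_of_nonneg_ae (Eventually.of_forall fun y => sq_nonneg _)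
      hcont.aestronglyMeasurable]
    rw [show (L : ℝ) ^ m = ((L : ℝ≥0∞) ^ m).toReal by simp, ← ENNReal.toReal_mul]
    refine ENNReal.toReal_mono (ENNReal.mul_ne_top (by simp) ?_) ?_
    · exact (hasFiniteIntegral_iff_ofReal (Eventually.of_forall fun y => sq_nonneg _)).1 hint.2 |>.ne
    · refine (lintegral_mono' (volume_refSimplex_le hT.1 hFT e hLip) le_rfl).trans ?_
      rw [lintegral_smul_measure, lintegral_map (f := fun y => ENNReal.ofReal (refPoly q c y ^ 2))
        ((continuous_refPoly q c).pow 2).measurable.ennreal_ofReal hLip.continuous.measurable,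
        smul_eq_mul]
      refine mul_le_mul_right (le_of_eq ?_) _
      refine setLIntegral_congr_fun hcompact.measurableSet fun x hx => ?_
      simp only [hpoly x hx]
  have hkq : (fun j => k (e j)) ∈ (Finset.univ : Finset (Fin (m + 1))).piAntidiag q := by
    rw [Finset.mem_piAntidiag] at hk ⊢
    refine ⟨?_, fun _ _ => Finset.mem_univ _⟩
    rw [← hk.1, ← Finset.sum_coe_sort F]
    exact Fintype.sum_equiv e _ _ fun j => rfl
  have h1 := hCN c _ hkq
  rw [hcF] at h1
  set Q := ∫ x in cell F, MvPolynomial.eval (fun i => x i) P ^ 2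
        ∂(Measure.euclideanHausdorffMeasure m) with hQ
  have hQ0 : 0 ≤ Q := integral_nonneg fun x => sq_nonneg _
  have hhm : 0 < h ^ m := by positivity
  calc h ^ m * MvPolynomial.eval (fun i => baryPoint F (fun v => (k v : ℝ) / q) i) P ^ 2
      ≤ h ^ m * (C * ((L : ℝ) ^ m * Q)) := by gcongr; exact h1.trans (by gcongr)
    _ = C * (m * (2 ^ m * κ)) ^ m * Q := by
      rw [hLr, ← mul_div_assoc, div_pow]; field_simp
    _ ≤ _ := by nlinarith

end

/-! ### The surface measure of a triangulated boundary -/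

section
variable {m : ℕ} {Ω Ω₀ : Set (E (m + 1))} {𝓣 : Finset (Finset (E (m + 1)))} {κ : ℝ}

lemma card_of_mem_bdryMesh {F : Finset (E (m + 1))} (hF : F ∈ bdryMesh Ω 𝓣) : F.card = m + 1 := by
  obtain ⟨⟨T, -, -, h⟩, -⟩ := mem_bdryMesh.1 hF
  exact h

lemma surf_restrict_cell {F : Finset (E (m + 1))} (hF : F ∈ bdryMesh Ω 𝓣) :
    (surf Ω).restrict (cell F) = (Measure.euclideanHausdorffMeasure m).restrict (cell F) := by
  rw [surf, Measure.restrict_restrict (measurableSet_cell F),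
    inter_eq_left.2 (mem_bdryMesh.1 hF).2]
  rfl

lemma surf_cell_inter {F F' : Finset (E (m + 1))} (h : IsMesh Ω₀ 𝓣) (hF : F ∈ bdryMesh Ω 𝓣)
    (hF' : F' ∈ bdryMesh Ω 𝓣) (hne : F ≠ F') : surf Ω (cell F ∩ cell F') = 0 := by
  classical
  obtain ⟨⟨T, hT, hFT, hcard⟩, -⟩ := mem_bdryMesh.1 hF
  obtain ⟨⟨T', hT', hFT', hcard'⟩, -⟩ := mem_bdryMesh.1 hF'
  refine Measure.restrict_le_self.absolutelyContinuous ?_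
  refine measure_mono_null (fun x hx => h.mem_cell_inter hT hT' hFT hFT' hx.1 hx.2)
    (measure_cell_eq_zero ?_)
  rw [Nat.add_sub_cancel]
  by_contra hcon
  have h1 : F ∩ F' = F := Finset.eq_of_subset_of_card_le Finset.inter_subset_left (by omega)
  have h2 : F ∩ F' = F' := Finset.eq_of_subset_of_card_le Finset.inter_subset_right (by omega)
  exact hne (h1.symm.trans h2)

lemma ae_mem_bdryMesh (hΩ : IsLipschitzDomain Ω) (hΩ₀ : IsLipschitzDomain Ω₀)
    (hsub : Ω₀ ⊆ Ω) (hfr : frontier Ω ⊆ frontier Ω₀) (h : IsMesh Ω₀ 𝓣) :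
    ∀ᵐ x ∂(surf Ω), ∃ F ∈ bdryMesh Ω 𝓣, x ∈ cell F := by
  classical
  have h1 : ∀ᵐ x ∂(surf Ω), x ∈ frontier Ω := ae_restrict_mem isClosed_frontier.measurableSet
  have h2 : ∀ᵐ x ∂(surf Ω), ∀ F ∈ (𝓣.biUnion Finset.powerset).filter (fun F => F.card < m + 1),
      x ∉ cell F := by
    refine (ae_ball_iff (Finset.countable_toSet _)).2 fun F hF => ?_
    have hF' := (Finset.mem_filter.1 hF).2
    exact measure_eq_zero_iff_ae_notMem.1 (Measure.restrict_le_self.absolutelyContinuous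
      (measure_cell_eq_zero (by omega)))
  filter_upwards [h1, h2] with x hx1 hx2
  rcases frontier_subset_bdryMesh hΩ hΩ₀ hsub hfr h hx1 with h | ⟨F, hF, hxF⟩
  · exact h
  · exact absurd hxF (hx2 F hF)

lemma surf_le_sum (hΩ : IsLipschitzDomain Ω) (hΩ₀ : IsLipschitzDomain Ω₀)
    (hsub : Ω₀ ⊆ Ω) (hfr : frontier Ω ⊆ frontier Ω₀) (h : IsMesh Ω₀ 𝓣) (B : Set (E (m + 1))) :
    surf Ω B ≤ ∑ F ∈ bdryMesh Ω 𝓣, Measure.euclideanHausdorffMeasure m (cell F ∩ B) := by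
  have h1 : surf Ω B ≤ surf Ω (⋃ F ∈ bdryMesh Ω 𝓣, cell F ∩ B) := by
    refine measure_mono_ae ?_
    filter_upwards [ae_mem_bdryMesh hΩ hΩ₀ hsub hfr h] with x ⟨F, hF, hxF⟩ hxB
    exact mem_iUnion₂.2 ⟨F, hF, hxF, hxB⟩
  refine h1.trans ((measure_biUnion_finset_le _ _).trans (Finset.sum_le_sum fun F _ => ?_))
  exact Measure.restrict_le_self _

lemma isFiniteMeasure_surf (hΩ : IsLipschitzDomain Ω) (hΩ₀ : IsLipschitzDomain Ω₀)
    (hsub : Ω₀ ⊆ Ω) (hfr : frontier Ω ⊆ frontier Ω₀) (h : IsMesh Ω₀ 𝓣) :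
    IsFiniteMeasure (surf Ω) := by
  refine ⟨(surf_le_sum hΩ hΩ₀ hsub hfr h univ).trans_lt (ENNReal.sum_lt_top.2 fun F hF => ?_)⟩
  rw [inter_univ]
  exact measure_cell_lt_top (card_of_mem_bdryMesh hF)

/-- The constant depends on the mesh, which does no harm: it serves only to show that `V` is
bounded, a property of `Ω` alone. -/
lemma exists_upperRegular_surf (hΩ : IsLipschitzDomain Ω) (hΩ₀ : IsLipschitzDomain Ω₀)
    (hsub : Ω₀ ⊆ Ω) (hfr : frontier Ω ⊆ frontier Ω₀) (h : IsMesh Ω₀ 𝓣) (hκ0 : 0 ≤ κ)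
    (hκ : ∀ T ∈ 𝓣, IsRegularSimplex κ T) : ∃ A, UpperRegular A (surf Ω) := by
  have hex : ∀ F ∈ bdryMesh Ω 𝓣, ∃ A : ℝ, 0 ≤ A ∧ ∀ (x : E (m + 1)) (r : ℝ), 0 < r →
      Measure.euclideanHausdorffMeasure m (cell F ∩ Metric.closedBall x r) ≤
        ENNReal.ofReal (A * r ^ m) := fun F hF => by
    obtain ⟨⟨T, hT, hFT, hcard⟩, -⟩ := mem_bdryMesh.1 hF
    exact exists_measure_cell_inter_le hκ0 (hκ T hT) hFT hcard
  choose! A hA0 hA using hex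
  refine ⟨∑ F ∈ bdryMesh Ω 𝓣, A F, Finset.sum_nonneg hA0, fun x r hr => ?_⟩
  refine (surf_le_sum hΩ hΩ₀ hsub hfr h _).trans ?_
  rw [Nat.add_sub_cancel, Finset.sum_mul, ENNReal.ofReal_sum_of_nonneg fun F hF =>
    mul_nonneg (hA0 F hF) (by positivity)]
  exact Finset.sum_le_sum fun F hF => hA F hF x r hr

lemma meanProj_ae (h : IsMesh Ω₀ 𝓣) {F : Finset (E (m + 1))} (hF : F ∈ bdryMesh Ω 𝓣)
    (f : E (m + 1) → ℝ) : ∀ᵐ x ∂((surf Ω).restrict (cell F)),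
      meanProj Ω 𝓣 f x = ⨍ y in cell F, f y ∂(surf Ω) := by
  have h1 : ∀ᵐ x ∂((surf Ω).restrict (cell F)), ∀ F' ∈ bdryMesh Ω 𝓣, F' ≠ F → x ∉ cell F' := by
    refine (ae_ball_iff (Finset.countable_toSet _)).2 fun F' hF' => ?_
    by_cases hne : F' = F
    · exact Eventually.of_forall fun x h => absurd hne h
    have : ((surf Ω).restrict (cell F)) (cell F') = 0 := by
      rw [Measure.restrict_apply (measurableSet_cell F')]
      exact surf_cell_inter h hF' hF hne
    filter_upwards [measure_eq_zero_iff_ae_notMem.1 this] with x hx _ using hx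
  filter_upwards [h1, ae_restrict_mem (measurableSet_cell F)] with x hx hxF
  rw [meanProj, Finset.sum_eq_single F]
  · exact indicator_of_mem hxF _
  · exact fun F' hF' hne => indicator_of_notMem (hx F' hF' hne) _
  · exact fun h => absurd hF h

/-! ### Estimates on a facet -/

/-- The quadratic polynomial `∫ (t f + g)²` in `t` is nonnegative, so its discriminant is not
positive. -/
lemma sq_integral_mul_le {α : Type*} [MeasurableSpace α] {μ : Measure α} {f g : α → ℝ}
    (hf : MemLp f 2 μ) (hg : MemLp g 2 μ) :
    (∫ x, f x * g x ∂μ) ^ 2 ≤ (∫ x, f x ^ 2 ∂μ) * ∫ x, g x ^ 2 ∂μ := by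
  have hfg : Integrable (fun x => f x * g x) μ := hf.integrable_mul hg
  have hff : Integrable (fun x => f x ^ 2) μ := hf.integrable_sq
  have hgg : Integrable (fun x => g x ^ 2) μ := hg.integrable_sq
  have key : ∀ t : ℝ, 0 ≤ (∫ x, f x ^ 2 ∂μ) * (t * t) + (2 * ∫ x, f x * g x ∂μ) * t +
      ∫ x, g x ^ 2 ∂μ := by
    intro t
    have h0 : 0 ≤ ∫ x, (t * f x + g x) ^ 2 ∂μ := integral_nonneg fun x => sq_nonneg _
    have e : ∀ x, (t * f x + g x) ^ 2 = (t * t) * f x ^ 2 + (2 * t) * (f x * g x) + g x ^ 2 :=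
      fun x => by ring
    simp_rw [e] at h0
    have i12 : Integrable (fun x => t * t * f x ^ 2 + 2 * t * (f x * g x)) μ :=
      (hff.const_mul _).add (hfg.const_mul _)
    rw [integral_add i12 hgg,
      integral_add (hff.const_mul _) (hfg.const_mul _), integral_const_mul,
      integral_const_mul] at h0
    linarith
  have := discrim_le_zero key
  rw [discrim] at this
  linarith

/-- The variance as a double integral. -/
lemma integral_sub_average_sq {α : Type*} [MeasurableSpace α] {μ : Measure α} [IsFiniteMeasure μ]
    {f : α → ℝ} (hf : MemLp f 2 μ) (hμ : 0 < μ.real univ) :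
    2 * μ.real univ * ∫ x, (f x - ⨍ y, f y ∂μ) ^ 2 ∂μ =
      ∫ z, (f z.1 - f z.2) ^ 2 ∂(μ.prod μ) := by
  have h1 : Integrable f μ := hf.integrable one_le_two
  have h2 : Integrable (fun x => f x ^ 2) μ := hf.integrable_sq
  have h0 : Integrable (fun _ : α => (1 : ℝ)) μ := integrable_const 1
  have e : ∀ z : α × α, (f z.1 - f z.2) ^ 2 = f z.1 ^ 2 * 1 + 1 * f z.2 ^ 2 - 2 * (f z.1 * f z.2) :=
    fun z => by ring
  have i1 := h2.mul_prod h0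
  have i2 := h0.mul_prod h2
  have i3 := h1.mul_prod h1
  simp_rw [e]
  have i12 : Integrable (fun z : α × α => f z.1 ^ 2 * 1 + 1 * f z.2 ^ 2) (μ.prod μ) := i1.add i2
  rw [integral_sub i12 (i3.const_mul 2), integral_add i1 i2,
    integral_prod_mul (fun x => f x ^ 2) (fun _ => (1 : ℝ)),
    integral_prod_mul (fun _ => (1 : ℝ)) (fun x => f x ^ 2), integral_const_mul (2 : ℝ),
    integral_prod_mul f f]
  set a := ⨍ y, f y ∂μ with ha
  have haa : μ.real univ * a = ∫ x, f x ∂μ := by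
    rw [ha, average_eq, smul_eq_mul, mul_inv_cancel_left₀ hμ.ne']
  have e2 : ∀ x, (f x - a) ^ 2 = f x ^ 2 - 2 * a * f x + a ^ 2 := fun x => by ring
  simp_rw [e2]
  have i4 : Integrable (fun x => f x ^ 2 - 2 * a * f x) μ := h2.sub (h1.const_mul _)
  rw [integral_add i4 (integrable_const _),
    integral_sub h2 (h1.const_mul _), integral_const_mul, integral_const, integral_const,
    ← haa, smul_eq_mul, smul_eq_mul]
  ring

/-- The contribution of a facet to the square of the seminorm. -/
def facetSq (Ω : Set (E (m + 1))) (s : ℝ) (f : E (m + 1) → ℝ) (F : Finset (E (m + 1))) : ℝ :=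
  ∫ z in cell F ×ˢ cell F, diffQuot s f z ^ 2 ∂((surf Ω).prod (surf Ω))

lemma facetSq_nonneg (s : ℝ) (f : E (m + 1) → ℝ) (F : Finset (E (m + 1))) :
    0 ≤ facetSq Ω s f F := integral_nonneg fun _ => sq_nonneg _

lemma sq_sub_le_diffQuot {s : ℝ} (hs : 0 ≤ s) (f : E (m + 1) → ℝ) {z : E (m + 1) × E (m + 1)}
    {h : ℝ} (hz : dist z.1 z.2 ≤ h) :
    (f z.1 - f z.2) ^ 2 ≤ h ^ ((m : ℝ) + 2 * s) * diffQuot s f z ^ 2 := by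
  have h0 : 0 ≤ h := dist_nonneg.trans hz
  rcases eq_or_ne z.1 z.2 with heq | hne
  · rw [heq, sub_self, zero_pow two_ne_zero]; positivity
  have hpos : 0 < ‖z.1 - z.2‖ := norm_pos_iff.2 (sub_ne_zero.2 hne)
  rw [diffQuot, div_pow, ← Real.rpow_natCast (‖z.1 - z.2‖ ^ _), ← Real.rpow_mul hpos.le]
  have e : (((m + 1 : ℕ) : ℝ) - 1) / 2 + s = (m : ℝ) / 2 + s := by push_cast; ring
  rw [e, show ((m : ℝ) / 2 + s) * ((2 : ℕ) : ℝ) = m + 2 * s by push_cast; ring, ← mul_div_assoc,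
    le_div_iff₀ (by positivity), mul_comm]
  gcongr
  rw [← dist_eq_norm]; exact hz

/-- Poincaré's inequality on a facet. -/
lemma integral_sub_mean_sq_le [IsFiniteMeasure (surf Ω)] {s : ℝ} (hs : 0 ≤ s)
    {f : E (m + 1) → ℝ} (hf : f ∈ Hs Ω s) {F : Finset (E (m + 1))} {h : ℝ}
    (hh : ∀ x ∈ cell F, ∀ y ∈ cell F, dist x y ≤ h) (hpos : 0 < (surf Ω).real (cell F)) :
    (surf Ω).real (cell F) *
      ∫ x in cell F, (f x - ⨍ y in cell F, f y ∂(surf Ω)) ^ 2 ∂(surf Ω) ≤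
      h ^ ((m : ℝ) + 2 * s) * facetSq Ω s f F := by
  have e0 : ((surf Ω).restrict (cell F)).real univ = (surf Ω).real (cell F) := by
    simp [measureReal_def]
  have h1 := integral_sub_average_sq (μ := (surf Ω).restrict (cell F)) (hf.1.restrict _)
    (by rw [e0]; exact hpos)
  rw [e0] at h1
  have hint : IntegrableOn (fun z => diffQuot s f z ^ 2) (cell F ×ˢ cell F)
      ((surf Ω).prod (surf Ω)) := hf.2.integrable_sq.integrableOn
  have h2 : ∫ z, (f z.1 - f z.2) ^ 2 ∂(((surf Ω).restrict (cell F)).prod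
      ((surf Ω).restrict (cell F))) ≤ h ^ ((m : ℝ) + 2 * s) * facetSq Ω s f F := by
    rw [facetSq, Measure.prod_restrict, ← integral_const_mul]
    refine integral_mono_of_nonneg (Eventually.of_forall fun z => sq_nonneg _)
      (hint.const_mul _) ?_
    filter_upwards [ae_restrict_mem ((measurableSet_cell F).prod (measurableSet_cell F))] with z hz
    exact sq_sub_le_diffQuot hs f (hh _ hz.1 _ hz.2)
  have h3 : 0 ≤ ∫ x in cell F, (f x - ⨍ y in cell F, f y ∂(surf Ω)) ^ 2 ∂(surf Ω) :=
    integral_nonneg fun _ => sq_nonneg _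
  nlinarith [mul_nonneg hpos.le h3]

/-- The contributions of the facets sum up to at most the seminorm. -/
lemma sum_facetSq_le [IsFiniteMeasure (surf Ω)] (h : IsMesh Ω₀ 𝓣) {s : ℝ}
    {f : E (m + 1) → ℝ} (hf : f ∈ Hs Ω s) :
    ∑ F ∈ bdryMesh Ω 𝓣, facetSq Ω s f F ≤
      ∫ z, diffQuot s f z ^ 2 ∂((surf Ω).prod (surf Ω)) := by
  have hint := hf.2.integrable_sq
  have hm : ∀ F : Finset (E (m + 1)), MeasurableSet (cell F ×ˢ cell F) := fun F =>
    (measurableSet_cell F).prod (measurableSet_cell F)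
  simp_rw [facetSq, ← integral_indicator (hm _)]
  rw [← integral_finsetSum _ fun F _ => hint.indicator (hm F)]
  refine integral_mono_of_nonneg (Eventually.of_forall fun z => Finset.sum_nonneg fun F _ =>
    indicator_nonneg (fun _ _ => sq_nonneg _) _) hint ?_
  -- The products of facets with themselves overlap in null sets; it suffices to separate the first
  -- coordinates.
  have h1 : ∀ᵐ x ∂(surf Ω), ∀ F ∈ bdryMesh Ω 𝓣, ∀ F' ∈ bdryMesh Ω 𝓣, F ≠ F' →
      x ∉ cell F ∩ cell F' := by
    refine (ae_ball_iff (Finset.countable_toSet _)).2 fun F hF =>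
      (ae_ball_iff (Finset.countable_toSet _)).2 fun F' hF' => ?_
    by_cases hne : F = F'
    · exact Eventually.of_forall fun x h => absurd hne h
    filter_upwards [measure_eq_zero_iff_ae_notMem.1 (surf_cell_inter h hF hF' hne)] with x hx _
      using hx
  filter_upwards [Measure.quasiMeasurePreserving_fst.ae h1] with z hz
  by_cases hex : ∃ F ∈ bdryMesh Ω 𝓣, z ∈ cell F ×ˢ cell F
  · obtain ⟨F, hF, hzF⟩ := hex
    rw [Finset.sum_eq_single F]
    · rw [indicator_of_mem hzF]
    · intro F' hF' hne
      refine indicator_of_notMem (fun hz' => hz F' hF' F hF hne ⟨hz'.1, hzF.1⟩) _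
    · exact fun h => absurd hF h
  · push Not at hex
    rw [Finset.sum_eq_zero fun F hF => indicator_of_notMem (hex F hF) _]
    exact sq_nonneg _

end

/-! ### The lifting and its gradient -/

/-! ### The coefficients of the Scott–Zhang interpolant -/

section
variable {m : ℕ} {Ω Ω₀ : Set (E (m + 1))} {𝓣 : Finset (Finset (E (m + 1)))} {κ : ℝ}

lemma continuous_eval_poly {d : ℕ} (P : MvPolynomial (Fin d) ℝ) :
    Continuous fun x : E d => MvPolynomial.eval (fun i => x i) P :=
  (MvPolynomial.continuous_eval P).comp (by fun_prop)

lemma memLp_poly_cell {d : ℕ} {σ : Measure (E d)} [IsFiniteMeasure σ] (P : MvPolynomial (Fin d) ℝ)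
    (F : Finset (E d)) (p : ℝ≥0∞) :
    MemLp (fun x : E d => MvPolynomial.eval (fun i => x i) P) p (σ.restrict (cell F)) := by
  obtain ⟨B, hB⟩ := (isCompact_cell F).exists_bound_of_continuousOn
    (continuous_eval_poly P).continuousOn
  refine MemLp.of_bound (continuous_eval_poly P).aestronglyMeasurable B ?_
  exact (ae_restrict_iff' (measurableSet_cell F)).2 (Eventually.of_forall hB)

/-- Elements of the dual basis satisfy `∫ ψ_z² = ψ_z(z)`. -/
lemma IsScottZhang.integral_sq [IsFiniteMeasure (surf Ω)] (h : IsMesh Ω₀ 𝓣) {q : ℕ} (hq : 1 ≤ q)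
    {K : E (m + 1) → Finset (E (m + 1))} {ψ : E (m + 1) → MvPolynomial (Fin (m + 1)) ℝ}
    (hSZ : IsScottZhang Ω q 𝓣 K ψ) {z : E (m + 1)} (hz : z ∈ bdryNodes Ω q 𝓣) :
    ∫ x in cell (K z), MvPolynomial.eval (fun i => x i) (ψ z) ^ 2 ∂(surf Ω) =
      MvPolynomial.eval (fun i => z i) (ψ z) := by
  classical
  obtain ⟨⟨T, hT, hKT, hcard⟩, hKΓ⟩ := mem_bdryMesh.1 (hSZ.facet z hz)
  have hzn : z ∈ nodes q 𝓣 := (Finset.mem_filter.1 hz).1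
  set F := K z with hF
  have hTs := h.isSimplex hT
  -- One of the two factors `ψ z` is expanded in the nodal basis of the facet; duality then leaves
  -- only the coefficient at `z`.
  have hexp : ∀ x ∈ cell F, MvPolynomial.eval (fun i => x i) (ψ z) ^ 2 =
      ∑ k ∈ F.piAntidiag q,
        MvPolynomial.eval (fun i => baryPoint F (fun v => (k v : ℝ) / q) i) (ψ z) *
          (MvPolynomial.eval (fun i => x i) (ψ z) *
            nodalBasis q 𝓣 (baryPoint F (fun v => (k v : ℝ) / q)) x) := by
    intro x hx
    have h0 := ((hTs.mem_face_iff hKT).1 hx).2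
    have e1 : ∑ v ∈ F, bary T v x = 1 := by
      rw [Finset.sum_subset hKT fun v _ hv => h0 v hv, hTs.sum_bary]
    have e2 : baryPoint F (fun v => bary T v x) = x := by
      rw [← baryPoint_subset hKT h0, hTs.baryPoint_bary]
    have e3 := eval_baryPoint F hq (hSZ.degree z hz) e1
    rw [e2] at e3
    rw [sq]
    conv_lhs => rw [e3]
    rw [Finset.sum_mul, ← e3]
    refine Finset.sum_congr rfl fun k hk => ?_
    rw [h.nodalBasis_eq hq hT hKT hk hx]
    ring
  rw [setIntegral_congr_fun (measurableSet_cell F) hexp, integral_finsetSum]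
  · obtain ⟨k₀, hk₀, hzk⟩ := h.exists_piAntidiag hq hzn hT hKT (hSZ.mem z hz)
    rw [Finset.sum_eq_single k₀]
    · rw [integral_const_mul, hSZ.dual z hz _ (node_mem_nodes hT hKT hk₀) (node_mem_cell hq hk₀),
        if_pos hzk, mul_one, hzk]
    · intro k hk hne
      rw [integral_const_mul, hSZ.dual z hz _ (node_mem_nodes hT hKT hk) (node_mem_cell hq hk),
        if_neg, mul_zero]
      intro e
      apply hne
      funext v
      have e1 := hTs.bary_node hq (piAntidiag_subset hKT hk) v
      have e2 := hTs.bary_node hq (piAntidiag_subset hKT hk₀) v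
      rw [baryPoint_node_subset hKT hk, e, ← hzk, ← baryPoint_node_subset hKT hk₀, e2] at e1
      have hq' : (q : ℝ) ≠ 0 := by positivity
      field_simp at e1
      exact_mod_cast e1.symm
    · exact fun h => absurd hk₀ h
  · intro k hk
    refine Integrable.const_mul ?_ _
    obtain ⟨P, -, hP⟩ := (h.nodalBasis_spec hq (node_mem_nodes hT hKT hk)).1.1 T hT
    have hint : Integrable (fun x => MvPolynomial.eval (fun i => x i) (ψ z) *
        MvPolynomial.eval (fun i => x i) P) ((surf Ω).restrict (cell F)) :=
      (memLp_poly_cell (ψ z) F 2).integrable_mul (memLp_poly_cell P F 2)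
    refine hint.congr ?_
    filter_upwards [ae_restrict_mem (measurableSet_cell F)] with x hx
    rw [hP x (cell_mono hKT hx)]

/-- With `N = ∫ ψ_z² = ψ_z(z)`, the inverse estimate reads `δ^m N² ≤ C N`, so `N ≤ C δ^(-m)`.
Applied to the constant one, it bounds the area of the facet from below by `δ^m / C`. Poincaré's
inequality then gives the factor `δ^(2s)` for `f - Q f`, and Cauchy–Schwarz multiplies the two
bounds. -/
lemma IsScottZhang.exists_coeff_sq_le (m : ℕ) {q : ℕ} (hq : 1 ≤ q) (hκ0 : 0 < κ) :
    ∃ C : ℝ, 0 < C ∧ ∀ {Ω Ω₀ : Set (E (m + 1))} {𝓣 : Finset (Finset (E (m + 1)))},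
      IsMesh Ω₀ 𝓣 → (∀ T ∈ 𝓣, IsRegularSimplex κ T) → IsFiniteMeasure (surf Ω) →
      ∀ {K : E (m + 1) → Finset (E (m + 1))} {ψ : E (m + 1) → MvPolynomial (Fin (m + 1)) ℝ},
      IsScottZhang Ω q 𝓣 K ψ → ∀ z ∈ bdryNodes Ω q 𝓣, ∀ T ∈ 𝓣, K z ⊆ T →
      ∀ {s : ℝ}, 0 ≤ s → ∀ f ∈ Hs Ω s,
        (∫ y in cell (K z), MvPolynomial.eval (fun i => y i) (ψ z) * (f - meanProj Ω 𝓣 f) y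
          ∂(surf Ω)) ^ 2 ≤
        C * Metric.diam (cell T) ^ (2 * s - m) * facetSq Ω s f (K z) := by
  classical
  obtain ⟨C, hC, hCF⟩ := exists_facet_inverse m hq hκ0
  refine ⟨C ^ 2, by positivity, ?_⟩
  intro Ω Ω₀ 𝓣 h hκ hfin K ψ hSZ z hz T hT hKT s hs f hf
  have hKb := hSZ.facet z hz
  have hcard := card_of_mem_bdryMesh hKb
  have hTd := (h.isSimplex hT).diam_pos (Nat.succ_pos m)
  have hzn : z ∈ nodes q 𝓣 := (Finset.mem_filter.1 hz).1
  obtain ⟨k₀, hk₀, hzk⟩ := h.exists_piAntidiag hq hzn hT hKT (hSZ.mem z hz)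
  set F := K z with hF
  set δ := Metric.diam (cell T) with hδ
  have hN := hCF (hκ T hT) hKT hcard (ψ z) (hSZ.degree z hz) k₀ hk₀
  rw [hzk, ← surf_restrict_cell hKb] at hN
  have hNsq := hSZ.integral_sq h hq hz
  rw [← hF] at hNsq
  set N := ∫ x in cell F, MvPolynomial.eval (fun i => x i) (ψ z) ^ 2 ∂(surf Ω) with hNdef
  rw [← hNsq] at hN
  have hN0 : 0 ≤ N := integral_nonneg fun _ => sq_nonneg _
  have hδm : 0 < δ ^ m := by positivity
  have hNle : δ ^ m * N ≤ C := by
    rcases hN0.eq_or_lt with h0 | hpos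
    · rw [← h0, mul_zero]; exact hC.le
    · refine le_of_mul_le_mul_right ?_ hpos
      calc δ ^ m * N * N = δ ^ m * N ^ 2 := by ring
        _ ≤ C * N := hN
  have hM := hCF (hκ T hT) hKT hcard 1 (by simp) k₀ hk₀
  rw [← surf_restrict_cell hKb] at hM
  simp only [map_one, one_pow, mul_one, integral_const, smul_eq_mul] at hM
  have e0 : ((surf Ω).restrict (cell F)).real univ = (surf Ω).real (cell F) := by
    simp [measureReal_def]
  rw [e0] at hM
  have hMpos : 0 < (surf Ω).real (cell F) := by
    by_contra hcon
    have : (surf Ω).real (cell F) = 0 := le_antisymm (not_lt.1 hcon) measureReal_nonneg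
    rw [this, mul_zero] at hM
    linarith
  have hP := integral_sub_mean_sq_le hs hf (F := F) (h := δ) (fun x hx y hy =>
    dist_le_diam_cell (cell_mono hKT hx) (cell_mono hKT hy)) hMpos
  set W := ∫ x in cell F, (f x - ⨍ y in cell F, f y ∂(surf Ω)) ^ 2 ∂(surf Ω) with hW
  have hW0 : 0 ≤ W := integral_nonneg fun _ => sq_nonneg _
  have hfm : MemLp (fun x => f x - ⨍ y in cell F, f y ∂(surf Ω)) 2 ((surf Ω).restrict (cell F)) :=
    (hf.1.restrict _).sub (memLp_const _)
  have hCS := sq_integral_mul_le (memLp_poly_cell (σ := surf Ω) (ψ z) F 2) hfm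
  have hcongr : ∫ y in cell F, MvPolynomial.eval (fun i => y i) (ψ z) * (f - meanProj Ω 𝓣 f) y
      ∂(surf Ω) = ∫ y in cell F, MvPolynomial.eval (fun i => y i) (ψ z) *
        (f y - ⨍ y in cell F, f y ∂(surf Ω)) ∂(surf Ω) := by
    refine integral_congr_ae ?_
    filter_upwards [meanProj_ae h hKb f] with y hy
    rw [Pi.sub_apply, hy]
  rw [hcongr]
  refine hCS.trans ?_
  rw [← hNdef, ← hW]
  have hfs := facetSq_nonneg (Ω := Ω) s f F
  have e1 : δ ^ ((m : ℝ) + 2 * s) = δ ^ (2 * s - m) * (δ ^ m * δ ^ m) := by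
    rw [← pow_add, ← Real.rpow_natCast, ← Real.rpow_add hTd]
    congr 1; push_cast; ring
  rw [e1] at hP
  have hWle : δ ^ m * W ≤ C * (δ ^ (2 * s - m) * (δ ^ m * δ ^ m) * facetSq Ω s f F) := by
    calc δ ^ m * W ≤ (C * (surf Ω).real (cell F)) * W := by gcongr
      _ = C * ((surf Ω).real (cell F) * W) := by ring
      _ ≤ _ := by gcongr
  have h1 : (δ ^ m * δ ^ m) * (N * W) ≤
      (δ ^ m * δ ^ m) * (C ^ 2 * δ ^ (2 * s - m) * facetSq Ω s f F) := by
    calc (δ ^ m * δ ^ m) * (N * W) = (δ ^ m * N) * (δ ^ m * W) := by ring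
      _ ≤ C * (C * (δ ^ (2 * s - m) * (δ ^ m * δ ^ m) * facetSq Ω s f F)) := by gcongr
      _ = _ := by ring
  exact le_of_mul_le_mul_left h1 (by positivity)

end

/-! ### Lipschitz continuity of piecewise Lipschitz functions -/

/-- A function that is Lipschitz on the members of a finite closed cover is Lipschitz. -/
lemma lipschitzWith_of_closed_cover {d : ℕ} {ι : Type*} [Finite ι] {A : ι → Set (E d)}
    (hA : ∀ i, IsClosed (A i)) (hcov : ∀ x, ∃ i, x ∈ A i) {u : E d → ℝ} {L : ℝ≥0}
    (hu : ∀ i, LipschitzOnWith L u (A i)) : LipschitzWith L u := by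
  have hcont : Continuous u := (locallyFinite_of_finite A).continuous
    (eq_univ_of_forall fun x => mem_iUnion.2 (hcov x)) hA fun i => (hu i).continuousOn
  refine LipschitzWith.of_dist_le_mul fun x y => ?_
  set γ : ℝ → E d := fun t => AffineMap.lineMap y x t with hγ
  have hγc : Continuous γ := AffineMap.lineMap_continuous
  have hγd : ∀ s t, dist (γ s) (γ t) = |s - t| * dist x y := fun s t => by
    rw [hγ]; beta_reduce
    rw [dist_lineMap_lineMap, dist_comm y x]; rfl
  set M := L * dist x y with hM
  set s : Set ℝ := {t | |u (γ t) - u (γ 0)| ≤ M * t} with hs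
  have hsub : Icc (0 : ℝ) 1 ⊆ s := by
    refine IsClosed.Icc_subset_of_forall_exists_gt ?_ ?_ ?_
    · refine IsClosed.inter (isClosed_le ?_ (by fun_prop)) isClosed_Icc
      exact ((hcont.comp hγc).sub continuous_const).abs
    · simp [hs]
    · rintro t ⟨ht, -, -⟩ b hb
      -- Continuous induction along the segment: one of the finitely many sets is visited at times
      -- arbitrarily close to `t` from the right. Being closed it contains `γ t`, and its Lipschitz
      -- bound carries the estimate past `t`.
      obtain ⟨i, hi⟩ : ∃ i, ∃ᶠ t' in 𝓝[>] t, γ t' ∈ A i := by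
        by_contra! hcon
        have h1 : ∀ᶠ t' in 𝓝[>] t, ∀ i, γ t' ∉ A i := eventually_all.2 hcon
        obtain ⟨t', ht'⟩ := h1.exists
        obtain ⟨i, hi⟩ := hcov (γ t')
        exact ht' i hi
      have hti : γ t ∈ A i := (hA i).mem_of_frequently_of_tendsto hi
        ((hγc.tendsto t).mono_left nhdsWithin_le_nhds)
      obtain ⟨t', ht'i, ht'⟩ := (hi.and_eventually (Ioc_mem_nhdsGT hb)).exists
      refine ⟨t', ?_, ht'⟩
      have h1 := (hu i).dist_le_mul _ ht'i _ hti
      rw [Real.dist_eq, hγd, abs_of_pos (sub_pos.2 ht'.1)] at h1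
      have h2 : |u (γ t') - u (γ 0)| ≤ |u (γ t') - u (γ t)| + |u (γ t) - u (γ 0)| :=
        abs_sub_le _ _ _
      have h3 : |u (γ t) - u (γ 0)| ≤ M * t := ht
      change |u (γ t') - u (γ 0)| ≤ M * t'
      have h4 : L * ((t' - t) * dist x y) = M * t' - M * t := by rw [hM]; ring
      linarith
  have h1 : |u (γ 1) - u (γ 0)| ≤ M * 1 := hsub (right_mem_Icc.2 zero_le_one)
  have e1 : γ 1 = x := AffineMap.lineMap_apply_one _ _
  have e0 : γ 0 = y := AffineMap.lineMap_apply_zero _ _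
  rw [e1, e0, mul_one] at h1
  exact h1

lemma contDiff_eval_poly {d : ℕ} (P : MvPolynomial (Fin d) ℝ) :
    ContDiff ℝ ∞ fun x : E d => MvPolynomial.eval (fun i => x i) P := by
  induction P using MvPolynomial.induction_on with
  | C a => simp only [MvPolynomial.eval_C]; exact contDiff_const
  | add p q hp hq => simp only [map_add]; exact hp.add hq
  | mul_X p i hp =>
    simp only [map_mul, MvPolynomial.eval_X]
    exact hp.mul (by fun_prop)

lemma exists_lipschitzOnWith_of_contDiff {d : ℕ} {f : E d → ℝ} (hf : ContDiff ℝ 1 f)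
    {s : Set (E d)} (hs : IsCompact s) : ∃ L, LipschitzOnWith L f s :=
  (hf.locallyLipschitz.locallyLipschitzOn).exists_lipschitzOnWith_of_compact hs

/-! ### The weak gradient of a discrete function -/

section
variable {d : ℕ} {Ω Ω₀ : Set (E d)} {𝓣 : Finset (Finset (E d))} {q : ℕ} {w : E d → ℝ}

/-- Almost every point lies inside an element or away from the mesh. -/
lemma ae_mem_interior_cell (𝓣 : Finset (Finset (E d))) :
    ∀ᵐ x : E d, ∀ T ∈ 𝓣, x ∈ cell T → x ∈ interior (cell T) := by
  refine (ae_ball_iff (Finset.countable_toSet _)).2 fun T _ => ?_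
  have h : volume (frontier (cell T)) = 0 :=
    (convex_convexHull ℝ (T : Set (E d))).addHaar_frontier volume
  filter_upwards [measure_eq_zero_iff_ae_notMem.1 h] with x hx hxT
  by_contra hcon
  exact hx ⟨subset_closure hxT, hcon⟩

lemma isClosed_mesh (𝓣 : Finset (Finset (E d))) : IsClosed (⋃ T ∈ 𝓣, cell T) :=
  𝓣.finite_toSet.isClosed_biUnion fun T _ => isClosed_cell T

lemma IsFEM.differentiableAt (hw : IsFEM q 𝓣 w) {x : E d}
    (hx : ∀ T ∈ 𝓣, x ∈ cell T → x ∈ interior (cell T)) : DifferentiableAt ℝ w x := by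
  by_cases hex : ∃ T ∈ 𝓣, x ∈ cell T
  · obtain ⟨T, hT, hxT⟩ := hex
    obtain ⟨P, -, hP⟩ := hw.1 T hT
    have : w =ᶠ[𝓝 x] fun x => MvPolynomial.eval (fun i => x i) P := by
      filter_upwards [mem_interior_iff_mem_nhds.1 (hx T hT hxT)] with y hy using hP y hy
    exact this.differentiableAt_iff.2 ((contDiff_eval_poly P).differentiable (by simp) x)
  · push Not at hex
    have : w =ᶠ[𝓝 x] fun _ => 0 := by
      filter_upwards [(isClosed_mesh 𝓣).isOpen_compl.mem_nhds (by simpa using hex)] with y hy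
      exact hw.2 y (by simpa using hy)
    exact this.differentiableAt_iff.2 (differentiableAt_const _)

lemma gradient_eq_zero_of_notMem (hw : IsFEM q 𝓣 w) {x : E d}
    (hx : ∀ T ∈ 𝓣, x ∉ cell T) : gradient w x = 0 := by
  have : w =ᶠ[𝓝 x] fun _ => 0 := by
    filter_upwards [(isClosed_mesh 𝓣).isOpen_compl.mem_nhds (by simpa using hx)] with y hy
    exact hw.2 y (by simpa using hy)
  rw [this.gradient_eq]
  simp [gradient]

lemma norm_gradient (w : E d → ℝ) (x : E d) : ‖gradient w x‖ = ‖fderiv ℝ w x‖ := by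
  rw [gradient, LinearIsometryEquiv.norm_map]

lemma norm_gradient_le {x : E d} {T : Finset (E d)} (hx : x ∈ interior (cell T)) {L : ℝ}
    (hL0 : 0 ≤ L) (hL : ∀ y ∈ cell T, |w y - w x| ≤ L * dist y x) : ‖gradient w x‖ ≤ L := by
  rw [norm_gradient]
  refine norm_fderiv_le_of_lip' ℝ hL0 ?_
  filter_upwards [mem_interior_iff_mem_nhds.1 hx] with y hy
  rw [← dist_eq_norm y x]
  exact hL y hy

lemma measurable_gradient (w : E d → ℝ) : Measurable (gradient w) :=
  (InnerProductSpace.toDual ℝ (E d)).symm.continuous.measurable.comp (measurable_fderiv ℝ w)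

lemma IsFEM.exists_lipschitzOnWith (hw : IsFEM q 𝓣 w) {φ : E d → ℝ} (hφ : ContDiff ℝ ∞ φ)
    {T : Finset (E d)} (hT : T ∈ 𝓣) : ∃ L, LipschitzOnWith L (fun x => w x * φ x) (cell T) := by
  obtain ⟨P, -, hP⟩ := hw.1 T hT
  obtain ⟨L, hL⟩ := exists_lipschitzOnWith_of_contDiff
    (f := fun x => MvPolynomial.eval (fun i => x i) P * φ x)
    (((contDiff_eval_poly P).mul hφ).of_le (by simp)) (isCompact_cell T)
  refine ⟨L, fun x hx y hy => ?_⟩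
  have := hL hx hy
  simp only [← hP x hx, ← hP y hy] at this
  exact this

/-- The gradient of a discrete function is bounded. -/
lemma IsFEM.exists_norm_gradient_le (hw : IsFEM q 𝓣 w) :
    ∃ B : ℝ, ∀ᵐ x : E d, ‖gradient w x‖ ≤ B := by
  have hex : ∀ T ∈ 𝓣, ∃ L : ℝ≥0, LipschitzOnWith L w (cell T) := fun T hT => by
    obtain ⟨L, hL⟩ := hw.exists_lipschitzOnWith (φ := fun _ => 1) contDiff_const hT
    simp only [mul_one] at hL
    exact ⟨L, hL⟩
  choose! L hL using hex
  refine ⟨∑ T ∈ 𝓣, (L T : ℝ), ?_⟩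
  filter_upwards [ae_mem_interior_cell 𝓣] with x hx
  by_cases hxT : ∃ T ∈ 𝓣, x ∈ cell T
  · obtain ⟨T, hT, hxT⟩ := hxT
    refine (norm_gradient_le (hx T hT hxT) (L T).coe_nonneg fun y hy =>
      (hL T hT).dist_le_mul y hy x hxT).trans ?_
    exact Finset.single_le_sum (f := fun T => (L T : ℝ)) (fun T _ => (L T).coe_nonneg) hT
  · push Not at hxT
    rw [gradient_eq_zero_of_notMem hw hxT, norm_zero]
    exact Finset.sum_nonneg fun T _ => (L T).coe_nonneg

lemma IsFEM.integrable (hw : IsFEM q 𝓣 w) : Integrable w := by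
  have h1 : IntegrableOn w (⋃ T ∈ 𝓣, cell T) := by
    refine (integrableOn_finset_iUnion).2 fun T hT => ?_
    obtain ⟨P, -, hP⟩ := hw.1 T hT
    refine ((continuous_eval_poly P).continuousOn.integrableOn_compact (isCompact_cell T)).congr_fun
      (fun x hx => (hP x hx).symm) (measurableSet_cell T)
  refine (integrableOn_iff_integrable_of_support_subset fun x hx => ?_).1 h1
  by_contra hcon
  exact hx (hw.2 x (by simpa using hcon))

/-- A discrete function that vanishes on the part of the boundary of the mesh inside of `Ω` is
weakly differentiable in `Ω`. -/
theorem IsFEM.hasWeakGradient (hΩ : Bornology.IsBounded Ω) (hΩ₀ : IsOpen Ω₀)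
    (h : IsMesh Ω₀ 𝓣) (hw : IsFEM q 𝓣 w) (hw0 : ∀ x ∈ Ω, x ∈ frontier Ω₀ → w x = 0) :
    HasWeakGradient Ω w (gradient w) := by
  have hfin : volume Ω < ⊤ := hΩ.measure_lt_top
  have : IsFiniteMeasure ((volume : Measure (E d)).restrict Ω) :=
    ⟨by rwa [Measure.restrict_apply_univ]⟩
  obtain ⟨B, hB⟩ := hw.exists_norm_gradient_le
  have hG : IntegrableOn (gradient w) Ω :=
    Integrable.of_bound (measurable_gradient w).aestronglyMeasurable B (ae_restrict_of_ae hB)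
  have hwi := hw.integrable
  refine ⟨hwi.integrableOn.locallyIntegrableOn, hG.locallyIntegrableOn, ?_⟩
  intro φ hφ hφc hφΩ e
  have hφ0 : ∀ x ∉ Ω, φ x = 0 := fun x hx => image_eq_zero_of_notMem_tsupport fun h => hx (hφΩ h)
  have hφ'0 : ∀ x ∉ Ω, fderiv ℝ φ x e = 0 := fun x hx => by
    have : x ∉ tsupport (fderiv ℝ φ) := fun h => hx (hφΩ (tsupport_fderiv_subset ℝ h))
    rw [image_eq_zero_of_notMem_tsupport this]; rfl
  set u : E d → ℝ := fun x => w x * φ x with hu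
  -- `u` is Lipschitz
  have hex : ∀ T ∈ 𝓣, ∃ L, LipschitzOnWith L u (cell T) := fun T hT =>
    hw.exists_lipschitzOnWith hφ hT
  choose! L hL using hex
  -- Outside `Ω₀` the product vanishes: `w` does so on `∂Ω₀` inside `Ω` and off the mesh, `φ` does
  -- so off `Ω`. Hence the complement of `Ω₀` can be added to the elements as a closed set on which
  -- `u` is Lipschitz.
  have hu0 : ∀ x ∉ Ω₀, u x = 0 := by
    intro x hx
    by_cases hcl : x ∈ closure Ω₀
    · by_cases hxΩ : x ∈ Ω
      · simp only [hu]
        rw [hw0 x hxΩ (by rw [hΩ₀.frontier_eq]; exact ⟨hcl, hx⟩), zero_mul]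
      · simp only [hu]
        rw [hφ0 x hxΩ, mul_zero]
    · simp only [hu]
      rw [hw.2 x fun T hT hxT => hcl (h.cell_subset hT hxT), zero_mul]
  have huL : LipschitzWith (∑ T ∈ 𝓣, L T) u := by
    refine lipschitzWith_of_closed_cover (ι := Option {T // T ∈ 𝓣})
      (A := fun i => i.elim Ω₀ᶜ fun T => cell T.1) ?_ ?_ ?_
    · rintro (_ | T)
      · exact hΩ₀.isClosed_compl
      · exact isClosed_cell T.1
    · intro x
      by_cases hx : x ∈ Ω₀
      · obtain ⟨T, hT, hxT⟩ := h.exists_cell (subset_closure hx)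
        exact ⟨some ⟨T, hT⟩, hxT⟩
      · exact ⟨none, hx⟩
    · rintro (_ | T)
      · intro x hx y hy
        rw [hu0 x hx, hu0 y hy, edist_self]
        exact zero_le
      · exact (hL T.1 T.2).weaken (Finset.single_le_sum (f := L) (fun T _ => zero_le) T.2)
  have huc : HasCompactSupport u := hφc.mul_left
  -- Integration by parts against the constant one: the integral of a directional derivative of `u`
  -- vanishes.
  have key := (LipschitzWith.const (1 : ℝ)).integral_lineDeriv_mul_eq
    (μ := (volume : Measure (E d))) huL huc (-e)
  have hz : ∀ x : E d, lineDeriv ℝ (fun _ : E d => (1 : ℝ)) x (-e) = 0 := fun x => by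
    simp [lineDeriv]
  simp only [hz, zero_mul, integral_zero, neg_neg, mul_one] at key
  have hae : ∀ᵐ x : E d, lineDeriv ℝ u x e =
      w x * fderiv ℝ φ x e + inner ℝ (gradient w x) e * φ x := by
    filter_upwards [ae_mem_interior_cell 𝓣] with x hx
    have hwd := hw.differentiableAt hx
    have hφd : DifferentiableAt ℝ φ x := hφ.differentiable (by simp) x
    have hud : HasFDerivAt u (w x • fderiv ℝ φ x + φ x • fderiv ℝ w x) x :=
      hwd.hasFDerivAt.mul hφd.hasFDerivAt
    rw [(hud.hasLineDerivAt e).lineDeriv]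
    have e1 : inner ℝ (gradient w x) e = fderiv ℝ w x e := by
      rw [gradient, InnerProductSpace.toDual_symm_apply]
    rw [e1]
    simp only [add_apply, smul_apply, smul_eq_mul]
    ring
  rw [integral_congr_ae hae, ← setIntegral_eq_integral_of_forall_compl_eq_zero (s := Ω)
    (fun x hx => by rw [hφ0 x hx, hφ'0 x hx]; simp)] at key
  obtain ⟨B1, hB1⟩ := (hφ.continuous_fderiv (by simp)).bounded_above_of_compact_support
    (hφc.fderiv ℝ)
  obtain ⟨B2, hB2⟩ := hφ.continuous.bounded_above_of_compact_support hφc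
  have i1 : IntegrableOn (fun x => w x * fderiv ℝ φ x e) Ω := by
    refine Integrable.mul_bdd (c := B1 * ‖e‖) hwi.integrableOn ?_ (Eventually.of_forall fun x => ?_)
    · exact ((hφ.continuous_fderiv (by simp)).clm_apply continuous_const).aestronglyMeasurable
    · exact (ContinuousLinearMap.le_opNorm _ _).trans (by gcongr; exact hB1 x)
  have i2 : IntegrableOn (fun x => inner ℝ (gradient w x) e * φ x) Ω := by
    refine Integrable.mul_bdd (c := B2) (hG.inner_const e) hφ.continuous.aestronglyMeasurable
      (Eventually.of_forall hB2)
  rw [integral_add i1 i2] at key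
  linarith

end

/-! ### The lifting as a discrete function -/

section
variable {d : ℕ} {Ω Ω₀ : Set (E d)} {𝓣 : Finset (Finset (E d))} {q : ℕ}
  {K : E d → Finset (E d)} {ψ : E d → MvPolynomial (Fin d) ℝ} {g : E d → ℝ}

/-- The coefficients of the Scott–Zhang interpolant. -/
def coeffSZ (Ω : Set (E d)) (K : E d → Finset (E d)) (ψ : E d → MvPolynomial (Fin d) ℝ)
    (g : E d → ℝ) (z : E d) : ℝ :=
  ∫ y in cell (K z), MvPolynomial.eval (fun i => y i) (ψ z) * g y ∂(surf Ω)

open Classical in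
lemma mem_bdryNodes {z : E d} : z ∈ bdryNodes Ω q 𝓣 ↔ z ∈ nodes q 𝓣 ∧ z ∈ frontier Ω :=
  Finset.mem_filter

lemma isFEM_liftSZ (h : IsMesh Ω₀ 𝓣) (hq : 1 ≤ q) : IsFEM q 𝓣 (liftSZ Ω q 𝓣 K ψ g) :=
  IsFEM.sum _ _ fun _ hz => (h.nodalBasis_spec hq (mem_bdryNodes.1 hz).1).1

open Classical in
lemma liftSZ_node (h : IsMesh Ω₀ 𝓣) (hq : 1 ≤ q) {z : E d} (hz : z ∈ nodes q 𝓣) :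
    liftSZ Ω q 𝓣 K ψ g z = if z ∈ frontier Ω then coeffSZ Ω K ψ g z else 0 := by
  have h1 : liftSZ Ω q 𝓣 K ψ g z =
      ∑ y ∈ bdryNodes Ω q 𝓣, coeffSZ Ω K ψ g y * if z = y then 1 else 0 :=
    Finset.sum_congr rfl fun y hy => by
      rw [(h.nodalBasis_spec hq (mem_bdryNodes.1 hy).1).2 z hz, coeffSZ]
  rw [h1]
  simp only [mul_ite, mul_one, mul_zero, Finset.sum_ite_eq, mem_bdryNodes, hz, true_and]

/-- The face whose relative interior contains `x` lies in `∂Ω₀`. A node of it on `Γ` would force the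
whole face into `Γ`, contrary to `x ∈ Ω`; so all nodal values on this face are zero. -/
lemma liftSZ_eq_zero (hΩ : IsLipschitzDomain Ω) (hΩ₀ : IsLipschitzDomain Ω₀)
    (hsub : Ω₀ ⊆ Ω) (hfr : frontier Ω ⊆ frontier Ω₀) (h : IsMesh Ω₀ 𝓣) (hq : 1 ≤ q)
    {x : E d} (hx : x ∈ Ω) (hxf : x ∈ frontier Ω₀) : liftSZ Ω q 𝓣 K ψ g x = 0 := by
  classical
  obtain ⟨T, hT, hxT⟩ := h.exists_cell (frontier_subset_closure hxf)
  have hxS := (h.isSimplex hT).mem_carrier hxT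
  have hS := carrier_subset_frontier hΩ₀ h hT hxT hxf
  rw [(isFEM_liftSZ h hq).eq_sum h hq hT (carrier_subset T x) hxS]
  refine Finset.sum_eq_zero fun k hk => ?_
  rw [liftSZ_node h hq (node_mem_nodes hT (carrier_subset T x) hk), if_neg, zero_mul]
  intro hcon
  exact hΩ.disjoint_frontier
    (cell_subset_frontier hΩ hΩ₀ hsub hfr hS (node_mem_cell hq hk) hcon hxS) hx

open Classical in
/-- Inverse estimate for the gradient of a discrete function. -/
lemma IsFEM.norm_gradient_le_sum (hd : 1 ≤ d) {κ : ℝ} (hκ0 : 0 ≤ κ) (h : IsMesh Ω₀ 𝓣) (hq : 1 ≤ q)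
    {w : E d → ℝ} (hw : IsFEM q 𝓣 w) {T : Finset (E d)} (hT : T ∈ 𝓣) (hTκ : IsRegularSimplex κ T)
    {A : ℝ} (hA0 : 0 ≤ A) (hA : ∀ z ∈ nodes q 𝓣, z ∈ cell T → |w z| ≤ A)
    {x : E d} (hx : x ∈ interior (cell T)) : ‖gradient w x‖ ≤
      (T.piAntidiag q).card * (q * (q : ℝ) ^ q * (q * (2 ^ (d - 1) * κ))) *
        (A / Metric.diam (cell T)) := by
  have hδ := (h.isSimplex hT).diam_pos hd
  have hTs := h.isSimplex hT
  have hxT := interior_subset hx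
  refine norm_gradient_le hx (by positivity) fun y hy => ?_
  rw [hw.eq_sum h hq hT subset_rfl hy, hw.eq_sum h hq hT subset_rfl hxT, ← Finset.sum_sub_distrib]
  refine (Finset.abs_sum_le_sum_abs _ _).trans ?_
  have hb : ∀ k ∈ T.piAntidiag q,
      |w (baryPoint T (fun v => (k v : ℝ) / q)) * lagrangePoly T k (fun v => q * bary T v y) -
        w (baryPoint T (fun v => (k v : ℝ) / q)) * lagrangePoly T k (fun v => q * bary T v x)| ≤
      A * (q * (q : ℝ) ^ q * (q * (2 ^ (d - 1) * κ / Metric.diam (cell T) * dist y x))) := by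
    intro k hk
    rw [← mul_sub, abs_mul]
    refine mul_le_mul (hA _ (node_mem_nodes hT subset_rfl hk) (node_mem_cell hq hk)) ?_
      (abs_nonneg _) hA0
    exact abs_lagrangePoly_sub_le hq hk
      (fun v _ => ⟨hTs.bary_nonneg hy v, hTs.bary_le_one hy v⟩)
      (fun v _ => ⟨hTs.bary_nonneg hxT v, hTs.bary_le_one hxT v⟩)
      (fun v _ => hTκ.abs_bary_sub_le hd v y x)
  refine (Finset.sum_le_card_nsmul _ _ _ hb).trans (le_of_eq ?_)
  rw [nsmul_eq_mul, div_eq_mul_inv, div_eq_mul_inv]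
  generalize (Metric.diam (cell T))⁻¹ = D
  ring

end

/-- The number of Lagrange nodes of degree `q` in a simplex of dimension `m`. -/
def numNodes (m q : ℕ) : ℕ := ((Finset.univ : Finset (Fin (m + 1))).piAntidiag q).card

lemma card_piAntidiag_eq {m : ℕ} {V : Type*} [DecidableEq V] {F : Finset V} (hF : F.card = m + 1)
    (q : ℕ) : (F.piAntidiag q).card = numNodes m q := by
  have e : Fin (m + 1) ≃ F := (F.equivFinOfCardEq hF).symm
  have := sum_piAntidiag_equiv e q (fun _ => 1)
  simp only [Finset.sum_const, nsmul_eq_mul, mul_one] at this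
  exact_mod_cast this

/-- The embedding of `ℓ¹` into `ℓ^p` for finite sums. -/
lemma sum_rpow_le {ι : Type*} (s : Finset ι) {a : ι → ℝ} (ha : ∀ i ∈ s, 0 ≤ a i) {p A : ℝ}
    (hp : 1 ≤ p) (hA : ∑ i ∈ s, a i ≤ A) : ∑ i ∈ s, a i ^ p ≤ A ^ p := by
  have hA0 : 0 ≤ A := (Finset.sum_nonneg ha).trans hA
  have h1 : ∀ {t : ℝ}, 0 ≤ t → t ^ p = t * t ^ (p - 1) := fun {t} ht => by
    conv_rhs => rw [← Real.rpow_one t]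
    rw [← Real.rpow_mul ht, one_mul, ← Real.rpow_add' ht (by linarith)]
    congr 1; ring
  calc ∑ i ∈ s, a i ^ p ≤ ∑ i ∈ s, a i * A ^ (p - 1) := by
        refine Finset.sum_le_sum fun i hi => ?_
        rw [h1 (ha i hi)]
        refine mul_le_mul_of_nonneg_left (Real.rpow_le_rpow (ha i hi) ?_ (by linarith)) (ha i hi)
        exact (Finset.single_le_sum ha hi).trans hA
    _ = (∑ i ∈ s, a i) * A ^ (p - 1) := by rw [Finset.sum_mul]
    _ ≤ A * A ^ (p - 1) := by gcongr
    _ = A ^ p := (h1 hA0).symm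

/-! ### The lifting estimate -/

lemma volume_real_cell_le {d : ℕ} {T : Finset (E d)} (hT : IsSimplex T) :
    volume.real (cell T) ≤
      Metric.diam (cell T) ^ d * volume.real (Metric.closedBall (0 : E d) 1) := by
  obtain ⟨x, hx⟩ := hT.interior_cell_nonempty
  have hsub : cell T ⊆ Metric.closedBall x (Metric.diam (cell T)) := fun y hy =>
    dist_le_diam_cell hy (interior_subset hx)
  refine (measureReal_mono hsub measure_closedBall_lt_top.ne).trans (le_of_eq ?_)
  rw [Measure.addHaar_real_closedBall' _ _ Metric.diam_nonneg, finrank_euclideanSpace_fin]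

section
variable {m q : ℕ} {Ω Ω₀ : Set (E (m + 1))} {𝓣 : Finset (Finset (E (m + 1)))} {κ : ℝ}
  {K : E (m + 1) → Finset (E (m + 1))} {ψ : E (m + 1) → MvPolynomial (Fin (m + 1)) ℝ}

/-- Scale invariance on one element. The powers of the diameter are `e r / 2` from the nodal values,
`-r` from the gradient and `m + 1` from the volume; the relation `he` says that they sum up to zero.
-/
lemma IsFEM.rpow_norm_gradient_mul_volume_le (hκ0 : 0 ≤ κ) (h : IsMesh Ω₀ 𝓣) (hq : 1 ≤ q)
    {w : E (m + 1) → ℝ} (hw : IsFEM q 𝓣 w) {T : Finset (E (m + 1))} (hT : T ∈ 𝓣)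
    (hTκ : IsRegularSimplex κ T) {r e c X : ℝ} (hr : 0 < r) (he : e / 2 * r = r - 1 - m)
    (hc : 0 ≤ c) (hX : 0 ≤ X)
    (hA : ∀ z ∈ nodes q 𝓣, z ∈ cell T →
      |w z| ≤ c * Metric.diam (cell T) ^ (e / 2) * X ^ (1 / r))
    {x : E (m + 1)} (hx : x ∈ interior (cell T)) :
    ‖gradient w x‖ ^ r * volume.real (cell T) ≤
      (numNodes (m + 1) q * (q * (q : ℝ) ^ q * (q * (2 ^ m * κ))) * c) ^ r *
        volume.real (Metric.closedBall (0 : E (m + 1)) 1) * X := by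
  classical
  have hδ := (h.isSimplex hT).diam_pos (Nat.succ_pos m)
  have h1 := hw.norm_gradient_le_sum (by omega) hκ0 h hq hT hTκ (by positivity) hA hx
  rw [card_piAntidiag_eq hTκ.1.1, Nat.add_sub_cancel] at h1
  set δ := Metric.diam (cell T) with hδdef
  set B : ℝ := numNodes (m + 1) q * (q * (q : ℝ) ^ q * (q * (2 ^ m * κ))) with hB
  have hB0 : 0 ≤ B := by positivity
  have h2 : ‖gradient w x‖ ^ r ≤ (B * c) ^ r * (δ ^ (-(m : ℝ) - 1) * X) := by
    have e1 : B * (c * δ ^ (e / 2) * X ^ (1 / r) / δ) = (B * c) * (δ ^ (e / 2 - 1) * X ^ (1 / r)) := by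
      rw [Real.rpow_sub_one hδ.ne']; ring
    rw [e1] at h1
    refine (Real.rpow_le_rpow (norm_nonneg _) h1 hr.le).trans (le_of_eq ?_)
    rw [Real.mul_rpow (mul_nonneg hB0 hc) (by positivity),
      Real.mul_rpow (x := δ ^ (e / 2 - 1)) (by positivity) (by positivity), ← Real.rpow_mul hδ.le, ← Real.rpow_mul hX, one_div_mul_cancel hr.ne', Real.rpow_one]
    congr 3
    rw [sub_mul, he]; ring
  have h3 := volume_real_cell_le hTκ.1
  rw [← hδdef] at h3
  have e2 : δ ^ (-(m : ℝ) - 1) * δ ^ (m + 1) = 1 := by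
    rw [← Real.rpow_natCast, ← Real.rpow_add hδ]
    push_cast
    rw [show -(m : ℝ) - 1 + (m + 1) = 0 by ring, Real.rpow_zero]
  calc ‖gradient w x‖ ^ r * volume.real (cell T)
      ≤ ((B * c) ^ r * (δ ^ (-(m : ℝ) - 1) * X)) *
        (δ ^ (m + 1) * volume.real (Metric.closedBall (0 : E (m + 1)) 1)) :=
        mul_le_mul h2 h3 measureReal_nonneg (by positivity)
    _ = (B * c) ^ r * volume.real (Metric.closedBall (0 : E (m + 1)) 1) * X *
        (δ ^ (-(m : ℝ) - 1) * δ ^ (m + 1)) := by ring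
    _ = _ := by rw [e2, mul_one]

/-- A facet is chosen for a bounded number of nodes only. -/
lemma sum_bdryNodes_le (h : IsMesh Ω₀ 𝓣) (hq : 1 ≤ q) (hSZ : IsScottZhang Ω q 𝓣 K ψ)
    {b : Finset (E (m + 1)) → ℝ} (hb : ∀ F, 0 ≤ b F) :
    ∑ z ∈ bdryNodes Ω q 𝓣, b (K z) ≤ numNodes m q * ∑ F ∈ bdryMesh Ω 𝓣, b F := by
  classical
  rw [← Finset.sum_fiberwise_of_maps_to hSZ.facet, Finset.mul_sum]
  refine Finset.sum_le_sum fun F hF => ?_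
  obtain ⟨⟨T, hT, hFT, hcard⟩, -⟩ := mem_bdryMesh.1 hF
  rw [Finset.sum_congr rfl (g := fun _ => b F) fun z hz => by rw [(Finset.mem_filter.1 hz).2],
    Finset.sum_const, nsmul_eq_mul]
  refine mul_le_mul_of_nonneg_right ?_ (hb F)
  have hsub : (bdryNodes Ω q 𝓣).filter (fun z => K z = F) ⊆
      (F.piAntidiag q).image fun k => baryPoint F (fun v => (k v : ℝ) / q) := by
    intro z hz
    obtain ⟨hz, hzF⟩ := Finset.mem_filter.1 hz
    obtain ⟨k, hk, e⟩ := h.exists_piAntidiag hq (mem_bdryNodes.1 hz).1 hT hFT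
      (hzF ▸ hSZ.mem z hz)
    exact Finset.mem_image.2 ⟨k, by convert hk, e⟩
  have := (Finset.card_le_card hsub).trans Finset.card_image_le
  rw [card_piAntidiag_eq hcard] at this
  exact_mod_cast this

open Classical in
/-- A node belongs to a bounded number of elements only. -/
lemma sum_cells_le (hκ0 : 0 ≤ κ) (h : IsMesh Ω₀ 𝓣) (hκ : ∀ T ∈ 𝓣, IsRegularSimplex κ T)
    (s : Finset (E (m + 1))) {b : E (m + 1) → ℝ} (hb : ∀ z, 0 ≤ b z) :
    ∑ T ∈ 𝓣, ∑ z ∈ s, (if z ∈ cell T then b z else 0) ≤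
      κ * volume.real (Metric.closedBall (0 : E (m + 1)) 1) * ∑ z ∈ s, b z := by
  rw [Finset.sum_comm, Finset.mul_sum]
  refine Finset.sum_le_sum fun z _ => ?_
  rw [← Finset.sum_filter, Finset.sum_const, nsmul_eq_mul]
  refine mul_le_mul_of_nonneg_right ?_ (hb z)
  exact card_cells_le hκ0 h (Nat.succ_pos m) hκ (Finset.filter_subset _ _)
    fun T hT => (Finset.mem_filter.1 hT).2

end

/-- Needed in both directions because the exponent `2 s - m` may have either sign. -/
lemma rpow_le_rpow_abs_mul {a b R e : ℝ} (ha : 0 < a) (hb : 0 < b) (hR : 0 < R) (hab : a ≤ R * b)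
    (hba : b ≤ R * a) : a ^ e ≤ R ^ |e| * b ^ e := by
  rcases le_total 0 e with he | he
  · rw [abs_of_nonneg he, ← Real.mul_rpow hR.le hb.le]
    exact Real.rpow_le_rpow ha.le hab he
  · rw [abs_of_nonpos he]
    have h1 : R ^ e * a ^ e ≤ b ^ e := by
      rw [← Real.mul_rpow hR.le ha.le]
      exact Real.rpow_le_rpow_of_nonpos hb hba he
    have h2 : R ^ (-e) * R ^ e = 1 := by
      rw [← Real.rpow_add hR, neg_add_cancel, Real.rpow_zero]
    calc a ^ e = R ^ (-e) * (R ^ e * a ^ e) := by rw [← mul_assoc, h2, one_mul]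
      _ ≤ _ := by gcongr

section
variable {m q : ℕ} {Ω Ω₀ : Set (E (m + 1))} {𝓣 : Finset (Finset (E (m + 1)))} {κ : ℝ}
  {K : E (m + 1) → Finset (E (m + 1))} {ψ : E (m + 1) → MvPolynomial (Fin (m + 1)) ℝ}

/-- Elementwise bounds on the gradient of a discrete function sum up. -/
lemma IsFEM.lintegral_gradient_le (h : IsMesh Ω₀ 𝓣) {w : E (m + 1) → ℝ} (hw : IsFEM q 𝓣 w)
    {r : ℝ} (hr : 0 < r) {M : Finset (E (m + 1)) → ℝ} (hM0 : ∀ T ∈ 𝓣, 0 ≤ M T)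
    (hM : ∀ T ∈ 𝓣, ∀ x ∈ interior (cell T), ‖gradient w x‖ ^ r * volume.real (cell T) ≤ M T) :
    ∫⁻ x, ‖gradient w x‖ₑ ^ r ≤ ENNReal.ofReal (∑ T ∈ 𝓣, M T) := by
  have h1 : ∀ᵐ x : E (m + 1), ‖gradient w x‖ₑ ^ r ≤ ∑ T ∈ 𝓣,
      (cell T).indicator (fun _ => ENNReal.ofReal (M T / volume.real (cell T))) x := by
    filter_upwards [ae_mem_interior_cell 𝓣] with x hx
    by_cases hex : ∃ T ∈ 𝓣, x ∈ cell T
    · obtain ⟨T, hT, hxT⟩ := hex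
      refine le_trans ?_ (Finset.single_le_sum (f := fun T => (cell T).indicator
        (fun _ => ENNReal.ofReal (M T / volume.real (cell T))) x) (fun _ _ => zero_le) hT)
      beta_reduce
      rw [indicator_of_mem hxT, ← ofReal_norm,
        ENNReal.ofReal_rpow_of_nonneg (norm_nonneg _) hr.le]
      refine ENNReal.ofReal_le_ofReal ?_
      rw [le_div_iff₀ (h.isSimplex hT).volume_pos]
      exact hM T hT x (hx T hT hxT)
    · push Not at hex
      rw [gradient_eq_zero_of_notMem hw hex, enorm_zero, ENNReal.zero_rpow_of_pos hr]
      exact zero_le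
  refine (lintegral_mono_ae h1).trans ?_
  rw [lintegral_finsetSum _ fun T _ => measurable_const.indicator (measurableSet_cell T),
    ENNReal.ofReal_sum_of_nonneg hM0]
  refine Finset.sum_le_sum fun T hT => ?_
  have hv := (h.isSimplex hT).volume_pos
  rw [lintegral_indicator (measurableSet_cell T), setLIntegral_const,
    ← ofReal_measureReal (isCompact_cell T).measure_lt_top.ne,
    ← ENNReal.ofReal_mul (div_nonneg (hM0 T hT) hv.le), div_mul_cancel₀ _ hv.ne']

lemma hsSeminorm_eq {d : ℕ} {Ω : Set (E d)} {s : ℝ} {f : E d → ℝ} (hf : f ∈ Hs Ω s) :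
    hsSeminorm Ω s f =
      ENNReal.ofReal ((∫ z, diffQuot s f z ^ 2 ∂((surf Ω).prod (surf Ω))) ^ (1 / 2 : ℝ)) := by
  have h1 := eLpNorm_two_sq ((surf Ω).prod (surf Ω)) (diffQuot s f)
  have h2 : ∫⁻ z, ‖diffQuot s f z‖ₑ ^ 2 ∂((surf Ω).prod (surf Ω)) =
      ENNReal.ofReal (∫ z, diffQuot s f z ^ 2 ∂((surf Ω).prod (surf Ω))) := by
    rw [ofReal_integral_eq_lintegral_ofReal hf.2.integrable_sq
      (Eventually.of_forall fun _ => sq_nonneg _)]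
    refine lintegral_congr fun z => ?_
    rw [← ofReal_norm, ← ENNReal.ofReal_pow (norm_nonneg _), Real.norm_eq_abs, sq_abs]
  rw [h2] at h1
  rw [← ENNReal.ofReal_rpow_of_nonneg (integral_nonneg fun _ => sq_nonneg _) (by norm_num), ← h1,
    ← ENNReal.rpow_natCast, ← ENNReal.rpow_mul]
  norm_num
  rfl

/-- The constant is fixed before the domains, the mesh and the choice of facets, and depends on `m`,
`q`, `κ` and `r` only. -/
theorem exists_eLpNorm_gradient_liftSZ_le (m : ℕ) (hq : 1 ≤ q) (hκ1 : 1 ≤ κ) {r : ℝ} (hr : 2 ≤ r)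
    (hs : 0 ≤ sExp (m + 1) r) :
    ∃ C : ℝ, 0 < C ∧ ∀ {Ω Ω₀ : Set (E (m + 1))} {𝓣 : Finset (Finset (E (m + 1)))},
      IsLipschitzDomain Ω₀ → frontier Ω ⊆ frontier Ω₀ → IsFiniteMeasure (surf Ω) →
      IsMesh Ω₀ 𝓣 → (∀ T ∈ 𝓣, IsRegularSimplex κ T) →
      ∀ {K : E (m + 1) → Finset (E (m + 1))} {ψ : E (m + 1) → MvPolynomial (Fin (m + 1)) ℝ},
      IsScottZhang Ω q 𝓣 K ψ → ∀ f ∈ Hs Ω (sExp (m + 1) r),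
      eLpNorm (gradient (liftSZ Ω q 𝓣 K ψ (f - meanProj Ω 𝓣 f))) (ENNReal.ofReal r)
        (volume.restrict Ω) ≤ ENNReal.ofReal C * hsSeminorm Ω (sExp (m + 1) r) f := by
  classical
  have hr0 : 0 < r := by linarith
  have hκ0 : 0 < κ := by linarith
  obtain ⟨C₀, hC₀, hcoeff⟩ := IsScottZhang.exists_coeff_sq_le m hq hκ0
  set s := sExp (m + 1) r with hsdef
  set e : ℝ := 2 * s - m with he
  -- This is the equation that determines the exponent `s_r`.
  have hers : e / 2 * r = r - 1 - m := by
    rw [he, hsdef, sExp]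
    push_cast
    field_simp
    ring
  set v : ℝ := volume.real (Metric.closedBall (0 : E (m + 1)) 1) with hv
  set R : ℝ := (2 ^ m * κ) ^ ⌊κ * v⌋₊ with hR
  have hR0 : 0 < R := by positivity
  set c : ℝ := (C₀ * R ^ |e|) ^ (1 / 2 : ℝ) with hc
  have hc0 : 0 ≤ c := by positivity
  set D : ℝ := (numNodes (m + 1) q * (q * (q : ℝ) ^ q * (q * (2 ^ m * κ))) * c) ^ r * v with hD
  have hD0 : 0 ≤ D := by positivity
  set D' : ℝ := D * (κ * v * numNodes m q) with hD'
  have hD'0 : 0 ≤ D' := by positivity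
  -- The summand `1` only secures positivity.
  refine ⟨(D' + 1) ^ (1 / r), by positivity, ?_⟩
  intro Ω Ω₀ 𝓣 hΩ₀ hfr hfin h hκ K ψ hSZ f hf
  set g := f - meanProj Ω 𝓣 f with hg
  set a := facetSq Ω s f with ha
  have ha0 : ∀ F, 0 ≤ a F := fun F => facetSq_nonneg s f F
  -- The power `r / 2` is taken before summation, so that the root of order `r` returns the square
  -- root of the facet contribution.
  set b : E (m + 1) → ℝ := fun z => a (K z) ^ (r / 2) with hb
  have hb0 : ∀ z, 0 ≤ b z := fun z => Real.rpow_nonneg (ha0 _) _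
  set X : Finset (E (m + 1)) → ℝ := fun T =>
    ∑ z ∈ bdryNodes Ω q 𝓣, if z ∈ cell T then b z else 0 with hX
  have hX0 : ∀ T, 0 ≤ X T := fun T => Finset.sum_nonneg fun z _ => by
    split_ifs
    · exact hb0 z
    · exact le_rfl
  set A := ∫ z, diffQuot s f z ^ 2 ∂((surf Ω).prod (surf Ω)) with hA
  have hA0 : 0 ≤ A := integral_nonneg fun _ => sq_nonneg _
  have hfem : IsFEM q 𝓣 (liftSZ Ω q 𝓣 K ψ g) := isFEM_liftSZ h hq
  have hnode : ∀ T ∈ 𝓣, ∀ z ∈ nodes q 𝓣, z ∈ cell T → |liftSZ Ω q 𝓣 K ψ g z| ≤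
      c * Metric.diam (cell T) ^ (e / 2) * X T ^ (1 / r) := by
    intro T hT z hz hzT
    have hδ : 0 < Metric.diam (cell T) := (h.isSimplex hT).diam_pos (by omega)
    rw [liftSZ_node h hq hz]
    split_ifs with hzΓ
    · have hzb : z ∈ bdryNodes Ω q 𝓣 := mem_bdryNodes.2 ⟨hz, hzΓ⟩
      obtain ⟨⟨T', hT', hKT', -⟩, -⟩ := mem_bdryMesh.1 (hSZ.facet z hzb)
      have hzT' : z ∈ cell T' := cell_mono hKT' (hSZ.mem z hzb)
      have hδ' : 0 < Metric.diam (cell T') := (h.isSimplex hT').diam_pos (by omega)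
      have h1 := hcoeff h hκ hfin hSZ z hzb T' hT' hKT' hs f hf
      -- `T` and the element `T'` carrying the chosen facet share the boundary node `z`, hence have
      -- comparable diameters.
      have h2 : Metric.diam (cell T') ^ e ≤ R ^ |e| * Metric.diam (cell T) ^ e :=
        rpow_le_rpow_abs_mul hδ' hδ hR0
          (diam_le_diam (by omega) hκ1 hΩ₀ h hκ (hfr hzΓ) hT' hT hzT' hzT)
          (diam_le_diam (by omega) hκ1 hΩ₀ h hκ (hfr hzΓ) hT hT' hzT hzT')
      have h3 : coeffSZ Ω K ψ g z ^ 2 ≤ C₀ * R ^ |e| * Metric.diam (cell T) ^ e * a (K z) := by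
        refine h1.trans ?_
        rw [mul_assoc C₀ (R ^ |e|)]
        exact mul_le_mul_of_nonneg_right (mul_le_mul_of_nonneg_left h2 hC₀.le) (ha0 _)
      have h4 : a (K z) ^ (1 / 2 : ℝ) ≤ X T ^ (1 / r) := by
        have e1 : a (K z) ^ (1 / 2 : ℝ) = b z ^ (1 / r) := by
          rw [hb]; beta_reduce
          rw [← Real.rpow_mul (ha0 _)]
          congr 1; field_simp
        rw [e1]
        refine Real.rpow_le_rpow (hb0 z) ?_ (by positivity)
        have := Finset.single_le_sum (f := fun z => if z ∈ cell T then b z else 0)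
          (fun z _ => by
            split_ifs
            · exact hb0 z
            · exact le_rfl) hzb
        simpa only [if_pos hzT] using this
      calc |coeffSZ Ω K ψ g z| = (coeffSZ Ω K ψ g z ^ 2) ^ (1 / 2 : ℝ) := by
            rw [← Real.sqrt_eq_rpow, Real.sqrt_sq_eq_abs]
        _ ≤ (C₀ * R ^ |e| * Metric.diam (cell T) ^ e * a (K z)) ^ (1 / 2 : ℝ) :=
            Real.rpow_le_rpow (sq_nonneg _) h3 (by norm_num)
        _ = c * Metric.diam (cell T) ^ (e / 2) * a (K z) ^ (1 / 2 : ℝ) := by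
            rw [Real.mul_rpow (x := C₀ * R ^ |e| * Metric.diam (cell T) ^ e) (by positivity) (ha0 _),
              Real.mul_rpow (x := C₀ * R ^ |e|) (by positivity) (by positivity),
              ← Real.rpow_mul hδ.le, ← hc, mul_one_div]
        _ ≤ _ := mul_le_mul_of_nonneg_left h4 (by positivity)
    · rw [abs_zero]
      exact mul_nonneg (by positivity) (Real.rpow_nonneg (hX0 T) _)
  have hint := hfem.lintegral_gradient_le h hr0 (M := fun T => D * X T)
    (fun T _ => mul_nonneg hD0 (hX0 T)) fun T hT x hx =>
      hfem.rpow_norm_gradient_mul_volume_le hκ0.le h hq hT (hκ T hT) hr0 hers hc0 (hX0 T)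
        (hnode T hT) hx
  have hsum : ∑ T ∈ 𝓣, D * X T ≤ D' * A ^ (r / 2) := by
    rw [← Finset.mul_sum, hD', mul_assoc D]
    refine mul_le_mul_of_nonneg_left ?_ hD0
    refine (sum_cells_le hκ0.le h hκ _ hb0).trans ?_
    rw [mul_assoc (κ * v)]
    refine mul_le_mul_of_nonneg_left ?_ (by positivity)
    refine (sum_bdryNodes_le h hq hSZ (b := fun F => a F ^ (r / 2))
      fun F => Real.rpow_nonneg (ha0 F) _).trans ?_
    refine mul_le_mul_of_nonneg_left ?_ (Nat.cast_nonneg _)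
    -- Here `r ≥ 2` is used, as the power `r / 2` must be at least one.
    exact sum_rpow_le _ (fun F _ => ha0 F) (by linarith) (sum_facetSq_le h hf)
  rw [eLpNorm_eq_lintegral_rpow_enorm_toReal (by simpa using hr0) ENNReal.ofReal_ne_top,
    ENNReal.toReal_ofReal hr0.le, hsSeminorm_eq hf, ← ENNReal.ofReal_mul (by positivity)]
  have e2 : (D' + 1) ^ (1 / r) * A ^ (1 / 2 : ℝ) = ((D' + 1) * A ^ (r / 2)) ^ (1 / r) := by
    rw [Real.mul_rpow (by positivity) (by positivity), ← Real.rpow_mul hA0]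
    congr 2; field_simp
  rw [e2, ← ENNReal.ofReal_rpow_of_nonneg (by positivity) (by positivity)]
  refine ENNReal.rpow_le_rpow ?_ (by positivity)
  refine (setLIntegral_le_lintegral _ _).trans (hint.trans (ENNReal.ofReal_le_ofReal ?_))
  refine hsum.trans (mul_le_mul_of_nonneg_right (by linarith) (by positivity))

end

/-! ### Galerkin solutions -/

section
variable {m p q : ℕ} {Ω Ω₀ : Set (E (m + 1))} {𝓣 : Finset (Finset (E (m + 1)))}

/-- Finitely many facets cover almost all of `Γ`, so Galerkin solutions are bounded densities and
`singleLayer` maps them into `H^{1/2}(Γ)`. -/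
lemma IsPiecewisePoly.memLp_top [IsFiniteMeasure (surf Ω)] (hΩ : IsLipschitzDomain Ω)
    (hΩ₀ : IsLipschitzDomain Ω₀) (hsub : Ω₀ ⊆ Ω) (hfr : frontier Ω ⊆ frontier Ω₀)
    (h : IsMesh Ω₀ 𝓣) {φ : E (m + 1) → ℝ} (hφ : IsPiecewisePoly Ω p 𝓣 φ) :
    MemLp φ ⊤ (surf Ω) := by
  have hres : (surf Ω).restrict (⋃ F ∈ bdryMesh Ω 𝓣, cell F) = surf Ω :=
    Measure.restrict_eq_self_of_ae_mem (by
      filter_upwards [ae_mem_bdryMesh hΩ hΩ₀ hsub hfr h] with x ⟨F, hF, hx⟩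
      exact mem_biUnion hF hx)
  have hF : ∀ F ∈ bdryMesh Ω 𝓣, MemLp φ ⊤ ((surf Ω).restrict (cell F)) := fun F hF => by
    obtain ⟨P, -, hP⟩ := hφ F hF
    exact (memLp_congr_ae hP).2 (memLp_poly_cell P F ⊤)
  have hb : ∀ F ∈ bdryMesh Ω 𝓣, ∃ B : ℝ, 0 ≤ B ∧ ∀ᵐ x ∂((surf Ω).restrict (cell F)), ‖φ x‖ ≤ B :=
    fun F hFm => by
      refine ⟨(eLpNormEssSup φ ((surf Ω).restrict (cell F))).toReal, ENNReal.toReal_nonneg, ?_⟩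
      have hlt := (hF F hFm).2
      rw [eLpNorm_exponent_top] at hlt
      filter_upwards [enorm_ae_le_eLpNormEssSup φ ((surf Ω).restrict (cell F))] with x hx
      rw [← toReal_enorm]
      exact ENNReal.toReal_mono hlt.ne hx
  choose! B hB0 hB using hb
  rw [← hres]
  refine MemLp.of_bound ?_ (∑ F ∈ bdryMesh Ω 𝓣, B F) ?_
  · have e : (⋃ F ∈ bdryMesh Ω 𝓣, cell F) = ⋃ F : {F // F ∈ bdryMesh Ω 𝓣}, cell F.1 := by
      ext; simp
    rw [e]
    exact AEStronglyMeasurable.iUnion fun F => (hF F.1 F.2).1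
  · refine (ae_restrict_biUnion_finset_iff _ _ _).2 fun F hF => ?_
    filter_upwards [hB F hF] with x hx
    exact hx.trans (Finset.single_le_sum hB0 hF)

lemma isPiecewisePoly_indicator (h : IsMesh Ω₀ 𝓣) {F : Finset (E (m + 1))}
    (hF : F ∈ bdryMesh Ω 𝓣) : IsPiecewisePoly Ω p 𝓣 ((cell F).indicator fun _ => (1 : ℝ)) := by
  intro F' hF'
  by_cases hne : F = F'
  · subst hne
    refine ⟨1, by simp, ?_⟩
    filter_upwards [ae_restrict_mem (measurableSet_cell F)] with x hx
    rw [indicator_of_mem hx, map_one]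
  · refine ⟨0, by simp, ?_⟩
    have h1 : ∀ᵐ x ∂((surf Ω).restrict (cell F')), x ∉ cell F ∩ cell F' := ae_restrict_of_ae
      (measure_eq_zero_iff_ae_notMem.1 (surf_cell_inter h hF hF' hne))
    filter_upwards [h1, ae_restrict_mem (measurableSet_cell F')] with x hx hx'
    rw [indicator_of_notMem (fun hxF => hx ⟨hxF, hx'⟩), map_zero]

/-- The residual of a Galerkin solution has vanishing integral means. -/
lemma IsGalerkin.meanProj_eq_zero [IsFiniteMeasure (surf Ω)] (h : IsMesh Ω₀ 𝓣)
    {g φ : E (m + 1) → ℝ} (hg : MemLp g 2 (surf Ω)) (hV : MemLp (singleLayer Ω φ) 2 (surf Ω))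
    (hφ : IsGalerkin Ω p 𝓣 g φ) : meanProj Ω 𝓣 (g - singleLayer Ω φ) = 0 := by
  funext x
  rw [meanProj]
  refine Finset.sum_eq_zero fun F hF => ?_
  -- Indicator functions of single facets are admissible test functions for every degree `p`.
  have h1 := hφ.2 _ (isPiecewisePoly_indicator h hF)
  have e : ∀ u : E (m + 1) → ℝ, ∫ x, u x * (cell F).indicator (fun _ => (1 : ℝ)) x ∂(surf Ω) =
      ∫ x in cell F, u x ∂(surf Ω) := fun u => by
    rw [← integral_indicator (measurableSet_cell F)]
    refine integral_congr_ae (Eventually.of_forall fun x => ?_)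
    by_cases hx : x ∈ cell F
    · simp [hx]
    · simp [hx]
  rw [e, e] at h1
  have h2 : ∫ y in cell F, (g - singleLayer Ω φ) y ∂(surf Ω) = 0 := by
    rw [integral_sub' (hg.integrable one_le_two).restrict (hV.integrable one_le_two).restrict, h1,
      sub_self]
  rw [average_eq, h2, smul_zero, indicator_apply_eq_zero]
  exact fun _ => rfl

end

/-! ### The range of exponents and the conclusion -/

lemma IsRegularSimplex.mono {d : ℕ} {κ κ' : ℝ} {T : Finset (E d)} (hT : IsRegularSimplex κ T)
    (h : κ ≤ κ') : IsRegularSimplex κ' T :=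
  ⟨hT.1, hT.2.trans (mul_le_mul_of_nonneg_right h measureReal_nonneg)⟩

lemma sExp_two (d : ℕ) : sExp d 2 = 1 / 2 := by
  rw [sExp]; norm_num

lemma half_le_sExp {d : ℕ} (hd : 1 ≤ d) {r : ℝ} (hr : 2 ≤ r) : 1 / 2 ≤ sExp d r := by
  have hd' : (1 : ℝ) ≤ d := by exact_mod_cast hd
  rw [sExp, le_div_iff₀ (by linarith)]
  nlinarith [mul_nonneg (sub_nonneg.2 hd') (by linarith : (0 : ℝ) ≤ r / 2 - 1)]

/-- The condition `s_r < 1` amounts to `m (r/2 - 1) < 1`; the bound on `r` makes the left-hand side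
at most `1/2`. -/
lemma sExp_lt_one {m : ℕ} (hm : 1 ≤ m) {r : ℝ} (hr : 2 ≤ r) (hr' : r ≤ 2 + 1 / m) :
    sExp (m + 1) r < 1 := by
  have hm' : (0 : ℝ) < m := by exact_mod_cast hm
  rw [sExp, div_lt_one (by linarith)]
  have h1 : (m : ℝ) * (r - 2) ≤ 1 := by
    calc (m : ℝ) * (r - 2) ≤ m * (1 / m) := by gcongr; linarith
      _ = 1 := by field_simp
  push_cast
  linarith

end BEM

end

theorem mainTheorem9 (d : ℕ) (hd : 2 ≤ d) :
    ∃ r₀ : ℝ, 2 < r₀ ∧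
      (∀ r ∈ Set.Icc (2 : ℝ) r₀, 1 / 2 ≤ BEM.sExp d r ∧ BEM.sExp d r < 1) ∧
      BEM.sExp d 2 = 1 / 2 ∧
      ∀ (Ω Ω₀ : Set (BEM.E d)), BEM.IsLipschitzDomain Ω → BEM.IsLipschitzDomain Ω₀ →
        Ω₀ ⊆ Ω → frontier Ω ⊆ frontier Ω₀ →
      ∀ (q : ℕ), 1 ≤ q → ∀ (κ : ℝ),
      ∃ C : ℝ → ℝ, (∀ r, 0 < C r) ∧
        ∀ (𝓣 : Finset (Finset (BEM.E d))), BEM.IsMesh Ω₀ 𝓣 → BEM.IsShapeRegular κ 𝓣 →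
        ∀ (K : BEM.E d → Finset (BEM.E d)) (ψ : BEM.E d → MvPolynomial (Fin d) ℝ),
          BEM.IsScottZhang Ω q 𝓣 K ψ →
          -- the lifting estimate
          (∀ r ∈ Set.Icc (2 : ℝ) r₀, ∀ f ∈ BEM.Hs Ω (BEM.sExp d r),
            ∃ G : BEM.E d → BEM.E d,
              BEM.HasWeakGradient Ω (BEM.liftSZ Ω q 𝓣 K ψ (f - BEM.meanProj Ω 𝓣 f)) G ∧
              MeasureTheory.eLpNorm G (ENNReal.ofReal r) (MeasureTheory.volume.restrict Ω) ≤
                ENNReal.ofReal (C r) * BEM.hsSeminorm Ω (BEM.sExp d r) f) ∧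
          -- the operator norm of `V` is finite
          BEM.singleLayerNorm Ω < ⊤ ∧
          -- the lifting of the discretized boundary residual
          (∀ (p : ℕ), ∀ g ∈ BEM.Hs Ω (1 / 2), ∀ φℓ : BEM.E d → ℝ, BEM.IsGalerkin Ω p 𝓣 g φℓ →
            (∃ G : BEM.E d → BEM.E d,
              BEM.HasWeakGradient Ω (BEM.liftSZ Ω q 𝓣 K ψ (g - BEM.singleLayer Ω φℓ)) G ∧
              MeasureTheory.eLpNorm G 2 (MeasureTheory.volume.restrict Ω) ≤
                ENNReal.ofReal (C 2) *
                  BEM.hsSeminorm Ω (1 / 2) (g - BEM.singleLayer Ω φℓ)) ∧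
            (∀ Φ : BEM.Hs Ω (1 / 2) →ₗ[ℝ] ℝ, BEM.IsSingleLayer Ω Φ g →
              ENNReal.ofReal (C 2) * BEM.hsSeminorm Ω (1 / 2) (g - BEM.singleLayer Ω φℓ) ≤
                ENNReal.ofReal (C 2) * BEM.singleLayerNorm Ω *
                  BEM.dualNorm Ω fun v => Φ v - BEM.pairing Ω φℓ v)) := by
  obtain ⟨m, rfl⟩ : ∃ m, d = m + 1 := ⟨d - 1, by omega⟩
  have hm : 1 ≤ m := by omega
  have hm' : (0 : ℝ) < m := by exact_mod_cast hm
  refine ⟨2 + 1 / m, by simpa using hm', fun r hr => ⟨BEM.half_le_sExp (by omega) hr.1,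
    BEM.sExp_lt_one hm hr.1 hr.2⟩, BEM.sExp_two _, ?_⟩
  intro Ω Ω₀ hΩ hΩ₀ hsub hfr q hq κ
  -- Constants are chosen for all real `r` at once; for `r < 2` the value is a dummy. Replacing
  -- `|κ|^d` by its maximum with one provides the lower bound that the comparison of diameters
  -- requires.
  have hC : ∀ r : ℝ, ∃ C : ℝ, 0 < C ∧ (2 ≤ r →
      ∀ (𝓣 : Finset (Finset (BEM.E (m + 1)))), BEM.IsMesh Ω₀ 𝓣 → BEM.IsShapeRegular κ 𝓣 →
      ∀ (K : BEM.E (m + 1) → Finset (BEM.E (m + 1)))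
        (ψ : BEM.E (m + 1) → MvPolynomial (Fin (m + 1)) ℝ), BEM.IsScottZhang Ω q 𝓣 K ψ →
      ∀ f ∈ BEM.Hs Ω (BEM.sExp (m + 1) r),
      MeasureTheory.eLpNorm (gradient (BEM.liftSZ Ω q 𝓣 K ψ (f - BEM.meanProj Ω 𝓣 f)))
        (ENNReal.ofReal r) (MeasureTheory.volume.restrict Ω) ≤
          ENNReal.ofReal C * BEM.hsSeminorm Ω (BEM.sExp (m + 1) r) f) := by
    intro r
    by_cases hr : 2 ≤ r
    · obtain ⟨C, hC, H⟩ := BEM.exists_eLpNorm_gradient_liftSZ_le m hq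
        (le_max_right (|κ| ^ (m + 1)) 1) hr
        (one_half_pos.le.trans (BEM.half_le_sExp (Nat.succ_pos m) hr))
      refine ⟨C, hC, fun _ 𝓣 h hκ K ψ hSZ f hf => ?_⟩
      exact H hΩ₀ hfr (BEM.isFiniteMeasure_surf hΩ hΩ₀ hsub hfr h) h
        (fun T hT => (hκ.isRegularSimplex (Nat.succ_pos m) h hT).mono (le_max_left _ _)) hSZ f hf
    · exact ⟨1, one_pos, fun h => absurd h hr⟩
  choose C hC0 hC using hC
  refine ⟨C, hC0, fun 𝓣 h hκ K ψ hSZ => ?_⟩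
  have hfin := BEM.isFiniteMeasure_surf hΩ hΩ₀ hsub hfr h
  obtain ⟨A, hA⟩ := BEM.exists_upperRegular_surf hΩ hΩ₀ hsub hfr h (by positivity)
    fun T hT => hκ.isRegularSimplex (Nat.succ_pos m) h hT
  have hbd : Bornology.IsBounded (frontier Ω) :=
    hΩ.isBounded.closure.subset frontier_subset_closure
  have hweak : ∀ f, BEM.HasWeakGradient Ω (BEM.liftSZ Ω q 𝓣 K ψ f)
      (gradient (BEM.liftSZ Ω q 𝓣 K ψ f)) := fun f =>
    (BEM.isFEM_liftSZ h hq).hasWeakGradient hΩ.isBounded hΩ₀.isOpen h fun x hx hxf =>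
      BEM.liftSZ_eq_zero hΩ hΩ₀ hsub hfr h hq hx hxf
  refine ⟨fun r hr f hf => ⟨_, hweak _, hC r hr.1 𝓣 h hκ K ψ hSZ f hf⟩,
    BEM.singleLayerNorm_lt_top hd hbd hA, fun p g hg φ hφ => ?_⟩
  have hφm : MeasureTheory.MemLp φ ⊤ (BEM.surf Ω) := hφ.1.memLp_top hΩ hΩ₀ hsub hfr h
  obtain ⟨_, _, HV⟩ := BEM.exists_singleLayer_hsNorm_le hd hbd hA
  have hV := (HV φ hφm).2.1
  refine ⟨⟨_, hweak _, ?_⟩, fun Φ hΦ => ?_⟩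
  -- The lifting estimate is applied to the residual, whose facet means vanish, so subtracting its
  -- projection changes nothing.
  · have h2 := hC 2 le_rfl 𝓣 h hκ K ψ hSZ (g - BEM.singleLayer Ω φ)
      (by rw [BEM.sExp_two]; exact Submodule.sub_mem _ hg hV)
    rwa [hφ.meanProj_eq_zero h hg.1 hV.1, sub_zero, BEM.sExp_two, ENNReal.ofReal_ofNat] at h2
  · rw [mul_assoc]
    exact mul_le_mul_right (BEM.hsSeminorm_sub_singleLayer_le hd hbd hA hΦ hφm) _
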